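/- Let $\mathbb D=\{w\in\mathbb C:|w|<1\}$. For a domain $\Omega\subset\mathbb C$ and $z\in\Omega$ the squeezing function is $$S_\Omega(z)=\sup\{\operatorname{dist}(0,\partial f(\Omega)) : f:\Omega\to\mathbb D \text{ holomorphic and injective},\ f(z)=0\},$$ and such an $f$ is called extremal (for $z$) if $\operatorname{dist}(0,\partial f(\Omega))=S_\Omega(z)$. A circularly slit disk is a domain $D\subset\mathbb D$ with $0\in D$ such that every connected component of $\overline{\mathbb D}\setminus D$ is either the unit circle $\partial\mathbb D$ or a proper closed arc (possibly a single point) of a circle centred at $0$ with radius in $(0,1)$. A domain $\Omega\subset\mathbb C$ is doubly connected if its complement in the Riemann sphere has exactly two connected components; the boundaries (in the sphere) of these components are the boundary components of $\Omega$, and a boundary component is non-degenerate if it is not a single point. Theorem. Let $\Omega\subset\mathbb C$ be a doubly connected domain with at least one non-degenerate boundary component, and let $z\in\Omega$. For every non-degenerate boundary component $\Gamma_j$ of $\Omega$ there is a unique conformal map $f_{z,j}$ of $\Omega$ onto a circularly slit disk with $f_{z,j}(z)=0$, $f_{z,j}'(z)>0$ and $f_{z,j}(\Gamma_j)=\partial\mathbb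 D$, where the last condition means that whenever a sequence $(z_k)$ in $\Omega$ converges to a point of $\Gamma_j$, all limit points of $(f_{z,j}(z_k))$ lie on $\partial\mathbb D$; and $$S_\Omega(z)=\max_j\ \operatorname{dist}\big(0,\partial f_{z,j}(\Omega)\big),$$ the maximum being taken over the non-degenerate boundary components $\Gamma_j$ of $\Omega$. Every extremal function is a conformal map of $\Omega$ onto a circularly slit disk. In particular, for every $r\in(0,1)$ and every $z$ in the annulus $\mathbb A_r=\{w\in\mathbb C: r<|w|<1\}$, $$S_{\mathbb A_r}(z)=\max\{|z|,\ r/|z|\}.$$ -/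

import Mathlib

open Set Filter Topology Metric

noncomputable section

namespace Squeezing

/-! ### The squeezing function of a planar domain -/

/-- `f` (restricted to `Ω`) is an injective holomorphic map of `Ω` into the open unit disk
with `f z = 0`. -/
structure IsAdmissible (Ω : Set ℂ) (z : ℂ) (f : ℂ → ℂ) : Prop where
  differentiableOn : DifferentiableOn ℂ f Ω
  injOn : InjOn f Ω
  mapsTo : MapsTo f Ω (ball 0 1)
  map_base : f z = 0

/-- The Euclidean distance `dist(0, ∂f(Ω))` of the origin from the boundary of `f(Ω)`. -/
def boundaryDist (Ω : Set ℂ) (f : ℂ → ℂ) : ℝ :=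
  infDist 0 (frontier (f '' Ω))

/-- The squeezing function `S_Ω(z)`: the supremum of `dist(0, ∂f(Ω))` over all injective
holomorphic maps `f` of `Ω` into the unit disk with `f z = 0`. -/
def squeezing (Ω : Set ℂ) (z : ℂ) : ℝ :=
  sSup {d : ℝ | ∃ f : ℂ → ℂ, IsAdmissible Ω z f ∧ d = boundaryDist Ω f}

/-- `f` is an extremal function: it is admissible and realises the value `S_Ω(z)`. -/
def IsExtremal (Ω : Set ℂ) (z : ℂ) (f : ℂ → ℂ) : Prop :=
  IsAdmissible Ω z f ∧ boundaryDist Ω f = squeezing Ω z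

/-! ### Connectivity and boundary components, taken in the Riemann sphere -/

/-- The complement of `Ω` in the Riemann sphere `OnePoint ℂ`. -/
def sphereCompl (Ω : Set ℂ) : Set (OnePoint ℂ) :=
  ((fun w : ℂ => (w : OnePoint ℂ)) '' Ω)ᶜ

/-- The connected components of the complement of `Ω` in the Riemann sphere. -/
def complComponents (Ω : Set ℂ) : Set (Set (OnePoint ℂ)) :=
  {K | ∃ p ∈ sphereCompl Ω, K = connectedComponentIn (sphereCompl Ω) p}

/-- A doubly connected planar domain: a nonempty connected open subset of `ℂ` whose complement
in the Riemann sphere has exactly two connected components. -/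
structure IsDoublyConnected (Ω : Set ℂ) : Prop where
  isOpen : IsOpen Ω
  isConnected : IsConnected Ω
  ncard_components : (complComponents Ω).ncard = 2

/-- The boundary components of a finitely connected domain `Ω`: the boundaries (in the Riemann
sphere) of the connected components of its complement. -/
def boundaryComponents (Ω : Set ℂ) : Set (Set (OnePoint ℂ)) :=
  {Γ | ∃ K ∈ complComponents Ω, Γ = frontier K}

/-- The boundary components that are non-degenerate, i.e. different from a singleton. -/
def nondegenerateComponents (Ω : Set ℂ) : Set (Set (OnePoint ℂ)) :=
  {Γ | Γ ∈ boundaryComponents Ω ∧ Γ.Nontrivial}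

/-- `Γ` corresponds to `C` under the map `f` of `Ω`: whenever a sequence in `Ω` converges to a
point of `Γ`, all limit points of the image sequence belong to `C`. -/
def BoundaryCorresponds (Ω : Set ℂ) (f : ℂ → ℂ) (Γ : Set (OnePoint ℂ)) (C : Set ℂ) : Prop :=
  ∀ u : ℕ → ℂ, (∀ k, u k ∈ Ω) →
    ∀ p ∈ Γ, Tendsto (fun k => (u k : OnePoint ℂ)) atTop (𝓝 p) →
      ∀ w : ℂ, MapClusterPt w atTop (fun k => f (u k)) → w ∈ C

/-! ### Circularly slit disks and the canonical maps -/

/-- `A` is a closed circular arc centred at the origin, lying in the unit disk, not the whole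
circle, and possibly degenerate to a point (when `a = b`). -/
def IsCircularArc (A : Set ℂ) : Prop :=
  ∃ ρ a b : ℝ, 0 < ρ ∧ ρ < 1 ∧ a ≤ b ∧ b < a + 2 * Real.pi ∧
    A = (fun θ : ℝ => (ρ : ℂ) * Complex.exp (θ * Complex.I)) '' Icc a b

/-- A circularly slit disk: a subdomain `D` of the unit disk containing the origin such that the
connected components of (closed unit disk) `\ D` are the unit circle and closed circular arcs
(or points) on circles centred at the origin. -/
structure IsCircularlySlitDisk (D : Set ℂ) : Prop where
  isOpen : IsOpen D
  isConnected : IsConnected D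
  zero_mem : (0 : ℂ) ∈ D
  subset_ball : D ⊆ ball 0 1
  components : ∀ w ∈ closedBall (0 : ℂ) 1 \ D,
    connectedComponentIn (closedBall (0 : ℂ) 1 \ D) w = sphere 0 1 ∨
      IsCircularArc (connectedComponentIn (closedBall (0 : ℂ) 1 \ D) w)

/-- `f` is a canonical map for `Ω`, the base point `z` and the boundary component `Γ`: a conformal
map of `Ω` onto a circularly slit disk with `f z = 0`, `f' z > 0`, `f(Γ) =` the unit circle. -/
structure IsCanonicalMap (Ω : Set ℂ) (z : ℂ) (Γ : Set (OnePoint ℂ)) (f : ℂ → ℂ) : Prop where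
  differentiableOn : DifferentiableOn ℂ f Ω
  injOn : InjOn f Ω
  slitDisk : IsCircularlySlitDisk (f '' Ω)
  map_base : f z = 0
  deriv_pos : ∃ c : ℝ, 0 < c ∧ deriv f z = c
  boundary : BoundaryCorresponds Ω f Γ (sphere 0 1)

/-- The annulus `{w : r < |w| < 1}`. -/
def annulus (r : ℝ) : Set ℂ := {w : ℂ | r < ‖w‖ ∧ ‖w‖ < 1}

end Squeezing

end

noncomputable section

namespace Squeezing

/-! The problem is moved to a round annulus `r < |w| < 1` with `r = 0` allowed, and is settled there
by comparing boundary values of `log |g / f|` on the two boundary circles. The boundary distance and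
the slit disk condition depend only on the image of a map, so a conformal equivalence transports
both.

Comparison. Let `f` be an injective map of the annulus into the disk with `f z = 0`. The index about
`0` of the image of the circle of radius `t` jumps by `2πi` as `t` crosses `|z|` (`logIndex_jump`),
and one side of each circle goes to the exterior of its image (`logIndex_inside_or_outside`). The
pair of indices is therefore `(0, 2πi)` (outer type) or `(-2πi, 0)` (inner type); the reflection `w
↦ r / w` exchanges the types, and for `r = 0` a bounded map is of outer type. If `f` and `g` both
have outer type, then `g / f`, continued across `z`, is zero-free with vanishing period, so it has a
single-valued logarithm `H`. The mean of `Re H` over a circle does not depend on the radius. Hence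
if `Re H` is asymptotically at least `0` outside and at most `m` inside, then `0 ≤ m`; and for `m =
0` both boundary conditions force every nonconstant Laurent coefficient to vanish
(`nonneg_of_re_boundary`, `log_norm_div_boundary`).

Take for `g` the slit map: `|g| → 1` at the outer circle and `|g| → |z|` at the inner one. The value
`|z|` is forced, because the circle means of `log |g|` are `log t` for `t > |z|` and constant for `t
< |z|`. Since `|f| < 1`, and since near the inner circle `|f|` exceeds every number below the
boundary distance, that distance is at most `|z|`, with equality only for rotations of `g`. Inner
type gives `r / |z|` in the same way (`IsAdmissible.annulus_cases`). Uniqueness of the canonical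
maps is the same comparison: a map onto a slit disk has a constant limit modulus at the inner end,
because its cluster set there is connected and lies in a single slit or in the unit circle.

The slit map is a Blaschke factor times `exp H` with `H` an explicit series
(`exists_isAnnulusSlitMap`). Injectivity and the shape of the image follow from its boundary values
by the argument principle.

Uniformization. With a point `p` of the complement moved to `0`, a component `V` of `exp ⁻¹' Ω` has
no compact holes. Dixon's proof of Cauchy's theorem then gives logarithms on `V`, and these give the
Riemann map of `V`. The deck translation of `V` becomes an automorphism of the disk without fixed
points, hence is conjugate to translation by `±2πi` of a strip or half-plane, and `exp` descends to
a conformal map of `Ω` onto an annulus (`uniformization`). A connectedness argument matches the two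
complementary components with the two ends. The outer end always comes from a non-degenerate
component, and so, by reflection, does the inner end when `r > 0`; a puncture comes from a point. -/

/-! ### Injective holomorphic functions and conformal equivalences -/

/-- An injective holomorphic function has nonvanishing derivative. -/
theorem deriv_ne_zero_of_injOn {f : ℂ → ℂ} {Ω : Set ℂ} (hΩ : IsOpen Ω)
    (hf : DifferentiableOn ℂ f Ω) (hinj : InjOn f Ω) {a : ℂ} (ha : a ∈ Ω) : deriv f a ≠ 0 := by
  have han : AnalyticAt ℂ f a := hf.analyticAt (hΩ.mem_nhds ha)
  have han' : AnalyticAt ℂ (fun z => f z - f a) a := han.sub analyticAt_const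
  have hne : ¬ ∀ᶠ z in 𝓝 a, f z - f a = 0 := by
    intro h
    have h1 : ∀ᶠ z in 𝓝[≠] a, f z - f a = 0 ∧ z ∈ Ω ∧ z ≠ a := by
      filter_upwards [h.filter_mono nhdsWithin_le_nhds,
        mem_nhdsWithin_of_mem_nhds (hΩ.mem_nhds ha),
        self_mem_nhdsWithin] with z h1 h2 h3 using ⟨h1, h2, h3⟩
    obtain ⟨z, hz1, hz2, hz3⟩ := h1.exists
    exact hz3 (hinj hz2 ha (sub_eq_zero.mp hz1))
  obtain ⟨n, g, hg, hga, hfg⟩ := han'.exists_eventuallyEq_pow_smul_nonzero_iff.mpr hne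
  intro hd
  have hn : 2 ≤ n := by
    by_contra hlt
    have : n = 0 ∨ n = 1 := by omega
    rcases this with rfl | rfl
    · have := hfg.self_of_nhds
      simp at this
      exact hga this.symm
    · have h1 : HasDerivAt (fun z => (z - a) ^ 1 • g z) (g a) a := by
        have := ((hasDerivAt_id a).sub_const a).fun_mul hg.differentiableAt.hasDerivAt
        simp only [pow_one, smul_eq_mul]
        simpa using this
      have h2 : HasDerivAt (fun z => f z - f a) (g a) a := h1.congr_of_eventuallyEq hfg
      have h3 : HasDerivAt f (g a) a := by simpa using h2.add_const (f a)
      exact hga (h3.deriv ▸ hd)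
  have hn0 : (n : ℂ) ≠ 0 := by exact_mod_cast (by omega : n ≠ 0)
  -- A local `n`-th root of `g / g a`, normalised to be `1` at `a`. It gives `f - f a = g a * ψ ^ n`
  -- with `ψ` a local homeomorphism at `a`.
  set h : ℂ → ℂ := fun z => Complex.exp (Complex.log (g z / g a) / n) with hh
  have hquot : AnalyticAt ℂ (fun z => g z / g a) a := hg.div analyticAt_const hga
  have hh_an : AnalyticAt ℂ h a := by
    refine AnalyticAt.cexp (AnalyticAt.div (AnalyticAt.clog hquot ?_) analyticAt_const hn0)
    simp [hga]
  have hha : h a = 1 := by simp [hh, hga]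
  set ψ : ℂ → ℂ := fun z => (z - a) * h z with hψ
  have hψ_an : AnalyticAt ℂ ψ a := (analyticAt_id.sub analyticAt_const).mul hh_an
  have hψd : HasStrictDerivAt ψ 1 a := by
    have h1 : HasDerivAt ψ (1 * h a + (a - a) * deriv h a) a :=
      ((hasDerivAt_id a).sub_const a).fun_mul hh_an.differentiableAt.hasDerivAt
    have h2 := hψ_an.hasStrictDerivAt
    rw [h1.deriv] at h2
    simpa [hha] using h2
  have hmap : map ψ (𝓝 a) = 𝓝 (ψ a) := hψd.map_nhds_eq one_ne_zero
  have hψa : ψ a = 0 := by simp [hψ]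
  have hgne : ∀ᶠ z in 𝓝 a, g z ≠ 0 := hg.continuousAt.eventually_ne hga
  have hW : {z | z ∈ Ω ∧ f z - f a = g a * ψ z ^ n} ∈ 𝓝 a := by
    filter_upwards [hfg, hgne, hΩ.mem_nhds ha] with z h1 h2 h3
    refine ⟨h3, ?_⟩
    have h4 : h z ^ n = g z / g a := by
      rw [hh]
      simp only
      rw [← Complex.exp_nat_mul, mul_div_cancel₀ _ hn0, Complex.exp_log (div_ne_zero h2 hga)]
    rw [h1, hψ]
    simp only [smul_eq_mul, mul_pow, h4]
    field_simp
  have himg := image_mem_map (m := ψ) hW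
  rw [hmap, hψa] at himg
  -- For small `x ≠ 0` both `x` and `ω * x` are values of `ψ`. They have the same `n`-th power, so
  -- `f` agrees at the two preimages, which contradicts injectivity because `n ≥ 2`.
  have hω := Complex.isPrimitiveRoot_exp n (by omega)
  set ω := Complex.exp (2 * Real.pi * Complex.I / n) with hωdef
  have hω1 : ω ≠ 1 := hω.ne_one (by omega)
  have hcont : Tendsto (fun x : ℂ => ω * x) (𝓝 0) (𝓝 0) := by
    have : Continuous (fun x : ℂ => ω * x) := by fun_prop
    simpa using this.tendsto 0
  have hev : ∀ᶠ x in 𝓝[≠] (0 : ℂ), x ∈ ψ '' {z | z ∈ Ω ∧ f z - f a = g a * ψ z ^ n} ∧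
      ω * x ∈ ψ '' {z | z ∈ Ω ∧ f z - f a = g a * ψ z ^ n} ∧ x ≠ 0 := by
    filter_upwards [mem_nhdsWithin_of_mem_nhds himg,
      (hcont.eventually himg).filter_mono nhdsWithin_le_nhds,
      self_mem_nhdsWithin] with x h1 h2 h3 using ⟨h1, h2, h3⟩
  obtain ⟨x, ⟨z1, ⟨hz1, hz1'⟩, hx1⟩, ⟨z2, ⟨hz2, hz2'⟩, hx2⟩, hx0⟩ := hev.exists
  have heq : f z1 = f z2 := by
    have : f z1 - f a = f z2 - f a := by
      rw [hz1', hz2', hx1, hx2, mul_pow, hω.pow_eq_one, one_mul]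
    linear_combination this
  have hz := hinj hz1 hz2 heq
  rw [hz, hx2] at hx1
  have : (ω - 1) * x = 0 := by linear_combination hx1
  rcases mul_eq_zero.mp this with h | h
  · exact hω1 (sub_eq_zero.mp h)
  · exact hx0 h

theorem map_nhds_eq_of_injOn {f : ℂ → ℂ} {Ω : Set ℂ} (hΩ : IsOpen Ω)
    (hf : DifferentiableOn ℂ f Ω) (hinj : InjOn f Ω) {a : ℂ} (ha : a ∈ Ω) :
    map f (𝓝 a) = 𝓝 (f a) :=
  (hf.analyticAt (hΩ.mem_nhds ha)).hasStrictDerivAt.map_nhds_eq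
    (deriv_ne_zero_of_injOn hΩ hf hinj ha)

theorem isOpen_image_of_injOn {f : ℂ → ℂ} {Ω : Set ℂ} (hΩ : IsOpen Ω)
    (hf : DifferentiableOn ℂ f Ω) (hinj : InjOn f Ω) : IsOpen (f '' Ω) := by
  rw [isOpen_iff_mem_nhds]
  rintro _ ⟨a, ha, rfl⟩
  rw [← map_nhds_eq_of_injOn hΩ hf hinj ha]
  exact image_mem_map (hΩ.mem_nhds ha)

/-- `φ` and `ψ` are mutually inverse holomorphic bijections between `U` and `V`. -/
structure IsConformalEquiv (φ ψ : ℂ → ℂ) (U V : Set ℂ) : Prop where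
  diff : DifferentiableOn ℂ φ U
  diff_symm : DifferentiableOn ℂ ψ V
  mapsTo : MapsTo φ U V
  mapsTo_symm : MapsTo ψ V U
  left_inv : ∀ x ∈ U, ψ (φ x) = x
  right_inv : ∀ y ∈ V, φ (ψ y) = y

namespace IsConformalEquiv

variable {φ ψ φ' ψ' : ℂ → ℂ} {U V W : Set ℂ}

theorem symm (h : IsConformalEquiv φ ψ U V) : IsConformalEquiv ψ φ V U :=
  ⟨h.diff_symm, h.diff, h.mapsTo_symm, h.mapsTo, h.right_inv, h.left_inv⟩

theorem trans (h : IsConformalEquiv φ ψ U V) (h' : IsConformalEquiv φ' ψ' V W) :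
    IsConformalEquiv (φ' ∘ φ) (ψ ∘ ψ') U W where
  diff := h'.diff.comp h.diff h.mapsTo
  diff_symm := h.diff_symm.comp h'.diff_symm h'.mapsTo_symm
  mapsTo := h'.mapsTo.comp h.mapsTo
  mapsTo_symm := h.mapsTo_symm.comp h'.mapsTo_symm
  left_inv x hx := by simp [h'.left_inv _ (h.mapsTo hx), h.left_inv x hx]
  right_inv x hx := by simp [h.right_inv _ (h'.mapsTo_symm hx), h'.right_inv x hx]

theorem injOn (h : IsConformalEquiv φ ψ U V) : InjOn φ U := fun x hx y hy hxy => by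
  rw [← h.left_inv x hx, hxy, h.left_inv y hy]

theorem image_eq (h : IsConformalEquiv φ ψ U V) : φ '' U = V :=
  Subset.antisymm (image_subset_iff.mpr h.mapsTo)
    fun y hy => ⟨ψ y, h.mapsTo_symm hy, h.right_inv y hy⟩

end IsConformalEquiv

theorem exists_isConformalEquiv {f : ℂ → ℂ} {Ω : Set ℂ} (hΩ : IsOpen Ω)
    (hf : DifferentiableOn ℂ f Ω) (hinj : InjOn f Ω) :
    ∃ ψ, IsConformalEquiv f ψ Ω (f '' Ω) := by
  have hl : ∀ x ∈ Ω, Function.invFunOn f Ω (f x) = x := fun x hx => hinj.leftInvOn_invFunOn hx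
  refine ⟨Function.invFunOn f Ω, hf, ?_, mapsTo_image _ _, ?_, hl, ?_⟩
  · rintro _ ⟨a, ha, rfl⟩
    have hc : ContinuousAt (Function.invFunOn f Ω) (f a) := by
      rw [ContinuousAt, ← map_nhds_eq_of_injOn hΩ hf hinj ha, hl a ha, tendsto_map'_iff]
      refine tendsto_id.congr' ?_
      filter_upwards [hΩ.mem_nhds ha] with x hx using (hl x hx).symm
    have hd : HasDerivAt f (deriv f a) (Function.invFunOn f Ω (f a)) := by
      rw [hl a ha]
      exact (hf.differentiableAt (hΩ.mem_nhds ha)).hasDerivAt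
    refine (HasDerivAt.of_local_left_inverse hc hd
      (deriv_ne_zero_of_injOn hΩ hf hinj ha) ?_).differentiableAt.differentiableWithinAt
    filter_upwards [(isOpen_image_of_injOn hΩ hf hinj).mem_nhds (mem_image_of_mem f ha)]
      with y hy using Function.invFunOn_eq hy
  · rintro _ ⟨a, ha, rfl⟩
    rw [hl a ha]; exact ha
  · rintro _ ⟨a, ha, rfl⟩
    rw [hl a ha]

/-! ### The distance from the origin to the boundary of the image -/

/-- The ball misses the frontier, so it is covered by the interior and the exterior of `D`. It is
connected and contains `0 ∈ D`. If the frontier is empty, `infDist` is `0` and the ball is empty. -/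
theorem ball_infDist_frontier_subset {D : Set ℂ} (h0 : (0 : ℂ) ∈ D) :
    ball (0 : ℂ) (infDist 0 (frontier D)) ⊆ D := by
  intro w hw
  by_contra hwD
  have hpos : 0 < infDist (0 : ℂ) (frontier D) := pos_of_mem_ball hw
  obtain ⟨x, hx, hxf⟩ : (ball (0 : ℂ) (infDist 0 (frontier D)) ∩ frontier D).Nonempty := by
    by_contra hne
    have hsub : ball (0 : ℂ) (infDist 0 (frontier D)) ⊆ interior D ∪ (closure D)ᶜ := by
      intro x hx
      by_contra hx'
      simp only [mem_union, mem_compl_iff, not_or, not_not] at hx'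
      exact hne ⟨x, hx, hx'.2, hx'.1⟩
    have hc := (convex_ball (0 : ℂ) (infDist 0 (frontier D))).isPreconnected
    have h0i : (0 : ℂ) ∈ interior D := by
      rcases hsub (mem_ball_self hpos) with h | h
      · exact h
      · exact absurd (subset_closure h0) h
    have hwi : w ∈ (closure D)ᶜ := by
      rcases hsub hw with h | h
      · exact absurd (interior_subset h) hwD
      · exact h
    obtain ⟨x, -, hx1, hx2⟩ := hc _ _ isOpen_interior isClosed_closure.isOpen_compl hsub
      ⟨0, mem_ball_self hpos, h0i⟩ ⟨w, hw, hwi⟩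
    exact hx2 (subset_closure (interior_subset hx1))
  have := infDist_le_dist_of_mem (x := (0 : ℂ)) hxf
  rw [mem_ball, dist_comm] at hx
  linarith

theorem infDist_frontier_le_one {D : Set ℂ} (h0 : (0 : ℂ) ∈ D) (hD : D ⊆ ball 0 1) :
    infDist (0 : ℂ) (frontier D) ≤ 1 := by
  by_contra h
  have h1 : (1 : ℂ) ∈ ball (0 : ℂ) (infDist 0 (frontier D)) := by simpa using h
  have := hD (ball_infDist_frontier_subset h0 h1)
  simp at this

theorem IsAdmissible.zero_mem {Ω : Set ℂ} {z : ℂ} {f : ℂ → ℂ} (hf : IsAdmissible Ω z f)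
    (hz : z ∈ Ω) : (0 : ℂ) ∈ f '' Ω := ⟨z, hz, hf.map_base⟩

theorem IsAdmissible.boundaryDist_le_one {Ω : Set ℂ} {z : ℂ} {f : ℂ → ℂ}
    (hf : IsAdmissible Ω z f) (hz : z ∈ Ω) : boundaryDist Ω f ≤ 1 :=
  infDist_frontier_le_one (hf.zero_mem hz) (image_subset_iff.mpr hf.mapsTo)

theorem bddAbove_boundaryDist {Ω : Set ℂ} {z : ℂ} (hz : z ∈ Ω) :
    BddAbove {d : ℝ | ∃ f : ℂ → ℂ, IsAdmissible Ω z f ∧ d = boundaryDist Ω f} :=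
  ⟨1, by rintro _ ⟨f, hf, rfl⟩; exact hf.boundaryDist_le_one hz⟩

theorem IsAdmissible.boundaryDist_le_squeezing {Ω : Set ℂ} {z : ℂ} {f : ℂ → ℂ}
    (hf : IsAdmissible Ω z f) (hz : z ∈ Ω) : boundaryDist Ω f ≤ squeezing Ω z :=
  le_csSup (bddAbove_boundaryDist hz) ⟨f, hf, rfl⟩

/-- For `d` below the boundary distance, `‖f‖ > d` off a compact subset of `Ω`. -/
theorem IsAdmissible.exists_isCompact {Ω : Set ℂ} (hΩ : IsOpen Ω) {z : ℂ} {f : ℂ → ℂ}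
    (hf : IsAdmissible Ω z f) (hz : z ∈ Ω) {d : ℝ} (hd : d < boundaryDist Ω f) :
    ∃ C ⊆ Ω, IsCompact C ∧ ∀ w ∈ Ω, w ∉ C → d < ‖f w‖ := by
  obtain ⟨ψ, hψ⟩ := exists_isConformalEquiv hΩ hf.differentiableOn hf.injOn
  have hsub : closedBall (0 : ℂ) d ⊆ f '' Ω :=
    (closedBall_subset_ball hd).trans (ball_infDist_frontier_subset (hf.zero_mem hz))
  refine ⟨ψ '' closedBall 0 d, ?_, ?_, ?_⟩
  · rintro _ ⟨y, hy, rfl⟩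
    exact hψ.mapsTo_symm (hsub hy)
  · exact (isCompact_closedBall _ _).image_of_continuousOn
      (hψ.diff_symm.continuousOn.mono hsub)
  · intro w hw hwC
    by_contra hle
    exact hwC ⟨f w, by simpa using not_lt.mp hle, hψ.left_inv w hw⟩

/-! ### Periodic functions on a strip: Laurent coefficients and boundary values -/

/-- The vertical strip covering the annulus under `exp`. -/
def strip (r : ℝ) : Set ℂ := {ζ : ℂ | Complex.exp ζ ∈ annulus r}

theorem mem_annulus {r : ℝ} {w : ℂ} : w ∈ annulus r ↔ r < ‖w‖ ∧ ‖w‖ < 1 := Iff.rfl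

theorem mem_strip {r : ℝ} {ζ : ℂ} :
    ζ ∈ strip r ↔ r < Real.exp ζ.re ∧ Real.exp ζ.re < 1 := by
  simp [strip, annulus, Complex.norm_exp]

theorem isOpen_annulus (r : ℝ) : IsOpen (annulus r) :=
  (isOpen_lt continuous_const continuous_norm).inter (isOpen_lt continuous_norm continuous_const)

theorem isOpen_strip (r : ℝ) : IsOpen (strip r) :=
  (isOpen_annulus r).preimage Complex.continuous_exp

theorem mem_strip_of_re {r : ℝ} {ζ ζ' : ℂ} (h : ζ.re = ζ'.re) (hζ : ζ ∈ strip r) :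
    ζ' ∈ strip r := by
  rw [mem_strip] at *
  rwa [← h]

theorem convex_strip (r : ℝ) : Convex ℝ (strip r) := by
  have h : strip r = Complex.re ⁻¹' (Real.exp ⁻¹' (Ioo r 1)) := by
    ext ζ
    rw [mem_strip]; rfl
  rw [h]
  have h2 : Convex ℝ (Real.exp ⁻¹' (Ioo r 1)) :=
    (ordConnected_Ioo.preimage_mono Real.exp_monotone).convex
  exact h2.is_linear_preimage (Complex.reLm.isLinear)

/-- The `n`-th Laurent coefficient (up to the factor `2π`) of a periodic function on a vertical
strip, computed on the line `Re ζ = s`. -/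
def stripCoeff (H : ℂ → ℂ) (n : ℤ) (s : ℝ) : ℂ :=
  ∫ θ in (0 : ℝ)..2 * Real.pi, H (s + θ * Complex.I) * Complex.exp (-n * (s + θ * Complex.I))

theorem line_mem_strip {r s : ℝ} (hs : Real.exp s ∈ Ioo r 1) (θ : ℝ) :
    (s + θ * Complex.I : ℂ) ∈ strip r := by
  rw [mem_strip]; simpa using hs

theorem continuous_line {r s : ℝ} {H : ℂ → ℂ} (hH : DifferentiableOn ℂ H (strip r))
    (hs : Real.exp s ∈ Ioo r 1) : Continuous fun θ : ℝ => H (s + θ * Complex.I) :=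
  hH.continuousOn.comp_continuous (by fun_prop) (line_mem_strip hs)

/-- Cauchy's theorem on the rectangle of height `2π` between the two lines: the horizontal sides
cancel because the integrand is `2πi`-periodic. -/
theorem stripCoeff_eq {r : ℝ} {H : ℂ → ℂ} (hH : DifferentiableOn ℂ H (strip r))
    (hper : ∀ ζ ∈ strip r, H (ζ + 2 * Real.pi * Complex.I) = H ζ) (n : ℤ) {s₁ s₂ : ℝ}
    (h₁ : Real.exp s₁ ∈ Ioo r 1) (h₂ : Real.exp s₂ ∈ Ioo r 1) :
    stripCoeff H n s₁ = stripCoeff H n s₂ := by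
  set G : ℂ → ℂ := fun ζ => H ζ * Complex.exp (-n * ζ) with hG
  have hGd : DifferentiableOn ℂ G (strip r) := by
    refine hH.mul (Differentiable.differentiableOn ?_)
    fun_prop
  have hx : ∀ x ∈ uIcc s₁ s₂, Real.exp x ∈ Ioo r 1 := fun x hx =>
    (ordConnected_Ioo.preimage_mono Real.exp_monotone).uIcc_subset h₁ h₂ hx
  have key := Complex.integral_boundary_rect_eq_zero_of_differentiableOn G (s₁ : ℂ)
    (s₂ + (2 * Real.pi : ℝ) * Complex.I) (hGd.mono (by
      intro ζ hζ
      have h := hζ.1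
      simp only [mem_preimage, Complex.ofReal_re, Complex.add_re, Complex.mul_re, Complex.I_re,
        mul_zero, Complex.ofReal_im, Complex.I_im, mul_one, sub_self, add_zero] at h
      exact mem_strip.mpr (hx _ h)))
  have hhor : ∀ x ∈ uIcc s₁ s₂, G (x + ((2 * Real.pi : ℝ) : ℂ) * Complex.I) = G x := by
    intro x hxm
    have hxs : (x : ℂ) ∈ strip r := by simpa using line_mem_strip (hx x hxm) 0
    have he : Complex.exp (-n * (x + 2 * Real.pi * Complex.I)) = Complex.exp (-n * x) := by
      rw [mul_add, Complex.exp_add]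
      have : Complex.exp (-n * (2 * Real.pi * Complex.I)) = 1 := by
        rw [Complex.exp_eq_one_iff]
        exact ⟨-n, by push_cast; ring⟩
      rw [this, mul_one]
    simp only [hG]
    push_cast
    rw [hper x hxs, he]
  simp only [Complex.ofReal_re, Complex.ofReal_im, Complex.add_re, Complex.mul_re, Complex.I_re,
    mul_zero, Complex.I_im, mul_one, sub_self, add_zero, Complex.add_im, Complex.mul_im, zero_add,
    Complex.ofReal_zero, zero_mul] at key
  rw [intervalIntegral.integral_congr hhor, sub_self, zero_add, sub_eq_zero] at key
  have := (smul_right_injective ℂ Complex.I_ne_zero) key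
  exact this.symm

/-- On the vertical line the function is a continuous function on the circle whose Fourier
coefficients are multiples of the `stripCoeff`. A zero Fourier series is summable, so it represents
the function pointwise. -/
theorem eq_zero_of_stripCoeff_eq_zero {r : ℝ} {H : ℂ → ℂ} (hH : DifferentiableOn ℂ H (strip r))
    (hper : ∀ ζ ∈ strip r, H (ζ + 2 * Real.pi * Complex.I) = H ζ) {s : ℝ}
    (hs : Real.exp s ∈ Ioo r 1) (h0 : ∀ n : ℤ, stripCoeff H n s = 0) (θ : ℝ) :
    H (s + θ * Complex.I) = 0 := by
  have hT : Fact (0 < 2 * Real.pi) := ⟨Real.two_pi_pos⟩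
  set f : ℝ → ℂ := fun θ => H (s + θ * Complex.I) with hf
  have hfp : Function.Periodic f (2 * Real.pi) := by
    intro x
    simp only [hf]
    rw [← hper _ (line_mem_strip hs x)]
    congr 1
    push_cast
    ring
  have hfc : Continuous f := continuous_line hH hs
  have hlc : Continuous (hfp.lift) := hfc.quotient_lift _
  set g : C(AddCircle (2 * Real.pi), ℂ) := ⟨hfp.lift, hlc⟩ with hg
  have hcoef : fourierCoeff g = 0 := by
    funext n
    rw [fourierCoeff_eq_intervalIntegral _ n 0]
    have h1 : (∫ x in (0:ℝ)..0 + 2 * Real.pi, fourier (-n) (x : AddCircle (2 * Real.pi)) • g x)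
        = Complex.exp (n * s) * stripCoeff H n s := by
      rw [stripCoeff, ← intervalIntegral.integral_const_mul, zero_add]
      refine intervalIntegral.integral_congr fun x _ => ?_
      have : g (x : AddCircle (2 * Real.pi)) = f x := rfl
      simp only [this, fourier_coe_apply, hf, smul_eq_mul]
      rw [mul_comm (H _), ← mul_assoc, ← Complex.exp_add]
      congr 2
      push_cast
      field_simp
      ring
    rw [h1, h0 n]
    simp
  have hsum := has_pointwise_sum_fourier_series_of_summable (f := g)
    (by rw [hcoef]; exact summable_zero) (θ : AddCircle (2 * Real.pi))
  simp only [hcoef, Pi.zero_apply, zero_smul] at hsum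
  exact hsum.unique hasSum_zero

theorem stripCoeff_sub_const {r : ℝ} {H : ℂ → ℂ} (hH : DifferentiableOn ℂ H (strip r)) {s : ℝ}
    (hs : Real.exp s ∈ Ioo r 1) (n : ℤ) :
    stripCoeff (fun ζ => H ζ - stripCoeff H 0 s / (2 * Real.pi)) n s =
      if n = 0 then 0 else stripCoeff H n s := by
  have hc := continuous_line hH hs
  have hsub : ∀ c : ℂ, stripCoeff (fun ζ => H ζ - c) n s = stripCoeff H n s -
      c * ∫ θ in (0 : ℝ)..2 * Real.pi, Complex.exp (-n * (s + θ * Complex.I)) := by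
    intro c
    rw [stripCoeff, stripCoeff, ← intervalIntegral.integral_const_mul,
      ← intervalIntegral.integral_sub]
    · simp only [sub_mul]
    · exact (hc.mul (by fun_prop)).intervalIntegrable _ _
    · exact Continuous.intervalIntegrable (by fun_prop) _ _
  rw [hsub]
  split_ifs with hn
  · subst hn
    have : (2 * Real.pi : ℂ) ≠ 0 := by exact_mod_cast Real.two_pi_pos.ne'
    simp
  · have hn' : (-n * Complex.I : ℂ) ≠ 0 :=
      mul_ne_zero (neg_ne_zero.mpr (by exact_mod_cast hn)) Complex.I_ne_zero
    have h1 : (∫ θ in (0 : ℝ)..2 * Real.pi, Complex.exp (-n * (s + θ * Complex.I))) =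
        Complex.exp (-n * s) * ∫ θ in (0 : ℝ)..2 * Real.pi, Complex.exp ((-n * Complex.I) * θ) := by
      rw [← intervalIntegral.integral_const_mul]
      refine intervalIntegral.integral_congr fun x _ => ?_
      rw [← Complex.exp_add]
      congr 1
      ring
    have h2 : Complex.exp (-n * Complex.I * (2 * Real.pi : ℝ)) = 1 := by
      rw [Complex.exp_eq_one_iff]
      exact ⟨-n, by push_cast; ring⟩
    rw [h1, integral_exp_mul_complex hn', h2]
    simp

theorem re_stripCoeff_zero {r : ℝ} {H : ℂ → ℂ} (hH : DifferentiableOn ℂ H (strip r)) {s : ℝ}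
    (hs : Real.exp s ∈ Ioo r 1) :
    (stripCoeff H 0 s).re = ∫ θ in (0 : ℝ)..2 * Real.pi, (H (s + θ * Complex.I)).re := by
  have := (Complex.reCLM.intervalIntegral_comp_comm
    ((continuous_line hH hs).intervalIntegrable (μ := MeasureTheory.volume) 0 (2 * Real.pi)))
  simp only [Complex.reCLM_apply] at this
  rw [this, stripCoeff]
  simp

/-- The Fourier coefficients of the real part in terms of the Laurent coefficients. -/
theorem two_mul_integral_re {r : ℝ} {H : ℂ → ℂ} (hH : DifferentiableOn ℂ H (strip r)) {s : ℝ}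
    (hs : Real.exp s ∈ Ioo r 1) (n : ℤ) :
    2 * ∫ θ in (0 : ℝ)..2 * Real.pi,
        ((H (s + θ * Complex.I)).re : ℂ) * Complex.exp (-n * (θ * Complex.I)) =
      stripCoeff H n s * Complex.exp (n * s) +
        (starRingEnd ℂ) (stripCoeff H (-n) s) * Complex.exp (-n * s) := by
  have hc := continuous_line hH hs
  have hconj : (starRingEnd ℂ) (stripCoeff H (-n) s) = ∫ θ in (0 : ℝ)..2 * Real.pi,
      (starRingEnd ℂ) (H (s + θ * Complex.I) *
        Complex.exp (-((-n : ℤ) : ℂ) * (s + θ * Complex.I))) := by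
    rw [stripCoeff]
    simp only [intervalIntegral]
    rw [map_sub, integral_conj, integral_conj]
  rw [hconj, stripCoeff, ← intervalIntegral.integral_mul_const,
    ← intervalIntegral.integral_mul_const, ← intervalIntegral.integral_const_mul,
    ← intervalIntegral.integral_add]
  · refine intervalIntegral.integral_congr fun θ _ => ?_
    simp only [map_mul, ← Complex.exp_conj]
    have h1 : (((H (s + θ * Complex.I)).re : ℝ) : ℂ) =
        (H (s + θ * Complex.I) + (starRingEnd ℂ) (H (s + θ * Complex.I))) / 2 := by
      rw [Complex.add_conj]; push_cast; ring
    rw [h1, mul_assoc, ← Complex.exp_add, mul_assoc, ← Complex.exp_add]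
    have e1 : (-n * (s + θ * Complex.I) + n * s : ℂ) = -n * (θ * Complex.I) := by ring
    have e2 : ((starRingEnd ℂ) (-((-n : ℤ) : ℂ) * (s + θ * Complex.I)) + -n * s : ℂ)
        = -n * (θ * Complex.I) := by
      simp
      ring
    rw [← map_mul] at *
    rw [e1, e2]
    ring
  · exact ((hc.mul (by fun_prop)).mul continuous_const).intervalIntegrable _ _
  · refine Continuous.intervalIntegrable ?_ _ _
    exact (Complex.continuous_conj.comp (hc.mul (by fun_prop))).mul continuous_const

/-- A one-sided comparison of the boundary values of `Re H` on the two ends of the strip. -/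
theorem nonneg_of_re_boundary {r : ℝ} (hr0 : 0 ≤ r) (hr : r < 1) {H : ℂ → ℂ}
    (hH : DifferentiableOn ℂ H (strip r))
    (hper : ∀ ζ ∈ strip r, H (ζ + 2 * Real.pi * Complex.I) = H ζ) {m : ℝ}
    (hOut : ∀ ε > 0, ∀ᶠ t in 𝓝[<] (1 : ℝ), ∀ θ : ℝ,
      -ε ≤ (H ((Real.log t : ℝ) + θ * Complex.I)).re)
    (hIn : ∀ ε > 0, ∀ᶠ t in 𝓝[>] r, ∀ θ : ℝ,
      (H ((Real.log t : ℝ) + θ * Complex.I)).re ≤ m + ε) :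
    0 ≤ m ∧ (m = 0 → ∃ c : ℂ, c.re = 0 ∧ ∀ ζ ∈ strip r, H ζ = c) := by
  have hpi := Real.two_pi_pos
  have hOutI : ∀ᶠ t in 𝓝[<] (1 : ℝ), t ∈ Ioo r 1 := Ioo_mem_nhdsLT hr
  have hInI : ∀ᶠ t in 𝓝[>] r, t ∈ Ioo r 1 := Ioo_mem_nhdsGT hr
  have hlog : ∀ t ∈ Ioo r 1, Real.exp (Real.log t) ∈ Ioo r 1 := fun t ht => by
    rwa [Real.exp_log (hr0.trans_lt ht.1)]
  obtain ⟨t₀, ht₀⟩ : (Ioo r 1).Nonempty := nonempty_Ioo.mpr hr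
  have hcoef : ∀ (n : ℤ), ∀ t ∈ Ioo r 1,
      stripCoeff H n (Real.log t) = stripCoeff H n (Real.log t₀) := fun n t ht =>
    stripCoeff_eq hH hper n (hlog t ht) (hlog t₀ ht₀)
  set M := (stripCoeff H 0 (Real.log t₀)).re with hM
  have hmean : ∀ t ∈ Ioo r 1,
      ∫ θ in (0 : ℝ)..2 * Real.pi, (H ((Real.log t : ℝ) + θ * Complex.I)).re = M := by
    intro t ht
    rw [hM, ← hcoef 0 t ht, re_stripCoeff_zero hH (hlog t ht)]
  have hcont : ∀ t ∈ Ioo r 1, Continuous fun θ : ℝ =>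
      (H ((Real.log t : ℝ) + θ * Complex.I)).re := fun t ht =>
    Complex.continuous_re.comp (continuous_line hH (hlog t ht))
  have hconst : ∀ c : ℝ, ∫ _ in (0 : ℝ)..2 * Real.pi, c = 2 * Real.pi * c := by
    intro c; simp
  have hM0 : 0 ≤ M := by
    refine le_of_forall_pos_le_add fun ε hε => ?_
    obtain ⟨t, h1, ht⟩ := ((hOut (ε / (2 * Real.pi)) (by positivity)).and hOutI).exists
    have h2 := intervalIntegral.integral_mono_on (μ := MeasureTheory.volume) hpi.le
      (continuous_const.intervalIntegrable _ _)
      ((hcont t ht).intervalIntegrable _ _) (fun θ _ => h1 θ)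
    rw [hmean t ht, hconst] at h2
    have : 2 * Real.pi * -(ε / (2 * Real.pi)) = -ε := by field_simp
    linarith
  have hMm : M ≤ 2 * Real.pi * m := by
    refine le_of_forall_pos_le_add fun ε hε => ?_
    obtain ⟨t, h1, ht⟩ := ((hIn (ε / (2 * Real.pi)) (by positivity)).and hInI).exists
    have h2 := intervalIntegral.integral_mono_on (μ := MeasureTheory.volume) hpi.le
      ((hcont t ht).intervalIntegrable _ _)
      (continuous_const.intervalIntegrable _ _) (fun θ _ => h1 θ)
    rw [hmean t ht, hconst] at h2
    have : 2 * Real.pi * (m + ε / (2 * Real.pi)) = 2 * Real.pi * m + ε := by field_simp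
    linarith
  refine ⟨nonneg_of_mul_nonneg_right (hM0.trans hMm) hpi, fun hm0 => ?_⟩
  have hMz : M = 0 := le_antisymm (by simpa [hm0] using hMm) hM0
  set V : ℤ → ℝ → ℂ := fun n t => ∫ θ in (0 : ℝ)..2 * Real.pi,
    ((H ((Real.log t : ℝ) + θ * Complex.I)).re : ℂ) * Complex.exp (-n * (θ * Complex.I)) with hV
  have hVle : ∀ n : ℤ, ∀ t ∈ Ioo r 1,
      ‖V n t‖ ≤ ∫ θ in (0 : ℝ)..2 * Real.pi, |(H ((Real.log t : ℝ) + θ * Complex.I)).re| := by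
    intro n t ht
    refine (intervalIntegral.norm_integral_le_integral_norm hpi.le).trans (le_of_eq ?_)
    refine intervalIntegral.integral_congr fun θ _ => ?_
    have : Complex.exp (-n * (θ * Complex.I)) = Complex.exp (((-n * θ : ℝ) : ℂ) * Complex.I) := by
      congr 1; push_cast; ring
    simp only [norm_mul, this, Complex.norm_exp_ofReal_mul_I, mul_one, Complex.norm_real,
      Real.norm_eq_abs]
  -- From `u ≥ -δ` follows `|u| ≤ u + 2 * δ`. As the mean of `u` is zero, the one-sided bound
  -- controls the full `L¹` norm and with it every Fourier coefficient.
  have hVout : ∀ n : ℤ, Tendsto (V n) (𝓝[<] 1) (𝓝 0) := by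
    intro n
    rw [Metric.tendsto_nhds]
    intro ε hε
    filter_upwards [hOut (ε / (8 * Real.pi)) (by positivity), hOutI] with t h1 ht
    rw [dist_zero_right]
    refine (hVle n t ht).trans_lt ?_
    have h2 := intervalIntegral.integral_mono_on (μ := MeasureTheory.volume) hpi.le
      ((hcont t ht).abs.intervalIntegrable _ _)
      (((hcont t ht).add continuous_const).intervalIntegrable _ _)
      (fun θ _ => show |(H ((Real.log t : ℝ) + θ * Complex.I)).re| ≤
        (H ((Real.log t : ℝ) + θ * Complex.I)).re + 2 * (ε / (8 * Real.pi)) by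
          rw [abs_le]; constructor <;> linarith [h1 θ, show 0 < ε / (8 * Real.pi) by positivity])
    simp only [Pi.add_apply] at h2
    rw [intervalIntegral.integral_add ((hcont t ht).intervalIntegrable _ _)
      (continuous_const.intervalIntegrable _ _), hmean t ht, hconst, hMz] at h2
    have : 2 * Real.pi * (2 * (ε / (8 * Real.pi))) = ε / 2 := by field_simp; norm_num
    linarith
  have hVin : ∀ n : ℤ, Tendsto (V n) (𝓝[>] r) (𝓝 0) := by
    intro n
    rw [Metric.tendsto_nhds]
    intro ε hε
    filter_upwards [hIn (ε / (8 * Real.pi)) (by positivity), hInI] with t h1 ht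
    rw [dist_zero_right]
    refine (hVle n t ht).trans_lt ?_
    have h2 := intervalIntegral.integral_mono_on (μ := MeasureTheory.volume) hpi.le
      ((hcont t ht).abs.intervalIntegrable _ _)
      ((continuous_const.sub (hcont t ht)).intervalIntegrable _ _)
      (fun θ _ => show |(H ((Real.log t : ℝ) + θ * Complex.I)).re| ≤
        2 * (ε / (8 * Real.pi)) - (H ((Real.log t : ℝ) + θ * Complex.I)).re by
          rw [abs_le]; constructor <;> linarith [h1 θ, show 0 < ε / (8 * Real.pi) by positivity])
    simp only [Pi.sub_apply] at h2
    rw [intervalIntegral.integral_sub (continuous_const.intervalIntegrable _ _)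
      ((hcont t ht).intervalIntegrable _ _), hmean t ht, hconst, hMz] at h2
    have : 2 * Real.pi * (2 * (ε / (8 * Real.pi))) = ε / 2 := by field_simp; norm_num
    linarith
  -- The factor `t ^ n` clears the negative power of `t`, so that the identity still has a limit as
  -- `t → r` when `r = 0`.
  have hVt : ∀ n : ℕ, ∀ t ∈ Ioo r 1, 2 * V n t * (t : ℂ) ^ n =
      stripCoeff H n (Real.log t₀) * (t : ℂ) ^ (2 * n) +
        (starRingEnd ℂ) (stripCoeff H (-n) (Real.log t₀)) := by
    intro n t ht
    have htpos : 0 < t := hr0.trans_lt ht.1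
    have hexp : Complex.exp ((n : ℤ) * (Real.log t : ℝ)) = (t : ℂ) ^ n := by
      rw [Int.cast_natCast, Complex.exp_nat_mul, ← Complex.ofReal_exp, Real.exp_log htpos]
    have hexp' : Complex.exp (-(n : ℤ) * (Real.log t : ℝ)) * (t : ℂ) ^ n = 1 := by
      rw [← hexp, ← Complex.exp_add]; simp
    rw [hV]
    simp only
    rw [two_mul_integral_re hH (hlog t ht), hcoef _ t ht, hcoef _ t ht, hexp, add_mul, mul_assoc,
      mul_assoc, hexp', ← pow_add, two_mul, mul_one]
  have hlim : ∀ n : ℕ, ∀ x : ℝ, ∀ l : Filter ℝ, l.NeBot → l ≤ 𝓝 x → (∀ᶠ t in l, t ∈ Ioo r 1) →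
      Tendsto (V n) l (𝓝 0) → stripCoeff H n (Real.log t₀) * (x : ℂ) ^ (2 * n) +
        (starRingEnd ℂ) (stripCoeff H (-n) (Real.log t₀)) = 0 := by
    intro n x l hl hlx hI hVl
    have hid : Tendsto (fun t : ℝ => (t : ℂ)) l (𝓝 (x : ℂ)) :=
      (Complex.continuous_ofReal.tendsto x).mono_left hlx
    have h1 : Tendsto (fun t : ℝ => 2 * V n t * (t : ℂ) ^ n) l (𝓝 (2 * 0 * (x : ℂ) ^ n)) :=
      (hVl.const_mul 2).mul (hid.pow n)
    have h2 : Tendsto (fun t : ℝ => stripCoeff H n (Real.log t₀) * (t : ℂ) ^ (2 * n) +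
        (starRingEnd ℂ) (stripCoeff H (-n) (Real.log t₀))) l
        (𝓝 (stripCoeff H n (Real.log t₀) * (x : ℂ) ^ (2 * n) +
        (starRingEnd ℂ) (stripCoeff H (-n) (Real.log t₀)))) :=
      ((hid.pow _).const_mul _).add_const _
    have h3 := h1.congr' (hI.mono fun t ht => hVt n t ht)
    have := tendsto_nhds_unique h2 h3
    simpa using this
  have hzero : ∀ n : ℕ, n ≠ 0 → stripCoeff H n (Real.log t₀) = 0 ∧
      stripCoeff H (-n) (Real.log t₀) = 0 := by
    intro n hn
    -- The two ends give two linear equations for the coefficients of index `n` and `-n`. Their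
    -- difference leaves the factor `1 - r ^ (2 * n)`, which is nonzero.
    have e1 := hlim n 1 (𝓝[<] 1) inferInstance nhdsWithin_le_nhds hOutI (hVout n)
    have e2 := hlim n r (𝓝[>] r) inferInstance nhdsWithin_le_nhds hInI (hVin n)
    have hr2 : (r : ℂ) ^ (2 * n) ≠ 1 := by
      have : r ^ (2 * n) < 1 := pow_lt_one₀ hr0 hr (by omega)
      exact_mod_cast this.ne
    have e3 : stripCoeff H n (Real.log t₀) * (1 - (r : ℂ) ^ (2 * n)) = 0 := by
      simp only [Complex.ofReal_one, one_pow, mul_one] at e1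
      linear_combination e1 - e2
    have e4 := (mul_eq_zero.mp e3).resolve_right (sub_ne_zero.mpr hr2.symm)
    refine ⟨e4, ?_⟩
    rw [e4] at e1
    simpa using e1
  refine ⟨stripCoeff H 0 (Real.log t₀) / (2 * Real.pi), ?_, fun ζ hζ => ?_⟩
  · have : (2 * Real.pi : ℂ) = ((2 * Real.pi : ℝ) : ℂ) := by push_cast; ring
    rw [this, Complex.div_ofReal_re, ← hM, hMz, zero_div]
  · set c := stripCoeff H 0 (Real.log t₀) / (2 * Real.pi) with hc
    have hζ' := mem_strip.mp hζ
    have hsz : stripCoeff H 0 ζ.re = stripCoeff H 0 (Real.log t₀) :=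
      stripCoeff_eq hH hper 0 hζ' (hlog t₀ ht₀)
    have h0 := eq_zero_of_stripCoeff_eq_zero (H := fun ζ => H ζ - c) (hH.sub_const c)
      (fun ζ hζ => by simp only [hper ζ hζ]) hζ' (fun n => by
        have h1 := stripCoeff_sub_const hH hζ' n
        rw [hsz] at h1
        rw [h1]
        split_ifs with hn
        · rfl
        · rw [stripCoeff_eq hH hper n hζ' (hlog t₀ ht₀)]
          obtain ⟨k, rfl | rfl⟩ := n.eq_nat_or_neg
          · exact (hzero k (by simpa using hn)).1
          · exact (hzero k (by simpa using hn)).2) ζ.im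
    rw [Complex.re_add_im] at h0
    exact sub_eq_zero.mp h0

/-- A holomorphic nonvanishing function on the annulus with vanishing period has a holomorphic
logarithm, written on the covering strip. -/
theorem exists_log_strip {r : ℝ} {q : ℂ → ℂ} (hq : DifferentiableOn ℂ q (annulus r))
    (hq0 : ∀ w ∈ annulus r, q w ≠ 0) {t : ℝ} (htpos : 0 < t) (ht : t ∈ Ioo r 1)
    (hper : ∮ w in C(0, t), deriv q w / q w = 0) :
    ∃ H : ℂ → ℂ, DifferentiableOn ℂ H (strip r) ∧
      (∀ ζ ∈ strip r, H (ζ + 2 * Real.pi * Complex.I) = H ζ) ∧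
      ∀ ζ ∈ strip r, Complex.exp (H ζ) = q (Complex.exp ζ) := by
  have hSo := isOpen_strip r
  have hSc := convex_strip r
  have hqd : ∀ w ∈ annulus r, HasDerivAt q (deriv q w) w := fun w hw =>
    (hq.differentiableAt ((isOpen_annulus r).mem_nhds hw)).hasDerivAt
  have hdq : DifferentiableOn ℂ (deriv q) (annulus r) := hq.deriv (isOpen_annulus r)
  set k : ℂ → ℂ := fun w => deriv q w / q w with hk
  have hkd : DifferentiableOn ℂ k (annulus r) := hdq.div hq hq0
  -- The logarithmic derivative of `q ∘ exp`; it has a primitive because the strip is convex.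
  set K : ℂ → ℂ := fun ζ => Complex.exp ζ * k (Complex.exp ζ) with hK
  have hKd : DifferentiableOn ℂ K (strip r) :=
    Complex.differentiable_exp.differentiableOn.mul
      (hkd.comp Complex.differentiable_exp.differentiableOn (fun ζ h => h))
  obtain ⟨L, hL⟩ := hSc.exists_forall_hasDerivWithinAt hKd
  have hL' : ∀ ζ ∈ strip r, HasDerivAt L (K ζ) ζ := fun ζ hζ =>
    (hL ζ hζ).hasDerivAt (hSo.mem_nhds hζ)
  have hs : Real.exp (Real.log t) ∈ Ioo r 1 := by rwa [Real.exp_log htpos]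
  set ζ₀ : ℂ := ((Real.log t : ℝ) : ℂ) with hζ₀
  have hζ₀S : ζ₀ ∈ strip r := by simpa using line_mem_strip hs 0
  have hconst : ∀ G : ℂ → ℂ, (∀ ζ ∈ strip r, HasDerivAt G 0 ζ) → ∀ ζ ∈ strip r, G ζ = G ζ₀ := by
    intro G hG ζ hζ
    refine hSc.is_const_of_fderivWithin_eq_zero (𝕜 := ℂ) (f := G)
      (fun x hx => (hG x hx).differentiableAt.differentiableWithinAt) (fun x hx => ?_) hζ hζ₀S
    have h1 := (hG x hx).hasFDerivAt.hasFDerivWithinAt (s := strip r)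
    rw [h1.fderivWithin (hSo.uniqueDiffWithinAt hx)]
    ext; simp
  have hE : ∀ ζ ∈ strip r, q (Complex.exp ζ) * Complex.exp (-L ζ) =
      q (Complex.exp ζ₀) * Complex.exp (-L ζ₀) := by
    apply hconst
    intro ζ hζ
    have h1 : HasDerivAt (fun ζ => q (Complex.exp ζ))
        (deriv q (Complex.exp ζ) * Complex.exp ζ) ζ :=
      (hqd _ hζ).comp ζ (Complex.hasDerivAt_exp ζ)
    have h2 := h1.fun_mul ((hL' ζ hζ).neg.cexp)
    have hne := hq0 _ hζ
    convert! h2 using 1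
    simp only [hK, hk, Pi.neg_apply]
    field_simp
    ring
  set c₀ := q (Complex.exp ζ₀) * Complex.exp (-L ζ₀) with hc₀
  have hc₀ne : c₀ ≠ 0 := mul_ne_zero (hq0 _ hζ₀S) (Complex.exp_ne_zero _)
  set H : ℂ → ℂ := fun ζ => L ζ + Complex.log c₀ with hH
  have hHd : ∀ ζ ∈ strip r, HasDerivAt H (K ζ) ζ := fun ζ hζ => (hL' ζ hζ).add_const _
  refine ⟨H, fun ζ hζ => (hHd ζ hζ).differentiableAt.differentiableWithinAt, ?_, fun ζ hζ => ?_⟩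
  · have htrans : ∀ ζ ∈ strip r, ζ + 2 * Real.pi * Complex.I ∈ strip r := fun ζ hζ =>
      mem_strip_of_re (by simp) hζ
    -- `K` is periodic, so the period of `H` is a constant. Evaluated at `ζ₀` it is the integral of
    -- `q' / q` over the circle of radius `t`, which vanishes by assumption.
    have hD : ∀ ζ ∈ strip r, H (ζ + 2 * Real.pi * Complex.I) - H ζ =
        H (ζ₀ + 2 * Real.pi * Complex.I) - H ζ₀ := by
      apply hconst
      intro ζ hζ
      have h1 := ((hHd _ (htrans ζ hζ)).comp_add_const ζ (2 * Real.pi * Complex.I)).fun_sub (hHd ζ hζ)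
      convert! h1 using 1
      simp [hK, Complex.exp_add, Complex.exp_two_pi_mul_I]
    have hz : H (ζ₀ + 2 * Real.pi * Complex.I) - H ζ₀ = 0 := by
      have h1 : ∀ θ : ℝ, HasDerivAt (fun θ : ℝ => H (ζ₀ + θ * Complex.I))
          (Complex.I * K (ζ₀ + θ * Complex.I)) θ := by
        intro θ
        have hm : ζ₀ + θ * Complex.I ∈ strip r := line_mem_strip hs θ
        have h2 : HasDerivAt (fun x : ℂ => ζ₀ + x * Complex.I) Complex.I (θ : ℂ) := by
          simpa using ((hasDerivAt_id (θ : ℂ)).mul_const Complex.I).const_add ζ₀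
        have h3 := ((hHd _ hm).comp (θ : ℂ) h2).comp_ofReal
        rw [mul_comm] at h3
        exact h3
      have hKc : Continuous fun θ : ℝ => Complex.I * K (ζ₀ + θ * Complex.I) :=
        continuous_const.mul (continuous_line hKd hs)
      have h4 := intervalIntegral.integral_eq_sub_of_hasDerivAt (a := 0) (b := 2 * Real.pi)
        (fun θ _ => h1 θ) (hKc.intervalIntegrable _ _)
      have h5 : (∮ w in C(0, t), k w) =
          ∫ θ in (0 : ℝ)..2 * Real.pi, Complex.I * K (ζ₀ + θ * Complex.I) := by
        rw [circleIntegral]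
        refine intervalIntegral.integral_congr fun θ _ => ?_
        have h6 : Complex.exp (ζ₀ + θ * Complex.I) = circleMap 0 t θ := by
          rw [Complex.exp_add, hζ₀, ← Complex.ofReal_exp, Real.exp_log htpos]
          simp [circleMap]
        simp only [hK, h6, deriv_circleMap, smul_eq_mul]
        ring
      rw [← h5, hper] at h4
      push_cast at h4
      simpa using h4.symm
    intro ζ hζ
    exact sub_eq_zero.mp ((hD ζ hζ).trans hz)
  · rw [hH]
    simp only
    rw [Complex.exp_add, Complex.exp_log hc₀ne, ← hE ζ hζ, mul_left_comm, ← Complex.exp_add]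
    simp

/-- Comparison of the boundary values of `log ‖q‖` on the two boundary circles, for `q` with
vanishing period; in the case of equality `q` is constant. -/
theorem log_norm_boundary {r : ℝ} (hr0 : 0 ≤ r) (hr : r < 1) {q : ℂ → ℂ}
    (hq : DifferentiableOn ℂ q (annulus r))
    (hq0 : ∀ w ∈ annulus r, q w ≠ 0) {t : ℝ} (ht : t ∈ Ioo r 1)
    (hper : ∮ w in C(0, t), deriv q w / q w = 0) {m : ℝ}
    (hOut : ∀ ε > 0, ∀ᶠ t in 𝓝[<] (1 : ℝ), ∀ w : ℂ, ‖w‖ = t → -ε ≤ Real.log ‖q w‖)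
    (hIn : ∀ ε > 0, ∀ᶠ t in 𝓝[>] r, ∀ w : ℂ, ‖w‖ = t → Real.log ‖q w‖ ≤ m + ε) :
    0 ≤ m ∧ (m = 0 → ∃ c : ℂ, ‖c‖ = 1 ∧ ∀ w ∈ annulus r, q w = c) := by
  obtain ⟨H, hH, hHper, hHq⟩ := exists_log_strip hq hq0 (hr0.trans_lt ht.1) ht hper
  have hre : ∀ t ∈ Ioo r 1, ∀ θ : ℝ, ‖Complex.exp ((Real.log t : ℝ) + θ * Complex.I)‖ = t ∧
      (H ((Real.log t : ℝ) + θ * Complex.I)).re =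
        Real.log ‖q (Complex.exp ((Real.log t : ℝ) + θ * Complex.I))‖ := by
    intro t ht θ
    have htpos : 0 < t := hr0.trans_lt ht.1
    have hm := line_mem_strip (r := r) (s := Real.log t) (by rwa [Real.exp_log htpos]) θ
    refine ⟨?_, ?_⟩
    · simp [Complex.norm_exp, Real.exp_log htpos]
    · rw [← hHq _ hm, Complex.norm_exp, Real.log_exp]
  obtain ⟨h1, h2⟩ := nonneg_of_re_boundary hr0 hr hH hHper (m := m)
    (fun ε hε => by
      filter_upwards [hOut ε hε, Ioo_mem_nhdsLT hr] with t h1 ht θ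
      rw [(hre t ht θ).2]
      exact h1 _ (hre t ht θ).1)
    (fun ε hε => by
      filter_upwards [hIn ε hε, Ioo_mem_nhdsGT hr] with t h1 ht θ
      rw [(hre t ht θ).2]
      exact h1 _ (hre t ht θ).1)
  refine ⟨h1, fun hm => ?_⟩
  obtain ⟨c, hc, hcH⟩ := h2 hm
  refine ⟨Complex.exp c, by rw [Complex.norm_exp, hc, Real.exp_zero], fun w hw => ?_⟩
  have hw0 : w ≠ 0 := norm_pos_iff.mp (hr0.trans_lt hw.1)
  have hm : Complex.log w ∈ strip r := by
    show Complex.exp (Complex.log w) ∈ annulus r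
    rwa [Complex.exp_log hw0]
  have := hHq _ hm
  rw [Complex.exp_log hw0, hcH _ hm] at this
  exact this.symm

theorem isPreconnected_norm_Ioo {a : ℝ} (ha : 0 ≤ a) (b : ℝ) :
    IsPreconnected {w : ℂ | a < ‖w‖ ∧ ‖w‖ < b} := by
  have h : {w : ℂ | a < ‖w‖ ∧ ‖w‖ < b} =
      Complex.exp '' (Complex.re ⁻¹' (Real.exp ⁻¹' (Ioo a b))) := by
    ext w
    constructor
    · rintro ⟨h1, h2⟩
      have hw : w ≠ 0 := norm_pos_iff.mp (ha.trans_lt h1)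
      refine ⟨Complex.log w, ?_, Complex.exp_log hw⟩
      simp only [mem_preimage, Complex.log_re, Real.exp_log (ha.trans_lt h1)]
      exact ⟨h1, h2⟩
    · rintro ⟨ζ, hζ, rfl⟩
      simpa [Complex.norm_exp] using hζ
  rw [h]
  have h2 : Convex ℝ (Real.exp ⁻¹' (Ioo a b)) :=
    (ordConnected_Ioo.preimage_mono Real.exp_monotone).convex
  exact (h2.is_linear_preimage (Complex.reLm.isLinear)).isPreconnected.image _
    Complex.continuous_exp.continuousOn

theorem isPreconnected_annulus {r : ℝ} (hr : 0 ≤ r) : IsPreconnected (annulus r) :=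
  isPreconnected_norm_Ioo hr 1

theorem sphere_subset_annulus {r t : ℝ} (ht : t ∈ Ioo r 1) : sphere (0 : ℂ) t ⊆ annulus r := by
  intro w hw
  rw [mem_sphere_zero_iff_norm] at hw
  rw [mem_annulus, hw]
  exact ht

/-! ### Indices of image circles; outer and inner type -/

/-- `∮ f' / (f - ξ)` over the circle of radius `t` about the origin. -/
def logIndex (f : ℂ → ℂ) (ξ : ℂ) (t : ℝ) : ℂ := ∮ w in C(0, t), deriv f w / (f w - ξ)

/-- The values of `u` on the circle stay in the disk of radius one about `1`, inside the slit plane,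
so the principal logarithm of `u` is a primitive. -/
theorem circleIntegral_logDeriv_eq_zero {u : ℂ → ℂ} {t : ℝ} (ht : 0 ≤ t)
    (hu : ∀ w ∈ sphere (0 : ℂ) t, DifferentiableAt ℂ u w)
    (h1 : ∀ w ∈ sphere (0 : ℂ) t, ‖u w - 1‖ < 1) : ∮ w in C(0, t), deriv u w / u w = 0 := by
  refine circleIntegral.integral_eq_zero_of_hasDerivWithinAt (f := fun w => Complex.log (u w)) ht
    fun w hw => ?_
  refine (HasDerivAt.clog (hu w hw).hasDerivAt ?_).hasDerivWithinAt
  have := Complex.mem_slitPlane_of_norm_lt_one (h1 w hw)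
  simpa using this

theorem circleIntegral_eq_of_differentiableOn {r : ℝ} (hr : 0 ≤ r) {F : ℂ → ℂ} {t₁ t₂ : ℝ}
    (hF : ∀ w : ℂ, t₁ ≤ ‖w‖ → ‖w‖ ≤ t₂ → DifferentiableAt ℂ F w) (h₁ : r < t₁) (h : t₁ ≤ t₂) :
    ∮ w in C(0, t₂), F w = ∮ w in C(0, t₁), F w := by
  refine Complex.circleIntegral_eq_of_differentiable_on_annulus_off_countable (hr.trans_lt h₁) h
    countable_empty (fun w hw => ?_) fun w hw => ?_
  · exact (hF w (by simpa using hw.2) (by simpa using hw.1)).continuousAt.continuousWithinAt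
  · refine hF w ?_ ?_
    · have := hw.1.2; simp at this; exact this.le
    · have := hw.1.1; simp at this; exact this.le

section

variable {r : ℝ} {f : ℂ → ℂ}

theorem continuousOn_deriv_div (hf : DifferentiableOn ℂ f (annulus r)) {ξ : ℂ} {t : ℝ}
    (ht : t ∈ Ioo r 1) (h : ∀ w ∈ sphere (0 : ℂ) t, f w ≠ ξ) :
    ContinuousOn (fun w => deriv f w / (f w - ξ)) (sphere 0 t) := by
  have hs := sphere_subset_annulus ht
  exact ((hf.deriv (isOpen_annulus r)).continuousOn.mono hs).div
    ((hf.continuousOn.mono hs).sub continuousOn_const) (fun w hw => sub_ne_zero.mpr (h w hw))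

/-- The difference of the indices is the integral of the logarithmic derivative of `(f - ξ') / (f -
ξ)`, and this quotient stays within distance one of `1`. -/
theorem logIndex_eq_of_norm_lt (hr : 0 ≤ r) (hf : DifferentiableOn ℂ f (annulus r)) {ξ ξ' : ℂ}
    {t : ℝ} (ht : t ∈ Ioo r 1) (h : ∀ w ∈ sphere (0 : ℂ) t, ‖ξ' - ξ‖ < ‖f w - ξ‖) :
    logIndex f ξ' t = logIndex f ξ t := by
  have ht0 : 0 ≤ t := hr.trans ht.1.le
  have hs := sphere_subset_annulus ht
  have hfd : ∀ w ∈ sphere (0 : ℂ) t, DifferentiableAt ℂ f w := fun w hw =>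
    hf.differentiableAt ((isOpen_annulus r).mem_nhds (hs hw))
  have hne : ∀ w ∈ sphere (0 : ℂ) t, f w ≠ ξ := fun w hw he => by
    have := h w hw
    rw [he, sub_self, norm_zero] at this
    exact absurd this (norm_nonneg _).not_gt
  have hne' : ∀ w ∈ sphere (0 : ℂ) t, f w ≠ ξ' := fun w hw he => by
    have := h w hw
    rw [he] at this
    exact lt_irrefl _ this
  rw [← sub_eq_zero, logIndex, logIndex, ← circleIntegral.integral_sub
    ((continuousOn_deriv_div hf ht hne').circleIntegrable ht0)
    ((continuousOn_deriv_div hf ht hne).circleIntegrable ht0)]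
  refine Eq.trans ?_ (circleIntegral_logDeriv_eq_zero
    (u := fun w => (f w - ξ') / (f w - ξ)) ht0 ?_ ?_)
  · refine circleIntegral.integral_congr ht0 fun w hw => ?_
    have h1 := sub_ne_zero.mpr (hne w hw)
    have h2 := sub_ne_zero.mpr (hne' w hw)
    have hd := (hfd w hw).hasDerivAt
    rw [((hd.sub_const ξ').fun_div (hd.sub_const ξ) h1).deriv]
    field_simp
  · intro w hw
    exact ((hfd w hw).sub_const _).div ((hfd w hw).sub_const _) (sub_ne_zero.mpr (hne w hw))
  · intro w hw
    have h1 := sub_ne_zero.mpr (hne w hw)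
    have : (f w - ξ') / (f w - ξ) - 1 = -(ξ' - ξ) / (f w - ξ) := by
      field_simp; ring
    rw [this, norm_div, norm_neg, div_lt_one (norm_pos_iff.mpr h1)]
    exact h w hw

theorem logIndex_eq_zero_of_norm_lt (hr : 0 ≤ r) (hf : DifferentiableOn ℂ f (annulus r)) {ξ : ℂ}
    {t : ℝ} (ht : t ∈ Ioo r 1) (h : ∀ w ∈ sphere (0 : ℂ) t, ‖f w‖ < ‖ξ‖) :
    logIndex f ξ t = 0 := by
  have ht0 : 0 ≤ t := hr.trans ht.1.le
  have hs := sphere_subset_annulus ht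
  have hfd : ∀ w ∈ sphere (0 : ℂ) t, DifferentiableAt ℂ f w := fun w hw =>
    hf.differentiableAt ((isOpen_annulus r).mem_nhds (hs hw))
  have hξ : ξ ≠ 0 := by
    have hm : (t : ℂ) ∈ sphere (0 : ℂ) t := by simp [abs_of_nonneg ht0]
    exact norm_pos_iff.mp ((norm_nonneg _).trans_lt (h _ hm))
  rw [logIndex]
  refine Eq.trans ?_ (circleIntegral_logDeriv_eq_zero (u := fun w => 1 - f w / ξ) ht0 ?_ ?_)
  · refine circleIntegral.integral_congr ht0 fun w hw => ?_
    have hne : f w - ξ ≠ 0 := sub_ne_zero.mpr fun he => by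
      have := h w hw
      rw [he] at this
      exact lt_irrefl _ this
    rw [(((hfd w hw).hasDerivAt.div_const ξ).const_sub 1).deriv]
    have h2 : 1 - f w / ξ ≠ 0 := by
      intro h0
      apply hne
      field_simp at h0
      linear_combination -h0
    have h3 : ξ - f w ≠ 0 := fun h => hne (by linear_combination -h)
    field_simp
    ring
  · intro w hw
    exact ((hfd w hw).div_const _).const_sub _
  · intro w hw
    have : 1 - f w / ξ - 1 = -(f w / ξ) := by ring
    rw [this, norm_neg, norm_div, div_lt_one (norm_pos_iff.mpr hξ)]
    exact h w hw

theorem logIndex_eq_of_ne (hr : 0 ≤ r) (hf : DifferentiableOn ℂ f (annulus r)) {ξ : ℂ}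
    {t₁ t₂ : ℝ} (h₁ : r < t₁) (h₂ : t₂ < 1) (h : t₁ ≤ t₂)
    (hne : ∀ w : ℂ, t₁ ≤ ‖w‖ → ‖w‖ ≤ t₂ → f w ≠ ξ) : logIndex f ξ t₂ = logIndex f ξ t₁ := by
  refine circleIntegral_eq_of_differentiableOn hr (fun w hw1 hw2 => ?_) h₁ h
  have hm : annulus r ∈ 𝓝 w := (isOpen_annulus r).mem_nhds ⟨h₁.trans_le hw1, hw2.trans_lt h₂⟩
  exact ((hf.deriv (isOpen_annulus r)).differentiableAt hm).div
    ((hf.differentiableAt hm).sub_const _) (sub_ne_zero.mpr (hne w hw1 hw2))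

theorem differentiableOn_dslope_annulus (hf : DifferentiableOn ℂ f (annulus r)) {z : ℂ}
    (hz : z ∈ annulus r) : DifferentiableOn ℂ (dslope f z) (annulus r) :=
  (Complex.differentiableOn_dslope ((isOpen_annulus r).mem_nhds hz)).mpr hf

theorem dslope_ne_zero_of_injOn {Ω : Set ℂ} (hΩ : IsOpen Ω) (hf : DifferentiableOn ℂ f Ω)
    (hinj : InjOn f Ω) {z w : ℂ} (hz : z ∈ Ω) (hw : w ∈ Ω) : dslope f z w ≠ 0 := by
  by_cases h : w = z
  · rw [h, dslope_same]
    exact deriv_ne_zero_of_injOn hΩ hf hinj hz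
  · rw [dslope_of_ne _ h, slope_def_field]
    exact div_ne_zero (sub_ne_zero.mpr fun he => h (hinj hw hz he)) (sub_ne_zero.mpr h)

theorem logDeriv_eq_add_dslope (hf : DifferentiableOn ℂ f (annulus r)) (hinj : InjOn f (annulus r))
    {z w : ℂ} (hz : z ∈ annulus r) (hw : w ∈ annulus r) (hwz : w ≠ z) :
    deriv f w / (f w - f z) =
      (w - z)⁻¹ + deriv (dslope f z) w / dslope f z w := by
  have hk := ((differentiableOn_dslope_annulus hf hz).differentiableAt
    ((isOpen_annulus r).mem_nhds hw)).hasDerivAt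
  have hk0 := dslope_ne_zero_of_injOn (isOpen_annulus r) hf hinj hz hw
  have h1 : f = fun w => (w - z) * dslope f z w + f z := by
    funext v
    have := sub_smul_dslope f z v
    rw [smul_eq_mul] at this
    rw [this]; ring
  have h2 : deriv f w = dslope f z w + (w - z) * deriv (dslope f z) w := by
    have h3 := (((hasDerivAt_id w).sub_const z).fun_mul hk).add_const (f z)
    rw [← (by simpa using h3.deriv : _ = dslope f z w + (w - z) * deriv (dslope f z) w)]
    conv_lhs => rw [h1]
    simp
  have h4 : f w - f z = (w - z) * dslope f z w := by
    have := sub_smul_dslope f z w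
    rw [smul_eq_mul] at this
    exact this.symm
  have hwz' := sub_ne_zero.mpr hwz
  rw [h2, h4]
  field_simp

theorem circleIntegral_sub_inv_of_norm_lt {z : ℂ} {t : ℝ} (ht : 0 ≤ t) (h : t < ‖z‖) :
    ∮ w in C(0, t), (w - z)⁻¹ = 0 := by
  refine Complex.circleIntegral_eq_zero_of_differentiable_on_off_countable ht countable_empty
    (fun w hw => ?_) fun w hw => ?_
  · refine ContinuousAt.continuousWithinAt (ContinuousAt.inv₀ (by fun_prop) (sub_ne_zero.mpr ?_))
    rintro rfl
    simp at hw; linarith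
  · refine DifferentiableAt.inv (by fun_prop) (sub_ne_zero.mpr ?_)
    rintro rfl
    have := hw.1
    simp at this; linarith

/-- The argument principle for the single simple zero of `f - f z`: in `f w - f z = (w - z) * dslope
f z w` the second factor has no zeros and contributes equally to both circles, while `(w - z)⁻¹`
contributes only to the larger one. -/
theorem logIndex_jump (hr : 0 ≤ r) (hf : DifferentiableOn ℂ f (annulus r))
    (hinj : InjOn f (annulus r)) {z : ℂ} {t₁ t₂ : ℝ} (h₁ : r < t₁) (h₂ : t₂ < 1)
    (hz₁ : t₁ < ‖z‖) (hz₂ : ‖z‖ < t₂) :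
    logIndex f (f z) t₂ = logIndex f (f z) t₁ + 2 * Real.pi * Complex.I := by
  have hz : z ∈ annulus r := ⟨h₁.trans hz₁, hz₂.trans h₂⟩
  have hk := differentiableOn_dslope_annulus hf hz
  have hk0 : ∀ w ∈ annulus r, dslope f z w ≠ 0 := fun w hw =>
    dslope_ne_zero_of_injOn (isOpen_annulus r) hf hinj hz hw
  have hquot : DifferentiableOn ℂ (fun w => deriv (dslope f z) w / dslope f z w) (annulus r) :=
    (hk.deriv (isOpen_annulus r)).div hk hk0
  have hsplit : ∀ t ∈ Ioo r 1, t ≠ ‖z‖ → logIndex f (f z) t = (∮ w in C(0, t), (w - z)⁻¹) +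
      ∮ w in C(0, t), deriv (dslope f z) w / dslope f z w := by
    intro t ht hne
    have ht0 : 0 ≤ t := hr.trans ht.1.le
    have hwz : ∀ w ∈ sphere (0 : ℂ) t, w ≠ z := by
      rintro w hw rfl
      exact hne (by simpa using hw.symm)
    rw [← circleIntegral.integral_add]
    · exact circleIntegral.integral_congr ht0 fun w hw =>
        logDeriv_eq_add_dslope hf hinj hz (sphere_subset_annulus ht hw) (hwz w hw)
    · refine ContinuousOn.circleIntegrable ht0 (ContinuousOn.inv₀ (by fun_prop) fun w hw => ?_)
      exact sub_ne_zero.mpr (hwz w hw)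
    · exact (hquot.continuousOn.mono (sphere_subset_annulus ht)).circleIntegrable ht0
  have ht1 : t₁ ∈ Ioo r 1 := ⟨h₁, (hz₁.trans hz₂).trans h₂⟩
  have ht2 : t₂ ∈ Ioo r 1 := ⟨h₁.trans (hz₁.trans hz₂), h₂⟩
  rw [hsplit t₁ ht1 hz₁.ne, hsplit t₂ ht2 hz₂.ne',
    circleIntegral_sub_inv_of_norm_lt (hr.trans h₁.le) hz₁,
    circleIntegral.integral_sub_inv_of_mem_ball (by simpa using hz₂),
    circleIntegral_eq_of_differentiableOn hr (fun w hw1 hw2 => hquot.differentiableAt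
      ((isOpen_annulus r).mem_nhds ⟨h₁.trans_le hw1, hw2.trans_lt h₂⟩)) h₁ (hz₁.trans hz₂).le]
  ring

/-- The index is locally constant off the compact image of the circle, and injectivity keeps `f` on
`S` away from that image. -/
theorem logIndex_eq_on_preconnected (hr : 0 ≤ r) (hf : DifferentiableOn ℂ f (annulus r))
    (hinj : InjOn f (annulus r)) {t : ℝ} (ht : t ∈ Ioo r 1) {S : Set ℂ} (hS : IsPreconnected S)
    (hSA : S ⊆ annulus r) (hSt : ∀ w ∈ S, ‖w‖ ≠ t) {a b : ℂ} (ha : a ∈ S) (hb : b ∈ S) :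
    logIndex f (f a) t = logIndex f (f b) t := by
  refine hS.induction₂ (fun a b => logIndex f (f a) t = logIndex f (f b) t) (fun x hx => ?_)
    (fun _ _ _ _ _ _ => Eq.trans) (fun _ _ _ _ => Eq.symm) ha hb
  have hs := sphere_subset_annulus ht
  have hxne : ∀ w ∈ sphere (0 : ℂ) t, f w ≠ f x := fun w hw he => by
    have := hinj (hs hw) (hSA hx) he
    rw [this] at hw
    exact hSt x hx (by simpa using hw)
  have hcl : IsClosed (f '' sphere (0 : ℂ) t) :=
    ((isCompact_sphere _ _).image_of_continuousOn (hf.continuousOn.mono hs)).isClosed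
  have hn : f x ∉ f '' sphere (0 : ℂ) t := by
    rintro ⟨w, hw, he⟩
    exact hxne w hw he
  obtain ⟨ε, hε, hball⟩ := Metric.isOpen_iff.mp hcl.isOpen_compl (f x) hn
  have hcx : ContinuousAt f x :=
    (hf.differentiableAt ((isOpen_annulus r).mem_nhds (hSA hx))).continuousAt
  filter_upwards [(mem_nhdsWithin_of_mem_nhds (hcx.preimage_mem_nhds (ball_mem_nhds _ hε)))]
    with y hy
  refine (logIndex_eq_of_norm_lt hr hf ht fun w hw => ?_).symm
  have h1 : ε ≤ ‖f w - f x‖ := by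
    by_contra hlt
    exact hball (by rw [mem_ball, dist_eq_norm]; exact not_le.mp hlt) (mem_image_of_mem f hw)
  have h2 : ‖f y - f x‖ < ε := by simpa [dist_eq_norm] using hy
  exact h2.trans_le h1

/-- One of the two sides of the circle of radius `t` is mapped to the exterior of its image. -/
theorem logIndex_inside_or_outside (hr : 0 ≤ r) (hf : DifferentiableOn ℂ f (annulus r))
    (hinj : InjOn f (annulus r)) {t : ℝ} (ht : t ∈ Ioo r 1) :
    (∀ w : ℂ, r < ‖w‖ → ‖w‖ < t → logIndex f (f w) t = 0) ∨
      ∀ w : ℂ, t < ‖w‖ → ‖w‖ < 1 → logIndex f (f w) t = 0 := by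
  have ht0 : 0 ≤ t := hr.trans ht.1.le
  have hs := sphere_subset_annulus ht
  obtain ⟨w₀, hw₀, hmax⟩ := (isCompact_sphere (0 : ℂ) t).exists_isMaxOn
    (NormedSpace.sphere_nonempty.mpr ht0) (hf.continuousOn.mono hs).norm
  have hopen := isOpen_image_of_injOn (isOpen_annulus r) hf hinj
  -- The image of the annulus is open and contains the point of largest modulus on the image circle,
  -- so it also has points of larger modulus. About such a point the index is zero, and this
  -- propagates over the side of the circle that contains `w₁`.
  obtain ⟨ξ, hξ, w₁, hw₁, hw₁'⟩ : ∃ ξ : ℂ, ‖f w₀‖ < ‖ξ‖ ∧ ξ ∈ f '' annulus r := by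
    by_contra hcon
    push Not at hcon
    have hsub : f '' annulus r ⊆ closedBall 0 ‖f w₀‖ := fun y hy => by
      rw [mem_closedBall_zero_iff]
      by_contra hlt
      exact hcon y (not_le.mp hlt) hy
    have h1 : f w₀ ∈ interior (closedBall (0 : ℂ) ‖f w₀‖) :=
      interior_maximal hsub hopen (mem_image_of_mem f (hs hw₀))
    rcases eq_or_ne ‖f w₀‖ 0 with h0 | h0
    · rw [h0, closedBall_zero, interior_singleton] at h1
      exact h1
    · rw [interior_closedBall _ h0] at h1
      simp at h1
  have hz : logIndex f (f w₁) t = 0 := by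
    rw [hw₁']
    exact logIndex_eq_zero_of_norm_lt hr hf ht fun w hw => (hmax hw).trans_lt hξ
  have hne : ‖w₁‖ ≠ t := fun he => by
    have := hmax (show w₁ ∈ sphere (0 : ℂ) t by simpa using he)
    simp only [mem_ofPred_eq, hw₁'] at this
    exact absurd hξ this.not_gt
  rcases lt_or_gt_of_ne hne with hlt | hgt
  · left
    intro w h1 h2
    rw [← hz]
    exact logIndex_eq_on_preconnected hr hf hinj ht (isPreconnected_norm_Ioo hr t)
      (fun v hv => ⟨hv.1, hv.2.trans ht.2⟩) (fun v hv => hv.2.ne) ⟨h1, h2⟩ ⟨hw₁.1, hlt⟩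
  · right
    intro w h1 h2
    rw [← hz]
    exact logIndex_eq_on_preconnected hr hf hinj ht (isPreconnected_norm_Ioo ht0 1)
      (fun v hv => ⟨ht.1.trans hv.1, hv.2⟩) (fun v hv => hv.1.ne') ⟨h1, h2⟩ ⟨hgt, hw₁.2⟩

/-- The outer boundary circle of the annulus corresponds to the outer boundary of the image
(expressed through the indices of the image circles about the image of `z`). -/
def IsOuterType (r : ℝ) (z : ℂ) (f : ℂ → ℂ) : Prop :=
  ∀ t ∈ Ioo r 1, (t < ‖z‖ → logIndex f (f z) t = 0) ∧
    (‖z‖ < t → logIndex f (f z) t = 2 * Real.pi * Complex.I)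

/-- The inner boundary circle of the annulus corresponds to the outer boundary of the image. -/
def IsInnerType (r : ℝ) (z : ℂ) (f : ℂ → ℂ) : Prop :=
  ∀ t ∈ Ioo r 1, (t < ‖z‖ → logIndex f (f z) t = -(2 * Real.pi * Complex.I)) ∧
    (‖z‖ < t → logIndex f (f z) t = 0)

theorem logIndex_eq_same_side (hr : 0 ≤ r) (hf : DifferentiableOn ℂ f (annulus r))
    (hinj : InjOn f (annulus r)) {z : ℂ} (hz : z ∈ annulus r) {s t : ℝ} (hs : s ∈ Ioo r 1)
    (ht : t ∈ Ioo r 1) (hst : s < ‖z‖ ∧ t < ‖z‖ ∨ ‖z‖ < s ∧ ‖z‖ < t) :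
    logIndex f (f z) s = logIndex f (f z) t := by
  wlog hle : s ≤ t generalizing s t
  · exact (this ht hs (by tauto) (not_le.mp hle).le).symm
  refine (logIndex_eq_of_ne hr hf hs.1 ht.2 hle fun w h1 h2 he => ?_).symm
  have := hinj ⟨hs.1.trans_le h1, h2.trans_lt ht.2⟩ hz he
  rw [this] at h1 h2
  rcases hst with h | h <;> linarith [h.1, h.2]

/-- Take circles `t₁ < ‖z‖ < t₂`. If the inside of `t₂` has index zero, the type is inner. Otherwise
a point `s` beyond `t₂` has index zero on `t₂`, hence also on `t₁` because `f s` is not attained in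
between, and `z` has the same index on `t₁` since it lies on the same side of `t₁` as `s`. The jump
of `2πi` supplies the other index in each case. -/
theorem isOuterType_or_isInnerType (hr : 0 ≤ r) (hf : DifferentiableOn ℂ f (annulus r))
    (hinj : InjOn f (annulus r)) {z : ℂ} (hz : z ∈ annulus r) :
    IsOuterType r z f ∨ IsInnerType r z f := by
  obtain ⟨t₁, h₁, hz₁⟩ := exists_between hz.1
  obtain ⟨t₂, hz₂, h₂⟩ := exists_between hz.2
  have ht1 : t₁ ∈ Ioo r 1 := ⟨h₁, hz₁.trans hz.2⟩
  have ht2 : t₂ ∈ Ioo r 1 := ⟨hz.1.trans hz₂, h₂⟩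
  have hjump := logIndex_jump hr hf hinj h₁ h₂ hz₁ hz₂
  have houter : logIndex f (f z) t₁ = 0 → IsOuterType r z f := by
    intro h0 t ht
    refine ⟨fun h => ?_, fun h => ?_⟩
    · rw [logIndex_eq_same_side hr hf hinj hz ht ht1 (Or.inl ⟨h, hz₁⟩), h0]
    · rw [logIndex_eq_same_side hr hf hinj hz ht ht2 (Or.inr ⟨h, hz₂⟩), hjump, h0, zero_add]
  have hinner : logIndex f (f z) t₂ = 0 → IsInnerType r z f := by
    intro h0 t ht
    refine ⟨fun h => ?_, fun h => ?_⟩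
    · rw [logIndex_eq_same_side hr hf hinj hz ht ht1 (Or.inl ⟨h, hz₁⟩)]
      rw [h0] at hjump
      linear_combination -hjump
    · rw [logIndex_eq_same_side hr hf hinj hz ht ht2 (Or.inr ⟨h, hz₂⟩), h0]
  rcases logIndex_inside_or_outside hr hf hinj ht2 with h2 | h2
  · exact Or.inr (hinner (h2 z hz.1 hz₂))
  · left
    apply houter
    obtain ⟨s, hs1, hs2⟩ := exists_between h₂
    have hsn : ‖(s : ℂ)‖ = s := by
      rw [Complex.norm_real, Real.norm_of_nonneg]
      exact hr.trans (ht2.1.trans hs1).le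
    have e1 : logIndex f (f s) t₂ = 0 := h2 s (by rwa [hsn]) (by rwa [hsn])
    have e2 : logIndex f (f s) t₂ = logIndex f (f s) t₁ := by
      refine logIndex_eq_of_ne hr hf h₁ h₂ (hz₁.trans hz₂).le fun w hw1 hw2 he => ?_
      have := hinj ⟨h₁.trans_le hw1, hw2.trans_lt h₂⟩
        (show (s : ℂ) ∈ annulus r by rw [mem_annulus, hsn]; exact ⟨ht2.1.trans hs1, hs2⟩) he
      rw [this, hsn] at hw2
      linarith
    rw [← e1, e2]
    exact logIndex_eq_on_preconnected hr hf hinj ht1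
      (isPreconnected_norm_Ioo (hr.trans h₁.le) 1) (fun v hv => ⟨h₁.trans hv.1, hv.2⟩)
      (fun v hv => hv.1.ne') ⟨hz₁, hz.2⟩
      (show t₁ < ‖(s : ℂ)‖ ∧ ‖(s : ℂ)‖ < 1 by rw [hsn]; exact ⟨(hz₁.trans hz₂).trans hs1, hs2⟩)

/-- A bounded injective function on the punctured disk is of outer type. -/
theorem isOuterType_of_bounded {f : ℂ → ℂ} (hf : DifferentiableOn ℂ f (annulus 0))
    (hinj : InjOn f (annulus 0)) (hb : MapsTo f (annulus 0) (ball 0 1)) {z : ℂ}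
    (hz : z ∈ annulus 0) (hfz : f z = 0) : IsOuterType 0 z f := by
  refine (isOuterType_or_isInnerType le_rfl hf hinj hz).resolve_right fun hin => ?_
  have hann : ball (0 : ℂ) 1 \ {0} = annulus 0 := by
    ext w
    simp [annulus, and_comm]
  set g := Function.update f 0 (limUnder (𝓝[≠] 0) f) with hg
  have hgd : DifferentiableOn ℂ g (ball 0 1) := by
    refine Complex.differentiableOn_update_limUnder_of_bddAbove (ball_mem_nhds _ one_pos)
      (by rwa [hann]) ⟨1, ?_⟩
    rintro _ ⟨w, hw, rfl⟩
    rw [hann] at hw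
    simpa using (mem_ball_zero_iff.mp (hb hw)).le
  have hgf : ∀ w : ℂ, w ≠ 0 → g w = f w := fun w hw => Function.update_of_ne hw _ _
  have hz0 : 0 < ‖z‖ := hz.1
  -- If the extension vanished at the puncture, the open mapping theorem near `0` and near `z` would
  -- produce a small nonzero value taken at two points.
  have hg0 : g 0 ≠ 0 := by
    intro h0
    have han : AnalyticAt ℂ g 0 := hgd.analyticAt (ball_mem_nhds _ one_pos)
    rcases han.eventually_constant_or_nhds_le_map_nhds with hc | hc
    · obtain ⟨ε, hε, hball⟩ := Metric.eventually_nhds_iff_ball.mp hc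
      have key : ∀ x : ℝ, 0 < x → x < min ε 1 → f x = 0 := by
        intro x hx0 hx
        rw [← hgf x (by exact_mod_cast hx0.ne'), hball x (by
          simpa [abs_of_pos hx0] using hx.trans_le (min_le_left _ _)), h0]
      have hm : 0 < min ε 1 := lt_min hε one_pos
      have hA : ∀ x : ℝ, 0 < x → x < min ε 1 → (x : ℂ) ∈ annulus 0 := fun x hx0 hx => by
        rw [mem_annulus, Complex.norm_real, Real.norm_of_nonneg hx0.le]
        exact ⟨hx0, hx.trans_le (min_le_right _ _)⟩
      have e1 := key (min ε 1 / 2) (by linarith) (by linarith)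
      have e2 := key (min ε 1 / 3) (by linarith) (by linarith)
      have := hinj (hA _ (by linarith) (by linarith)) (hA _ (by linarith) (by linarith))
        (e1.trans e2.symm)
      have := Complex.ofReal_injective this
      linarith
    · have h1 : g '' ball 0 (‖z‖ / 2) ∈ 𝓝 (g 0) :=
        hc (image_mem_map (ball_mem_nhds _ (half_pos hz0)))
      rw [h0] at h1
      have h2 : f '' (ball z (‖z‖ / 2) ∩ annulus 0) ∈ 𝓝 (f z) := by
        rw [← map_nhds_eq_of_injOn (isOpen_annulus 0) hf hinj hz]
        exact image_mem_map (inter_mem (ball_mem_nhds _ (half_pos hz0))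
          ((isOpen_annulus 0).mem_nhds hz))
      rw [hfz] at h2
      have h3 : ∀ᶠ y in 𝓝[≠] (0 : ℂ), y ∈ g '' ball 0 (‖z‖ / 2) ∧
          y ∈ f '' (ball z (‖z‖ / 2) ∩ annulus 0) ∧ y ≠ 0 := by
        filter_upwards [mem_nhdsWithin_of_mem_nhds h1, mem_nhdsWithin_of_mem_nhds h2,
          self_mem_nhdsWithin] with y a b c using ⟨a, b, c⟩
      obtain ⟨y, ⟨w₁, hw₁, hy₁⟩, ⟨w₂, ⟨hw₂, hw₂A⟩, hy₂⟩, hy⟩ := h3.exists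
      have hw₁0 : w₁ ≠ 0 := by
        rintro rfl
        exact hy (hy₁.symm.trans h0)
      rw [hgf _ hw₁0] at hy₁
      rw [mem_ball_zero_iff] at hw₁
      have hw₁A : w₁ ∈ annulus 0 := ⟨norm_pos_iff.mpr hw₁0, by linarith [hz.2]⟩
      have := hinj hw₁A hw₂A (hy₁.trans hy₂.symm)
      rw [← this, mem_ball, dist_eq_norm] at hw₂
      have := norm_sub_norm_le z w₁
      rw [norm_sub_rev] at this
      linarith
  have hgc : ContinuousAt g 0 :=
    (hgd.differentiableAt (ball_mem_nhds _ one_pos)).continuousAt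
  -- On a small circle `f` stays within `‖g 0‖` of `g 0`, so its index about `0` vanishes, whereas
  -- inner type requires `-2πi`.
  obtain ⟨ε, hε, hball⟩ := Metric.continuousAt_iff.mp hgc ‖g 0‖ (norm_pos_iff.mpr hg0)
  obtain ⟨t, ht0, htm⟩ := exists_between (lt_min hε hz0)
  have ht : t ∈ Ioo (0 : ℝ) 1 := ⟨ht0, (htm.trans_le (min_le_right _ _)).trans hz.2⟩
  have hJ := (hin t ht).1 (htm.trans_le (min_le_right _ _))
  have hwne : ∀ w ∈ sphere (0 : ℂ) t, w ≠ 0 := by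
    rintro w hw rfl
    simp at hw
    linarith
  have hgda : ∀ w ∈ sphere (0 : ℂ) t, DifferentiableAt ℂ g w := fun w hw =>
    hgd.differentiableAt (isOpen_ball.mem_nhds (by
      rw [mem_sphere_zero_iff_norm] at hw
      rw [mem_ball_zero_iff, hw]; exact ht.2))
  have h0 : logIndex f (f z) t = 0 := by
    rw [logIndex]
    refine Eq.trans ?_ (circleIntegral_logDeriv_eq_zero (u := fun w => g w / g 0) ht0.le ?_ ?_)
    · refine circleIntegral.integral_congr ht0.le fun w hw => ?_
      have he : f =ᶠ[𝓝 w] g := by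
        filter_upwards [isOpen_ne.mem_nhds (hwne w hw)] with v hv using (hgf v hv).symm
      rw [((hgda w hw).hasDerivAt.div_const (g 0)).deriv, he.deriv_eq, he.self_of_nhds, hfz,
        sub_zero, div_div_div_cancel_right₀ hg0]
    · intro w hw
      exact (hgda w hw).div_const _
    · intro w hw
      have hw' : ‖w‖ < ε := by
        rw [mem_sphere_zero_iff_norm] at hw
        rw [hw]; exact htm.trans_le (min_le_left _ _)
      have h5 := hball (show dist w 0 < ε by simpa using hw')
      have : g w / g 0 - 1 = (g w - g 0) / g 0 := by field_simp
      rw [this, norm_div, div_lt_one (norm_pos_iff.mpr hg0), ← dist_eq_norm]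
      exact h5
  rw [h0] at hJ
  have := Complex.two_pi_I_ne_zero
  exact this (by linear_combination hJ)

end

/-! ### Counting preimages by the argument principle -/

/-- Infinitely many zeros would accumulate in the closed subannulus, and the identity theorem would
make `h` vanish on the circle of radius `t₂`. -/
theorem finite_zeros_of_annulus {r : ℝ} (hr : 0 ≤ r) {h : ℂ → ℂ}
    (hh : DifferentiableOn ℂ h (annulus r)) {t₁ t₂ : ℝ} (h₁ : r < t₁) (h₂ : t₂ < 1)
    (h₁₂ : t₁ < t₂) (hne₂ : ∀ w : ℂ, ‖w‖ = t₂ → h w ≠ 0) :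
    {w : ℂ | t₁ < ‖w‖ ∧ ‖w‖ < t₂ ∧ h w = 0}.Finite := by
  by_contra hinf
  set K : Set ℂ := {w | t₁ ≤ ‖w‖} ∩ closedBall 0 t₂ with hK
  have hKc : IsCompact K :=
    (isCompact_closedBall _ _).inter_left (isClosed_le continuous_const continuous_norm)
  obtain ⟨a, haK, hacc⟩ := Set.Infinite.exists_accPt_of_subset_isCompact hinf hKc
    (fun w hw => ⟨hw.1.le, by simpa using hw.2.1.le⟩)
  have haA : a ∈ annulus r := ⟨h₁.trans_le haK.1, by
    have := haK.2; rw [mem_closedBall_zero_iff] at this; exact this.trans_lt h₂⟩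
  have han : AnalyticOnNhd ℂ h (annulus r) := hh.analyticOnNhd (isOpen_annulus r)
  have hfreq : ∃ᶠ w in 𝓝[≠] a, h w = 0 := by
    rw [accPt_iff_frequently_nhdsNE] at hacc
    exact hacc.mono fun w hw => hw.2.2
  have hz := han.eqOn_zero_of_preconnected_of_frequently_eq_zero (isPreconnected_annulus hr) haA
    hfreq
  have hpos : 0 ≤ t₂ := hr.trans (h₁.trans h₁₂).le
  have hn : ‖(t₂ : ℂ)‖ = t₂ := by rw [Complex.norm_real, Real.norm_of_nonneg hpos]
  exact hne₂ t₂ hn (hz ⟨by rw [hn]; exact h₁.trans h₁₂, by rw [hn]; exact h₂⟩)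

/-- The argument principle on a round annulus, as a lower bound for the number of zeros. -/
theorem exists_nat_circleIntegral_logDeriv {r : ℝ} (hr : 0 ≤ r) {t₁ t₂ : ℝ} (h₁ : r < t₁)
    (h₂ : t₂ < 1) (h₁₂ : t₁ < t₂) (n : ℕ) : ∀ h : ℂ → ℂ, DifferentiableOn ℂ h (annulus r) →
    (∀ w : ℂ, ‖w‖ = t₁ → h w ≠ 0) → (∀ w : ℂ, ‖w‖ = t₂ → h w ≠ 0) →
    {w : ℂ | t₁ < ‖w‖ ∧ ‖w‖ < t₂ ∧ h w = 0}.ncard = n →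
    ∃ m : ℕ, n ≤ m ∧ ((∮ w in C(0, t₂), deriv h w / h w) - ∮ w in C(0, t₁), deriv h w / h w) =
      2 * Real.pi * Complex.I * m := by
  have hA1 : t₁ ∈ Ioo r 1 := ⟨h₁, h₁₂.trans h₂⟩
  have hA2 : t₂ ∈ Ioo r 1 := ⟨h₁.trans h₁₂, h₂⟩
  have ht10 : 0 ≤ t₁ := hr.trans h₁.le
  have ht20 : 0 ≤ t₂ := ht10.trans h₁₂.le
  -- Each step divides out one zero with its full multiplicity `j ≥ 1`. Thus `n` counts distinct
  -- zeros and `m` counts them with multiplicity, which is why only `n ≤ m` is claimed.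
  induction n with
  | zero =>
    intro h hh hne1 hne2 hcard
    have hfin := finite_zeros_of_annulus hr hh h₁ h₂ h₁₂ hne2
    rw [ncard_eq_zero hfin] at hcard
    refine ⟨0, le_rfl, ?_⟩
    rw [Nat.cast_zero, mul_zero, sub_eq_zero]
    refine circleIntegral_eq_of_differentiableOn hr (fun w hw1 hw2 => ?_) h₁ h₁₂.le
    have hm : annulus r ∈ 𝓝 w := (isOpen_annulus r).mem_nhds ⟨h₁.trans_le hw1, hw2.trans_lt h₂⟩
    refine ((hh.deriv (isOpen_annulus r)).differentiableAt hm).div (hh.differentiableAt hm) ?_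
    intro h0
    rcases hw1.eq_or_lt with e | e
    · exact hne1 w e.symm h0
    rcases hw2.eq_or_lt with e' | e'
    · exact hne2 w e' h0
    · have : w ∈ {w : ℂ | t₁ < ‖w‖ ∧ ‖w‖ < t₂ ∧ h w = 0} := ⟨e, e', h0⟩
      rw [hcard] at this
      exact this
  | succ n ih =>
    intro h hh hne1 hne2 hcard
    have hfin := finite_zeros_of_annulus hr hh h₁ h₂ h₁₂ hne2
    obtain ⟨a, ha⟩ : {w : ℂ | t₁ < ‖w‖ ∧ ‖w‖ < t₂ ∧ h w = 0}.Nonempty := by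
      rw [← ncard_pos hfin]; omega
    have haA : a ∈ annulus r := ⟨h₁.trans ha.1, ha.2.1.trans h₂⟩
    have han : AnalyticAt ℂ h a := hh.analyticAt ((isOpen_annulus r).mem_nhds haA)
    have hnz : ¬ ∀ᶠ w in 𝓝 a, h w = 0 := by
      intro hev
      have hz := (hh.analyticOnNhd (isOpen_annulus r)).eqOn_zero_of_preconnected_of_eventuallyEq_zero
        (isPreconnected_annulus hr) haA hev
      have hn : ‖(t₂ : ℂ)‖ = t₂ := by rw [Complex.norm_real, Real.norm_of_nonneg ht20]
      exact hne2 t₂ hn (hz ⟨by rw [hn]; exact h₁.trans h₁₂, by rw [hn]; exact h₂⟩)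
    obtain ⟨j, k₀, hk₀, hk₀a, hj⟩ := han.exists_eventuallyEq_pow_smul_nonzero_iff.mpr hnz
    have hj1 : 1 ≤ j := by
      by_contra hj0
      have hj0 : j = 0 := by omega
      have := hj.self_of_nhds
      rw [hj0, pow_zero, one_smul, ha.2.2] at this
      exact hk₀a this.symm
    set k : ℂ → ℂ := Function.update (fun w => h w / (w - a) ^ j) a (k₀ a) with hk
    have hkne : ∀ w, w ≠ a → k w = h w / (w - a) ^ j := fun w hw => Function.update_of_ne hw _ _
    have hka : k a = k₀ a := Function.update_self _ _ _
    have hkk : k =ᶠ[𝓝 a] k₀ := by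
      filter_upwards [hj] with w hw
      by_cases hwa : w = a
      · rw [hwa, hka]
      · rw [hkne w hwa, hw, smul_eq_mul, mul_div_cancel_left₀]
        exact pow_ne_zero _ (sub_ne_zero.mpr hwa)
    have hhk : ∀ w, h w = (w - a) ^ j * k w := by
      intro w
      by_cases hwa : w = a
      · rw [hwa, ha.2.2, sub_self, zero_pow (by omega), zero_mul]
      · rw [hkne w hwa, mul_div_cancel₀]
        exact pow_ne_zero _ (sub_ne_zero.mpr hwa)
    have hkd : DifferentiableOn ℂ k (annulus r) := by
      intro w hw
      by_cases hwa : w = a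
      · rw [hwa]
        exact (hk₀.differentiableAt.congr_of_eventuallyEq hkk).differentiableWithinAt
      · have : k =ᶠ[𝓝 w] fun w => h w / (w - a) ^ j := by
          filter_upwards [isOpen_ne.mem_nhds hwa] with v hv using hkne v hv
        refine (DifferentiableAt.congr_of_eventuallyEq ?_ this).differentiableWithinAt
        exact (hh.differentiableAt ((isOpen_annulus r).mem_nhds hw)).div (by fun_prop)
          (pow_ne_zero _ (sub_ne_zero.mpr hwa))
    have hk1 : ∀ w : ℂ, ‖w‖ = t₁ → k w ≠ 0 := fun w hw h0 =>
      hne1 w hw (by rw [hhk, h0, mul_zero])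
    have hk2 : ∀ w : ℂ, ‖w‖ = t₂ → k w ≠ 0 := fun w hw h0 =>
      hne2 w hw (by rw [hhk, h0, mul_zero])
    have hset : {w : ℂ | t₁ < ‖w‖ ∧ ‖w‖ < t₂ ∧ k w = 0} =
        {w : ℂ | t₁ < ‖w‖ ∧ ‖w‖ < t₂ ∧ h w = 0} \ {a} := by
      ext w
      simp only [mem_ofPred_eq, Set.mem_sdiff, mem_singleton_iff]
      constructor
      · rintro ⟨e1, e2, e3⟩
        refine ⟨⟨e1, e2, by rw [hhk, e3, mul_zero]⟩, ?_⟩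
        rintro rfl
        exact hk₀a (hka ▸ e3)
      · rintro ⟨⟨e1, e2, e3⟩, e4⟩
        refine ⟨e1, e2, ?_⟩
        rw [hkne w e4, e3, zero_div]
    obtain ⟨m, hm, hmeq⟩ := ih k hkd hk1 hk2 (by
      rw [hset, ncard_sdiff_singleton_of_mem ha, hcard]; rfl)
    refine ⟨m + j, by omega, ?_⟩
    have hsplit : ∀ t ∈ Ioo r 1, (∀ w : ℂ, ‖w‖ = t → k w ≠ 0) → ‖a‖ ≠ t →
        (∮ w in C(0, t), deriv h w / h w) = (j : ℂ) * (∮ w in C(0, t), (w - a)⁻¹) +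
          ∮ w in C(0, t), deriv k w / k w := by
      intro t ht hkt hat
      have ht0 : 0 ≤ t := hr.trans ht.1.le
      have hwa : ∀ w ∈ sphere (0 : ℂ) t, w ≠ a := by
        rintro w hw rfl
        exact hat (by simpa using hw)
      have hsA := sphere_subset_annulus ht
      rw [← circleIntegral.integral_const_mul, ← circleIntegral.integral_add]
      · refine circleIntegral.integral_congr ht0 fun w hw => ?_
        have e1 := sub_ne_zero.mpr (hwa w hw)
        have e2 := hkt w (by simpa using hw)
        have hkw := (hkd.differentiableAt ((isOpen_annulus r).mem_nhds (hsA hw))).hasDerivAt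
        have hdw : HasDerivAt h (j * (w - a) ^ (j - 1) * k w + (w - a) ^ j * deriv k w) w := by
          have := (((hasDerivAt_id w).sub_const a).fun_pow j).fun_mul hkw
          rw [funext hhk]
          simpa using this
        rw [hdw.deriv, hhk w]
        obtain ⟨i, rfl⟩ : ∃ i, j = i + 1 := ⟨j - 1, by omega⟩
        simp only [Nat.add_sub_cancel]
        field_simp
        ring
      · refine ContinuousOn.circleIntegrable ht0 (continuousOn_const.mul
          (ContinuousOn.inv₀ (by fun_prop) fun w hw => sub_ne_zero.mpr (hwa w hw)))
      · refine ContinuousOn.circleIntegrable ht0 (((hkd.deriv (isOpen_annulus r)).continuousOn.mono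
          hsA).div (hkd.continuousOn.mono hsA) fun w hw => hkt w (by simpa using hw))
    rw [hsplit t₁ hA1 hk1 ha.1.ne', hsplit t₂ hA2 hk2 ha.2.1.ne,
      circleIntegral_sub_inv_of_norm_lt ht10 ha.1,
      circleIntegral.integral_sub_inv_of_mem_ball (by simpa using ha.2.1)]
    push_cast
    linear_combination hmeq

/-- Values taken by a function on an annulus whose index on the inner circle is known. -/
theorem ncard_le_one_of_logIndex {r : ℝ} (hr : 0 ≤ r) {g : ℂ → ℂ}
    (hg : DifferentiableOn ℂ g (annulus r)) {ξ : ℂ} {t₁ t₂ : ℝ} (h₁ : r < t₁) (h₂ : t₂ < 1)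
    (h₁₂ : t₁ < t₂) (hne1 : ∀ w : ℂ, ‖w‖ = t₁ → g w ≠ ξ) (hne2 : ∀ w : ℂ, ‖w‖ = t₂ → g w ≠ ξ)
    {m : ℕ} (hm : logIndex g ξ t₂ - logIndex g ξ t₁ = 2 * Real.pi * Complex.I * m) :
    {w : ℂ | t₁ < ‖w‖ ∧ ‖w‖ < t₂ ∧ g w = ξ}.Finite ∧
    {w : ℂ | t₁ < ‖w‖ ∧ ‖w‖ < t₂ ∧ g w = ξ}.ncard ≤ m := by
  have hd := hg.sub_const ξ
  have hn1 : ∀ w : ℂ, ‖w‖ = t₁ → g w - ξ ≠ 0 := fun w hw => sub_ne_zero.mpr (hne1 w hw)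
  have hn2 : ∀ w : ℂ, ‖w‖ = t₂ → g w - ξ ≠ 0 := fun w hw => sub_ne_zero.mpr (hne2 w hw)
  have hset : {w : ℂ | t₁ < ‖w‖ ∧ ‖w‖ < t₂ ∧ g w = ξ} =
      {w : ℂ | t₁ < ‖w‖ ∧ ‖w‖ < t₂ ∧ g w - ξ = 0} := by
    simp only [sub_eq_zero]
  obtain ⟨m', hm', he⟩ := exists_nat_circleIntegral_logDeriv hr h₁ h₂ h₁₂ _ _ hd hn1 hn2 rfl
  rw [hset]
  refine ⟨finite_zeros_of_annulus hr hd h₁ h₂ h₁₂ hn2, hm'.trans ?_⟩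
  simp only [deriv_sub_const_fun] at he
  rw [logIndex, logIndex] at hm
  rw [hm] at he
  have := mul_left_cancel₀ Complex.two_pi_I_ne_zero he
  exact le_of_eq (by exact_mod_cast this.symm)

/-! ### The ends of an annulus and the properties of its slit map -/

/-- Points of the plane approaching the unit circle from inside. -/
def outerEnd : Filter ℂ := comap norm (𝓝[<] (1 : ℝ))

/-- Points of the plane approaching the circle of radius `r` from outside. -/
def innerEnd (r : ℝ) : Filter ℂ := comap norm (𝓝[>] r)

theorem eventually_outerEnd {p : ℂ → Prop} :
    (∀ᶠ w in outerEnd, p w) ↔ ∀ᶠ t in 𝓝[<] (1 : ℝ), ∀ w : ℂ, ‖w‖ = t → p w := eventually_comap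

theorem eventually_innerEnd {r : ℝ} {p : ℂ → Prop} :
    (∀ᶠ w in innerEnd r, p w) ↔ ∀ᶠ t in 𝓝[>] r, ∀ w : ℂ, ‖w‖ = t → p w := eventually_comap

/-- A holomorphic function on the annulus with the boundary values of the circular slit map that
takes the outer circle to the unit circle. -/
structure IsAnnulusSlitMap (r : ℝ) (z : ℂ) (g : ℂ → ℂ) : Prop where
  diff : DifferentiableOn ℂ g (annulus r)
  map_base : g z = 0
  outerType : IsOuterType r z g
  outer : Tendsto (fun w => ‖g w‖) outerEnd (𝓝 1)
  inner : Tendsto (fun w => ‖g w‖) (innerEnd r) (𝓝 ‖z‖)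

namespace IsAnnulusSlitMap

variable {r : ℝ} {z : ℂ} {g : ℂ → ℂ}

/-- Close to each end `|g|` is nearly constant and separated from `|ξ|`. So the index about `ξ`
either equals the index about `0 = g z`, which the outer type prescribes, or is zero because the
image circle is closer to the origin than `ξ`. -/
theorem exists_circles (h : IsAnnulusSlitMap r z g) (hr : 0 ≤ r) (hz : z ∈ annulus r) {ξ : ℂ}
    (hξ1 : ‖ξ‖ ≠ 1) (hξz : ‖ξ‖ ≠ ‖z‖) {a b : ℝ} (ha : r < a) (hb : b < 1) :
    ∃ t₁ t₂ : ℝ, r < t₁ ∧ t₂ < 1 ∧ t₁ < t₂ ∧ t₁ < a ∧ b < t₂ ∧ (∀ w : ℂ, ‖w‖ = t₁ → g w ≠ ξ) ∧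
      (∀ w : ℂ, ‖w‖ = t₂ → g w ≠ ξ) ∧ logIndex g ξ t₁ = 0 ∧
      (‖ξ‖ < 1 → logIndex g ξ t₂ = 2 * Real.pi * Complex.I) ∧ (1 < ‖ξ‖ → logIndex g ξ t₂ = 0) := by
  have e2 : ∀ᶠ t in 𝓝[<] (1 : ℝ), max b ‖z‖ < t ∧ t < 1 :=
    Ioo_mem_nhdsLT (max_lt hb hz.2)
  have e1 : ∀ᶠ t in 𝓝[>] r, r < t ∧ t < min a ‖z‖ := Ioo_mem_nhdsGT (lt_min ha hz.1)
  have o2 : ∀ᶠ w in outerEnd, (‖ξ‖ < 1 → ‖ξ‖ < ‖g w‖) ∧ (1 < ‖ξ‖ → ‖g w‖ < ‖ξ‖) := by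
    rcases lt_or_gt_of_ne hξ1 with hlt | hgt
    · filter_upwards [h.outer.eventually (lt_mem_nhds hlt)] with w hw
      exact ⟨fun _ => hw, fun h' => absurd hlt h'.not_gt⟩
    · filter_upwards [h.outer.eventually (gt_mem_nhds hgt)] with w hw
      exact ⟨fun h' => absurd hgt h'.not_gt, fun _ => hw⟩
  have o1 : ∀ᶠ w in innerEnd r, (‖ξ‖ < ‖z‖ → ‖ξ‖ < ‖g w‖) ∧ (‖z‖ < ‖ξ‖ → ‖g w‖ < ‖ξ‖) := by
    rcases lt_or_gt_of_ne hξz with hlt | hgt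
    · filter_upwards [h.inner.eventually (lt_mem_nhds hlt)] with w hw
      exact ⟨fun _ => hw, fun h' => absurd hlt h'.not_gt⟩
    · filter_upwards [h.inner.eventually (gt_mem_nhds hgt)] with w hw
      exact ⟨fun h' => absurd hgt h'.not_gt, fun _ => hw⟩
  obtain ⟨t₂, ⟨hbt, h2⟩, ho2⟩ := (e2.and (eventually_outerEnd.mp o2)).exists
  obtain ⟨t₁, ⟨h1, hta⟩, ho1⟩ := (e1.and (eventually_innerEnd.mp o1)).exists
  have hz2 : ‖z‖ < t₂ := (le_max_right _ _).trans_lt hbt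
  have hz1 : t₁ < ‖z‖ := hta.trans_le (min_le_right _ _)
  have ht1 : t₁ ∈ Ioo r 1 := ⟨h1, hz1.trans hz.2⟩
  have ht2 : t₂ ∈ Ioo r 1 := ⟨hz.1.trans hz2, h2⟩
  have hJ1 := (h.outerType t₁ ht1).1 hz1
  have hJ2 := (h.outerType t₂ ht2).2 hz2
  rw [h.map_base] at hJ1 hJ2
  refine ⟨t₁, t₂, h1, h2, hz1.trans hz2, hta.trans_le (min_le_left _ _),
    (le_max_left _ _).trans_lt hbt, ?_, ?_, ?_, ?_, ?_⟩
  · rintro w hw rfl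
    rcases lt_or_gt_of_ne hξz with hlt | hgt
    · exact lt_irrefl _ ((ho1 w hw).1 hlt)
    · exact lt_irrefl _ ((ho1 w hw).2 hgt)
  · rintro w hw rfl
    rcases lt_or_gt_of_ne hξ1 with hlt | hgt
    · exact lt_irrefl _ ((ho2 w hw).1 hlt)
    · exact lt_irrefl _ ((ho2 w hw).2 hgt)
  · rcases lt_or_gt_of_ne hξz with hlt | hgt
    · rw [← hJ1]
      refine logIndex_eq_of_norm_lt hr h.diff ht1 fun w hw => ?_
      simpa using (ho1 w (by simpa using hw)).1 hlt
    · exact logIndex_eq_zero_of_norm_lt hr h.diff ht1 fun w hw =>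
        (ho1 w (by simpa using hw)).2 hgt
  · intro hlt
    rw [← hJ2]
    refine logIndex_eq_of_norm_lt hr h.diff ht2 fun w hw => ?_
    simpa using (ho2 w (by simpa using hw)).1 hlt
  · intro hgt
    exact logIndex_eq_zero_of_norm_lt hr h.diff ht2 fun w hw =>
      (ho2 w (by simpa using hw)).2 hgt

/-- An omitted value would have the same index on both circles of `exists_circles`, but these differ
by `2πi` when `‖ξ‖ < 1`. The excluded modulus `‖z‖` is that of the slit. -/
theorem mem_image (h : IsAnnulusSlitMap r z g) (hr : 0 ≤ r) (hz : z ∈ annulus r) {ξ : ℂ}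
    (hξ1 : ‖ξ‖ < 1) (hξz : ‖ξ‖ ≠ ‖z‖) : ξ ∈ g '' annulus r := by
  obtain ⟨t₁, t₂, h1, h2, h12, -, -, hne1, hne2, hJ1, hJ2, -⟩ :=
    h.exists_circles hr hz hξ1.ne hξz hz.1 hz.2
  by_contra hcon
  have := logIndex_eq_of_ne hr h.diff (ξ := ξ) h1 h2 h12.le fun w hw1 hw2 he =>
    hcon ⟨w, ⟨h1.trans_le hw1, hw2.trans_lt h2⟩, he⟩
  rw [hJ1, hJ2 hξ1] at this
  exact Complex.two_pi_I_ne_zero this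

/-- The same difference of indices, read as a count: between circles enclosing `a` and `b` the value
is taken at most once. -/
theorem eq_of_eq_of_norm_ne (h : IsAnnulusSlitMap r z g) (hr : 0 ≤ r) (hz : z ∈ annulus r)
    {a b : ℂ} (ha : a ∈ annulus r) (hb : b ∈ annulus r) (hab : g a = g b)
    (hξ1 : ‖g b‖ < 1) (hξz : ‖g b‖ ≠ ‖z‖) : a = b := by
  obtain ⟨t₁, t₂, h1, h2, h12, hta, htb, hne1, hne2, hJ1, hJ2, -⟩ :=
    h.exists_circles hr hz hξ1.ne hξz (a := min ‖a‖ ‖b‖) (b := max ‖a‖ ‖b‖)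
    (lt_min ha.1 hb.1) (max_lt ha.2 hb.2)
  obtain ⟨hfin, hcard⟩ := ncard_le_one_of_logIndex hr h.diff h1 h2 h12 hne1 hne2 (m := 1)
    (by rw [hJ1, hJ2 hξ1]; simp)
  rw [ncard_le_one hfin] at hcard
  exact hcard a ⟨hta.trans_le (min_le_left _ _), (le_max_left _ _).trans_lt htb, hab⟩ b
    ⟨hta.trans_le (min_le_right _ _), (le_max_right _ _).trans_lt htb, rfl⟩

theorem norm_le_one (h : IsAnnulusSlitMap r z g) (hr : 0 ≤ r) (hz : z ∈ annulus r)
    {a : ℂ} (ha : a ∈ annulus r) : ‖g a‖ ≤ 1 := by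
  by_contra hcon
  push Not at hcon
  obtain ⟨t₁, t₂, h1, h2, h12, hta, htb, hne1, hne2, hJ1, -, hJ2⟩ :=
    h.exists_circles hr hz hcon.ne' (hz.2.trans hcon).ne' ha.1 ha.2
  obtain ⟨hfin, hcard⟩ := ncard_le_one_of_logIndex hr h.diff h1 h2 h12 hne1 hne2 (m := 0)
    (by rw [hJ1, hJ2 hcon]; simp)
  rw [Nat.le_zero, ncard_eq_zero hfin] at hcard
  have : a ∈ {w : ℂ | t₁ < ‖w‖ ∧ ‖w‖ < t₂ ∧ g w = g a} := ⟨hta, htb, rfl⟩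
  rw [hcard] at this
  exact this

/-- A constant `g` would be identically zero, but by `mem_image` it attains a value of modulus `‖z‖
/ 2`. -/
theorem isOpen_image (h : IsAnnulusSlitMap r z g) (hr : 0 ≤ r) (hz : z ∈ annulus r)
    {U : Set ℂ} (hU : IsOpen U) (hUA : U ⊆ annulus r) : IsOpen (g '' U) := by
  rcases (h.diff.analyticOnNhd (isOpen_annulus r)).is_constant_or_isOpen
    (isPreconnected_annulus hr) with ⟨c, hc⟩ | ho
  · have hz' := hz.1.trans hz.2
    have h1 : (‖z‖ / 2 : ℝ) < ‖z‖ := by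
      have : 0 < ‖z‖ := hr.trans_lt hz.1
      linarith
    have hpos : 0 < ‖z‖ / 2 := by
      have : 0 < ‖z‖ := hr.trans_lt hz.1
      linarith
    have hn : ‖((‖z‖ / 2 : ℝ) : ℂ)‖ = ‖z‖ / 2 := by
      rw [Complex.norm_real, Real.norm_of_nonneg hpos.le]
    obtain ⟨w, hw, he⟩ := h.mem_image hr hz (ξ := ((‖z‖ / 2 : ℝ) : ℂ))
      (by rw [hn]; exact h1.trans hz.2) (by rw [hn]; exact h1.ne)
    rw [hc w hw, ← hc z hz, h.map_base] at he
    rw [← he, norm_zero] at hn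
    exact absurd hn hpos.ne
  · exact ho U hUA hU

theorem norm_lt_one (h : IsAnnulusSlitMap r z g) (hr : 0 ≤ r) (hz : z ∈ annulus r)
    {a : ℂ} (ha : a ∈ annulus r) : ‖g a‖ < 1 := by
  have hsub : g '' annulus r ⊆ closedBall 0 1 := by
    rintro _ ⟨w, hw, rfl⟩
    rw [mem_closedBall_zero_iff]
    exact h.norm_le_one hr hz hw
  have := interior_maximal hsub (h.isOpen_image hr hz (isOpen_annulus r) Subset.rfl)
    (mem_image_of_mem g ha)
  rw [interior_closedBall _ one_ne_zero] at this
  simpa using this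

/-- The count of preimages says nothing on the circle of modulus `‖z‖`. A double value there is
pushed radially inwards: disjoint neighbourhoods of the two preimages both have open images, hence
both attain a nearby value of smaller modulus. -/
theorem injOn (h : IsAnnulusSlitMap r z g) (hr : 0 ≤ r) (hz : z ∈ annulus r) :
    InjOn g (annulus r) := by
  intro a ha b hb hab
  by_cases hne : ‖g b‖ = ‖z‖
  swap
  · exact h.eq_of_eq_of_norm_ne hr hz ha hb hab (h.norm_lt_one hr hz hb) hne
  by_contra hcon
  obtain ⟨U, V, hU, hV, haU, hbV, hUV⟩ := t2_separation hcon
  have hUo := h.isOpen_image hr hz (hU.inter (isOpen_annulus r)) inter_subset_right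
  have hVo := h.isOpen_image hr hz (hV.inter (isOpen_annulus r)) inter_subset_right
  have hmem : g '' (U ∩ annulus r) ∩ g '' (V ∩ annulus r) ∈ 𝓝 (g b) :=
    inter_mem (hUo.mem_nhds ⟨a, ⟨haU, ha⟩, hab⟩) (hVo.mem_nhds ⟨b, ⟨hbV, hb⟩, rfl⟩)
  have hlim : Tendsto (fun s : ℝ => (s : ℂ) * g b) (𝓝[<] 1) (𝓝 (g b)) := by
    have : Continuous fun s : ℝ => (s : ℂ) * g b := by fun_prop
    have := this.tendsto 1
    simp only [Complex.ofReal_one, one_mul] at this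
    exact this.mono_left nhdsWithin_le_nhds
  obtain ⟨s, ⟨⟨a', ha', ea⟩, ⟨b', hb', eb⟩⟩, hs0, hs1⟩ :=
    ((hlim.eventually hmem).and (Ioo_mem_nhdsLT (one_pos) :
      ∀ᶠ s in 𝓝[<] (1 : ℝ), s ∈ Ioo 0 1)).exists
  have hzpos : 0 < ‖z‖ := hr.trans_lt hz.1
  have hnorm : ‖(s : ℂ) * g b‖ < ‖z‖ := by
    rw [norm_mul, Complex.norm_real, Real.norm_of_nonneg hs0.le, hne]
    exact mul_lt_of_lt_one_left hzpos hs1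
  have heq : a' = b' := h.eq_of_eq_of_norm_ne hr hz ha'.2 hb'.2 (ea.trans eb.symm)
    (by rw [eb]; exact hnorm.trans hz.2) (by rw [eb]; exact hnorm.ne)
  rw [heq] at ha'
  exact hUV.le_bot ⟨ha'.1, hb'.1⟩

theorem isAdmissible (h : IsAnnulusSlitMap r z g) (hr : 0 ≤ r) (hz : z ∈ annulus r) :
    IsAdmissible (annulus r) z g :=
  ⟨h.diff, h.injOn hr hz, fun w hw => by simpa using h.norm_lt_one hr hz hw, h.map_base⟩

end IsAnnulusSlitMap

/-! ### Circular arcs and circularly slit disks -/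

/-- The norm maps a component to an interval, and an interval containing both `ρ` and `1` would
contain their midpoint. -/
theorem isPreconnected_connectedComponentIn_norm {X : Set ℂ} {ρ : ℝ} (hρ : ρ < 1)
    (hX : ∀ w ∈ X, ‖w‖ = 1 ∨ ‖w‖ = ρ) {w v : ℂ} (hv : v ∈ connectedComponentIn X w) (hw : w ∈ X) :
    ‖v‖ = ‖w‖ := by
  have hpre : IsPreconnected (connectedComponentIn X w) := isPreconnected_connectedComponentIn
  have himg := (hpre.image norm continuous_norm.continuousOn).ordConnected
  have hsub := connectedComponentIn_subset X w
  by_contra hne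
  have key : ∀ a b : ℂ, a ∈ connectedComponentIn X w → b ∈ connectedComponentIn X w →
      ‖a‖ = ρ → ‖b‖ = 1 → False := by
    intro a b ha hb e1 e2
    obtain ⟨c, hc, e⟩ := himg.out (mem_image_of_mem _ ha) (mem_image_of_mem _ hb)
      (show (ρ + 1) / 2 ∈ Icc ‖a‖ ‖b‖ by rw [e1, e2]; constructor <;> linarith)
    rcases hX c (hsub hc) with h | h <;> linarith
  have hw' := mem_connectedComponentIn hw
  rcases hX v (hsub hv) with h1 | h1 <;> rcases hX w hw with h2 | h2
  · exact hne (h1.trans h2.symm)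
  · exact key w v hw' hv h2 h1
  · exact key v w hv hw' h1 h2
  · exact hne (h1.trans h2.symm)

/-- A compact connected subset of a circle centred at the origin that misses a point of the circle
is a circular arc. -/
theorem isCircularArc_of_isConnected {C : Set ℂ} (hC : IsCompact C) (hconn : IsConnected C) {ρ : ℝ}
    (hρ0 : 0 < ρ) (hρ1 : ρ < 1) (hCρ : ∀ w ∈ C, ‖w‖ = ρ) {ξ₀ : ℂ} (hξ₀ : ‖ξ₀‖ = ρ)
    (hξ₀C : ξ₀ ∉ C) : IsCircularArc C := by
  have hξ0 : ξ₀ ≠ 0 := norm_pos_iff.mp (hξ₀ ▸ hρ0)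
  -- Rotates the missing point `ξ₀` to `-1`, where `Complex.arg` jumps, so that the argument is
  -- continuous on `C`.
  set q : ℂ → ℂ := fun ξ => -ξ / ξ₀ with hq
  have hqn : ∀ ξ ∈ C, ‖q ξ‖ = 1 := fun ξ hξ => by
    rw [hq]
    simp only [norm_div, norm_neg, hCρ ξ hξ, hξ₀]
    exact div_self hρ0.ne'
  have hqexp : ∀ ξ ∈ C, Complex.exp (Complex.arg (q ξ) * Complex.I) = q ξ := fun ξ hξ => by
    have := Complex.norm_mul_exp_arg_mul_I (q ξ)
    rwa [hqn ξ hξ, Complex.ofReal_one, one_mul] at this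
  have hqpi : ∀ ξ ∈ C, Complex.arg (q ξ) ≠ Real.pi := fun ξ hξ he => by
    have h1 := hqexp ξ hξ
    rw [he, Complex.exp_pi_mul_I] at h1
    have h2 : ξ = ξ₀ := by
      rw [hq] at h1
      simp only at h1
      field_simp at h1
      linear_combination h1
    exact hξ₀C (h2 ▸ hξ)
  have hcont : ContinuousOn (fun ξ => Complex.arg (q ξ)) C := by
    intro ξ hξ
    have hsl : q ξ ∈ Complex.slitPlane := by
      rw [Complex.mem_slitPlane_iff_arg]
      exact ⟨hqpi ξ hξ, norm_pos_iff.mp (by rw [hqn ξ hξ]; exact one_pos)⟩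
    have h1 : ContinuousAt q ξ := by
      simp only [hq]; fun_prop (disch := exact hξ0)
    exact (ContinuousAt.comp (f := q) (Complex.continuousAt_arg hsl) h1).continuousWithinAt
  set T := (fun ξ => Complex.arg (q ξ)) '' C with hT
  have hTconn : IsConnected T := hconn.image _ hcont
  have hTc : IsCompact T := hC.image_of_continuousOn hcont
  have hTI := eq_Icc_of_connected_compact hTconn hTc
  have ha : sInf T ∈ T := hTc.sInf_mem hTconn.nonempty
  have hb : sSup T ∈ T := hTc.sSup_mem hTconn.nonempty
  have hTr : ∀ t ∈ T, -Real.pi < t ∧ t < Real.pi := by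
    rintro _ ⟨ξ, hξ, rfl⟩
    exact ⟨Complex.neg_pi_lt_arg _, lt_of_le_of_ne (Complex.arg_le_pi _) (hqpi ξ hξ)⟩
  set β := Complex.arg (-ξ₀) with hβ
  have hβe : -ξ₀ = ρ * Complex.exp (β * Complex.I) := by
    have := Complex.norm_mul_exp_arg_mul_I (-ξ₀)
    rw [norm_neg, hξ₀] at this
    exact this.symm
  have hform : ∀ ξ ∈ C, (ρ : ℂ) * Complex.exp (((Complex.arg (q ξ) + β : ℝ) : ℂ) * Complex.I)
      = ξ := by
    intro ξ hξ
    rw [Complex.ofReal_add, add_mul, Complex.exp_add, hqexp ξ hξ, mul_left_comm, ← hβe, hq]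
    field_simp
  refine ⟨ρ, sInf T + β, sSup T + β, hρ0, hρ1, ?_, ?_, ?_⟩
  · have := (hTI ▸ ha : sInf T ∈ Icc (sInf T) (sSup T)).2
    linarith
  · linarith [(hTr _ ha).1, (hTr _ hb).2]
  · ext ξ
    constructor
    · intro hξ
      refine ⟨Complex.arg (q ξ) + β, ?_, hform ξ hξ⟩
      have : Complex.arg (q ξ) ∈ T := mem_image_of_mem _ hξ
      rw [hTI] at this
      exact ⟨by linarith [this.1], by linarith [this.2]⟩
    · rintro ⟨t, ht, rfl⟩
      have : t - β ∈ T := by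
        rw [hTI]
        exact ⟨by linarith [ht.1], by linarith [ht.2]⟩
      obtain ⟨ξ, hξ, he⟩ := this
      have h1 := hform ξ hξ
      simp only at he
      rw [he, sub_add_cancel] at h1
      simp only
      rw [h1]
      exact hξ

theorem isCircularlySlitDisk_of_subset {D : Set ℂ} (hDo : IsOpen D) (hDc : IsConnected D)
    (h0 : (0 : ℂ) ∈ D) (hD1 : D ⊆ ball 0 1) {ρ : ℝ} (hρ0 : 0 < ρ) (hρ1 : ρ < 1)
    (hD : ∀ ξ : ℂ, ‖ξ‖ < 1 → ‖ξ‖ ≠ ρ → ξ ∈ D) : IsCircularlySlitDisk D := by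
  refine ⟨hDo, hDc, h0, hD1, fun w hw => ?_⟩
  set X := closedBall (0 : ℂ) 1 \ D with hXdef
  have hX : ∀ v ∈ X, ‖v‖ = 1 ∨ ‖v‖ = ρ := by
    intro v hv
    have h1 : ‖v‖ ≤ 1 := by simpa using hv.1
    rcases h1.eq_or_lt with h | h
    · exact Or.inl h
    · right
      by_contra hne
      exact hv.2 (hD v h hne)
  have hXc : IsClosed X := isClosed_closedBall.sdiff hDo
  have hsub := connectedComponentIn_subset X w
  have hwC := mem_connectedComponentIn hw
  have hnorm : ∀ v ∈ connectedComponentIn X w, ‖v‖ = ‖w‖ := fun v hv =>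
    isPreconnected_connectedComponentIn_norm hρ1 hX hv hw
  rcases hX w hw with h1 | h1
  · left
    refine Subset.antisymm (fun v hv => by simpa [h1] using hnorm v hv) ?_
    refine IsPreconnected.subset_connectedComponentIn
      (isPreconnected_sphere (by rw [Complex.rank_real_complex]; norm_num) _ _)
      (by simpa using h1) fun v hv => ⟨sphere_subset_closedBall hv, fun hvD => ?_⟩
    have e1 := hD1 hvD
    rw [mem_ball_zero_iff] at e1
    rw [mem_sphere_zero_iff_norm] at hv
    exact e1.ne hv
  · right
    -- `D` is connected and contains `0` as well as a point of modulus above `ρ`, so it meets the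
    -- circle of radius `ρ`. Hence no slit is the whole circle.
    obtain ⟨ξ₀, hξ₀D, hξ₀⟩ : ∃ ξ₀ ∈ D, ‖ξ₀‖ = ρ := by
      have ho := (hDc.isPreconnected.image norm continuous_norm.continuousOn).ordConnected
      have hpos : 0 < (1 + ρ) / 2 := by linarith
      have hn : ‖(((1 + ρ) / 2 : ℝ) : ℂ)‖ = (1 + ρ) / 2 := by
        rw [Complex.norm_real, Real.norm_of_nonneg hpos.le]
      have hm : (((1 + ρ) / 2 : ℝ) : ℂ) ∈ D := hD _ (by rw [hn]; linarith) (by rw [hn]; linarith)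
      obtain ⟨ξ, hξ, e⟩ := ho.out (mem_image_of_mem _ h0) (mem_image_of_mem _ hm)
        (show ρ ∈ Icc ‖(0 : ℂ)‖ ‖(((1 + ρ) / 2 : ℝ) : ℂ)‖ by
          rw [hn, norm_zero]; constructor <;> linarith)
      exact ⟨ξ, hξ, e⟩
    have hCcl : IsClosed (connectedComponentIn X w) := by
      refine isClosed_of_closure_subset ?_
      exact isPreconnected_connectedComponentIn.closure.subset_connectedComponentIn
        (subset_closure hwC) (closure_minimal hsub hXc)
    have hCc : IsCompact (connectedComponentIn X w) :=
      (isCompact_closedBall (0 : ℂ) 1).of_isClosed_subset hCcl (hsub.trans sdiff_subset)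
    refine isCircularArc_of_isConnected hCc ⟨⟨w, hwC⟩, isPreconnected_connectedComponentIn⟩ hρ0 hρ1
      (fun v hv => (hnorm v hv).trans h1) hξ₀ fun hcon => (hsub hcon).2 hξ₀D

theorem eventually_innerEnd_mem {r : ℝ} (hr : r < 1) : ∀ᶠ w in innerEnd r, w ∈ annulus r := by
  rw [eventually_innerEnd]
  filter_upwards [Ioo_mem_nhdsGT hr] with t ht w hw
  rw [mem_annulus, hw]; exact ht

theorem eventually_outerEnd_mem {r : ℝ} (hr : r < 1) : ∀ᶠ w in outerEnd, w ∈ annulus r := by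
  rw [eventually_outerEnd]
  filter_upwards [Ioo_mem_nhdsLT hr] with t ht w hw
  rw [mem_annulus, hw]; exact ht

theorem eventually_innerEnd_notMem {r : ℝ} {C : Set ℂ} (hC : IsCompact C) (hCA : C ⊆ annulus r) :
    ∀ᶠ w in innerEnd r, w ∉ C := by
  rw [eventually_innerEnd]
  rcases C.eq_empty_or_nonempty with rfl | hne
  · simp
  · obtain ⟨a, ha, hmin⟩ := hC.exists_isMinOn hne continuous_norm.continuousOn
    filter_upwards [Ioo_mem_nhdsGT (hCA ha).1] with t ht w hw hwC
    have : ‖a‖ ≤ ‖w‖ := hmin hwC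
    rw [hw] at this
    exact absurd ht.2 this.not_gt

theorem eventually_outerEnd_notMem {r : ℝ} {C : Set ℂ} (hC : IsCompact C) (hCA : C ⊆ annulus r) :
    ∀ᶠ w in outerEnd, w ∉ C := by
  rw [eventually_outerEnd]
  rcases C.eq_empty_or_nonempty with rfl | hne
  · simp
  · obtain ⟨a, ha, hmax⟩ := hC.exists_isMaxOn hne continuous_norm.continuousOn
    filter_upwards [Ioo_mem_nhdsLT (hCA ha).2] with t ht w hw hwC
    have : ‖w‖ ≤ ‖a‖ := hmax hwC
    rw [hw] at this
    exact absurd ht.1 this.not_gt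

theorem innerEnd_neBot {r : ℝ} (hr : 0 ≤ r) : (innerEnd r).NeBot := by
  refine comap_neBot_iff.mpr fun s hs => ?_
  obtain ⟨t, hts, ht⟩ := (inter_mem hs (self_mem_nhdsWithin : Ioi r ∈ 𝓝[>] r) |>
    fun h => (inferInstance : (𝓝[>] r).NeBot).nonempty_of_mem h)
  refine ⟨(t : ℂ), ?_⟩
  rwa [Complex.norm_real, Real.norm_of_nonneg (hr.trans (le_of_lt ht))]

theorem outerEnd_neBot : outerEnd.NeBot := by
  refine comap_neBot_iff.mpr fun s hs => ?_
  obtain ⟨t, hts, ht⟩ := (inter_mem hs (Ioo_mem_nhdsLT one_pos : Ioo (0 : ℝ) 1 ∈ 𝓝[<] 1) |>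
    fun h => (inferInstance : (𝓝[<] (1 : ℝ)).NeBot).nonempty_of_mem h)
  refine ⟨(t : ℂ), ?_⟩
  rwa [Complex.norm_real, Real.norm_of_nonneg ht.1.le]

theorem isConnected_annulus {r : ℝ} (hr : 0 ≤ r) {z : ℂ} (hz : z ∈ annulus r) :
    IsConnected (annulus r) := ⟨⟨z, hz⟩, isPreconnected_annulus hr⟩

namespace IsAnnulusSlitMap

variable {r : ℝ} {z : ℂ} {g : ℂ → ℂ}

theorem isCircularlySlitDisk (h : IsAnnulusSlitMap r z g) (hr : 0 ≤ r) (hz : z ∈ annulus r) :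
    IsCircularlySlitDisk (g '' annulus r) :=
  isCircularlySlitDisk_of_subset (h.isOpen_image hr hz (isOpen_annulus r) Subset.rfl)
    ((isConnected_annulus hr hz).image _ h.diff.continuousOn) ⟨z, hz, h.map_base⟩
    (image_subset_iff.mpr (h.isAdmissible hr hz).mapsTo) (hr.trans_lt hz.1) hz.2
    fun _ h1 h2 => h.mem_image hr hz h1 h2

/-- The upper bound holds because `|g|` comes close to `‖z‖` at the inner end, off every compact
subset. The lower bound holds because all points of modulus below `‖z‖` are values. -/
theorem boundaryDist_eq (h : IsAnnulusSlitMap r z g) (hr : 0 ≤ r) (hz : z ∈ annulus r) :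
    boundaryDist (annulus r) g = ‖z‖ := by
  have hadm := h.isAdmissible hr hz
  refine le_antisymm ?_ ?_
  · by_contra hlt
    obtain ⟨d, hd1, hd2⟩ := exists_between (not_le.mp hlt)
    obtain ⟨C, hCA, hC, hCd⟩ := hadm.exists_isCompact (isOpen_annulus r) hz hd2
    have hne := innerEnd_neBot hr
    obtain ⟨w, hw1, hw2, hw3⟩ := ((eventually_innerEnd_mem (hz.1.trans hz.2)).and
      ((eventually_innerEnd_notMem hC hCA).and (h.inner.eventually (gt_mem_nhds hd1)))).exists
    exact lt_asymm hw3 (hCd w hw1 hw2)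
  · have hfr : (frontier (g '' annulus r)).Nonempty := by
      rw [nonempty_frontier_iff]
      refine ⟨⟨0, z, hz, h.map_base⟩, fun hu => ?_⟩
      have h1 : (1 : ℂ) ∈ g '' annulus r := hu ▸ mem_univ _
      have := (image_subset_iff.mpr hadm.mapsTo : g '' annulus r ⊆ ball 0 1) h1
      simp at this
    rw [boundaryDist, le_infDist hfr]
    intro ξ hξ
    rw [dist_zero_left]
    by_contra hlt
    have hlt := not_le.mp hlt
    have hm := h.mem_image hr hz (hlt.trans hz.2) hlt.ne
    have ho := h.isOpen_image hr hz (isOpen_annulus r) Subset.rfl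
    rw [ho.frontier_eq] at hξ
    exact hξ.2 hm

end IsAnnulusSlitMap

end Squeezing

namespace Squeezing

open ComplexConjugate

/-! ### Existence of the slit map of an annulus -/

/-- The norm is a closed map, so a neighbourhood of a whole circle contains a thin ring about it;
continuity at the points of the circle thus gives a uniform limit. -/
theorem tendsto_comap_norm {u : ℂ → ℝ} {a c : ℝ}
    (hu : ∀ w : ℂ, ‖w‖ = a → ContinuousAt u w ∧ u w = c) :
    Tendsto u (comap norm (𝓝 a)) (𝓝 c) := by
  intro s hs
  have h1 : IsClosedMap (fun w : ℂ => ‖w‖) := by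
    have := isClosedMap_dist (0 : ℂ)
    have h2 : dist (0 : ℂ) = fun w : ℂ => ‖w‖ := funext dist_zero_left
    rwa [h2] at this
  refine eventually_comap.mpr (h1.eventually_nhds_fiber a fun w hw => ?_)
  obtain ⟨hc, he⟩ := hu w hw
  exact hc (he ▸ hs)

theorem differentiableAt_tsum_mul_pow {a : ℕ → ℂ} {C q : ℝ} (hq : 0 < q)
    (ha : ∀ n, ‖a n‖ ≤ C * q ^ n) {w : ℂ} (hw : ‖w‖ * q < 1) :
    (Summable fun n => a n * w ^ n) ∧
      DifferentiableAt ℂ (fun v => ∑' n, a n * v ^ n) w := by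
  obtain ⟨s, hs1, hs2⟩ := exists_between ((lt_div_iff₀ hq).mpr hw)
  have hs0 : 0 < s := (norm_nonneg w).trans_lt hs1
  have hsq : s * q < 1 := (lt_div_iff₀ hq).mp hs2
  have hsum : Summable fun n : ℕ => C * (s * q) ^ n :=
    (summable_geometric_of_lt_one (by positivity) hsq).mul_left C
  have hb : ∀ (n : ℕ) (v : ℂ), v ∈ ball (0 : ℂ) s → ‖a n * v ^ n‖ ≤ C * (s * q) ^ n := by
    intro n v hv
    rw [mem_ball_zero_iff] at hv
    rw [norm_mul, norm_pow, mul_pow, mul_comm (s ^ n), ← mul_assoc]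
    exact mul_le_mul (ha n) (pow_le_pow_left₀ (norm_nonneg _) hv.le n) (by positivity)
      ((norm_nonneg _).trans (ha n))
  have hwb : w ∈ ball (0 : ℂ) s := by simpa using hs1
  refine ⟨Summable.of_norm_bounded hsum fun n => hb n w hwb, ?_⟩
  exact (Complex.differentiableOn_tsum_of_summable_norm hsum
    (fun n => ((differentiable_id.pow n).const_mul (a n)).differentiableOn) isOpen_ball
    hb).differentiableAt (isOpen_ball.mem_nhds hwb)

theorem one_sub_conj_mul_mem_slitPlane {z w : ℂ} (hz : ‖z‖ < 1) (hw : ‖w‖ ≤ 1) :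
    1 - conj z * w ∈ Complex.slitPlane := by
  have h1 : ‖conj z * w‖ < 1 := by
    rw [norm_mul, Complex.norm_conj]
    nlinarith [norm_nonneg z, norm_nonneg w]
  left
  have := (Complex.re_le_norm (conj z * w)).trans_lt h1
  simp only [Complex.sub_re, Complex.one_re]
  linarith

theorem norm_sub_eq_norm_one_sub_conj {z w : ℂ} (hw : ‖w‖ = 1) :
    ‖z - w‖ = ‖1 - conj z * w‖ := by
  have h1 : w * conj w = 1 := by
    rw [Complex.mul_conj, Complex.normSq_eq_norm_sq, hw]; simp
  have h2 : 1 - conj z * w = - (w * conj (z - w)) := by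
    rw [map_sub]
    linear_combination -h1
  rw [h2, norm_neg, norm_mul, hw, one_mul, Complex.norm_conj]

/-- The Blaschke factor carries the zero and has modulus one on the unit circle; `exp H` keeps that
and turns the modulus on the inner circle into `‖z‖`. Only the factor `z - w` contributes to the
index, as `1 - conj z * w` and `exp H` have holomorphic logarithms. -/
theorem isAnnulusSlitMap_of_re {r : ℝ} (hr : 0 ≤ r) {z : ℂ} (hz : z ∈ annulus r) {H : ℂ → ℂ}
    (hH : ∀ w : ℂ, r ≤ ‖w‖ → ‖w‖ ≤ 1 → DifferentiableAt ℂ H w)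
    (hH1 : ∀ w : ℂ, ‖w‖ = 1 → (H w).re = 0)
    (hHr : ∀ w : ℂ, ‖w‖ = r →
      (H w).re = Real.log ‖1 - conj z * w‖ - Real.log ‖1 - w / z‖) :
    IsAnnulusSlitMap r z fun w => (z - w) / (1 - conj z * w) * Complex.exp (H w) := by
  set g : ℂ → ℂ := fun w => (z - w) / (1 - conj z * w) * Complex.exp (H w) with hg
  have hz0 : z ≠ 0 := norm_pos_iff.mp (hr.trans_lt hz.1)
  have hden : ∀ w : ℂ, ‖w‖ ≤ 1 → 1 - conj z * w ≠ 0 := fun w hw =>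
    Complex.slitPlane_ne_zero (one_sub_conj_mul_mem_slitPlane hz.2 hw)
  have hgd : ∀ w : ℂ, r ≤ ‖w‖ → ‖w‖ ≤ 1 → HasDerivAt g
      (((-1 * (1 - conj z * w) - (z - w) * -(conj z)) / (1 - conj z * w) ^ 2) *
        Complex.exp (H w) + (z - w) / (1 - conj z * w) * (Complex.exp (H w) * deriv H w)) w := by
    intro w h1 h2
    have e1 : HasDerivAt (fun w : ℂ => z - w) (-1) w := (hasDerivAt_id w).const_sub z
    have e2 : HasDerivAt (fun w : ℂ => 1 - conj z * w) (-(conj z)) w := by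
      simpa using ((hasDerivAt_id w).const_mul (conj z)).const_sub 1
    exact (e1.fun_div e2 (hden w h2)).fun_mul (hH w h1 h2).hasDerivAt.cexp
  have hnorm : ∀ w, ‖g w‖ = ‖z - w‖ / ‖1 - conj z * w‖ * Real.exp (H w).re := fun w => by
    rw [hg]; simp only [norm_mul, norm_div, Complex.norm_exp]
  have hgz : g z = 0 := by simp [hg]
  have hlog : ∀ t ∈ Ioo r 1, t ≠ ‖z‖ → logIndex g (g z) t = ∮ w in C(0, t), (w - z)⁻¹ := by
    intro t ht htz
    have ht0 : 0 < t := hr.trans_lt ht.1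
    have key : ∀ w ∈ sphere (0 : ℂ) t, deriv g w / (g w - g z) =
        (w - z)⁻¹ + (conj z / (1 - conj z * w) + deriv H w) := by
      intro w hw
      rw [mem_sphere_zero_iff_norm] at hw
      rw [(hgd w (by rw [hw]; exact ht.1.le) (by rw [hw]; exact ht.2.le)).deriv, hgz]
      have n1 : z - w ≠ 0 := fun h => htz (by rw [← hw, sub_eq_zero.mp h])
      have n1' : w - z ≠ 0 := fun h => n1 (by rw [← neg_sub, h, neg_zero])
      have n2 := hden w (by rw [hw]; exact ht.2.le)
      have n3 := Complex.exp_ne_zero (H w)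
      simp only [hg, sub_zero]
      rw [inv_eq_one_div]
      have : w - z = -(z - w) := by ring
      rw [this]
      field_simp
      ring
    have hprim : ∀ w ∈ sphere (0 : ℂ) t,
        HasDerivAt (fun w => -Complex.log (1 - conj z * w) + H w)
          (conj z / (1 - conj z * w) + deriv H w) w := by
      intro w hw
      rw [mem_sphere_zero_iff_norm] at hw
      have e2 : HasDerivAt (fun w : ℂ => 1 - conj z * w) (-(conj z)) w := by
        simpa using ((hasDerivAt_id w).const_mul (conj z)).const_sub 1
      have e3 := (e2.clog (one_sub_conj_mul_mem_slitPlane hz.2 (by rw [hw]; exact ht.2.le))).neg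
      rw [← neg_div, neg_neg] at e3
      exact e3.add (hH w (by rw [hw]; exact ht.1.le) (by rw [hw]; exact ht.2.le)).hasDerivAt
    have hA : IsOpen (annulus r) := isOpen_annulus r
    have hsub : sphere (0 : ℂ) t ⊆ annulus r := fun w hw => by
      rw [mem_sphere_zero_iff_norm] at hw; rw [mem_annulus, hw]; exact ht
    have hHA : DifferentiableOn ℂ H (annulus r) := fun w hw =>
      (hH w hw.1.le hw.2.le).differentiableWithinAt
    have i1 : CircleIntegrable (fun w => (w - z)⁻¹) 0 t := by
      refine ContinuousOn.circleIntegrable ht0.le ?_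
      refine (continuousOn_id.sub continuousOn_const).inv₀ fun w hw h => htz ?_
      rw [mem_sphere_zero_iff_norm] at hw
      have e : w = z := sub_eq_zero.mp h
      rw [← hw, e]
    have i2 : CircleIntegrable (fun w => conj z / (1 - conj z * w) + deriv H w) 0 t := by
      refine ContinuousOn.circleIntegrable ht0.le ?_
      refine ContinuousOn.add ?_ ((hHA.deriv hA).continuousOn.mono hsub)
      refine continuousOn_const.div (by fun_prop) fun w hw => hden w ?_
      rw [mem_sphere_zero_iff_norm] at hw
      rw [hw]; exact ht.2.le
    rw [logIndex, circleIntegral.integral_congr ht0.le key, circleIntegral.integral_add i1 i2,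
      circleIntegral.integral_eq_zero_of_hasDerivWithinAt ht0.le
        fun w hw => (hprim w hw).hasDerivWithinAt, add_zero]
  refine ⟨fun w hw => (hgd w hw.1.le hw.2.le).differentiableAt.differentiableWithinAt, hgz, ?_,
    ?_, ?_⟩
  · intro t ht
    have ht0 : 0 < t := hr.trans_lt ht.1
    refine ⟨fun h => ?_, fun h => ?_⟩
    · rw [hlog t ht h.ne, circleIntegral_sub_inv_of_norm_lt ht0.le h]
    · rw [hlog t ht h.ne', circleIntegral.integral_sub_inv_of_mem_ball (by simpa using h)]
  · have : Tendsto (fun w => ‖g w‖) (comap norm (𝓝 (1 : ℝ))) (𝓝 1) := by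
      refine tendsto_comap_norm fun w hw => ⟨?_, ?_⟩
      · exact (hgd w (by rw [hw]; exact (hz.1.trans hz.2).le) hw.le).continuousAt.norm
      · rw [hnorm, hH1 w hw, norm_sub_eq_norm_one_sub_conj hw, div_self, Real.exp_zero, one_mul]
        exact norm_ne_zero_iff.mpr (hden w hw.le)
    exact this.mono_left (comap_mono nhdsWithin_le_nhds)
  · have : Tendsto (fun w => ‖g w‖) (comap norm (𝓝 r)) (𝓝 ‖z‖) := by
      refine tendsto_comap_norm fun w hw => ⟨?_, ?_⟩
      · exact (hgd w hw.ge (by rw [hw]; exact (hz.1.trans hz.2).le)).continuousAt.norm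
      · have n1 : 0 < ‖1 - conj z * w‖ :=
          norm_pos_iff.mpr (hden w (by rw [hw]; exact (hz.1.trans hz.2).le))
        have n2 : 1 - w / z ≠ 0 := fun h => by
          have : w = z := by field_simp at h; linear_combination -h
          rw [← this, mem_annulus, hw] at hz
          exact lt_irrefl _ hz.1
        have n2' := norm_pos_iff.mpr n2
        rw [hnorm, hHr w hw, Real.exp_sub, Real.exp_log n1, Real.exp_log n2']
        have : z - w = z * (1 - w / z) := by field_simp
        rw [this, norm_mul]
        rw [div_mul_div_cancel₀ n1.ne', mul_div_cancel_right₀ _ n2'.ne']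
    exact this.mono_left (comap_mono nhdsWithin_le_nhds)

/-- With `F w = ∑ a n * w ^ n`, put `H w = F w - conj (F (1 / conj w))`. Its real part vanishes on
the unit circle. On the circle of radius `r` it equals `Re (F w - F (w / r ^ 2))`, whose `n`-th
coefficient is `a n * (1 - r ^ (-2 * n))`, and `a n` is chosen so that the prescribed logarithms
result. For `r = 0` the Blaschke factor alone suffices. -/
theorem exists_isAnnulusSlitMap {r : ℝ} (hr : 0 ≤ r) {z : ℂ} (hz : z ∈ annulus r) :
    ∃ g, IsAnnulusSlitMap r z g := by
  have hz0 : 0 < ‖z‖ := hr.trans_lt hz.1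
  have hzne : z ≠ 0 := norm_pos_iff.mp hz0
  rcases hr.eq_or_lt with rfl | hr0
  · refine ⟨_, isAnnulusSlitMap_of_re le_rfl hz (H := fun _ => 0)
      (fun w _ _ => differentiableAt_const _) (fun w _ => rfl) fun w hw => ?_⟩
    rw [norm_eq_zero.mp hw]; simp
  have hr1 : r < 1 := hz.1.trans hz.2
  -- The coefficients decay like `q ^ n` with `q < r`, so the series converges in a disk of radius
  -- larger than `1 / r`. This covers both `w` and `w⁻¹` on the closed annulus.
  set q := r ^ 2 / ‖z‖ with hq
  have hq0 : 0 < q := by positivity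
  have hqr : q < r := by
    rw [hq, div_lt_iff₀ hz0, sq]
    exact mul_lt_mul_of_pos_left hz.1 hr0
  set c : ℕ → ℂ := fun n => ((1 / z) ^ n - (conj z) ^ n) / n with hc
  set a : ℕ → ℂ := fun n => -c n * ((r ^ (2 * n) / (1 - r ^ (2 * n)) : ℝ) : ℂ) with ha
  have hr2 : r ^ 2 < 1 := by nlinarith
  have hrn : ∀ n : ℕ, n ≠ 0 → r ^ (2 * n) ≤ r ^ 2 := fun n hn =>
    pow_le_pow_of_le_one hr0.le hr1.le (by omega)
  have hcb : ∀ n, ‖c n‖ ≤ 2 * (1 / ‖z‖) ^ n := by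
    intro n
    rcases Nat.eq_zero_or_pos n with rfl | hn
    · simp [hc]
    have hn1 : (1 : ℝ) ≤ n := by exact_mod_cast hn
    have h1 : 1 ≤ 1 / ‖z‖ := (one_le_div hz0).mpr hz.2.le
    have h2 : ‖z‖ ^ n ≤ (1 / ‖z‖) ^ n := pow_le_pow_left₀ hz0.le (hz.2.le.trans h1) n
    rw [hc]
    simp only [norm_div, Complex.norm_natCast]
    refine (div_le_self (norm_nonneg _) hn1).trans ((norm_sub_le _ _).trans ?_)
    simp only [norm_pow, norm_div, norm_one, Complex.norm_conj]
    linarith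
  have hab : ∀ n, ‖a n‖ ≤ 2 / (1 - r ^ 2) * q ^ n := by
    intro n
    rcases Nat.eq_zero_or_pos n with rfl | hn
    · have h3 : 0 ≤ 2 / (1 - r ^ 2) := div_nonneg zero_le_two (by linarith)
      simpa [ha, hc] using h3
    have h3 : 0 < 1 - r ^ 2 := by linarith
    have h4 : 1 - r ^ 2 ≤ 1 - r ^ (2 * n) := by linarith [hrn n hn.ne']
    have h5 : 0 ≤ r ^ (2 * n) / (1 - r ^ (2 * n)) := div_nonneg (by positivity) (by linarith)
    rw [ha]
    simp only [norm_mul, norm_neg, Complex.norm_real, Real.norm_of_nonneg h5]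
    calc ‖c n‖ * (r ^ (2 * n) / (1 - r ^ (2 * n)))
        ≤ (2 * (1 / ‖z‖) ^ n) * (r ^ (2 * n) / (1 - r ^ 2)) := by
          refine mul_le_mul (hcb n) ?_ h5 (by positivity)
          exact div_le_div_of_nonneg_left (by positivity) h3 h4
      _ = 2 / (1 - r ^ 2) * q ^ n := by
          rw [hq, div_pow, pow_mul, div_pow, one_pow]; ring
  have hab' : ∀ n, ‖conj (a n)‖ ≤ 2 / (1 - r ^ 2) * q ^ n := fun n => by
    rw [Complex.norm_conj]; exact hab n
  set F : ℂ → ℂ := fun w => ∑' n, a n * w ^ n with hF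
  set G : ℂ → ℂ := fun w => ∑' n, conj (a n) * w ^ n with hG
  have hGF : ∀ w, G (conj w) = conj (F w) := fun w => by
    rw [hF, hG, Complex.conj_tsum]
    simp only [map_mul, map_pow]
  refine ⟨_, isAnnulusSlitMap_of_re hr hz (H := fun w => F w - G w⁻¹) ?_ ?_ ?_⟩
  · intro w h1 h2
    have hw0 : w ≠ 0 := norm_pos_iff.mp (hr0.trans_le h1)
    refine DifferentiableAt.sub (differentiableAt_tsum_mul_pow hq0 hab (by nlinarith)).2 ?_
    have h3 : ‖w⁻¹‖ * q < 1 := by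
      rw [norm_inv, inv_mul_lt_iff₀ (hr0.trans_le h1)]; linarith
    exact DifferentiableAt.comp w (differentiableAt_tsum_mul_pow hq0 hab' h3).2
      (differentiableAt_inv hw0)
  · intro w hw
    have : w⁻¹ = conj w := Complex.inv_eq_conj hw
    rw [this, hGF]
    simp
  · intro w hw
    have hw0 : w ≠ 0 := norm_pos_iff.mp (hw ▸ hr0)
    have hrc : (r : ℂ) ≠ 0 := by exact_mod_cast hr0.ne'
    -- On the inner circle the reflected point is `w / r ^ 2`, whose modulus is `1 / r`.
    have hinv : w⁻¹ = conj (w / (r : ℂ) ^ 2) := by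
      rw [map_div₀, map_pow, Complex.conj_ofReal, Complex.inv_def, Complex.normSq_eq_norm_sq, hw]
      push_cast
      rw [div_eq_mul_inv]
    have s1 := (differentiableAt_tsum_mul_pow hq0 hab (w := w) (by rw [hw]; nlinarith)).1
    have s2 := (differentiableAt_tsum_mul_pow hq0 hab (w := w / (r : ℂ) ^ 2) (by
      rw [norm_div, norm_pow, Complex.norm_real, Real.norm_of_nonneg hr0.le, hw]
      have : r / r ^ 2 * q = q / r := by field_simp
      rw [this, div_lt_one hr0]; exact hqr)).1
    have hn1 : ‖w / z‖ < 1 := by rw [norm_div, hw, div_lt_one hz0]; exact hz.1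
    have hn2 : ‖conj z * w‖ < 1 := by
      rw [norm_mul, Complex.norm_conj, hw]; nlinarith [hz.2]
    have s3 := (Complex.hasSum_taylorSeries_neg_log hn1).sub
      (Complex.hasSum_taylorSeries_neg_log hn2)
    have hterm : ∀ n : ℕ, a n * w ^ n - a n * (w / (r : ℂ) ^ 2) ^ n =
        (w / z) ^ n / n - (conj z * w) ^ n / n := by
      intro n
      rcases Nat.eq_zero_or_pos n with rfl | hn
      · simp
      have h4 : (1 : ℂ) - (r : ℂ) ^ (2 * n) ≠ 0 := by
        have : r ^ (2 * n) < 1 := (hrn n hn.ne').trans_lt hr2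
        exact_mod_cast (sub_pos.mpr this).ne'
      have h5 : (n : ℂ) ≠ 0 := by exact_mod_cast hn.ne'
      have h6 : (r : ℂ) ^ (2 * n) ≠ 0 := pow_ne_zero _ hrc
      simp only [ha, hc]
      push_cast
      rw [div_pow w, ← pow_mul, mul_pow, div_pow w, div_pow 1, one_pow]
      field_simp
      ring
    have h7 : F w - F (w / (r : ℂ) ^ 2) =
        -Complex.log (1 - w / z) - -Complex.log (1 - conj z * w) := by
      rw [hF]
      simp only
      rw [← s1.tsum_sub s2, ← s3.tsum_eq]
      exact tsum_congr hterm
    have h8 : (F w - G w⁻¹).re = (F w - F (w / (r : ℂ) ^ 2)).re := by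
      rw [hinv, hGF]; simp
    rw [h8, h7]
    simp only [Complex.sub_re, Complex.neg_re, Complex.log_re]
    ring

/-! ### Extremal properties of the slit map of an annulus -/

/-- Disjoint open sets separating the intersection would, by compactness, already cover and separate
some `V i`. It serves to show that the cluster set at an end is connected. -/
theorem isConnected_iInter_of_directed {X : Type*} [TopologicalSpace X] [T2Space X] {ι : Type*}
    [Nonempty ι] {V : ι → Set X} (hV : Directed (· ⊇ ·) V) (hc : ∀ i, IsCompact (V i))
    (hconn : ∀ i, IsConnected (V i)) : IsConnected (⋂ i, V i) := by
  have hcl : ∀ i, IsClosed (V i) := fun i => (hc i).isClosed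
  have hKcl : IsClosed (⋂ i, V i) := isClosed_iInter hcl
  obtain ⟨i₀⟩ := ‹Nonempty ι›
  have hKc : IsCompact (⋂ i, V i) := (hc i₀).of_isClosed_subset hKcl (iInter_subset _ _)
  have : Nonempty ι := ⟨i₀⟩
  refine ⟨IsCompact.nonempty_iInter_of_directed_nonempty_isCompact_isClosed V hV
    (fun i => (hconn i).nonempty) hc hcl, ?_⟩
  intro u v hu hv hsub ⟨a, ha, hau⟩ ⟨b, hb, hbv⟩
  by_contra hne
  have hdisj : ∀ x ∈ ⋂ i, V i, x ∈ u → x ∉ v := fun x hx h1 h2 => hne ⟨x, hx, h1, h2⟩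
  have hA : IsCompact ((⋂ i, V i) \ v) := hKc.diff hv
  have hB : IsCompact ((⋂ i, V i) \ u) := hKc.diff hu
  have hd : Disjoint ((⋂ i, V i) \ v) ((⋂ i, V i) \ u) := by
    rw [Set.disjoint_left]
    rintro x ⟨hx, h1⟩ ⟨_, h2⟩
    exact (hsub hx).elim h2 h1
  obtain ⟨U', V', hU', hV', hAU, hBV, hUV⟩ := SeparatedNhds.of_isCompact_isCompact hA hB hd
  obtain ⟨i, hi⟩ := exists_subset_nhds_of_isCompact hV hc (U := U' ∪ V') fun x hx =>
    (hU'.union hV').mem_nhds <| by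
      by_cases hxv : x ∈ v
      · exact Or.inr (hBV ⟨hx, fun h => hdisj x hx h hxv⟩)
      · exact Or.inl (hAU ⟨hx, hxv⟩)
  obtain ⟨x, _, hx1, hx2⟩ := (hconn i).isPreconnected U' V' hU' hV' hi
    ⟨a, mem_iInter.mp ha i, hAU ⟨ha, hdisj a ha hau⟩⟩
    ⟨b, mem_iInter.mp hb i, hBV ⟨hb, fun h => hdisj b hb h hbv⟩⟩
  exact (Set.disjoint_left.mp hUV) hx1 hx2

theorem dslope_div_dslope {f g : ℂ → ℂ} {z w : ℂ} (hf : f z = 0) (hg : g z = 0) (hw : w ≠ z) :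
    dslope g z w / dslope f z w = g w / f w := by
  rw [dslope_of_ne _ hw, dslope_of_ne _ hw, slope_def_field, slope_def_field, hf, hg, sub_zero,
    sub_zero, div_div_div_cancel_right₀ (sub_ne_zero.mpr hw)]

/-- Comparison of two injective maps of an annulus of the same type through the boundary values
of their quotient. -/
theorem log_norm_div_boundary {r : ℝ} (hr : 0 ≤ r) {z : ℂ} (hz : z ∈ annulus r) {f g : ℂ → ℂ}
    (hf : DifferentiableOn ℂ f (annulus r)) (hfi : InjOn f (annulus r)) (hfz : f z = 0)
    (hfo : IsOuterType r z f)
    (hg : DifferentiableOn ℂ g (annulus r)) (hgi : InjOn g (annulus r)) (hgz : g z = 0)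
    (hgo : IsOuterType r z g) {m : ℝ}
    (hOut : ∀ ε > 0, ∀ᶠ w in outerEnd, -ε ≤ Real.log (‖g w‖ / ‖f w‖))
    (hIn : ∀ ε > 0, ∀ᶠ w in innerEnd r, Real.log (‖g w‖ / ‖f w‖) ≤ m + ε) :
    0 ≤ m ∧ (m = 0 → ∃ c : ℂ, ‖c‖ = 1 ∧ ∀ w ∈ annulus r, g w = c * f w) := by
  have hA := isOpen_annulus r
  have hr1 : r < 1 := hz.1.trans hz.2
  -- Away from `z` this is `g / f`; the difference quotients cancel the common simple zero.
  set q : ℂ → ℂ := fun w => dslope g z w / dslope f z w with hq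
  have hf0 : ∀ w ∈ annulus r, dslope f z w ≠ 0 := fun w hw =>
    dslope_ne_zero_of_injOn hA hf hfi hz hw
  have hg0 : ∀ w ∈ annulus r, dslope g z w ≠ 0 := fun w hw =>
    dslope_ne_zero_of_injOn hA hg hgi hz hw
  have hfd := differentiableOn_dslope_annulus hf hz
  have hgd := differentiableOn_dslope_annulus hg hz
  have hqd : DifferentiableOn ℂ q (annulus r) := hgd.div hfd hf0
  obtain ⟨t, hzt, ht1⟩ := exists_between hz.2
  have ht : t ∈ Ioo r 1 := ⟨hz.1.trans hzt, ht1⟩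
  have ht0 : 0 ≤ t := hr.trans ht.1.le
  have hs := sphere_subset_annulus ht
  have hne : ∀ w ∈ sphere (0 : ℂ) t, w ≠ z := fun w hw he => by
    rw [mem_sphere_zero_iff_norm, he] at hw; exact hzt.ne hw
  have hcont : ∀ {k : ℂ → ℂ}, DifferentiableOn ℂ k (annulus r) → InjOn k (annulus r) →
      CircleIntegrable (fun w => deriv k w / (k w - k z)) 0 t := fun {k} hk hki => by
    refine ContinuousOn.circleIntegrable ht0 ?_
    refine ((hk.deriv hA).continuousOn.mono hs).div
      ((hk.continuousOn.mono hs).sub continuousOn_const) fun w hw he => hne w hw ?_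
    exact hki (hs hw) hz (sub_eq_zero.mp he)
  -- The period of `log q` is the difference of the indices of `g` and `f`, equal because both maps
  -- have outer type.
  have hper : ∮ w in C(0, t), deriv q w / q w = 0 := by
    have key : ∀ w ∈ sphere (0 : ℂ) t, deriv q w / q w =
        deriv g w / (g w - g z) - deriv f w / (f w - f z) := by
      intro w hw
      rw [logDeriv_eq_add_dslope hf hfi hz (hs hw) (hne w hw),
        logDeriv_eq_add_dslope hg hgi hz (hs hw) (hne w hw)]
      have d1 := (hfd.differentiableAt (hA.mem_nhds (hs hw))).hasDerivAt
      have d2 := (hgd.differentiableAt (hA.mem_nhds (hs hw))).hasDerivAt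
      have n1 := hf0 w (hs hw)
      have n2 := hg0 w (hs hw)
      rw [hq, (d2.fun_div d1 n1).deriv]
      field_simp
      ring
    rw [circleIntegral.integral_congr ht0 key,
      circleIntegral.integral_sub (hcont hg hgi) (hcont hf hfi)]
    change logIndex g (g z) t - logIndex f (f z) t = 0
    rw [(hgo t ht).2 hzt, (hfo t ht).2 hzt, sub_self]
  have hqe : ∀ w, w ≠ z → ‖q w‖ = ‖g w‖ / ‖f w‖ := fun w hw => by
    rw [hq]; simp only; rw [dslope_div_dslope hfz hgz hw, norm_div]
  have hzc : IsCompact ({z} : Set ℂ) := isCompact_singleton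
  have hzs : ({z} : Set ℂ) ⊆ annulus r := singleton_subset_iff.mpr hz
  obtain ⟨h1, h2⟩ := log_norm_boundary hr hr1 hqd
    (fun w hw => div_ne_zero (hg0 w hw) (hf0 w hw)) ht hper (m := m)
    (fun ε hε => eventually_outerEnd.mp <| by
      filter_upwards [hOut ε hε, eventually_outerEnd_notMem hzc hzs] with w hw hwz
      rwa [hqe w hwz])
    (fun ε hε => eventually_innerEnd.mp <| by
      filter_upwards [hIn ε hε, eventually_innerEnd_notMem hzc hzs] with w hw hwz
      rwa [hqe w hwz])
  refine ⟨h1, fun hm => ?_⟩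
  obtain ⟨c, hc, hcq⟩ := h2 hm
  refine ⟨c, hc, fun w hw => ?_⟩
  by_cases hwz : w = z
  · rw [hwz, hfz, hgz, mul_zero]
  · have := hcq w hw
    rw [hq] at this
    simp only at this
    rw [dslope_div_dslope hfz hgz hwz, div_eq_iff] at this
    · exact this
    · intro h
      exact hwz (hfi hw hz (h.trans hfz.symm))

theorem eventually_ne_zero_outerEnd {r : ℝ} {z : ℂ} (hz : z ∈ annulus r) {f : ℂ → ℂ}
    (hf : IsAdmissible (annulus r) z f) :
    ∀ᶠ w in outerEnd, w ∈ annulus r ∧ 0 < ‖f w‖ ∧ ‖f w‖ < 1 := by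
  filter_upwards [eventually_outerEnd_mem (hz.1.trans hz.2), eventually_outerEnd_notMem
    isCompact_singleton (singleton_subset_iff.mpr hz)] with w hw hwz
  refine ⟨hw, norm_pos_iff.mpr fun h => hwz (hf.injOn hw hz (h.trans hf.map_base.symm)), ?_⟩
  simpa using hf.mapsTo hw

theorem eventually_ne_zero_innerEnd {r : ℝ} {z : ℂ} (hz : z ∈ annulus r) {f : ℂ → ℂ}
    (hf : IsAdmissible (annulus r) z f) :
    ∀ᶠ w in innerEnd r, w ∈ annulus r ∧ 0 < ‖f w‖ ∧ ‖f w‖ < 1 := by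
  filter_upwards [eventually_innerEnd_mem (hz.1.trans hz.2), eventually_innerEnd_notMem
    isCompact_singleton (singleton_subset_iff.mpr hz)] with w hw hwz
  refine ⟨hw, norm_pos_iff.mpr fun h => hwz (hf.injOn hw hz (h.trans hf.map_base.symm)), ?_⟩
  simpa using hf.mapsTo hw

theorem eventually_log_div_outerEnd {r : ℝ} {z : ℂ} (hz : z ∈ annulus r) {f g : ℂ → ℂ}
    (hf : IsAdmissible (annulus r) z f) (hg : Tendsto (fun w => ‖g w‖) outerEnd (𝓝 1)) {ε : ℝ}
    (hε : 0 < ε) : ∀ᶠ w in outerEnd, -ε ≤ Real.log (‖g w‖ / ‖f w‖) := by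
  have h1 : Real.exp (-ε) < 1 := by rw [Real.exp_lt_one_iff]; linarith
  filter_upwards [eventually_ne_zero_outerEnd hz hf, hg.eventually (lt_mem_nhds h1)] with w hw hw'
  have hgp : 0 < ‖g w‖ := (Real.exp_pos _).trans hw'
  rw [Real.le_log_iff_exp_le (div_pos hgp hw.2.1), le_div_iff₀ hw.2.1]
  nlinarith [Real.exp_pos (-ε), hw.2.2]

/-- An admissible map of an annulus of outer type does no better than the slit map. -/
theorem IsAnnulusSlitMap.boundaryDist_le {r : ℝ} (hr : 0 ≤ r) {z : ℂ} (hz : z ∈ annulus r)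
    {f g : ℂ → ℂ} (hg : IsAnnulusSlitMap r z g) (hf : IsAdmissible (annulus r) z f)
    (hfo : IsOuterType r z f) :
    boundaryDist (annulus r) f ≤ ‖z‖ ∧
      (boundaryDist (annulus r) f = ‖z‖ → ∃ c : ℂ, ‖c‖ = 1 ∧ ∀ w ∈ annulus r, g w = c * f w) := by
  have hz0 : 0 < ‖z‖ := hr.trans_lt hz.1
  set b := boundaryDist (annulus r) f with hb
  rcases le_or_gt b 0 with hb0 | hb0
  · exact ⟨hb0.trans hz0.le, fun h => absurd (h ▸ hb0) hz0.not_ge⟩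
  have hga := hg.isAdmissible hr hz
  obtain ⟨h1, h2⟩ := log_norm_div_boundary hr hz hf.differentiableOn hf.injOn hf.map_base hfo
    hg.diff hga.injOn hg.map_base hg.outerType (m := Real.log (‖z‖ / b))
    (fun ε hε => eventually_log_div_outerEnd hz hf hg.outer hε) (by
      intro ε hε
      -- One half of `ε` pays for `‖f‖ > b * exp (-ε / 2)` off a compact set, the other half for
      -- `‖g‖ < ‖z‖ * exp (ε / 2)` near the inner end.
      have hd : b * Real.exp (-(ε / 2)) < b := by
        have : Real.exp (-(ε / 2)) < 1 := by rw [Real.exp_lt_one_iff]; linarith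
        nlinarith
      have he : ‖z‖ < ‖z‖ * Real.exp (ε / 2) := by
        have : 1 < Real.exp (ε / 2) := by rw [Real.one_lt_exp_iff]; linarith
        nlinarith
      obtain ⟨C, hCA, hC, hCd⟩ := hf.exists_isCompact (isOpen_annulus r) hz hd
      filter_upwards [eventually_ne_zero_innerEnd hz hf, eventually_ne_zero_innerEnd hz hga,
        eventually_innerEnd_notMem hC hCA, hg.inner.eventually (gt_mem_nhds he)] with w w1 w2 w3 w4
      have w5 := hCd w w1.1 w3
      have hp := Real.exp_pos (-(ε / 2))
      rw [← Real.log_exp ε, ← Real.log_mul (by positivity) (by positivity)]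
      refine Real.log_le_log (div_pos w2.2.1 w1.2.1) ?_
      have : ‖z‖ / b * Real.exp ε = ‖z‖ * Real.exp (ε / 2) / (b * Real.exp (-(ε / 2))) := by
        have e1 : Real.exp ε = Real.exp (ε / 2) * Real.exp (ε / 2) := by
          rw [← Real.exp_add]; ring_nf
        rw [e1, Real.exp_neg]
        field_simp
      rw [this]
      exact div_le_div₀ (by positivity) w4.le (by positivity) w5.le)
  have hle : 1 ≤ ‖z‖ / b := by
    have := (Real.le_log_iff_exp_le (div_pos hz0 hb0)).mp h1
    rwa [Real.exp_zero] at this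
  refine ⟨(one_le_div hb0).mp hle, fun he => h2 ?_⟩
  rw [he, div_self hz0.ne', Real.log_one]

theorem eventually_log_div_innerEnd {r : ℝ} {f g : ℂ → ℂ} {a b : ℝ}
    (ha : 0 < a) (hb : 0 < b) (hfa : Tendsto (fun w => ‖f w‖) (innerEnd r) (𝓝 a))
    (hgb : Tendsto (fun w => ‖g w‖) (innerEnd r) (𝓝 b)) {ε : ℝ} (hε : 0 < ε) :
    ∀ᶠ w in innerEnd r, Real.log (‖g w‖ / ‖f w‖) ≤ Real.log (b / a) + ε := by
  have h1 := (hgb.div hfa ha.ne').log (div_pos hb ha).ne'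
  filter_upwards [h1.eventually (gt_mem_nhds (lt_add_of_pos_right _ hε))] with w hw
  exact hw.le

/-- Rigidity: an admissible map of outer type of constant boundary modulus is the slit map up to
rotation. -/
theorem IsAnnulusSlitMap.eq_of_tendsto {r : ℝ} (hr : 0 ≤ r) {z : ℂ} (hz : z ∈ annulus r)
    {f g : ℂ → ℂ} (hg : IsAnnulusSlitMap r z g) (hf : IsAdmissible (annulus r) z f)
    (hfo : IsOuterType r z f) (hf1 : Tendsto (fun w => ‖f w‖) outerEnd (𝓝 1)) {ρ : ℝ} (hρ : 0 < ρ)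
    (hfρ : Tendsto (fun w => ‖f w‖) (innerEnd r) (𝓝 ρ)) :
    ∃ c : ℂ, ‖c‖ = 1 ∧ ∀ w ∈ annulus r, g w = c * f w := by
  have hz0 : 0 < ‖z‖ := hr.trans_lt hz.1
  have hga := hg.isAdmissible hr hz
  obtain ⟨h1, h2⟩ := log_norm_div_boundary hr hz hf.differentiableOn hf.injOn hf.map_base hfo
    hg.diff hga.injOn hg.map_base hg.outerType (m := Real.log (‖z‖ / ρ))
    (fun ε hε => eventually_log_div_outerEnd hz hf hg.outer hε)
    (fun ε hε => eventually_log_div_innerEnd hρ hz0 hfρ hg.inner hε)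
  -- Here `f` also has boundary modulus one, so the roles can be exchanged. The two inequalities
  -- give `ρ = ‖z‖`, the equality case.
  obtain ⟨h3, _⟩ := log_norm_div_boundary hr hz
    hg.diff hga.injOn hg.map_base hg.outerType hf.differentiableOn hf.injOn hf.map_base hfo
    (m := Real.log (ρ / ‖z‖))
    (fun ε hε => eventually_log_div_outerEnd hz hga hf1 hε)
    (fun ε hε => eventually_log_div_innerEnd hz0 hρ hg.inner hfρ hε)
  refine h2 (le_antisymm ?_ h1)
  rw [← inv_div, Real.log_inv] at h3
  linarith

/-! ### The reflection `w ↦ r / w` of an annulus -/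

theorem mapsTo_reflect_annulus {r : ℝ} (hr : 0 < r) :
    MapsTo (fun w : ℂ => (r : ℂ) / w) (annulus r) (annulus r) := by
  intro w hw
  have hw0 : 0 < ‖w‖ := hr.trans hw.1
  have : ‖(r : ℂ) / w‖ = r / ‖w‖ := by
    rw [norm_div, Complex.norm_real, Real.norm_of_nonneg hr.le]
  rw [mem_annulus, this, lt_div_iff₀ hw0, div_lt_one hw0]
  exact ⟨by nlinarith [hw.2], hw.1⟩

theorem isConformalEquiv_reflect {r : ℝ} (hr : 0 < r) :
    IsConformalEquiv (fun w : ℂ => (r : ℂ) / w) (fun w : ℂ => (r : ℂ) / w) (annulus r)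
      (annulus r) := by
  have hrc : (r : ℂ) ≠ 0 := by exact_mod_cast hr.ne'
  have h0 : ∀ w ∈ annulus r, w ≠ 0 := fun w hw => norm_pos_iff.mp (hr.trans hw.1)
  have hd : DifferentiableOn ℂ (fun w : ℂ => (r : ℂ) / w) (annulus r) :=
    (differentiableOn_const _).div differentiableOn_id h0
  have hi : ∀ w ∈ annulus r, (r : ℂ) / (r / w) = w := fun w hw => by
    have := h0 w hw
    field_simp
  exact ⟨hd, hd, mapsTo_reflect_annulus hr, mapsTo_reflect_annulus hr, hi, hi⟩

theorem IsAdmissible.comp {U V : Set ℂ} {φ ψ f : ℂ → ℂ} {z : ℂ} (h : IsConformalEquiv φ ψ U V)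
    (hf : IsAdmissible V (φ z) f) : IsAdmissible U z (f ∘ φ) :=
  ⟨hf.differentiableOn.comp h.diff h.mapsTo, hf.injOn.comp h.injOn h.mapsTo,
    hf.mapsTo.comp h.mapsTo, hf.map_base⟩

theorem IsConformalEquiv.image_comp {U V : Set ℂ} {φ ψ : ℂ → ℂ} (h : IsConformalEquiv φ ψ U V)
    (f : ℂ → ℂ) : (f ∘ φ) '' U = f '' V := by
  rw [Set.image_comp, h.image_eq]

theorem IsConformalEquiv.boundaryDist_comp {U V : Set ℂ} {φ ψ : ℂ → ℂ}
    (h : IsConformalEquiv φ ψ U V) (f : ℂ → ℂ) : boundaryDist U (f ∘ φ) = boundaryDist V f := by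
  rw [boundaryDist, h.image_comp, boundaryDist]

theorem tendsto_reflect_outerEnd {r : ℝ} (hr : 0 < r) :
    Tendsto (fun w : ℂ => (r : ℂ) / w) outerEnd (innerEnd r) := by
  rw [innerEnd, tendsto_comap_iff]
  have : (norm ∘ fun w : ℂ => (r : ℂ) / w) = (fun t : ℝ => r / t) ∘ norm := by
    funext w
    simp [abs_of_pos hr]
  rw [this]
  refine Tendsto.comp ?_ tendsto_comap
  refine tendsto_nhdsWithin_iff.mpr ⟨?_, ?_⟩
  · have : ContinuousAt (fun t : ℝ => r / t) 1 := by
      refine continuousAt_const.div continuousAt_id one_ne_zero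
    have h := this.tendsto
    rw [div_one] at h
    exact h.mono_left nhdsWithin_le_nhds
  · filter_upwards [Ioo_mem_nhdsLT (one_pos : (0 : ℝ) < 1)] with t ht
    rw [mem_Ioi, lt_div_iff₀ ht.1]
    nlinarith [ht.2]

theorem tendsto_reflect_innerEnd {r : ℝ} (hr : 0 < r) :
    Tendsto (fun w : ℂ => (r : ℂ) / w) (innerEnd r) outerEnd := by
  rw [outerEnd, tendsto_comap_iff]
  have : (norm ∘ fun w : ℂ => (r : ℂ) / w) = (fun t : ℝ => r / t) ∘ norm := by
    funext w
    simp [abs_of_pos hr]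
  rw [this]
  refine Tendsto.comp ?_ tendsto_comap
  refine tendsto_nhdsWithin_iff.mpr ⟨?_, ?_⟩
  · have : ContinuousAt (fun t : ℝ => r / t) r := by
      refine continuousAt_const.div continuousAt_id hr.ne'
    have h := this.tendsto
    rw [div_self hr.ne'] at h
    exact h.mono_left nhdsWithin_le_nhds
  · filter_upwards [self_mem_nhdsWithin] with t ht
    rw [mem_Iio, div_lt_one (hr.trans ht)]
    exact ht

/-- The reflection carries the circle of radius `t` to the circle of radius `r / t` traversed
backwards, whence the sign. -/
theorem logIndex_reflect {r : ℝ} (hr : 0 < r) {f : ℂ → ℂ} (hf : DifferentiableOn ℂ f (annulus r))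
    {t : ℝ} (ht : t ∈ Ioo r 1) (ξ : ℂ) :
    logIndex (f ∘ fun w => (r : ℂ) / w) ξ t = -logIndex f ξ (r / t) := by
  have ht0 : 0 < t := hr.trans ht.1
  have htc : (t : ℂ) ≠ 0 := by exact_mod_cast ht0.ne'
  have hcm : ∀ (R θ : ℝ), circleMap 0 R θ = R * Complex.exp (θ * Complex.I) := fun R θ => by
    simp [circleMap]
  set h : ℝ → ℂ := fun θ => deriv (circleMap 0 (r / t)) θ •
    (deriv f (circleMap 0 (r / t) θ) / (f (circleMap 0 (r / t) θ) - ξ)) with hh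
  have hper : Function.Periodic h (2 * Real.pi) := by
    intro θ
    have h1 : circleMap 0 (r / t) (θ + 2 * Real.pi) = circleMap 0 (r / t) θ :=
      periodic_circleMap 0 (r / t) θ
    simp only [hh, deriv_circleMap, h1]
  have h1 : logIndex (f ∘ fun w => (r : ℂ) / w) ξ t = ∫ θ in (0)..(2 * Real.pi), -h (-θ) := by
    rw [logIndex, circleIntegral]
    refine intervalIntegral.integral_congr fun θ _ => ?_
    have hm : circleMap 0 t θ ∈ annulus r := by
      rw [mem_annulus, norm_circleMap_zero, abs_of_pos ht0]; exact ht
    have hw0 : circleMap 0 t θ ≠ 0 := norm_pos_iff.mp (hr.trans hm.1)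
    have hm' := mapsTo_reflect_annulus hr hm
    have hinv : (r : ℂ) / circleMap 0 t θ = circleMap 0 (r / t) (-θ) := by
      rw [hcm, hcm]
      push_cast
      rw [neg_mul, Complex.exp_neg]
      field_simp
    have hd : deriv (f ∘ fun w => (r : ℂ) / w) (circleMap 0 t θ) =
        deriv f (circleMap 0 (r / t) (-θ)) * (-(r : ℂ) / (circleMap 0 t θ) ^ 2) := by
      have e1 := (hf.differentiableAt ((isOpen_annulus r).mem_nhds hm')).hasDerivAt
      have e2 : HasDerivAt (fun w : ℂ => (r : ℂ) / w) (-(r : ℂ) / (circleMap 0 t θ) ^ 2)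
          (circleMap 0 t θ) := by
        simpa using (hasDerivAt_const (circleMap 0 t θ) (r : ℂ)).fun_div
          (hasDerivAt_id _) hw0
      rw [(e1.comp _ e2).deriv]
      simp only [hinv]
    simp only [hh, deriv_circleMap, smul_eq_mul, hd, Function.comp_apply, hinv]
    have : -(r : ℂ) / (circleMap 0 t θ) ^ 2 = -(circleMap 0 (r / t) (-θ)) / circleMap 0 t θ := by
      rw [← hinv]; field_simp
    rw [this]
    field_simp
  rw [h1, intervalIntegral.integral_neg, intervalIntegral.integral_comp_neg (fun θ => h θ)]
  congr 1
  have h2 := hper.intervalIntegral_add_eq (-(2 * Real.pi)) 0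
  rw [neg_add_cancel, zero_add] at h2
  rw [neg_zero, h2, logIndex, circleIntegral]

theorem IsInnerType.reflect {r : ℝ} (hr : 0 < r) {z : ℂ} (hz : z ∈ annulus r) {f : ℂ → ℂ}
    (hf : DifferentiableOn ℂ f (annulus r)) (h : IsInnerType r z f) :
    IsOuterType r (r / z) (f ∘ fun w => (r : ℂ) / w) := by
  have hz0 : 0 < ‖z‖ := hr.trans hz.1
  have e1 : (f ∘ fun w => (r : ℂ) / w) (r / z) = f z := by
    have : z ≠ 0 := norm_pos_iff.mp hz0
    have hrc : (r : ℂ) ≠ 0 := by exact_mod_cast hr.ne'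
    simp only [Function.comp_apply]
    congr 1
    field_simp
  have e2 : ‖(r : ℂ) / z‖ = r / ‖z‖ := by
    rw [norm_div, Complex.norm_real, Real.norm_of_nonneg hr.le]
  intro t ht
  have ht0 : 0 < t := hr.trans ht.1
  have ht' : r / t ∈ Ioo r 1 := by
    refine ⟨?_, (div_lt_one ht0).mpr ht.1⟩
    rw [lt_div_iff₀ ht0]; nlinarith [ht.2]
  rw [e1, e2, logIndex_reflect hr hf ht]
  refine ⟨fun h' => ?_, fun h' => ?_⟩
  · rw [(h _ ht').2, neg_zero]
    rw [lt_div_iff₀ ht0]; rw [lt_div_iff₀ hz0] at h'; linarith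
  · rw [(h _ ht').1, neg_neg]
    rw [div_lt_iff₀ ht0]; rw [div_lt_iff₀ hz0] at h'; linarith

theorem norm_reflect {r : ℝ} (hr : 0 ≤ r) (z : ℂ) : ‖(r : ℂ) / z‖ = r / ‖z‖ := by
  rw [norm_div, Complex.norm_real, Real.norm_of_nonneg hr]

theorem reflect_reflect {r : ℝ} (hr : 0 < r) {z : ℂ} (hz : z ∈ annulus r) :
    (r : ℂ) / (r / z) = z := (isConformalEquiv_reflect hr).left_inv z hz

/-- Multiplying the slit map by a unimodular constant. -/
theorem IsAnnulusSlitMap.const_mul {r : ℝ} (hr : 0 ≤ r) {z : ℂ} (hz : z ∈ annulus r) {f g : ℂ → ℂ}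
    (hg : IsAnnulusSlitMap r z g) {c : ℂ} (hc : ‖c‖ = 1) (h : ∀ w ∈ annulus r, f w = c * g w) :
    IsAnnulusSlitMap r z f := by
  have hc0 : c ≠ 0 := norm_pos_iff.mp (by rw [hc]; exact one_pos)
  have hfz : f z = 0 := by rw [h z hz, hg.map_base, mul_zero]
  have hn : ∀ w ∈ annulus r, ‖g w‖ = ‖f w‖ := fun w hw => by rw [h w hw, norm_mul, hc, one_mul]
  refine ⟨(hg.diff.const_mul c).congr h, hfz, ?_, ?_, ?_⟩
  · have key : ∀ t ∈ Ioo r 1, logIndex f (f z) t = logIndex g (g z) t := by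
      intro t ht
      refine circleIntegral.integral_congr (hr.trans ht.1.le) fun w hw => ?_
      have hwA := sphere_subset_annulus ht hw
      have e : f =ᶠ[𝓝 w] fun w => c * g w :=
        eventually_of_mem ((isOpen_annulus r).mem_nhds hwA) h
      have hd := hg.diff.differentiableAt ((isOpen_annulus r).mem_nhds hwA)
      rw [e.deriv_eq, deriv_const_mul _ hd, hfz, hg.map_base, sub_zero, sub_zero, h w hwA,
        mul_div_mul_left _ _ hc0]
    intro t ht
    rw [key t ht]
    exact hg.outerType t ht
  · refine hg.outer.congr' ?_
    filter_upwards [eventually_outerEnd_mem (hz.1.trans hz.2)] with w hw using hn w hw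
  · refine hg.inner.congr' ?_
    filter_upwards [eventually_innerEnd_mem (hz.1.trans hz.2)] with w hw using hn w hw

/-! ### Uniqueness and extremality on an annulus -/

/-- The modulus of a conformal map of an annulus onto a circularly slit disk has a limit at the
inner end. -/
theorem IsAdmissible.exists_tendsto_innerEnd {r : ℝ} (hr : 0 ≤ r) {z : ℂ} (hz : z ∈ annulus r)
    {f : ℂ → ℂ} (hf : IsAdmissible (annulus r) z f) (hs : IsCircularlySlitDisk (f '' annulus r)) :
    ∃ ρ : ℝ, 0 < ρ ∧ Tendsto (fun w => ‖f w‖) (innerEnd r) (𝓝 ρ) := by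
  have hr1 : r < 1 := hz.1.trans hz.2
  let E : {t : ℝ // r < t ∧ t ≤ 1} → Set ℂ := fun t => {w | r < ‖w‖ ∧ ‖w‖ < t}
  have hEA : ∀ t, E t ⊆ annulus r := fun t w hw => ⟨hw.1, hw.2.trans_le t.2.2⟩
  -- The closed images of shrinking collars of the inner circle; their intersection is the cluster
  -- set of `f` at the inner end.
  let V : {t : ℝ // r < t ∧ t ≤ 1} → Set ℂ := fun t => closure (f '' E t)
  have hVball : ∀ t, V t ⊆ closedBall 0 1 := fun t =>
    closure_minimal (((image_mono (hEA t)).trans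
      (image_subset_iff.mpr hf.mapsTo : f '' annulus r ⊆ ball 0 1)).trans
      ball_subset_closedBall) isClosed_closedBall
  have hVc : ∀ t, IsCompact (V t) := fun t =>
    (isCompact_closedBall (0 : ℂ) 1).of_isClosed_subset isClosed_closure (hVball t)
  have hmono : ∀ s t : {t : ℝ // r < t ∧ t ≤ 1}, s.1 ≤ t.1 → V s ⊆ V t := fun s t h =>
    closure_mono (image_mono fun w hw => ⟨hw.1, hw.2.trans_le h⟩)
  have hdir : Directed (· ⊇ ·) V := fun s t =>
    ⟨⟨min s.1 t.1, lt_min s.2.1 t.2.1, (min_le_left _ _).trans s.2.2⟩,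
      hmono _ _ (min_le_left _ _), hmono _ _ (min_le_right _ _)⟩
  have hVconn : ∀ t, IsConnected (V t) := fun t => by
    refine IsConnected.closure ?_
    refine IsConnected.image ⟨?_, isPreconnected_norm_Ioo hr _⟩ _
      (hf.differentiableOn.continuousOn.mono (hEA t))
    obtain ⟨s, hs1, hs2⟩ := exists_between t.2.1
    have : ‖(s : ℂ)‖ = s := by rw [Complex.norm_real, Real.norm_of_nonneg (hr.trans hs1.le)]
    exact ⟨(s : ℂ), by rw [this]; exact hs1, by rw [this]; exact hs2⟩
  have : Nonempty {t : ℝ // r < t ∧ t ≤ 1} := ⟨⟨1, hr1, le_rfl⟩⟩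
  have hK := isConnected_iInter_of_directed hdir hVc hVconn
  -- A cluster value `f w₀` would also be approached from a collar not containing `w₀`, against
  -- injectivity and openness.
  have hKD : (⋂ t, V t) ⊆ closedBall 0 1 \ f '' annulus r := by
    intro ξ hξ
    refine ⟨hVball ⟨1, hr1, le_rfl⟩ (mem_iInter.mp hξ _), ?_⟩
    rintro ⟨w₀, hw₀, rfl⟩
    obtain ⟨t, ht1, ht2⟩ := exists_between hw₀.1
    have hsub : {w : ℂ | t < ‖w‖ ∧ ‖w‖ < 1} ⊆ annulus r := fun w hw => ⟨ht1.trans hw.1, hw.2⟩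
    have ho : IsOpen (f '' {w : ℂ | t < ‖w‖ ∧ ‖w‖ < 1}) :=
      isOpen_image_of_injOn (isOpen_annulus t) (hf.differentiableOn.mono hsub)
        (hf.injOn.mono hsub)
    have hmem := mem_iInter.mp hξ ⟨t, ht1, (ht2.trans hw₀.2).le⟩
    obtain ⟨y, ⟨w₁, hw₁, h1⟩, ⟨w₂, hw₂, h2⟩⟩ :=
      mem_closure_iff.mp hmem _ ho ⟨w₀, ⟨ht2, hw₀.2⟩, rfl⟩
    have := hf.injOn (hsub hw₁) (hEA _ hw₂) (h1.trans h2.symm)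
    rw [this] at hw₁
    exact lt_asymm hw₁.1 hw₂.2
  -- The connected cluster set lies in one component of the complement of the slit disk, and the
  -- modulus is constant on each of these.
  obtain ⟨ρ, hρ, hKρ⟩ : ∃ ρ : ℝ, 0 < ρ ∧ ∀ ξ ∈ ⋂ t, V t, ‖ξ‖ = ρ := by
    obtain ⟨ξ₀, hξ₀⟩ := hK.nonempty
    have hsub := hK.isPreconnected.subset_connectedComponentIn hξ₀ hKD
    rcases hs.components ξ₀ (hKD hξ₀) with h | ⟨ρ, a, b, hρ, _, _, _, h⟩
    · exact ⟨1, one_pos, fun ξ hξ => by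
        have := hsub hξ
        rw [h] at this
        simpa using this⟩
    · refine ⟨ρ, hρ, fun ξ hξ => ?_⟩
      have := hsub hξ
      rw [h] at this
      obtain ⟨θ, _, rfl⟩ := this
      simp [abs_of_pos hρ]
  refine ⟨ρ, hρ, fun s hs => ?_⟩
  obtain ⟨t, ht⟩ := exists_subset_nhds_of_isCompact hdir hVc (U := norm ⁻¹' s) fun x hx =>
    continuous_norm.continuousAt (by rw [hKρ x hx]; exact hs)
  have : ∀ᶠ w in innerEnd r, ‖f w‖ ∈ s := by
    rw [eventually_innerEnd]
    filter_upwards [Ioo_mem_nhdsGT t.2.1] with τ hτ w hw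
    exact ht (subset_closure ⟨w, ⟨by rw [hw]; exact hτ.1, by rw [hw]; exact hτ.2⟩, rfl⟩)
  exact this

/-- Given the limit modulus at the inner end, only inner type has to be excluded. After reflection
such a map would have modulus tending to one at the inner end, and comparison with the slit map for
`r / z` would give `0 ≤ log ‖r / z‖`, which is negative. -/
theorem IsAnnulusSlitMap.eq_of_slitDisk {r : ℝ} (hr : 0 ≤ r) {z : ℂ} (hz : z ∈ annulus r)
    {f g : ℂ → ℂ} (hg : IsAnnulusSlitMap r z g) (hf : IsAdmissible (annulus r) z f)
    (hs : IsCircularlySlitDisk (f '' annulus r))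
    (hf1 : Tendsto (fun w => ‖f w‖) outerEnd (𝓝 1)) :
    ∃ c : ℂ, ‖c‖ = 1 ∧ ∀ w ∈ annulus r, g w = c * f w := by
  obtain ⟨ρ, hρ, hfρ⟩ := hf.exists_tendsto_innerEnd hr hz hs
  have hfo : IsOuterType r z f := by
    rcases hr.eq_or_lt with rfl | hr0
    · exact isOuterType_of_bounded hf.differentiableOn hf.injOn hf.mapsTo hz hf.map_base
    refine (isOuterType_or_isInnerType hr hf.differentiableOn hf.injOn hz).resolve_right
      fun hin => ?_
    have hz' := mapsTo_reflect_annulus hr0 hz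
    simp only at hz'
    obtain ⟨g', hg'⟩ := exists_isAnnulusSlitMap hr hz'
    have hf' : IsAdmissible (annulus r) ((r : ℂ) / z) (f ∘ fun w => (r : ℂ) / w) :=
      IsAdmissible.comp (isConformalEquiv_reflect hr0) (by rwa [reflect_reflect hr0 hz])
    have h1 : Tendsto (fun w => ‖(f ∘ fun w => (r : ℂ) / w) w‖) (innerEnd r) (𝓝 1) :=
      hf1.comp (tendsto_reflect_innerEnd hr0)
    have hz0 : 0 < ‖(r : ℂ) / z‖ := hr.trans_lt hz'.1
    have hga' := hg'.isAdmissible hr hz'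
    obtain ⟨h2, _⟩ := log_norm_div_boundary hr hz' hf'.differentiableOn hf'.injOn hf'.map_base
      (hin.reflect hr0 hz hf.differentiableOn) hg'.diff hga'.injOn hg'.map_base hg'.outerType
      (m := Real.log (‖(r : ℂ) / z‖ / 1))
      (fun ε hε => eventually_log_div_outerEnd hz' hf' hg'.outer hε)
      (fun ε hε => eventually_log_div_innerEnd one_pos hz0 h1 hg'.inner hε)
    rw [div_one] at h2
    exact absurd (Real.log_neg hz0 hz'.2) h2.not_gt
  exact hg.eq_of_tendsto hr hz hf hfo hf1 hρ hfρ

/-- Every admissible map of an annulus is bounded by one of the two slit maps, with equality only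
for slit disks. -/
theorem IsAdmissible.annulus_cases {r : ℝ} (hr : 0 ≤ r) {z : ℂ} (hz : z ∈ annulus r)
    {f : ℂ → ℂ} (hf : IsAdmissible (annulus r) z f) :
    (boundaryDist (annulus r) f ≤ ‖z‖ ∧
      (boundaryDist (annulus r) f = ‖z‖ → IsCircularlySlitDisk (f '' annulus r))) ∨
    (0 < r ∧ boundaryDist (annulus r) f ≤ r / ‖z‖ ∧
      (boundaryDist (annulus r) f = r / ‖z‖ → IsCircularlySlitDisk (f '' annulus r))) := by
  have key : ∀ {z : ℂ}, z ∈ annulus r → ∀ {f : ℂ → ℂ}, IsAdmissible (annulus r) z f →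
      IsOuterType r z f → boundaryDist (annulus r) f ≤ ‖z‖ ∧
      (boundaryDist (annulus r) f = ‖z‖ → IsCircularlySlitDisk (f '' annulus r)) := by
    intro z hz f hf hfo
    obtain ⟨g, hg⟩ := exists_isAnnulusSlitMap hr hz
    obtain ⟨h1, h2⟩ := hg.boundaryDist_le hr hz hf hfo
    refine ⟨h1, fun he => ?_⟩
    obtain ⟨c, hc, hcf⟩ := h2 he
    have hc0 : c ≠ 0 := norm_pos_iff.mp (by rw [hc]; exact one_pos)
    refine (hg.const_mul hr hz (c := c⁻¹) (by rw [norm_inv, hc, inv_one])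
      fun w hw => ?_).isCircularlySlitDisk hr hz
    rw [hcf w hw, inv_mul_cancel_left₀ hc0]
  rcases isOuterType_or_isInnerType hr hf.differentiableOn hf.injOn hz with ho | hi
  · exact Or.inl (key hz hf ho)
  · rcases hr.eq_or_lt with rfl | hr0
    · exact Or.inl (key hz hf
        (isOuterType_of_bounded hf.differentiableOn hf.injOn hf.mapsTo hz hf.map_base))
    right
    have hz' := mapsTo_reflect_annulus hr0 hz
    have hf' : IsAdmissible (annulus r) ((r : ℂ) / z) (f ∘ fun w => (r : ℂ) / w) :=
      IsAdmissible.comp (isConformalEquiv_reflect hr0) (by rwa [reflect_reflect hr0 hz])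
    have := key hz' hf' (hi.reflect hr0 hz hf.differentiableOn)
    rw [(isConformalEquiv_reflect hr0).boundaryDist_comp,
      (isConformalEquiv_reflect hr0).image_comp, norm_reflect hr] at this
    exact ⟨hr0, this⟩

/-- The two values are attained by the slit map for `z` and by the slit map for `r / z` preceded by
the reflection. -/
theorem squeezing_annulus {r : ℝ} (hr : 0 < r) {z : ℂ} (hz : z ∈ annulus r) :
    squeezing (annulus r) z = max ‖z‖ (r / ‖z‖) := by
  have hz' := mapsTo_reflect_annulus hr hz
  obtain ⟨g, hg⟩ := exists_isAnnulusSlitMap hr.le hz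
  obtain ⟨g', hg'⟩ := exists_isAnnulusSlitMap hr.le hz'
  have hga := hg.isAdmissible hr.le hz
  have hga' : IsAdmissible (annulus r) z (g' ∘ fun w => (r : ℂ) / w) :=
    IsAdmissible.comp (isConformalEquiv_reflect hr) (hg'.isAdmissible hr.le hz')
  refine le_antisymm (csSup_le ⟨_, g, hga, rfl⟩ ?_) (max_le ?_ ?_)
  · rintro _ ⟨f, hf, rfl⟩
    rcases hf.annulus_cases hr.le hz with h | h
    · exact h.1.trans (le_max_left _ _)
    · exact h.2.1.trans (le_max_right _ _)
  · rw [← hg.boundaryDist_eq hr.le hz]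
    exact hga.boundaryDist_le_squeezing hz
  · have := hga'.boundaryDist_le_squeezing hz
    rwa [(isConformalEquiv_reflect hr).boundaryDist_comp, hg'.boundaryDist_eq hr.le hz',
      norm_reflect hr.le] at this

end Squeezing

namespace Squeezing

open MeasureTheory

/-! ### Polygonal integrals -/

/-- The integral of `f` along the segment from `a` to `b`. -/
def segInt (f : ℂ → ℂ) (a b : ℂ) : ℂ := ∫ t in (0 : ℝ)..1, f (a + t * (b - a)) * (b - a)

/-- The integral of `f` along the polygon starting at `a` with further vertices `l`. -/
def polyInt (f : ℂ → ℂ) : ℂ → List ℂ → ℂ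
  | _, [] => 0
  | a, b :: l => segInt f a b + polyInt f b l

/-- The support of the polygon starting at `a` with further vertices `l`. -/
def polySet : ℂ → List ℂ → Set ℂ
  | a, [] => {a}
  | a, b :: l => segment ℝ a b ∪ polySet b l

/-- The end point of the polygon starting at `a` with further vertices `l`. -/
def polyEnd : ℂ → List ℂ → ℂ
  | a, [] => a
  | _, b :: l => polyEnd b l

theorem mem_segment_of_mem_Icc {a b : ℂ} {t : ℝ} (ht : t ∈ Icc (0 : ℝ) 1) :
    a + t * (b - a) ∈ segment ℝ a b := by
  rw [segment_eq_image']
  exact ⟨t, ht, by simp⟩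

theorem exists_of_mem_segment {a b x : ℂ} (hx : x ∈ segment ℝ a b) :
    ∃ t ∈ Icc (0 : ℝ) 1, x = a + t * (b - a) := by
  rw [segment_eq_image'] at hx
  obtain ⟨t, ht, rfl⟩ := hx
  exact ⟨t, ht, by simp⟩

theorem isCompact_segment (a b : ℂ) : IsCompact (segment ℝ a b) := by
  rw [segment_eq_image']
  exact isCompact_Icc.image (by fun_prop)

theorem isCompact_polySet (a : ℂ) (l : List ℂ) : IsCompact (polySet a l) := by
  induction l generalizing a with
  | nil => exact isCompact_singleton
  | cons b l ih => exact (isCompact_segment a b).union (ih b)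

theorem left_mem_polySet (a : ℂ) (l : List ℂ) : a ∈ polySet a l := by
  cases l with
  | nil => exact mem_singleton a
  | cons b l => exact Or.inl (left_mem_segment ℝ a b)

theorem polyEnd_append (a : ℂ) (l m : List ℂ) : polyEnd a (l ++ m) = polyEnd (polyEnd a l) m := by
  induction l generalizing a with
  | nil => rfl
  | cons b l ih => exact ih b

theorem polyInt_append (f : ℂ → ℂ) (a : ℂ) (l m : List ℂ) :
    polyInt f a (l ++ m) = polyInt f a l + polyInt f (polyEnd a l) m := by
  induction l generalizing a with
  | nil => simp [polyInt, polyEnd]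
  | cons b l ih => simp only [List.cons_append, polyInt, polyEnd, ih b, add_assoc]

theorem polySet_append_subset {a : ℂ} {l m : List ℂ} {V : Set ℂ} (h1 : polySet a l ⊆ V)
    (h2 : polySet (polyEnd a l) m ⊆ V) : polySet a (l ++ m) ⊆ V := by
  induction l generalizing a with
  | nil => exact h2
  | cons b l ih =>
    exact union_subset (subset_union_left.trans h1) (ih (subset_union_right.trans h1) h2)

theorem continuousOn_segInt_integrand {f : ℂ → ℂ} {a b : ℂ}
    (hf : ContinuousOn f (segment ℝ a b)) :
    ContinuousOn (fun t : ℝ => f (a + t * (b - a)) * (b - a)) (Icc 0 1) :=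
  (hf.comp (by fun_prop) fun _ ht => mem_segment_of_mem_Icc ht).mul continuousOn_const

theorem intervalIntegrable_segInt_integrand {f : ℂ → ℂ} {a b : ℂ}
    (hf : ContinuousOn f (segment ℝ a b)) :
    IntervalIntegrable (fun t : ℝ => f (a + t * (b - a)) * (b - a)) volume 0 1 :=
  ContinuousOn.intervalIntegrable (by
    rw [uIcc_of_le zero_le_one]; exact continuousOn_segInt_integrand hf)

theorem segInt_congr {f g : ℂ → ℂ} {a b : ℂ} (h : ∀ x ∈ segment ℝ a b, f x = g x) :
    segInt f a b = segInt g a b := by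
  refine intervalIntegral.integral_congr fun t ht => ?_
  rw [uIcc_of_le zero_le_one] at ht
  simp only [h _ (mem_segment_of_mem_Icc ht)]

theorem polyInt_congr {f g : ℂ → ℂ} {a : ℂ} {l : List ℂ} (h : ∀ x ∈ polySet a l, f x = g x) :
    polyInt f a l = polyInt g a l := by
  induction l generalizing a with
  | nil => rfl
  | cons b l ih =>
    rw [polyInt, polyInt, segInt_congr fun x hx => h x (Or.inl hx), ih fun x hx => h x (Or.inr hx)]

theorem segInt_sub_mul {f g : ℂ → ℂ} {a b : ℂ} (hf : ContinuousOn f (segment ℝ a b))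
    (hg : ContinuousOn g (segment ℝ a b)) (c : ℂ) :
    segInt (fun x => f x - c * g x) a b = segInt f a b - c * segInt g a b := by
  rw [segInt, segInt, segInt, ← intervalIntegral.integral_const_mul,
    ← intervalIntegral.integral_sub (intervalIntegrable_segInt_integrand hf)
      ((intervalIntegrable_segInt_integrand hg).const_mul c)]
  refine intervalIntegral.integral_congr fun t _ => ?_
  ring

theorem polyInt_sub_mul {f g : ℂ → ℂ} {a : ℂ} {l : List ℂ} (hf : ContinuousOn f (polySet a l))
    (hg : ContinuousOn g (polySet a l)) (c : ℂ) :
    polyInt (fun x => f x - c * g x) a l = polyInt f a l - c * polyInt g a l := by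
  induction l generalizing a with
  | nil => simp [polyInt]
  | cons b l ih =>
    rw [polyInt, polyInt, polyInt, segInt_sub_mul (hf.mono subset_union_left)
      (hg.mono subset_union_left), ih (hf.mono subset_union_right) (hg.mono subset_union_right)]
    ring

theorem segInt_eq_sub {F f : ℂ → ℂ} {a b : ℂ} (hF : ∀ x ∈ segment ℝ a b, HasDerivAt F (f x) x)
    (hf : ContinuousOn f (segment ℝ a b)) : segInt f a b = F b - F a := by
  have := intervalIntegral.integral_eq_sub_of_hasDerivAt (a := (0 : ℝ)) (b := 1)
    (f := fun t : ℝ => F (a + t * (b - a))) (f' := fun t : ℝ => f (a + t * (b - a)) * (b - a))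
    (fun t ht => ?_) (intervalIntegrable_segInt_integrand hf)
  · rw [segInt, this]; simp
  · rw [uIcc_of_le zero_le_one] at ht
    have h1 : HasDerivAt (fun t : ℝ => a + (t : ℂ) * (b - a)) (b - a) t := by
      simpa using ((Complex.ofRealCLM.hasDerivAt (x := t)).mul_const (b - a)).const_add a
    exact (hF _ (mem_segment_of_mem_Icc ht)).comp t h1

theorem norm_segInt_le {f : ℂ → ℂ} {a b : ℂ} {C : ℝ} (hC : ∀ x ∈ segment ℝ a b, ‖f x‖ ≤ C) :
    ‖segInt f a b‖ ≤ C * ‖b - a‖ := by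
  have := intervalIntegral.norm_integral_le_of_norm_le_const (a := (0 : ℝ)) (b := 1)
    (f := fun t : ℝ => f (a + t * (b - a)) * (b - a)) (C := C * ‖b - a‖) fun t ht => by
      rw [uIoc_of_le zero_le_one] at ht
      rw [norm_mul]
      exact mul_le_mul_of_nonneg_right (hC _ (mem_segment_of_mem_Icc ⟨ht.1.le, ht.2⟩))
        (norm_nonneg _)
  simpa [segInt] using this

theorem exists_polygon {V : Set ℂ} (hV : IsOpen V) (hc : IsPreconnected V) {a b : ℂ} (ha : a ∈ V)
    (hb : b ∈ V) : ∃ l, polyEnd a l = b ∧ polySet a l ⊆ V := by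
  refine hc.induction₂' (fun x y => ∃ l, polyEnd x l = y ∧ polySet x l ⊆ V) (fun x hx => ?_)
    (fun x y w _ _ _ h1 h2 => ?_) ha hb
  · obtain ⟨ε, hε, hball⟩ := Metric.isOpen_iff.mp hV x hx
    filter_upwards [mem_nhdsWithin_of_mem_nhds (ball_mem_nhds x hε)] with y hy
    have key : ∀ u ∈ ball x ε, ∀ v ∈ ball x ε, ∃ l, polyEnd u l = v ∧ polySet u l ⊆ V := by
      intro u hu v hv
      refine ⟨[v], rfl, union_subset (((convex_ball x ε).segment_subset hu hv).trans hball) ?_⟩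
      exact singleton_subset_iff.mpr (hball hv)
    exact ⟨key x (mem_ball_self hε) y hy, key y hy x (mem_ball_self hε)⟩
  · obtain ⟨l, h1, h1'⟩ := h1
    obtain ⟨m, h2, h2'⟩ := h2
    exact ⟨l ++ m, by rw [polyEnd_append, h1, h2], polySet_append_subset h1' (by rwa [h1])⟩

/-! ### Winding numbers of polygons -/

/-- If the ratio were real and nonpositive, `c` would lie between `a` and `b`. -/
theorem div_mem_slitPlane_of_notMem_segment {a b c : ℂ} (hc : c ∉ segment ℝ a b) :
    a - c ≠ 0 ∧ (b - c) / (a - c) ∈ Complex.slitPlane := by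
  have hac : a - c ≠ 0 := fun h => hc (sub_eq_zero.mp h ▸ left_mem_segment ℝ a b)
  refine ⟨hac, ?_⟩
  by_contra hn
  rw [Complex.mem_slitPlane_iff_not_le_zero, not_not] at hn
  set x := (b - c) / (a - c) with hx
  obtain ⟨hre, him⟩ := Complex.le_def.mp hn
  simp only [Complex.zero_re, Complex.zero_im] at hre him
  have hxr : x = (x.re : ℂ) := Complex.ext (by simp) (by simp [him])
  have hs : 0 < 1 - x.re := by linarith
  have hbc : b - c = x.re * (a - c) := by rw [← hxr, hx]; field_simp
  apply hc
  have h1 : c = a + ((1 / (1 - x.re) : ℝ) : ℂ) * (b - a) := by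
    have hsc : (1 : ℂ) - x.re ≠ 0 := by exact_mod_cast hs.ne'
    push_cast
    field_simp
    linear_combination -hbc
  rw [h1]
  exact mem_segment_of_mem_Icc ⟨by positivity, by rw [div_le_one hs]; linarith⟩

/-- The principal logarithm of `(x - c) / (a - c)` is a primitive along the segment: this ratio runs
straight from `1` to a point of the slit plane, which is star-shaped about `1`. -/
theorem segInt_inv {a b c : ℂ} (hc : c ∉ segment ℝ a b) :
    segInt (fun x => (x - c)⁻¹) a b = Complex.log ((b - c) / (a - c)) := by
  obtain ⟨hac, hsl⟩ := div_mem_slitPlane_of_notMem_segment hc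
  have hne : ∀ x ∈ segment ℝ a b, x - c ≠ 0 := fun x hx h => hc (sub_eq_zero.mp h ▸ hx)
  rw [segInt_eq_sub (F := fun x => Complex.log ((x - c) / (a - c)))]
  · simp [hac]
  · intro x hx
    obtain ⟨t, ht, rfl⟩ := exists_of_mem_segment hx
    have h1 := hne _ hx
    have h2 : (a + t * (b - a) - c) / (a - c) ∈ Complex.slitPlane := by
      have := Complex.starConvex_one_slitPlane hsl (sub_nonneg.mpr ht.2) ht.1 (by ring)
      convert! this using 1
      rw [Complex.real_smul, Complex.real_smul]
      push_cast
      field_simp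
      ring
    have h3 : HasDerivAt (fun x => (x - c) / (a - c)) (1 / (a - c)) (a + t * (b - a)) :=
      ((hasDerivAt_id _).sub_const c).div_const _
    convert! h3.clog h2 using 1
    field_simp
  · exact (continuousOn_id.sub continuousOn_const).inv₀ hne

/-- The exponentials of the segment integrals telescope. For a closed polygon the product is `1`,
which makes the winding number an integer. -/
theorem exp_polyInt_inv {a c : ℂ} {l : List ℂ} (hc : c ∉ polySet a l) :
    Complex.exp (polyInt (fun x => (x - c)⁻¹) a l) = (polyEnd a l - c) / (a - c) := by
  induction l generalizing a with
  | nil =>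
    have : a - c ≠ 0 := fun h => hc (sub_eq_zero.mp h ▸ mem_singleton a)
    simp [polyInt, polyEnd, this]
  | cons b l ih =>
    have h1 : c ∉ segment ℝ a b := fun h => hc (Or.inl h)
    have h2 : c ∉ polySet b l := fun h => hc (Or.inr h)
    obtain ⟨hac, hsl⟩ := div_mem_slitPlane_of_notMem_segment h1
    have hbc : b - c ≠ 0 := fun h => h2 (sub_eq_zero.mp h ▸ left_mem_polySet b l)
    rw [polyInt, Complex.exp_add, ih h2, segInt_inv h1, Complex.exp_log (div_ne_zero hbc hac),
      polyEnd]
    field_simp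

theorem exists_int_polyInt_inv {a c : ℂ} {l : List ℂ} (hl : polyEnd a l = a)
    (hc : c ∉ polySet a l) :
    ∃ n : ℤ, polyInt (fun x => (x - c)⁻¹) a l = n * (2 * Real.pi * Complex.I) := by
  rw [← Complex.exp_eq_one_iff, exp_polyInt_inv hc, hl]
  exact div_self fun h => hc (sub_eq_zero.mp h ▸ left_mem_polySet a l)

theorem continuousAt_polyInt_inv {a c : ℂ} {l : List ℂ} (hc : c ∉ polySet a l) :
    ContinuousAt (fun c => polyInt (fun x => (x - c)⁻¹) a l) c := by
  induction l generalizing a with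
  | nil => exact continuousAt_const
  | cons b l ih =>
    have h1 : c ∉ segment ℝ a b := fun h => hc (Or.inl h)
    have h2 : c ∉ polySet b l := fun h => hc (Or.inr h)
    refine ContinuousAt.add ?_ (ih h2)
    obtain ⟨hac, hsl⟩ := div_mem_slitPlane_of_notMem_segment h1
    have e : ∀ᶠ c' in 𝓝 c, Complex.log ((b - c') / (a - c')) = segInt (fun x => (x - c')⁻¹) a b := by
      filter_upwards [(isCompact_segment a b).isClosed.isOpen_compl.mem_nhds h1] with c' hc'
      exact (segInt_inv hc').symm
    refine ContinuousAt.congr ?_ e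
    exact ContinuousAt.clog (by fun_prop (disch := assumption)) hsl

theorem tendsto_polyInt_inv_cocompact (a : ℂ) (l : List ℂ) :
    Tendsto (fun c => polyInt (fun x => (x - c)⁻¹) a l) (cocompact ℂ) (𝓝 0) := by
  induction l generalizing a with
  | nil => exact tendsto_const_nhds
  | cons b l ih =>
    rw [← add_zero (0 : ℂ)]
    refine Tendsto.add ?_ (ih b)
    have e : ∀ᶠ c in cocompact ℂ, Complex.log (1 + (b - a) * (a - c)⁻¹) =
        segInt (fun x => (x - c)⁻¹) a b := by
      filter_upwards [(isCompact_segment a b).compl_mem_cocompact] with c hc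
      rw [segInt_inv hc]
      have := (div_mem_slitPlane_of_notMem_segment hc).1
      congr 1
      field_simp
      ring
    refine Tendsto.congr' e ?_
    have h1 : Tendsto (fun c : ℂ => (a - c)⁻¹) (cocompact ℂ) (𝓝 0) := by
      refine tendsto_inv₀_cobounded.comp ?_
      rw [← Metric.cobounded_eq_cocompact, ← tendsto_norm_atTop_iff_cobounded]
      refine tendsto_atTop_mono (fun c => ?_)
        (tendsto_atTop_add_const_right _ (-‖a‖) (tendsto_norm_cobounded_atTop (E := ℂ)))
      have := norm_sub_norm_le c a
      rw [norm_sub_rev] at this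
      linarith
    have h2 : Tendsto (fun c : ℂ => 1 + (b - a) * (a - c)⁻¹) (cocompact ℂ) (𝓝 1) := by
      simpa using (h1.const_mul (b - a)).const_add 1
    have := h2.clog Complex.one_mem_slitPlane
    rwa [Complex.log_one] at this

end Squeezing

namespace Squeezing

open MeasureTheory

/-! ### Winding numbers about points outside a set without compact holes -/

/-- No compact set disjoint from `V` can be added to `V` so that the union is open: all
components of the complement of `V` in the sphere reach infinity. -/
def NoCompactHoles (V : Set ℂ) : Prop :=
  ∀ N : Set ℂ, IsCompact N → Disjoint N V → IsOpen (V ∪ N) → N = ∅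

/-- The integral depends continuously on `c` and takes values in `2πi ℤ`, so it is locally constant.
-/
theorem eventually_polyInt_inv_eq {a c : ℂ} {l : List ℂ} (hl : polyEnd a l = a)
    (hc : c ∉ polySet a l) :
    ∀ᶠ c' in 𝓝 c, c' ∉ polySet a l ∧
      polyInt (fun x => (x - c')⁻¹) a l = polyInt (fun x => (x - c)⁻¹) a l := by
  have h1 := (continuousAt_polyInt_inv hc).eventually
    (ball_mem_nhds _ (by positivity : (0 : ℝ) < 2 * Real.pi))
  filter_upwards [h1, (isCompact_polySet a l).isClosed.isOpen_compl.mem_nhds hc] with c' h2 h3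
  refine ⟨h3, ?_⟩
  obtain ⟨n, hn⟩ := exists_int_polyInt_inv hl hc
  obtain ⟨m, hm⟩ := exists_int_polyInt_inv hl h3
  rw [dist_eq_norm, hn, hm, ← sub_mul, norm_mul] at h2
  have h4 : ‖(2 * Real.pi * Complex.I : ℂ)‖ = 2 * Real.pi := by
    simp [abs_of_pos Real.pi_pos]
  rw [h4] at h2
  have h5 : ‖(m : ℂ) - n‖ < 1 := by
    by_contra hcon
    nlinarith [not_lt.mp hcon, Real.pi_pos]
  have h6 : ((|m - n| : ℤ) : ℝ) < 1 := by
    rw [← Int.cast_sub, Complex.norm_intCast] at h5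
    exact_mod_cast h5
  have h7 : m = n := by
    have : |m - n| < 1 := by exact_mod_cast h6
    rw [Int.abs_lt_one_iff] at this
    omega
  rw [hn, hm, h7]

theorem eventually_polyInt_inv_eq_zero {a : ℂ} {l : List ℂ} (hl : polyEnd a l = a) :
    ∀ᶠ c in cocompact ℂ, c ∉ polySet a l ∧ polyInt (fun x => (x - c)⁻¹) a l = 0 := by
  filter_upwards [(tendsto_polyInt_inv_cocompact a l).eventually
    (ball_mem_nhds _ (by positivity : (0 : ℝ) < 2 * Real.pi)),
    (isCompact_polySet a l).compl_mem_cocompact] with c h1 h2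
  refine ⟨h2, ?_⟩
  obtain ⟨n, hn⟩ := exists_int_polyInt_inv hl h2
  rw [dist_zero_right, hn, norm_mul] at h1
  have h4 : ‖(2 * Real.pi * Complex.I : ℂ)‖ = 2 * Real.pi := by
    simp [abs_of_pos Real.pi_pos]
  rw [h4] at h1
  have h5 : ‖(n : ℂ)‖ < 1 := by
    by_contra hcon
    nlinarith [not_lt.mp hcon, Real.pi_pos]
  rw [Complex.norm_intCast] at h5
  have h7 : n = 0 := Int.abs_lt_one_iff.mp (by exact_mod_cast h5)
  rw [hn, h7]; simp

/-- The points outside `V` with nonzero winding number form a set `N` that is closed, is bounded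
because the winding number vanishes far away, and makes `V ∪ N` open. So `N` is a compact hole,
hence empty. -/
theorem polyInt_inv_eq_zero_of_noCompactHoles {V : Set ℂ} (hV : IsOpen V) (hN : NoCompactHoles V)
    {a : ℂ} {l : List ℂ} (hl : polyEnd a l = a) (hlV : polySet a l ⊆ V) {c : ℂ} (hc : c ∉ V) :
    polyInt (fun x => (x - c)⁻¹) a l = 0 := by
  set W : ℂ → ℂ := fun c => polyInt (fun x => (x - c)⁻¹) a l with hW
  set N : Set ℂ := {c | c ∉ V ∧ W c ≠ 0} with hNdef
  have hoff : ∀ c, c ∉ V → c ∉ polySet a l := fun c h h' => h (hlV h')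
  have hcl : IsClosed N := by
    rw [← isOpen_compl_iff, isOpen_iff_mem_nhds]
    intro c hcN
    by_cases hcV : c ∈ V
    · filter_upwards [hV.mem_nhds hcV] with c' h1 h2 using h2.1 h1
    · have h0 : W c = 0 := by
        by_contra h
        exact hcN ⟨hcV, h⟩
      filter_upwards [eventually_polyInt_inv_eq hl (hoff c hcV)] with c' h1 h2
      exact h2.2 (h1.2.trans h0)
  have hb : ∀ᶠ c in cocompact ℂ, c ∉ N := by
    filter_upwards [eventually_polyInt_inv_eq_zero hl] with c h1 h3 using h3.2 h1.2
  obtain ⟨K, hK, hKN⟩ := mem_cocompact.mp hb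
  have hcomp : IsCompact N := hK.of_isClosed_subset hcl fun x hx => by
    by_contra h
    exact hKN h hx
  have hempty := hN N hcomp (Set.disjoint_left.mpr fun x hx => hx.1) (by
    rw [isOpen_iff_mem_nhds]
    rintro c (h | h)
    · exact mem_of_superset (hV.mem_nhds h) subset_union_left
    · filter_upwards [eventually_polyInt_inv_eq hl (hoff c h.1)] with c' h1
      by_cases hcV : c' ∈ V
      · exact Or.inl hcV
      · exact Or.inr ⟨hcV, fun h0 => h.2 (h1.2.symm.trans h0)⟩)
  by_contra h
  have : c ∈ N := ⟨hc, h⟩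
  rw [hempty] at this
  exact this

/-! ### Holomorphic dependence on parameters -/

/-- Differentiation under the integral sign. The bound on `K` dominates its derivative by Cauchy's
estimate on circles of radius `δ / 4` about points of the ball of radius `δ / 2`. -/
theorem differentiableAt_segInt_param {K : ℂ → ℂ → ℂ} {a b z₀ : ℂ} {δ C : ℝ} (hδ : 0 < δ)
    (hd : ∀ x ∈ segment ℝ a b, DifferentiableOn ℂ (fun z => K z x) (ball z₀ δ))
    (hc : ∀ z ∈ ball z₀ δ, ContinuousOn (K z) (segment ℝ a b))
    (hC : ∀ z ∈ ball z₀ δ, ∀ x ∈ segment ℝ a b, ‖K z x‖ ≤ C) :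
    DifferentiableAt ℂ (fun z => segInt (K z) a b) z₀ := by
  set F : ℂ → ℝ → ℂ := fun z t => K z (a + t * (b - a)) * (b - a) with hF
  have hmem : ∀ {t : ℝ}, t ∈ uIoc (0 : ℝ) 1 → a + t * (b - a) ∈ segment ℝ a b := fun {t} ht => by
    rw [uIoc_of_le zero_le_one] at ht
    exact mem_segment_of_mem_Icc ⟨ht.1.le, ht.2⟩
  have hmeas : ∀ z ∈ ball z₀ δ, AEStronglyMeasurable (F z) (volume.restrict (uIoc (0 : ℝ) 1)) :=
    fun z hz => (intervalIntegrable_iff.mp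
      (intervalIntegrable_segInt_integrand (hc z hz))).aestronglyMeasurable
  have hdiff : ∀ t ∈ uIoc (0 : ℝ) 1, DifferentiableOn ℂ (fun z => F z t) (ball z₀ δ) :=
    fun t ht => (hd _ (hmem ht)).mul_const _
  have hFb : ∀ t ∈ uIoc (0 : ℝ) 1, ∀ z ∈ ball z₀ δ, ‖F z t‖ ≤ C * ‖b - a‖ := fun t ht z hz => by
    rw [hF]
    simp only [norm_mul]
    exact mul_le_mul_of_nonneg_right (hC z hz _ (hmem ht)) (norm_nonneg _)
  have hz₀ : z₀ ∈ ball z₀ δ := mem_ball_self hδ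
  refine (intervalIntegral.hasDerivAt_integral_of_dominated_loc_of_deriv_le (F := F)
    (F' := fun z t => deriv (fun z => F z t) z) (s := ball z₀ (δ / 2)) (x₀ := z₀) (a := 0) (b := 1)
    (bound := fun _ => C * ‖b - a‖ / (δ / 4)) (μ := volume) (ball_mem_nhds _ (half_pos hδ)) ?_
    (intervalIntegrable_segInt_integrand (hc z₀ hz₀)) ?_ ?_ intervalIntegrable_const
    ?_).2.differentiableAt
  · filter_upwards [ball_mem_nhds z₀ hδ] with z hz using hmeas z hz
  -- The derivative is measurable in `t` as a pointwise limit of difference quotients along a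
  -- sequence.
  · have hseq : Tendsto (fun n : ℕ => z₀ + ((δ / (n + 2) : ℝ) : ℂ)) atTop (𝓝[≠] z₀) := by
      refine tendsto_nhdsWithin_iff.mpr ⟨?_, Eventually.of_forall fun n => ?_⟩
      · have h1 : Tendsto (fun n : ℕ => δ / ((n : ℝ) + 2)) atTop (𝓝 0) :=
          tendsto_const_nhds.div_atTop
            (tendsto_atTop_add_const_right _ _ tendsto_natCast_atTop_atTop)
        have h2 := (Complex.continuous_ofReal.tendsto _).comp h1
        rw [Complex.ofReal_zero] at h2
        simpa using h2.const_add z₀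
      · have : ((δ / (n + 2) : ℝ) : ℂ) ≠ 0 := by
          have : (0 : ℝ) < δ / (n + 2) := by positivity
          exact_mod_cast this.ne'
        simpa using this
    have hin : ∀ n : ℕ, z₀ + ((δ / (n + 2) : ℝ) : ℂ) ∈ ball z₀ δ := fun n => by
      have h0 : (0 : ℝ) < δ / (n + 2) := by positivity
      have h1 : δ / ((n : ℝ) + 2) < δ := by
        rw [div_lt_iff₀ (by positivity)]
        have : (0 : ℝ) ≤ n := Nat.cast_nonneg n
        nlinarith
      rw [mem_ball, dist_eq_norm, add_sub_cancel_left, Complex.norm_real,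
        Real.norm_of_nonneg h0.le]
      exact h1
    refine aestronglyMeasurable_of_tendsto_ae atTop
      (f := fun (n : ℕ) t => (((δ / (n + 2) : ℝ) : ℂ))⁻¹ *
        (F (z₀ + ((δ / (n + 2) : ℝ) : ℂ)) t - F z₀ t)) (fun n => ?_) ?_
    · exact ((hmeas _ (hin n)).sub (hmeas z₀ hz₀)).const_mul _
    · rw [ae_restrict_iff' measurableSet_uIoc]
      refine Eventually.of_forall fun t ht => ?_
      have h1 := ((hdiff t ht).differentiableAt (ball_mem_nhds z₀ hδ)).hasDerivAt
      have h2 := (hasDerivAt_iff_tendsto_slope.mp h1).comp hseq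
      refine h2.congr fun n => ?_
      simp [slope_def_field, div_eq_inv_mul]
  · refine Eventually.of_forall fun t ht z hz => ?_
    refine Complex.norm_deriv_le_of_forall_mem_sphere_norm_le (by positivity) ?_ fun x hx => ?_
    · refine ((hdiff t ht).mono ?_).diffContOnCl
      refine closure_ball_subset_closedBall.trans fun x hx => ?_
      rw [mem_closedBall] at hx
      rw [mem_ball] at hz ⊢
      linarith [dist_triangle x z z₀]
    · refine hFb t ht x ?_
      rw [mem_sphere] at hx
      rw [mem_ball] at hz ⊢
      linarith [dist_triangle x z z₀]
  · refine Eventually.of_forall fun t ht z hz => ?_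
    exact ((hdiff t ht).differentiableAt (isOpen_ball.mem_nhds
      (ball_subset_ball (by linarith) hz))).hasDerivAt

theorem differentiableAt_polyInt_param {K : ℂ → ℂ → ℂ} {a z₀ : ℂ} {l : List ℂ} {δ C : ℝ}
    (hδ : 0 < δ)
    (hd : ∀ x ∈ polySet a l, DifferentiableOn ℂ (fun z => K z x) (ball z₀ δ))
    (hc : ∀ z ∈ ball z₀ δ, ContinuousOn (K z) (polySet a l))
    (hC : ∀ z ∈ ball z₀ δ, ∀ x ∈ polySet a l, ‖K z x‖ ≤ C) :
    DifferentiableAt ℂ (fun z => polyInt (K z) a l) z₀ := by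
  induction l generalizing a with
  | nil => exact differentiableAt_const _
  | cons b l ih =>
    refine DifferentiableAt.add ?_ ?_
    · exact differentiableAt_segInt_param hδ (fun x hx => hd x (Or.inl hx))
        (fun z hz => (hc z hz).mono subset_union_left) fun z hz x hx => hC z hz x (Or.inl hx)
    · exact ih (fun x hx => hd x (Or.inr hx))
        (fun z hz => (hc z hz).mono subset_union_right) fun z hz x hx => hC z hz x (Or.inr hx)

theorem dslope_symm (f : ℂ → ℂ) (a b : ℂ) : dslope f a b = dslope f b a := by
  by_cases h : a = b
  · rw [h]
  · rw [dslope_of_ne _ (Ne.symm h), dslope_of_ne _ h, slope_comm]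

/-- If `z` and `x` are at least `δ` apart, a bound on `f` suffices. If `x` is near `z₀`, the maximum
principle in `z` moves the estimate to the circle of radius `4 * δ`, which is far from `x`. -/
theorem exists_norm_dslope_le {V S : Set ℂ} {f : ℂ → ℂ} (hV : IsOpen V)
    (hf : DifferentiableOn ℂ f V) (hS : IsCompact S) (hSV : S ⊆ V) {z₀ : ℂ} (hz₀ : z₀ ∈ V) :
    ∃ δ > 0, ball z₀ δ ⊆ V ∧ ∃ C, ∀ z ∈ ball z₀ δ, ∀ x ∈ S, ‖dslope f x z‖ ≤ C := by
  obtain ⟨ε, hε, hball⟩ := Metric.isOpen_iff.mp hV z₀ hz₀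
  set δ := ε / 5 with hδdef
  have hδ : 0 < δ := by positivity
  have hcb : closedBall z₀ (4 * δ) ⊆ V := (closedBall_subset_ball (by rw [hδdef]; linarith)).trans
    hball
  have hcomp : IsCompact (S ∪ closedBall z₀ (4 * δ)) := hS.union (isCompact_closedBall _ _)
  obtain ⟨M, hM⟩ := hcomp.exists_bound_of_continuousOn
    (hf.continuousOn.mono (union_subset hSV hcb))
  have hfar : ∀ x ∈ S, ∀ z ∈ closedBall z₀ (4 * δ), δ ≤ ‖z - x‖ → ‖dslope f x z‖ ≤ 2 * M / δ := by
    intro x hx z hz hle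
    have hne : z ≠ x := fun h => by rw [h, sub_self, norm_zero] at hle; linarith
    rw [dslope_of_ne _ hne, slope_def_field, norm_div]
    have h1 : ‖f z - f x‖ ≤ 2 * M := by
      have := norm_sub_le (f z) (f x)
      linarith [hM z (Or.inr hz), hM x (Or.inl hx)]
    exact div_le_div₀ ((norm_nonneg _).trans h1) h1 hδ hle
  refine ⟨δ, hδ, (ball_subset_ball (by rw [hδdef]; linarith)).trans hball, 2 * M / δ,
    fun z hz x hx => ?_⟩
  rw [mem_ball] at hz
  rcases le_or_gt (2 * δ) (dist x z₀) with h | h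
  · refine hfar x hx z (by rw [mem_closedBall]; linarith) ?_
    rw [← dist_eq_norm]
    linarith [dist_triangle x z z₀, dist_comm x z]
  · have hdd : DifferentiableOn ℂ (dslope f x) V :=
      (Complex.differentiableOn_dslope (hV.mem_nhds (hSV hx))).mpr hf
    refine Complex.norm_le_of_forall_mem_frontier_norm_le (U := ball z₀ (4 * δ)) isBounded_ball
      (hdd.mono (closure_ball_subset_closedBall.trans hcb)).diffContOnCl (fun v hv => ?_)
      (subset_closure (by rw [mem_ball]; linarith))
    rw [frontier_ball _ (by positivity)] at hv
    rw [mem_sphere] at hv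
    refine hfar x hx v (by rw [mem_closedBall]; exact hv.le) ?_
    rw [← dist_eq_norm]
    linarith [dist_triangle v x z₀]

/-! ### Cauchy's theorem -/

/-- Dixon's argument: Cauchy's theorem for closed polygons that do not wind around any point of
the complement. -/
theorem polyInt_eq_zero_of_winding {V : Set ℂ} (hV : IsOpen V) {a : ℂ} {l : List ℂ}
    (hl : polyEnd a l = a) (hlV : polySet a l ⊆ V)
    (hw : ∀ c ∉ V, polyInt (fun x => (x - c)⁻¹) a l = 0) {f : ℂ → ℂ}
    (hf : DifferentiableOn ℂ f V) : polyInt f a l = 0 := by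
  have haV : a ∈ V := hlV (left_mem_polySet a l)
  -- The factor `x - a` makes the difference quotient of `g` at `a` equal to `f`, so that `h a`
  -- below is the integral to be computed.
  set g : ℂ → ℂ := fun x => (x - a) * f x with hg
  have hgd : DifferentiableOn ℂ g V := (differentiableOn_id.sub_const a).mul hf
  have hSc := isCompact_polySet a l
  have hgc : ContinuousOn g (polySet a l) := hgd.continuousOn.mono hlV
  have hinvc : ∀ c ∉ polySet a l, ContinuousOn (fun x : ℂ => (x - c)⁻¹) (polySet a l) :=
    fun c hc => (continuousOn_id.sub continuousOn_const).inv₀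
      fun x hx h => hc (by have : x = c := sub_eq_zero.mp h
                           exact this ▸ hx)
  classical
  -- The two formulas differ by `g z` times the winding number, so they agree wherever this vanishes
  -- and together define an entire function.
  set h : ℂ → ℂ := fun z => if z ∈ V then polyInt (fun x => dslope g x z) a l
    else polyInt (fun x => g x * (x - z)⁻¹) a l with hh
  have hds : ∀ z ∈ V, ContinuousOn (fun x => dslope g x z) (polySet a l) := fun z hz => by
    simp_rw [fun x => dslope_symm g x z]
    exact ((Complex.differentiableOn_dslope (hV.mem_nhds hz)).mpr hgd).continuousOn.mono hlV
  have hcauchy : ∀ z, z ∉ polySet a l → polyInt (fun x => (x - z)⁻¹) a l = 0 →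
      h z = polyInt (fun x => g x * (x - z)⁻¹) a l := by
    intro z hz hz0
    by_cases hzV : z ∈ V
    · have e : polyInt (fun x => dslope g x z) a l =
          polyInt (fun x => g x * (x - z)⁻¹ - g z * (x - z)⁻¹) a l := by
        refine polyInt_congr fun x hx => ?_
        have hne : x ≠ z := fun h => hz (h ▸ hx)
        have hne' := sub_ne_zero.mpr hne
        rw [dslope_symm, dslope_of_ne _ hne, slope_def_field]
        field_simp
      rw [hh]
      simp only [if_pos hzV]
      have e2 := polyInt_sub_mul (f := fun x => g x * (x - z)⁻¹) (hgc.mul (hinvc z hz))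
        (hinvc z hz) (g z)
      rw [e, e2, hz0, mul_zero, sub_zero]
    · rw [hh]
      simp only [if_neg hzV]
  have hdiff : Differentiable ℂ h := by
    intro z₀
    by_cases hz₀ : z₀ ∈ V
    · obtain ⟨δ, hδ, hδV, C, hC⟩ := exists_norm_dslope_le hV hgd hSc hlV hz₀
      have h1 : DifferentiableAt ℂ (fun z => polyInt (fun x => dslope g x z) a l) z₀ :=
        differentiableAt_polyInt_param hδ
          (fun x hx => ((Complex.differentiableOn_dslope (hV.mem_nhds (hlV hx))).mpr hgd).mono hδV)
          (fun z hz => hds z (hδV hz)) hC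
      refine h1.congr_of_eventuallyEq ?_
      filter_upwards [hV.mem_nhds hz₀] with z hz
      rw [hh]
      simp only [if_pos hz]
    · have hoff : z₀ ∉ polySet a l := fun h => hz₀ (hlV h)
      obtain ⟨M, hM⟩ := hSc.exists_bound_of_continuousOn hgc
      obtain ⟨δ, hδ, hball⟩ := Metric.isOpen_iff.mp hSc.isClosed.isOpen_compl z₀ hoff
      have hfar : ∀ z ∈ ball z₀ (δ / 2), ∀ x ∈ polySet a l, δ / 2 ≤ ‖x - z‖ := by
        intro z hz x hx
        by_contra hlt
        rw [not_le, ← dist_eq_norm] at hlt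
        rw [mem_ball] at hz
        have : x ∈ ball z₀ δ := by
          rw [mem_ball]
          linarith [dist_triangle x z z₀]
        exact hball this hx
      have hoff' : ∀ z ∈ ball z₀ (δ / 2), z ∉ polySet a l := fun z hz hz' =>
        hball (ball_subset_ball (by linarith) hz) hz'
      have h1 : DifferentiableAt ℂ (fun z => polyInt (fun x => g x * (x - z)⁻¹) a l) z₀ := by
        refine differentiableAt_polyInt_param (half_pos hδ) (C := M * (δ / 2)⁻¹)
          (fun x hx => ?_) (fun z hz => hgc.mul (hinvc z (hoff' z hz))) fun z hz x hx => ?_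
        · refine DifferentiableOn.const_mul (DifferentiableOn.inv (by fun_prop) fun z hz h => ?_) _
          have := hfar z hz x hx
          rw [h, norm_zero] at this
          linarith
        · rw [norm_mul, norm_inv]
          exact mul_le_mul (hM x hx) (inv_anti₀ (half_pos hδ) (hfar z hz x hx)) (by positivity)
            ((norm_nonneg _).trans (hM x hx))
      refine h1.congr_of_eventuallyEq ?_
      filter_upwards [eventually_polyInt_inv_eq hl hoff] with z hz
      exact hcauchy z hz.1 (hz.2.trans (hw z₀ hz₀))
  -- Far away the winding number is zero and `h` is a Cauchy integral of `g`, which tends to zero.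
  -- Liouville's theorem then gives `h = 0`.
  have hlim : Tendsto h (cocompact ℂ) (𝓝 0) := by
    obtain ⟨M, hM⟩ := hSc.exists_bound_of_continuousOn hgc
    have hpoly : ∀ (b : ℂ) (m : List ℂ), (∀ x ∈ polySet b m, ‖g x‖ ≤ M) →
        Tendsto (fun z => polyInt (fun x => g x * (x - z)⁻¹) b m) (cocompact ℂ) (𝓝 0) := by
      intro b m
      induction m generalizing b with
      | nil => exact fun _ => tendsto_const_nhds
      | cons c m ih =>
        intro hM'
        rw [← add_zero (0 : ℂ)]
        refine Tendsto.add ?_ (ih c fun x hx => hM' x (Or.inr hx))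
        obtain ⟨R, hR⟩ := (isCompact_segment b c).isBounded.exists_norm_le
        have hnorm : Tendsto (fun z : ℂ => ‖z‖ - R) (cocompact ℂ) atTop := by
          rw [← Metric.cobounded_eq_cocompact]
          exact tendsto_atTop_add_const_right _ (-R) tendsto_norm_cobounded_atTop
        have hlim0 : Tendsto (fun z : ℂ => M * (‖z‖ - R)⁻¹ * ‖c - b‖) (cocompact ℂ) (𝓝 0) := by
          simpa using ((tendsto_inv_atTop_zero.comp hnorm).const_mul M).mul_const ‖c - b‖
        refine squeeze_zero_norm' ?_ hlim0
        filter_upwards [hnorm.eventually (eventually_gt_atTop 0)] with z hz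
        refine norm_segInt_le fun x hx => ?_
        rw [norm_mul, norm_inv]
        refine mul_le_mul (hM' x (Or.inl hx)) (inv_anti₀ hz ?_) (by positivity)
          ((norm_nonneg _).trans (hM' x (Or.inl hx)))
        have := norm_sub_norm_le z x
        rw [norm_sub_rev] at this
        linarith [hR x hx]
    refine (hpoly a l hM).congr' ?_
    filter_upwards [eventually_polyInt_inv_eq_zero hl] with z hz
    exact (hcauchy z hz.1 hz.2).symm
  have h0 : h a = 0 := hdiff.apply_eq_of_tendsto_cocompact a hlim
  rw [hh] at h0
  simp only [if_pos haV] at h0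
  rw [← h0]
  refine polyInt_congr fun x hx => ?_
  have hga : g a = 0 := by simp [hg]
  rw [dslope_symm]
  by_cases hxa : x = a
  · rw [hxa, dslope_same]
    have e1 := ((hasDerivAt_id a).sub_const a).fun_mul
      (hf.differentiableAt (hV.mem_nhds haV)).hasDerivAt
    simp only [id] at e1
    rw [hg, e1.deriv]
    simp
  · have := sub_ne_zero.mpr hxa
    rw [dslope_of_ne _ hxa, slope_def_field, hga, hg]
    field_simp
    simp

/-- On a connected open set without compact holes, holomorphic functions have primitives. -/
theorem exists_primitive {V : Set ℂ} (hV : IsOpen V) (hc : IsPreconnected V)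
    (hN : NoCompactHoles V) {f : ℂ → ℂ} (hf : DifferentiableOn ℂ f V) :
    ∃ F : ℂ → ℂ, ∀ z ∈ V, HasDerivAt F (f z) z := by
  rcases V.eq_empty_or_nonempty with rfl | ⟨a, ha⟩
  · exact ⟨0, by simp⟩
  have hclosed : ∀ l, polyEnd a l = a → polySet a l ⊆ V → polyInt f a l = 0 := fun l hl hlV =>
    polyInt_eq_zero_of_winding hV hl hlV
      (fun c hc => polyInt_inv_eq_zero_of_noCompactHoles hV hN hl hlV hc) hf
  have hex : ∀ z, ∃ l, z ∈ V → polyEnd a l = z ∧ polySet a l ⊆ V := fun z => by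
    by_cases hz : z ∈ V
    · obtain ⟨l, hl⟩ := exists_polygon hV hc ha hz
      exact ⟨l, fun _ => hl⟩
    · exact ⟨[], fun h => absurd h hz⟩
  choose L hL using hex
  refine ⟨fun z => polyInt f a (L z), fun z hz => ?_⟩
  obtain ⟨ε, hε, hball⟩ := Metric.isOpen_iff.mp hV z hz
  obtain ⟨G, hG⟩ := (hf.mono hball).isExactOn_ball
  have hzb : z ∈ ball z ε := mem_ball_self hε
  -- The loops through `w` directly and through `z` then `w` share the return path `m`. Since both
  -- integrals vanish, the arbitrary choice of the polygons `L` does not matter.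
  have hstep : ∀ w ∈ ball z ε, polyInt f a (L w) = polyInt f a (L z) + (G w - G z) := by
    intro w hw
    have hwV := hball hw
    obtain ⟨m, hm1, hm2⟩ := exists_polygon hV hc hwV ha
    have hseg : segment ℝ z w ⊆ ball z ε := (convex_ball z ε).segment_subset hzb hw
    have h1 := hclosed (L w ++ m) (by rw [polyEnd_append, (hL w hwV).1, hm1])
      (polySet_append_subset (hL w hwV).2 (by rw [(hL w hwV).1]; exact hm2))
    have h2 := hclosed (L z ++ w :: m) (by rw [polyEnd_append]; exact hm1)
      (polySet_append_subset (hL z hz).2 (by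
        rw [(hL z hz).1]; exact union_subset (hseg.trans hball) hm2))
    rw [polyInt_append, (hL w hwV).1] at h1
    rw [polyInt_append, (hL z hz).1, polyInt] at h2
    have h3 : segInt f z w = G w - G z := segInt_eq_sub (fun x hx => hG x (hseg hx))
      (hf.continuousOn.mono (hseg.trans hball))
    rw [← h3]
    linear_combination h1 - h2
  have h4 : HasDerivAt (fun w => polyInt f a (L z) + (G w - G z)) (f z) z :=
    ((hG z hzb).sub_const _).const_add _
  refine h4.congr_of_eventuallyEq ?_
  filter_upwards [ball_mem_nhds z hε] with w hw using hstep w hw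

/-- On a connected open set without compact holes, zero-free holomorphic functions have
logarithms. -/
theorem exists_holomorphic_log {V : Set ℂ} (hV : IsOpen V) (hc : IsPreconnected V)
    (hN : NoCompactHoles V) {f : ℂ → ℂ} (hf : DifferentiableOn ℂ f V) (h0 : ∀ z ∈ V, f z ≠ 0) :
    ∃ L : ℂ → ℂ, DifferentiableOn ℂ L V ∧ ∀ z ∈ V, Complex.exp (L z) = f z := by
  rcases V.eq_empty_or_nonempty with rfl | ⟨a, ha⟩
  · exact ⟨0, by simp⟩
  obtain ⟨F, hF⟩ := exists_primitive hV hc hN ((hf.deriv hV).div hf h0)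
  set G : ℂ → ℂ := fun z => Complex.exp (F z) / f z with hG
  have hGd : ∀ z ∈ V, HasDerivAt G 0 z := fun z hz => by
    have e1 := (hF z hz).cexp
    have e2 := (hf.differentiableAt (hV.mem_nhds hz)).hasDerivAt
    have := e1.fun_div e2 (h0 z hz)
    convert! this using 1
    have := h0 z hz
    rw [Pi.div_apply]
    field_simp
    ring
  have hconst : ∀ z ∈ V, G z = G a := fun z hz =>
    hV.is_const_of_deriv_eq_zero hc (fun x hx => (hGd x hx).differentiableAt.differentiableWithinAt)
      (fun x hx => (hGd x hx).deriv) hz ha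
  have hGa : G a ≠ 0 := div_ne_zero (Complex.exp_ne_zero _) (h0 a ha)
  refine ⟨fun z => F z - Complex.log (G a),
    fun z hz => ((hF z hz).sub_const _).differentiableAt.differentiableWithinAt, fun z hz => ?_⟩
  rw [Complex.exp_sub, Complex.exp_log hGa, ← hconst z hz, hG]
  have := h0 z hz
  have := Complex.exp_ne_zero (F z)
  field_simp

end Squeezing

namespace Squeezing

open ComplexConjugate

/-! ### Automorphisms of the disk -/

/-- The disk automorphism `w ↦ (w - c) / (1 - conj c * w)`. -/
def mob (c w : ℂ) : ℂ := (w - c) / (1 - conj c * w)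

theorem one_sub_conj_mul_ne_zero {c w : ℂ} (hc : ‖c‖ < 1) (hw : ‖w‖ < 1) :
    1 - conj c * w ≠ 0 :=
  Complex.slitPlane_ne_zero (one_sub_conj_mul_mem_slitPlane hc hw.le)

theorem norm_mob_lt_one {c w : ℂ} (hc : ‖c‖ < 1) (hw : ‖w‖ < 1) : ‖mob c w‖ < 1 := by
  have h0 := norm_pos_iff.mpr (one_sub_conj_mul_ne_zero hc hw)
  rw [mob, norm_div, div_lt_one h0]
  have h1 : ‖1 - conj c * w‖ ^ 2 - ‖w - c‖ ^ 2 = (1 - ‖c‖ ^ 2) * (1 - ‖w‖ ^ 2) := by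
    rw [Complex.sq_norm, Complex.sq_norm, Complex.sq_norm, Complex.sq_norm]
    simp only [Complex.normSq_apply, Complex.sub_re, Complex.sub_im, Complex.mul_re,
      Complex.mul_im, Complex.one_re, Complex.one_im, Complex.conj_re, Complex.conj_im]
    ring
  have h2 : 0 < (1 - ‖c‖ ^ 2) * (1 - ‖w‖ ^ 2) := by
    refine mul_pos ?_ ?_
    · nlinarith [norm_nonneg c]
    · nlinarith [norm_nonneg w]
  exact lt_of_pow_lt_pow_left₀ 2 h0.le (by linarith)

theorem hasDerivAt_mob {c w : ℂ} (hc : ‖c‖ < 1) (hw : ‖w‖ < 1) :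
    HasDerivAt (mob c) ((1 - conj c * c) / (1 - conj c * w) ^ 2) w := by
  have e1 : HasDerivAt (fun w : ℂ => w - c) 1 w := (hasDerivAt_id w).sub_const c
  have e2 : HasDerivAt (fun w : ℂ => 1 - conj c * w) (-(conj c)) w := by
    simpa using ((hasDerivAt_id w).const_mul (conj c)).const_sub 1
  convert! e1.fun_div e2 (one_sub_conj_mul_ne_zero hc hw) using 1
  congr 1
  ring

theorem isConformalEquiv_mob {c : ℂ} (hc : ‖c‖ < 1) :
    IsConformalEquiv (mob c) (mob (-c)) (ball 0 1) (ball 0 1) := by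
  have key : ∀ {c : ℂ}, ‖c‖ < 1 → DifferentiableOn ℂ (mob c) (ball 0 1) ∧
      MapsTo (mob c) (ball 0 1) (ball 0 1) ∧ ∀ w ∈ ball (0 : ℂ) 1, mob (-c) (mob c w) = w := by
    intro c hc
    refine ⟨fun w hw => ?_, fun w hw => ?_, fun w hw => ?_⟩
    · rw [mem_ball_zero_iff] at hw
      exact (hasDerivAt_mob hc hw).differentiableAt.differentiableWithinAt
    · rw [mem_ball_zero_iff] at hw ⊢
      exact norm_mob_lt_one hc hw
    · rw [mem_ball_zero_iff] at hw
      have h1 := one_sub_conj_mul_ne_zero hc hw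
      have h2 := one_sub_conj_mul_ne_zero hc hc
      have h1' : 1 - w * conj c ≠ 0 := by rwa [mul_comm]
      have h2' : 1 - c * conj c ≠ 0 := by rwa [mul_comm]
      have h4 : 1 - conj (-c) * mob c w = (1 - conj c * c) / (1 - conj c * w) := by
        rw [mob, map_neg]
        field_simp
        ring
      have h5 : mob c w - -c = w * (1 - conj c * c) / (1 - conj c * w) := by
        rw [mob]
        field_simp
        ring
      rw [mob, h4, h5]
      field_simp
  obtain ⟨h1, h2, h3⟩ := key hc
  obtain ⟨h4, h5, h6⟩ := key (c := -c) (by rwa [norm_neg])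
  exact ⟨h1, h4, h2, h5, h3, fun w hw => by have := h6 w hw; rwa [neg_neg] at this⟩

theorem mob_self (c : ℂ) : mob c c = 0 := by simp [mob]

theorem mob_zero (c : ℂ) : mob c 0 = -c := by simp [mob]

/-! ### Normal families -/

/-- Montel's theorem along an ultrafilter: pointwise limits exist by compactness of the closed disk,
and Schwarz's lemma gives a Lipschitz bound independent of `n`, which makes the convergence locally
uniform. -/
theorem exists_tendstoLocallyUniformlyOn {V : Set ℂ} (hV : IsOpen V) {F : ℕ → ℂ → ℂ}
    (hF : ∀ n, DifferentiableOn ℂ (F n) V) (hb : ∀ n, MapsTo (F n) V (ball 0 1))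
    (l : Ultrafilter ℕ) :
    ∃ f : ℂ → ℂ, TendstoLocallyUniformlyOn F f l V := by
  have hex : ∀ z, ∃ w, z ∈ V → Tendsto (fun n => F n z) l (𝓝 w) := by
    intro z
    by_cases hz : z ∈ V
    · have hc : IsCompact (closedBall (0 : ℂ) 1) := isCompact_closedBall _ _
      obtain ⟨w, _, hw⟩ := isCompact_iff_ultrafilter_le_nhds.mp hc (l.map fun n => F n z) (by
        rw [le_principal_iff, Ultrafilter.mem_coe, Ultrafilter.mem_map]
        exact univ_mem' fun n => ball_subset_closedBall (hb n hz))
      exact ⟨w, fun _ => hw⟩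
    · exact ⟨0, fun h => absurd h hz⟩
  choose f hf using hex
  refine ⟨f, ?_⟩
  rw [Metric.tendstoLocallyUniformlyOn_iff]
  intro ε hε z hz
  obtain ⟨R, hR, hball⟩ := Metric.isOpen_iff.mp hV z hz
  have hlip : ∀ n, ∀ w ∈ ball z R, dist (F n w) (F n z) ≤ 2 / R * dist w z := fun n w hw => by
    refine Complex.dist_le_div_mul_dist_of_mapsTo_ball ((hF n).mono hball) (fun x hx => ?_) hw
    have h1 := hb n (hball hx)
    have h2 := hb n hz
    rw [mem_ball_zero_iff] at h1 h2
    rw [mem_closedBall, dist_eq_norm]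
    linarith [norm_sub_le (F n x) (F n z)]
  have hlipf : ∀ w ∈ ball z R, dist (f w) (f z) ≤ 2 / R * dist w z := fun w hw =>
    le_of_tendsto ((hf w (hball hw)).dist (hf z hz)) (Eventually.of_forall fun n => hlip n w hw)
  set δ := min R (ε * R / 8) with hδ
  have hδ0 : 0 < δ := lt_min hR (by positivity)
  refine ⟨ball z δ, mem_nhdsWithin_of_mem_nhds (ball_mem_nhds z hδ0), ?_⟩
  filter_upwards [(hf z hz).eventually (ball_mem_nhds _ (half_pos hε))] with n hn w hw
  rw [mem_ball] at hw
  have hwR : w ∈ ball z R := mem_ball.mpr (hw.trans_le (min_le_left _ _))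
  have hs : 2 / R * dist w z ≤ ε / 4 := by
    have : dist w z ≤ ε * R / 8 := hw.le.trans (min_le_right _ _)
    calc 2 / R * dist w z ≤ 2 / R * (ε * R / 8) := by gcongr
      _ = ε / 4 := by field_simp; ring
  have h1 := hlip n w hwR
  have h2 := hlipf w hwR
  have h3 := dist_triangle4 (f w) (f z) (F n z) (F n w)
  rw [dist_comm (F n z) (F n w), dist_comm (f z) (F n z)] at h3
  linarith

/-- Hurwitz: a locally uniform limit of injective holomorphic functions is injective unless
it is constant. -/
theorem injOn_of_tendstoLocallyUniformlyOn {V : Set ℂ} (hV : IsOpen V) (hc : IsPreconnected V)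
    {F : ℕ → ℂ → ℂ} {f : ℂ → ℂ} {l : Filter ℕ} [l.NeBot]
    (hlim : TendstoLocallyUniformlyOn F f l V)
    (hF : ∀ n, DifferentiableOn ℂ (F n) V) (hFi : ∀ n, InjOn (F n) V)
    (hne : ∃ a ∈ V, ∃ b ∈ V, f a ≠ f b) : InjOn f V := by
  have hfd : DifferentiableOn ℂ f V := hlim.differentiableOn (Eventually.of_forall hF) hV
  intro a ha b hb hab
  by_contra hne'
  have han : AnalyticOnNhd ℂ f V := hfd.analyticOnNhd hV
  have hnz : ∀ᶠ z in 𝓝[≠] a, f z ≠ f b := by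
    rcases (han a ha).eventually_eq_or_eventually_ne (analyticAt_const (v := f b)) with h | h
    · obtain ⟨x, hx, y, hy, hxy⟩ := hne
      have := han.eqOn_of_preconnected_of_eventuallyEq analyticOnNhd_const hc ha h
      exact absurd ((this hx).trans (this hy).symm) hxy
    · exact h
  have hev : ∀ᶠ z in 𝓝 a, z ∈ V ∧ z ≠ b ∧ (z ≠ a → f z ≠ f b) := by
    filter_upwards [hV.mem_nhds ha, isOpen_ne.mem_nhds hne', eventually_nhdsWithin_iff.mp hnz]
      with z h1 h2 h3 using ⟨h1, h2, h3⟩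
  obtain ⟨ρ, hρ, hball⟩ := Metric.nhds_basis_closedBall.mem_iff.mp hev
  have hcb : closedBall a ρ ⊆ V := fun z hz => (hball hz).1
  have hsc : IsCompact (sphere a ρ) := isCompact_sphere _ _
  have hsV : sphere a ρ ⊆ V := sphere_subset_closedBall.trans hcb
  obtain ⟨x₀, hx₀, hmin⟩ := hsc.exists_isMinOn (NormedSpace.sphere_nonempty.mpr hρ.le)
    (((hfd.continuousOn.mono hsV).sub (continuousOn_const (c := f b))).norm)
  set m := ‖f x₀ - f b‖ with hm
  have hm0 : 0 < m := norm_pos_iff.mpr (sub_ne_zero.mpr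
    ((hball (sphere_subset_closedBall hx₀)).2.2 fun h => by
      rw [h, mem_sphere, dist_self] at hx₀; exact hρ.ne hx₀))
  have hunif := (tendstoLocallyUniformlyOn_iff_forall_isCompact hV).mp hlim _ hcb
    (isCompact_closedBall a ρ)
  obtain ⟨n, h1, h2⟩ := ((Metric.tendstoUniformlyOn_iff.mp hunif (m / 8) (by positivity)).and
    ((hlim.tendsto_at hb).eventually (ball_mem_nhds _ (by positivity : 0 < m / 8)))).exists
  rw [dist_comm] at h2
  have hbound : ∀ z ∈ closedBall a ρ, ‖(f z - f b) - (F n z - F n b)‖ < m / 4 := by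
    intro z hz
    have e1 := h1 z hz
    rw [dist_eq_norm] at e1 h2
    have : (f z - f b) - (F n z - F n b) = (f z - F n z) - (f b - F n b) := by ring
    rw [this]
    linarith [norm_sub_le (f z - F n z) (f b - F n b)]
  have haa : a ∈ closedBall a ρ := mem_closedBall_self hρ.le
  have hFa : ‖F n a - F n b‖ < m / 4 := by
    have := hbound a haa
    rwa [hab, sub_self, zero_sub, norm_neg] at this
  -- A quantitative open mapping theorem: `F n - F n b` is small at `a` and exceeds its value there
  -- by `m / 2` on the circle, so it vanishes at a point near `a`, which is not `b`.
  have hsub := DiffContOnCl.ball_subset_image_closedBall (f := fun z => F n z - F n b) (z₀ := a)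
    (r := ρ) (ε := m / 2)
    ((((hF n).sub_const _).mono (closure_ball_subset_closedBall.trans hcb)).diffContOnCl) hρ
    (fun z hz => ?_) ?_
  · obtain ⟨z, hz, hz0⟩ := hsub (show (0 : ℂ) ∈ ball (F n a - F n b) (m / 2 / 2) by
      rw [mem_ball, dist_eq_norm, zero_sub, norm_neg]; linarith)
    exact (hball hz).2.1 (hFi n (hcb hz) hb (sub_eq_zero.mp hz0))
  · have e1 : m ≤ ‖f z - f b‖ := hmin hz
    have e2 := hbound z (sphere_subset_closedBall hz)
    have e3 := norm_sub_norm_le (f z - f b) (F n z - F n b)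
    have e4 := norm_sub_norm_le (F n z - F n b) (F n a - F n b)
    linarith
  · have : ∀ᶠ z in 𝓝[≠] a, F n z - F n b ≠ F n a - F n b := by
      filter_upwards [self_mem_nhdsWithin, mem_nhdsWithin_of_mem_nhds (hV.mem_nhds ha)]
        with z h3 h4 h5
      exact h3 (hFi n h4 ha (sub_left_injective h5))
    exact this.frequently.filter_mono nhdsWithin_le_nhds

/-! ### The Riemann mapping theorem -/

/-- A logarithm `L` of `z - c` never takes two values differing by `2πi`. As `L` covers a disk about
`L z₀`, it omits the translated disk about `p`, and inversion at `p` gives a bounded injective map.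
-/
theorem exists_isAdmissible {V : Set ℂ} (hV : IsOpen V) (hc : IsPreconnected V)
    (hN : NoCompactHoles V) (hne : V ≠ univ) {z₀ : ℂ} (hz₀ : z₀ ∈ V) :
    ∃ f, IsAdmissible V z₀ f := by
  obtain ⟨c, hcV⟩ := (ne_univ_iff_exists_notMem V).mp hne
  obtain ⟨L, hL, hLe⟩ := exists_holomorphic_log hV hc hN (f := fun z => z - c)
    (differentiableOn_id.sub_const c) fun z hz h => hcV (sub_eq_zero.mp h ▸ hz)
  have hLi : ∀ z ∈ V, ∀ w ∈ V, Complex.exp (L z) = Complex.exp (L w) → z = w :=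
    fun z hz w hw h => by
      rw [hLe z hz, hLe w hw] at h
      exact sub_left_injective h
  have hinj : InjOn L V := fun z hz w hw h => hLi z hz w hw (by rw [h])
  have ho := isOpen_image_of_injOn hV hL hinj
  obtain ⟨ε, hε, hball⟩ := Metric.isOpen_iff.mp ho (L z₀) ⟨z₀, hz₀, rfl⟩
  set p : ℂ := L z₀ + 2 * Real.pi * Complex.I with hp
  have hfar : ∀ z ∈ V, ε ≤ ‖L z - p‖ := by
    intro z hz
    by_contra hlt
    have hm : L z - 2 * Real.pi * Complex.I ∈ ball (L z₀) ε := by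
      rw [mem_ball, dist_eq_norm]
      have : L z - 2 * Real.pi * Complex.I - L z₀ = L z - p := by rw [hp]; ring
      rw [this]; exact not_le.mp hlt
    obtain ⟨w, hw, hwe⟩ := hball hm
    have := hLi w hw z hz (by rw [hwe, Complex.exp_periodic.sub_eq])
    rw [this] at hwe
    have h0 : (2 * Real.pi * Complex.I : ℂ) = 0 := by linear_combination hwe
    exact Complex.two_pi_I_ne_zero h0
  have hne0 : ∀ z ∈ V, L z - p ≠ 0 := fun z hz h => by
    have := hfar z hz
    rw [h, norm_zero] at this
    linarith
  set k : ℂ → ℂ := fun z => (ε / 4 : ℝ) * (L z - p)⁻¹ with hk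
  have hkb : ∀ z ∈ V, ‖k z‖ ≤ 1 / 4 := fun z hz => by
    rw [hk]
    simp only [norm_mul, norm_inv, Complex.norm_real]
    rw [Real.norm_of_nonneg (by positivity), ← div_eq_mul_inv,
      div_le_iff₀ (hε.trans_le (hfar z hz))]
    linarith [hfar z hz]
  have hε4 : ((ε / 4 : ℝ) : ℂ) ≠ 0 := by exact_mod_cast (by positivity : ε / 4 ≠ 0)
  refine ⟨fun z => k z - k z₀, ?_, ?_, ?_, by simp⟩
  · exact ((((hL.sub_const p).inv hne0).const_mul _).sub_const _)
  · intro z hz w hw h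
    have h1 : k z = k w := sub_left_injective h
    have h2 := mul_left_cancel₀ hε4 h1
    exact hinj hz hw (sub_left_injective (inv_injective h2))
  · intro z hz
    rw [mem_ball_zero_iff]
    linarith [norm_sub_le (k z) (k z₀), hkb z hz, hkb z₀ hz₀]

/-- An admissible map that omits a value of the disk does not maximise the derivative. -/
theorem exists_norm_deriv_lt {V : Set ℂ} (hV : IsOpen V) (hc : IsPreconnected V)
    (hN : NoCompactHoles V) {z₀ : ℂ} (hz₀ : z₀ ∈ V) {f : ℂ → ℂ} (hf : IsAdmissible V z₀ f)
    {c : ℂ} (hc1 : ‖c‖ < 1) (hcf : c ∉ f '' V) :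
    ∃ g, IsAdmissible V z₀ g ∧ ‖deriv f z₀‖ < ‖deriv g z₀‖ := by
  have hm := isConformalEquiv_mob hc1
  set u : ℂ → ℂ := mob c ∘ f with hu
  have hud : DifferentiableOn ℂ u V := hm.diff.comp hf.differentiableOn hf.mapsTo
  have hui : InjOn u V := hm.injOn.comp hf.injOn hf.mapsTo
  have hub : MapsTo u V (ball 0 1) := hm.mapsTo.comp hf.mapsTo
  have hcb : c ∈ ball (0 : ℂ) 1 := by simpa using hc1
  have hu0 : ∀ z ∈ V, u z ≠ 0 := fun z hz h => hcf ⟨z, hz, by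
    have : mob c (f z) = mob c c := by rw [mob_self]; exact h
    exact hm.injOn (hf.mapsTo hz) hcb this⟩
  -- Koebe's square root trick: `u` omits `0`, so it has a square root `s`, again injective into the
  -- disk, which is then recentred.
  obtain ⟨L, hL, hLe⟩ := exists_holomorphic_log hV hc hN hud hu0
  set s : ℂ → ℂ := fun z => Complex.exp (L z / 2) with hs
  have hsd : DifferentiableOn ℂ s V := (hL.div_const 2).cexp
  have hss : ∀ z ∈ V, s z ^ 2 = u z := fun z hz => by
    rw [hs, ← hLe z hz]
    simp only
    rw [← Complex.exp_nat_mul]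
    congr 1
    push_cast
    ring
  have hsi : InjOn s V := fun z hz w hw h => hui hz hw (by rw [← hss z hz, ← hss w hw, h])
  have hsb : MapsTo s V (ball 0 1) := fun z hz => by
    have h1 := hub hz
    rw [mem_ball_zero_iff] at h1 ⊢
    rw [← hss z hz, norm_pow] at h1
    exact (pow_lt_one_iff_of_nonneg (norm_nonneg _) two_ne_zero).mp h1
  have hs1 : ‖s z₀‖ < 1 := by simpa using hsb hz₀
  have hm' := isConformalEquiv_mob hs1
  refine ⟨mob (s z₀) ∘ s, ⟨hm'.diff.comp hsd hsb, hm'.injOn.comp hsi hsb, hm'.mapsTo.comp hsb,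
    mob_self _⟩, ?_⟩
  have hds := (hsd.differentiableAt (hV.mem_nhds hz₀)).hasDerivAt
  have hdf := (hf.differentiableOn.differentiableAt (hV.mem_nhds hz₀)).hasDerivAt
  have hf0 := deriv_ne_zero_of_injOn hV hf.differentiableOn hf.injOn hz₀
  set x := ‖s z₀‖ with hx
  have hcx : ‖c‖ = x ^ 2 := by
    have := hss z₀ hz₀
    rw [hu, Function.comp_apply, hf.map_base, mob_zero] at this
    rw [hx, ← norm_pow, this, norm_neg]
  have hx0 : 0 < x := norm_pos_iff.mpr (Complex.exp_ne_zero _)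
  have e1 : deriv (mob (s z₀) ∘ s) z₀ = deriv s z₀ / (1 - x ^ 2 : ℝ) := by
    rw [((hasDerivAt_mob hs1 hs1).comp z₀ hds).deriv]
    have h2 : conj (s z₀) * s z₀ = ((x ^ 2 : ℝ) : ℂ) := by
      rw [← Complex.normSq_eq_conj_mul_self, Complex.normSq_eq_norm_sq]
    have h3 : (1 : ℂ) - ((x ^ 2 : ℝ) : ℂ) ≠ 0 := by rw [← h2]; exact one_sub_conj_mul_ne_zero hs1 hs1
    rw [h2]
    push_cast at h3 ⊢
    field_simp
  have e2 : 2 * s z₀ * deriv s z₀ = (1 - ‖c‖ ^ 2 : ℝ) * deriv f z₀ := by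
    have h1 : HasDerivAt (fun z => s z ^ 2) (2 * s z₀ * deriv s z₀) z₀ := by
      simpa using hds.fun_pow 2
    have h2 : HasDerivAt u ((1 - conj c * c) / (1 - conj c * f z₀) ^ 2 * deriv f z₀) z₀ :=
      (hasDerivAt_mob hc1 (by simpa using hf.mapsTo hz₀)).comp z₀ hdf
    have h3 : (fun z => s z ^ 2) =ᶠ[𝓝 z₀] u := eventually_of_mem (hV.mem_nhds hz₀) hss
    have h4 := h1.unique (h2.congr_of_eventuallyEq h3)
    have h5 : conj c * c = ((‖c‖ ^ 2 : ℝ) : ℂ) := by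
      rw [← Complex.normSq_eq_conj_mul_self, Complex.normSq_eq_norm_sq]
    rw [h4, hf.map_base, h5]
    push_cast
    simp
  have hx1 : x ^ 2 < 1 := by nlinarith
  have e3 : 2 * x * ‖deriv s z₀‖ = (1 - (x ^ 2) ^ 2) * ‖deriv f z₀‖ := by
    have := congrArg norm e2
    rw [norm_mul, norm_mul, norm_mul, Complex.norm_real, hcx, Real.norm_of_nonneg (by nlinarith)]
      at this
    simpa using this
  rw [e1, norm_div, Complex.norm_real, Real.norm_of_nonneg (by linarith),
    lt_div_iff₀ (by linarith)]
  have hD := norm_pos_iff.mpr hf0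
  have e4 : ‖deriv s z₀‖ = (1 - (x ^ 2) ^ 2) * ‖deriv f z₀‖ / (2 * x) := by
    rw [← e3]; field_simp
  rw [e4, lt_div_iff₀ (by positivity)]
  -- The new derivative is the old one times `(1 + x ^ 2) / (2 * x)`, which exceeds one because `(1
  -- - x) ^ 2 > 0`.
  have h6 : 0 < (1 - x ^ 2) * (1 - x) ^ 2 * ‖deriv f z₀‖ := by
    have : 0 < 1 - x := by linarith
    have : 0 < 1 - x ^ 2 := by linarith
    positivity
  nlinarith

/-- The Riemann mapping theorem. -/
theorem exists_isConformalEquiv_ball {V : Set ℂ} (hV : IsOpen V) (hc : IsConnected V)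
    (hN : NoCompactHoles V) (hne : V ≠ univ) :
    ∃ f ψ, IsConformalEquiv f ψ V (ball 0 1) := by
  obtain ⟨z₀, hz₀⟩ := hc.nonempty
  obtain ⟨f₀, hf₀⟩ := exists_isAdmissible hV hc.isPreconnected hN hne hz₀
  set S : Set ℝ := {d | ∃ f, IsAdmissible V z₀ f ∧ d = ‖deriv f z₀‖} with hS
  have hSne : S.Nonempty := ⟨_, f₀, hf₀, rfl⟩
  obtain ⟨ε, hε, hball⟩ := Metric.isOpen_iff.mp hV z₀ hz₀
  have hbdd : BddAbove S := by
    refine ⟨1 / ε, ?_⟩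
    rintro _ ⟨f, hf, rfl⟩
    refine Complex.norm_deriv_le_div_of_mapsTo_ball (hf.differentiableOn.mono hball)
      (fun z hz => ?_) hε
    rw [hf.map_base]
    exact ball_subset_closedBall (hf.mapsTo (hball hz))
  obtain ⟨u, _, hu, huS⟩ := exists_seq_tendsto_sSup hSne hbdd
  choose F hF hFu using huS
  -- The ultrafilter replaces the choice of a subsequence of the maximising sequence. The limit
  -- attains the positive supremum, so it is not constant and Hurwitz applies.
  set l : Ultrafilter ℕ := hyperfilter ℕ with hl
  obtain ⟨f, hlim⟩ := exists_tendstoLocallyUniformlyOn hV (fun n => (hF n).differentiableOn)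
    (fun n => (hF n).mapsTo) l
  have hFd : ∀ᶠ n in (l : Filter ℕ), DifferentiableOn ℂ (F n) V :=
    Eventually.of_forall fun n => (hF n).differentiableOn
  have hfd := hlim.differentiableOn hFd hV
  have hderiv : ‖deriv f z₀‖ = sSup S := by
    refine tendsto_nhds_unique ((hlim.deriv hFd hV).tendsto_at hz₀).norm ?_
    refine (hu.mono_left (Nat.hyperfilter_le_atTop)).congr fun n => ?_
    rw [hFu n]; rfl
  have hpos : 0 < sSup S := (norm_pos_iff.mpr (deriv_ne_zero_of_injOn hV hf₀.differentiableOn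
    hf₀.injOn hz₀)).trans_le (le_csSup hbdd ⟨f₀, hf₀, rfl⟩)
  have hfz : f z₀ = 0 := by
    refine tendsto_nhds_unique (hlim.tendsto_at hz₀) ?_
    exact tendsto_const_nhds.congr fun n => ((hF n).map_base).symm
  have hnc : ∃ a ∈ V, ∃ b ∈ V, f a ≠ f b := by
    by_contra hcon
    push Not at hcon
    have : f =ᶠ[𝓝 z₀] fun _ => f z₀ :=
      eventually_of_mem (hV.mem_nhds hz₀) fun z hz => hcon z hz z₀ hz₀
    rw [this.deriv_eq, deriv_const, norm_zero] at hderiv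
    exact hpos.ne hderiv
  have hfi := injOn_of_tendstoLocallyUniformlyOn hV hc.isPreconnected hlim
    (fun n => (hF n).differentiableOn) (fun n => (hF n).injOn) hnc
  have hle : ∀ z ∈ V, ‖f z‖ ≤ 1 := fun z hz =>
    le_of_tendsto (hlim.tendsto_at hz).norm (Eventually.of_forall fun n => by
      have := (hF n).mapsTo hz
      rw [mem_ball_zero_iff] at this
      exact this.le)
  have hfb : MapsTo f V (ball 0 1) := by
    have ho := isOpen_image_of_injOn hV hfd hfi
    have hsub : f '' V ⊆ interior (closedBall 0 1) := interior_maximal (by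
      rintro _ ⟨z, hz, rfl⟩
      simpa using hle z hz) ho
    rw [interior_closedBall _ one_ne_zero] at hsub
    exact fun z hz => hsub ⟨z, hz, rfl⟩
  have hfa : IsAdmissible V z₀ f := ⟨hfd, hfi, hfb, hfz⟩
  obtain ⟨ψ, hψ⟩ := exists_isConformalEquiv hV hfd hfi
  have himg : f '' V = ball 0 1 := by
    refine Subset.antisymm (image_subset_iff.mpr hfb) fun c hcb => ?_
    by_contra hcf
    obtain ⟨g, hg, hlt⟩ := exists_norm_deriv_lt hV hc.isPreconnected hN hz₀ hfa
      (by simpa using hcb) hcf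
    have := le_csSup hbdd ⟨g, hg, rfl⟩
    linarith
  rw [himg] at hψ
  exact ⟨f, ψ, hψ⟩

end Squeezing

namespace Squeezing

open ComplexConjugate

/-! ### Automorphisms of the disk without fixed points -/

/-- Once the zero is moved to the origin, Schwarz's lemma for the map and for its inverse gives `‖g
w‖ = ‖w‖`. The quotient `g w / w` then has constant modulus and is constant by the maximum
principle. -/
theorem exists_eq_mul_mob {τ τ' : ℂ → ℂ} (h : IsConformalEquiv τ τ' (ball 0 1) (ball 0 1)) :
    ∃ a c : ℂ, ‖a‖ < 1 ∧ ‖c‖ = 1 ∧ ∀ w ∈ ball (0 : ℂ) 1, τ w = c * mob a w := by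
  have h0 : (0 : ℂ) ∈ ball (0 : ℂ) 1 := mem_ball_self one_pos
  set a := τ' 0 with ha
  have ha1 : ‖a‖ < 1 := by simpa using h.mapsTo_symm h0
  have hna1 : ‖-a‖ < 1 := by rwa [norm_neg]
  have hm := isConformalEquiv_mob ha1
  have hg := hm.symm.trans h
  have hg0 : (τ ∘ mob (-a)) 0 = 0 := by
    simp only [Function.comp_apply, mob_zero, neg_neg]
    exact h.right_inv 0 h0
  have hg0' : (mob a ∘ τ') 0 = 0 := by
    simp only [Function.comp_apply]
    exact mob_self a
  have hle : ∀ w ∈ ball (0 : ℂ) 1, ‖(τ ∘ mob (-a)) w‖ ≤ ‖w‖ := fun w hw =>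
    Complex.norm_le_norm_of_mapsTo_ball hg.diff (fun x hx => ball_subset_closedBall (hg.mapsTo hx))
      hg0 (by simpa using hw)
  have hle' : ∀ w ∈ ball (0 : ℂ) 1, ‖(mob a ∘ τ') w‖ ≤ ‖w‖ := fun w hw =>
    Complex.norm_le_norm_of_mapsTo_ball hg.diff_symm
      (fun x hx => ball_subset_closedBall (hg.mapsTo_symm hx)) hg0' (by simpa using hw)
  have heq : ∀ w ∈ ball (0 : ℂ) 1, ‖(τ ∘ mob (-a)) w‖ = ‖w‖ := fun w hw => by
    refine le_antisymm (hle w hw) ?_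
    have := hle' _ (hg.mapsTo hw)
    rwa [hg.left_inv w hw] at this
  set g := τ ∘ mob (-a) with hgdef
  have hh : (1 / 2 : ℂ) ∈ ball (0 : ℂ) 1 := by rw [mem_ball_zero_iff]; norm_num
  have hdd : DifferentiableOn ℂ (dslope g 0) (ball 0 1) :=
    (Complex.differentiableOn_dslope (ball_mem_nhds 0 one_pos)).mpr hg.diff
  have hdn : ∀ w ∈ ball (0 : ℂ) 1, w ≠ 0 → ‖dslope g 0 w‖ = 1 := fun w hw hw0 => by
    rw [dslope_of_ne _ hw0, slope_def_field, hg0, sub_zero, sub_zero, norm_div, heq w hw,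
      div_self (norm_ne_zero_iff.mpr hw0)]
  have hd1 : ‖dslope g 0 (1 / 2)‖ = 1 := hdn _ hh (by norm_num)
  have hmax : IsMaxOn (norm ∘ dslope g 0) (ball 0 1) (1 / 2) := fun w hw => by
    simp only [mem_ofPred_eq, Function.comp_apply]
    rw [hd1]
    have := Complex.norm_dslope_le_div_of_mapsTo_ball (c := 0) (R₁ := 1) (R₂ := 1) hg.diff
      (fun x hx => by rw [hg0]; exact ball_subset_closedBall (hg.mapsTo hx)) hw
    simpa using this
  have hconst := Complex.eqOn_of_isPreconnected_of_isMaxOn_norm (convex_ball _ _).isPreconnected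
    isOpen_ball hdd hh hmax
  refine ⟨a, dslope g 0 (1 / 2), ha1, hd1, fun w hw => ?_⟩
  have hgv : ∀ v ∈ ball (0 : ℂ) 1, g v = dslope g 0 (1 / 2) * v := fun v hv => by
    have e1 := sub_smul_dslope g 0 v
    rw [hconst hv, hg0, sub_zero, sub_zero, smul_eq_mul] at e1
    rw [← e1, mul_comm]; rfl
  rw [← hgv _ (hm.mapsTo hw), hgdef, Function.comp_apply, hm.left_inv w hw]

/-- The right half-plane. -/
def rightHalfPlane : Set ℂ := {x | 0 < x.re}

/-- The boundary point `p` goes to infinity; `p / (p - w)` has real part above `1 / 2` on the disk.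
-/
theorem isConformalEquiv_cayley {p : ℂ} (hp : ‖p‖ = 1) :
    IsConformalEquiv (fun w => p / (p - w) - 1 / 2) (fun x => p * ((x - 1 / 2) / (x + 1 / 2)))
      (ball 0 1) rightHalfPlane := by
  have hp0 : p ≠ 0 := norm_pos_iff.mp (by rw [hp]; exact one_pos)
  have hpw : ∀ w ∈ ball (0 : ℂ) 1, p - w ≠ 0 := fun w hw h => by
    rw [mem_ball_zero_iff, ← sub_eq_zero.mp h, hp] at hw
    exact lt_irrefl _ hw
  have hx2 : ∀ x ∈ rightHalfPlane, x + 1 / 2 ≠ 0 := fun x hx h => by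
    have h1 : 0 < x.re := hx
    have h2 := congrArg Complex.re h
    norm_num at h2
    linarith
  have hn : ∀ x ∈ rightHalfPlane, ‖(x - 1 / 2) / (x + 1 / 2)‖ < 1 := fun x hx => by
    rw [norm_div, div_lt_one (norm_pos_iff.mpr (hx2 x hx))]
    refine lt_of_pow_lt_pow_left₀ 2 (norm_nonneg _) ?_
    rw [Complex.sq_norm, Complex.sq_norm, Complex.normSq_apply, Complex.normSq_apply]
    have h1 : 0 < x.re := hx
    have e : (1 / 2 : ℂ).re = 1 / 2 ∧ (1 / 2 : ℂ).im = 0 := by norm_num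
    simp only [Complex.sub_re, Complex.sub_im, Complex.add_re, Complex.add_im, e.1, e.2]
    nlinarith
  refine ⟨?_, ?_, fun w hw => ?_, fun x hx => ?_, fun w hw => ?_, fun x hx => ?_⟩
  · exact ((differentiableOn_const _).div (by fun_prop) hpw).sub_const _
  · exact ((differentiableOn_id.sub_const _).div (differentiableOn_id.add_const _) hx2).const_mul _
  · have h1 := hpw w hw
    have h2 : 0 < Complex.normSq (p - w) := Complex.normSq_pos.mpr h1
    have h3 : (p / (p - w) - 1 / 2).re = (1 - ‖w‖ ^ 2) / (2 * Complex.normSq (p - w)) := by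
      have e : (1 / 2 : ℂ).re = 1 / 2 := by norm_num
      have e2 : p.re * p.re + p.im * p.im = 1 := by
        rw [← Complex.normSq_apply, Complex.normSq_eq_norm_sq, hp]; norm_num
      have e3 : ‖w‖ ^ 2 = w.re * w.re + w.im * w.im := by
        rw [Complex.sq_norm, Complex.normSq_apply]
      rw [Complex.sub_re, Complex.div_re, e, e3]
      field_simp
      rw [Complex.normSq_apply]
      simp only [Complex.sub_re, Complex.sub_im]
      linear_combination e2
    have h4 : ‖w‖ < 1 := by simpa using hw
    change 0 < (p / (p - w) - 1 / 2).re
    rw [h3]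
    have : 0 < 1 - ‖w‖ ^ 2 := by nlinarith [norm_nonneg w]
    positivity
  · rw [mem_ball_zero_iff, norm_mul, hp, one_mul]
    exact hn x hx
  · have h1 := hpw w hw
    field_simp
    ring
  · have h1 := hx2 x hx
    have h2 : p - p * ((x - 1 / 2) / (x + 1 / 2)) = p / (x + 1 / 2) := by
      have hq : (x - 1 / 2) / (x + 1 / 2) * (x + 1 / 2) = x - 1 / 2 := div_mul_cancel₀ _ h1
      rw [eq_div_iff h1]
      linear_combination (-p) * hq
    rw [h2, div_div_cancel₀ hp0]
    ring

/-- A disk automorphism without fixed points is conjugate to a translation or a dilation of the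
right half-plane. -/
theorem exists_conj_affine {τ τ' : ℂ → ℂ} (h : IsConformalEquiv τ τ' (ball 0 1) (ball 0 1))
    (hfix : ∀ w ∈ ball (0 : ℂ) 1, τ w ≠ w) :
    ∃ X X' : ℂ → ℂ, IsConformalEquiv X X' (ball 0 1) rightHalfPlane ∧ ∃ α β : ℝ, 0 < α ∧
      ∀ w ∈ ball (0 : ℂ) 1, X (τ w) = α * X w + β * Complex.I := by
  obtain ⟨a, c, ha, hc, hτ⟩ := exists_eq_mul_mob h
  have h0 : (0 : ℂ) ∈ ball (0 : ℂ) 1 := mem_ball_self one_pos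
  have hc0 : c ≠ 0 := norm_pos_iff.mp (by rw [hc]; exact one_pos)
  have ha0 : a ≠ 0 := fun he => hfix 0 h0 (by rw [hτ 0 h0, he, mob_zero]; simp)
  have hac : conj a ≠ 0 := by simpa using ha0
  have hfix' : ∀ w : ℂ, conj a * (w * w) + (c - 1) * w + -(c * a) = 0 → ¬ ‖w‖ < 1 := by
    intro w hw hw1
    have hwb : w ∈ ball (0 : ℂ) 1 := by simpa using hw1
    refine hfix w hwb ?_
    have h1 := one_sub_conj_mul_ne_zero ha hw1
    rw [hτ w hwb, mob, ← mul_div_assoc, div_eq_iff h1]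
    linear_combination hw
  -- Fixed points are roots of this quadratic. The product of its roots has modulus one and no root
  -- lies in the disk, so they lie on the unit circle.
  obtain ⟨p, hpe, hp1⟩ : ∃ p : ℂ, conj a * (p * p) + (c - 1) * p + -(c * a) = 0 ∧ ‖p‖ = 1 := by
    obtain ⟨s, hs⟩ := IsAlgClosed.exists_pow_nat_eq
      (discrim (conj a) (c - 1) (-(c * a))) (n := 2) two_pos
    obtain ⟨p, hp⟩ := exists_quadratic_eq_zero hac ⟨s, by rw [← hs, sq]⟩
    have hp0 : p ≠ 0 := fun h => by
      rw [h] at hp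
      simp [hc0, ha0] at hp
    set p' : ℂ := -(c * a) / (conj a * p) with hp'
    have hprod : ‖p‖ * ‖p'‖ = 1 := by
      rw [← norm_mul, hp']
      have : p * (-(c * a) / (conj a * p)) = -(c * (a / conj a)) := by field_simp
      rw [this, norm_neg, norm_mul, hc, norm_div, Complex.norm_conj,
        div_self (norm_ne_zero_iff.mpr ha0), mul_one]
    have hpp' : conj a * (p' * p') + (c - 1) * p' + -(c * a) = 0 := by
      have e : conj a * p * p' = -(c * a) := by rw [hp']; field_simp
      have e2 : p * p * (conj a * (p' * p') + (c - 1) * p' + -(c * a)) =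
          -(c * a) / conj a * (conj a * (p * p) + (c - 1) * p + -(c * a)) := by
        have e3 : p * p' = -(c * a) / conj a := by rw [hp']; field_simp
        calc _ = conj a * (p * p') ^ 2 + (c - 1) * p * (p * p') - c * a * (p * p) := by ring
          _ = _ := by rw [e3]; field_simp; ring
      rw [hp, mul_zero] at e2
      exact (mul_eq_zero.mp e2).resolve_left (mul_ne_zero hp0 hp0)
    refine ⟨p, hp, le_antisymm ?_ (not_lt.mp (hfix' p hp))⟩
    have := not_lt.mp (hfix' p' hpp')
    nlinarith [norm_nonneg p]
  have hden : 1 - conj a * p ≠ 0 :=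
    Complex.slitPlane_ne_zero (one_sub_conj_mul_mem_slitPlane ha hp1.le)
  have hp0 : p ≠ 0 := norm_pos_iff.mp (by rw [hp1]; exact one_pos)
  have hpp : p * conj p = 1 := by rw [Complex.mul_conj, Complex.normSq_eq_norm_sq, hp1]; simp
  have haa : a * conj a = ((‖a‖ ^ 2 : ℝ) : ℂ) := by
    rw [Complex.mul_conj, Complex.normSq_eq_norm_sq]
  have hk : 0 < 1 - ‖a‖ ^ 2 := by nlinarith [norm_nonneg a]
  set k : ℝ := 1 - ‖a‖ ^ 2 with hkdef
  have hkc : (1 : ℂ) - a * conj a = k := by rw [haa, hkdef]; push_cast; ring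
  have hk0 : (k : ℂ) ≠ 0 := by exact_mod_cast hk.ne'
  -- With the fixed point `p` at infinity the automorphism becomes affine; preserving the half-plane
  -- makes the factor positive and the translation imaginary.
  refine ⟨_, _, isConformalEquiv_cayley hp1, Complex.normSq (1 - conj a * p) / k,
    (conj a * p).im / k, div_pos (Complex.normSq_pos.mpr hden) hk, fun w hw => ?_⟩
  have hw1 : ‖w‖ < 1 := by simpa using hw
  have hdw := one_sub_conj_mul_ne_zero ha hw1
  have hpw : p - w ≠ 0 := fun h => by rw [← sub_eq_zero.mp h, hp1] at hw1; exact lt_irrefl _ hw1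
  have e1 : c * (p - a) = p * (1 - conj a * p) := by linear_combination hpe
  have hpa : p - a ≠ 0 := fun h => by rw [← sub_eq_zero.mp h, hp1] at ha; exact lt_irrefl _ ha
  have e2 : (p - τ w) * ((1 - conj a * p) * (1 - conj a * w)) = c * k * (p - w) := by
    rw [hτ w hw, mob]
    have : (p - c * ((w - a) / (1 - conj a * w))) * ((1 - conj a * p) * (1 - conj a * w)) =
        (p * (1 - conj a * p)) * (1 - conj a * w) - c * (w - a) * (1 - conj a * p) := by
      have hq : (w - a) / (1 - conj a * w) * (1 - conj a * w) = w - a := div_mul_cancel₀ _ hdw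
      linear_combination (-c * (1 - conj a * p)) * hq
    rw [this, ← e1, ← hkc]
    ring
  have hpt : p - τ w ≠ 0 := fun h => by
    rw [h, zero_mul] at e2
    exact mul_ne_zero (mul_ne_zero hc0 hk0) hpw e2.symm
  have e3 : p / (p - τ w) = (p - a) * (1 - conj a * w) / (k * (p - w)) := by
    rw [div_eq_div_iff hpt (mul_ne_zero hk0 hpw)]
    refine mul_left_cancel₀ (mul_ne_zero hc0 hden) ?_
    linear_combination (-p * (1 - conj a * p)) * e2 -
      (p - τ w) * (1 - conj a * w) * (1 - conj a * p) * e1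
  have e4 : ((Complex.normSq (1 - conj a * p) : ℝ) : ℂ) = (1 - conj a * p) * (1 - a * conj p) := by
    rw [← Complex.mul_conj]
    simp
  have e5 : (((conj a * p).im : ℝ) : ℂ) * Complex.I = (conj a * p - a * conj p) / 2 := by
    have := Complex.sub_conj (conj a * p)
    simp only [map_mul, Complex.conj_conj] at this
    rw [this]
    push_cast
    ring
  rw [e3]
  push_cast
  rw [e4, div_mul_eq_mul_div _ _ Complex.I, e5]
  have key : 2 * ((p - a) * (1 - conj a * w)) - k * (p - w) =
      (1 - conj a * p) * (1 - a * conj p) * (p + w) + (conj a * p - a * conj p) * (p - w) := by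
    linear_combination (2 * a - a * conj a * (p + w)) * hpp + (p - w) * hkc
  have e6 : p / (p - w) - 1 / 2 = (p + w) / (2 * (p - w)) := by
    field_simp
    ring
  rw [e6, div_sub_div _ _ (mul_ne_zero hk0 hpw) two_ne_zero, div_mul_div_comm, div_div,
    div_add_div _ _ (mul_ne_zero hk0 (mul_ne_zero two_ne_zero hpw)) (mul_ne_zero two_ne_zero hk0),
    div_eq_div_iff (by simp [hk0, hpw]) (by simp [hk0, hpw])]
  linear_combination (4 * k ^ 2 * (p - w)) * key

/-! ### Normal form of a disk automorphism without fixed points -/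

theorem isConformalEquiv_neg_mul {b : ℝ} (hb : 0 < b) :
    IsConformalEquiv (fun x => -(b : ℂ) * x) (fun ζ => -ζ / (b : ℂ)) rightHalfPlane (strip 0) := by
  have hb0 : (b : ℂ) ≠ 0 := by exact_mod_cast hb.ne'
  refine ⟨by fun_prop, by fun_prop, fun x hx => ?_, fun ζ hζ => ?_, fun x _ => ?_, fun x _ => ?_⟩
  · have h1 : 0 < x.re := hx
    rw [mem_strip]
    refine ⟨Real.exp_pos _, ?_⟩
    rw [Real.exp_lt_one_iff, ← Complex.ofReal_neg, Complex.re_ofReal_mul]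
    nlinarith
  · have h1 := (mem_strip.mp hζ).2
    rw [Real.exp_lt_one_iff] at h1
    change 0 < (-ζ / (b : ℂ)).re
    rw [Complex.div_ofReal_re, Complex.neg_re]
    exact div_pos (by linarith) hb
  · field_simp
  · field_simp

theorem isConformalEquiv_add_imaginary (b : ℝ) :
    IsConformalEquiv (fun x => x + b * Complex.I) (fun x => x - b * Complex.I)
      rightHalfPlane rightHalfPlane := by
  refine ⟨by fun_prop, by fun_prop, fun x hx => ?_, fun x hx => ?_, fun x _ => ?_, fun x _ => ?_⟩
  · change 0 < (x + b * Complex.I).re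
    have : 0 < x.re := hx
    simpa
  · change 0 < (x - b * Complex.I).re
    have : 0 < x.re := hx
    simpa
  · ring
  · ring

/-- On the half-plane the argument ranges over `(-π / 2, π / 2)`, so the real part of the image
ranges over `(-|κ| * π, 0)`. The dilation by `α` becomes the translation by `I * κ * log α`. -/
theorem isConformalEquiv_log {κ : ℝ} (hκ : κ ≠ 0) :
    IsConformalEquiv (fun y => Complex.I * κ * Complex.log y - (|κ| * (Real.pi / 2) : ℝ))
      (fun ζ => Complex.exp ((ζ + (|κ| * (Real.pi / 2) : ℝ)) / (Complex.I * κ)))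
      rightHalfPlane (strip (Real.exp (-(|κ| * Real.pi)))) := by
  have hκ0 : Complex.I * (κ : ℂ) ≠ 0 :=
    mul_ne_zero Complex.I_ne_zero (by exact_mod_cast hκ)
  have hak : 0 < |κ| := abs_pos.mpr hκ
  set m : ℝ := |κ| * (Real.pi / 2) with hm
  have him : ∀ ζ : ℂ, ((ζ + (m : ℂ)) / (Complex.I * κ)).im = -(ζ.re + m) / κ := fun ζ => by
    have : (ζ + (m : ℂ)) / (Complex.I * κ) = (-(ζ + m) * Complex.I) / (κ : ℂ) := by
      rw [div_eq_div_iff hκ0 (by exact_mod_cast hκ)]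
      linear_combination (ζ + m) * κ * Complex.I_mul_I
    rw [this, Complex.div_ofReal_im]
    simp
  have hab : ∀ ζ ∈ strip (Real.exp (-(|κ| * Real.pi))),
      |((ζ + (m : ℂ)) / (Complex.I * κ)).im| < Real.pi / 2 := fun ζ hζ => by
    obtain ⟨h1, h2⟩ := mem_strip.mp hζ
    rw [Real.exp_lt_one_iff] at h2
    rw [Real.exp_lt_exp] at h1
    rw [him, abs_div, abs_neg, div_lt_iff₀ hak, abs_lt]
    constructor <;> nlinarith
  have hpos : ∀ y ∈ rightHalfPlane, y ∈ Complex.slitPlane := fun y hy => Or.inl hy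
  refine ⟨?_, ?_, fun y hy => ?_, fun ζ hζ => ?_, fun y hy => ?_, fun ζ hζ => ?_⟩
  · exact ((differentiableOn_id.clog hpos).const_mul _).sub_const _
  · exact ((differentiableOn_id.add_const _).div_const _).cexp
  · have hy0 : 0 < y.re := hy
    have harg : |y.arg| < Real.pi / 2 := Complex.abs_arg_lt_pi_div_two_iff.mpr (Or.inl hy0)
    have hre : (Complex.I * κ * Complex.log y - (m : ℂ)).re = -(κ * y.arg) - m := by
      simp [Complex.log_im]
    have hlt : |κ * y.arg| < m := by
      rw [abs_mul, hm]
      exact mul_lt_mul_of_pos_left harg hak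
    rw [abs_lt] at hlt
    rw [mem_strip, hre, Real.exp_lt_one_iff, Real.exp_lt_exp]
    constructor <;> nlinarith
  · change 0 < (Complex.exp _).re
    rw [Complex.exp_re]
    have := abs_lt.mp (hab ζ hζ)
    exact mul_pos (Real.exp_pos _) (Real.cos_pos_of_mem_Ioo ⟨by linarith, this.2⟩)
  · rw [sub_add_cancel, mul_div_cancel_left₀ _ hκ0]
    exact Complex.exp_log (Complex.slitPlane_ne_zero (hpos y hy))
  · have := abs_lt.mp (hab ζ hζ)
    rw [Complex.log_exp (by linarith [Real.pi_pos]) (by linarith [Real.pi_pos]),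
      mul_div_cancel₀ _ hκ0, add_sub_cancel_right]

/-- A disk automorphism without fixed points is conjugate to the translation by `± 2πi` of a
vertical strip or of the left half-plane. -/
theorem exists_conj_strip_translation {τ τ' : ℂ → ℂ}
    (h : IsConformalEquiv τ τ' (ball 0 1) (ball 0 1)) (hfix : ∀ w ∈ ball (0 : ℂ) 1, τ w ≠ w) :
    ∃ r : ℝ, 0 ≤ r ∧ r < 1 ∧ ∃ Ψ Ψ' : ℂ → ℂ, IsConformalEquiv Ψ Ψ' (ball 0 1) (strip r) ∧
      ∃ s : ℤ, (s = 1 ∨ s = -1) ∧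
        ∀ w ∈ ball (0 : ℂ) 1, Ψ (τ w) = Ψ w + s * (2 * Real.pi * Complex.I) := by
  obtain ⟨X, X', hX, α, β, hα, hτ⟩ := exists_conj_affine h hfix
  have h0 : (0 : ℂ) ∈ ball (0 : ℂ) 1 := mem_ball_self one_pos
  -- A pure translation leads to the half-plane, that is to `r = 0`. Otherwise the finite fixed
  -- point is moved to `0`, and `κ = 2π / log α` normalises the translation to `2πi`.
  by_cases h1 : α = 1
  · have hβ : β ≠ 0 := fun hb => hfix 0 h0 (hX.injOn (h.mapsTo h0) h0 (by
      rw [hτ 0 h0, h1, hb]; simp))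
    have hb : 0 < 2 * Real.pi / |β| := div_pos (by positivity) (abs_pos.mpr hβ)
    refine ⟨0, le_rfl, one_pos, _, _, hX.trans (isConformalEquiv_neg_mul hb), ?_⟩
    rcases lt_or_gt_of_ne hβ with hneg | hpos
    · refine ⟨1, Or.inl rfl, fun w hw => ?_⟩
      have hβc : (β : ℂ) ≠ 0 := by exact_mod_cast hβ
      simp only [Function.comp_apply]
      rw [hτ w hw, h1, abs_of_neg hneg]
      push_cast
      field_simp
    · refine ⟨-1, Or.inr rfl, fun w hw => ?_⟩
      have hβc : (β : ℂ) ≠ 0 := by exact_mod_cast hβ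
      simp only [Function.comp_apply]
      rw [hτ w hw, h1, abs_of_pos hpos]
      push_cast
      field_simp
      ring
  · have hα1 : α - 1 ≠ 0 := sub_ne_zero.mpr h1
    have hlog : Real.log α ≠ 0 := Real.log_ne_zero_of_pos_of_ne_one hα h1
    have hκ : 2 * Real.pi / Real.log α ≠ 0 := div_ne_zero (by positivity) hlog
    refine ⟨_, (Real.exp_pos _).le, Real.exp_lt_one_iff.mpr ?_, _, _,
      (hX.trans (isConformalEquiv_add_imaginary (β / (α - 1)))).trans (isConformalEquiv_log hκ),
      1, Or.inl rfl, fun w hw => ?_⟩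
    · have := mul_pos (abs_pos.mpr hκ) Real.pi_pos
      linarith
    · have hα1c : (α : ℂ) - 1 ≠ 0 := by exact_mod_cast hα1
      have hlc : (Real.log α : ℂ) ≠ 0 := by exact_mod_cast hlog
      have hy0 : X w + ((β / (α - 1) : ℝ) : ℂ) * Complex.I ≠ 0 := fun he => by
        have h2 : X w + ((β / (α - 1) : ℝ) : ℂ) * Complex.I ∈ rightHalfPlane :=
          (isConformalEquiv_add_imaginary (β / (α - 1))).mapsTo (hX.mapsTo hw)
        rw [he] at h2
        exact lt_irrefl (0 : ℝ) h2
      have e : X (τ w) + ((β / (α - 1) : ℝ) : ℂ) * Complex.I =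
          α * (X w + ((β / (α - 1) : ℝ) : ℂ) * Complex.I) := by
        rw [hτ w hw]
        push_cast
        field_simp
        ring
      simp only [Function.comp_apply]
      rw [e, Complex.log_ofReal_mul hα hy0]
      push_cast
      have e2 : Complex.I * (2 * Real.pi / Real.log α : ℂ) * Real.log α =
          2 * Real.pi * Complex.I := by
        field_simp
      linear_combination e2

/-! ### Uniformization of domains with one bounded complementary component -/

/-- A component of the logarithm of `Ω`. -/
structure IsLogComponent (Ω V : Set ℂ) : Prop where
  isOpen : IsOpen V
  isConnected : IsConnected V
  mapsTo : MapsTo Complex.exp V Ω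
  maximal : ∀ A : Set ℂ, IsPreconnected A → MapsTo Complex.exp A Ω → (A ∩ V).Nonempty → A ⊆ V

theorem exists_isLogComponent {Ω : Set ℂ} (hΩ : IsOpen Ω) (hne : Ω.Nonempty) (h0 : (0 : ℂ) ∉ Ω) :
    ∃ V, IsLogComponent Ω V := by
  obtain ⟨w, hw⟩ := hne
  have hw0 : w ≠ 0 := fun h => h0 (h ▸ hw)
  have hU : IsOpen (Complex.exp ⁻¹' Ω) := hΩ.preimage Complex.continuous_exp
  have hmem : Complex.log w ∈ Complex.exp ⁻¹' Ω := by
    rw [mem_preimage, Complex.exp_log hw0]; exact hw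
  refine ⟨connectedComponentIn (Complex.exp ⁻¹' Ω) (Complex.log w), hU.connectedComponentIn,
    isConnected_connectedComponentIn_iff.mpr hmem,
    fun ζ hζ => connectedComponentIn_subset (Complex.exp ⁻¹' Ω) _ hζ, fun A hA hAΩ ⟨ζ, hζA, hζ⟩ => ?_⟩
  rw [connectedComponentIn_eq hζ]
  exact hA.subset_connectedComponentIn hζA hAΩ

namespace IsLogComponent

variable {Ω V : Set ℂ}

/-- A branch of the logarithm on a ball missing `0`, normalised to pass through `ζ`; its connected
image meets `V` and hence stays in it. -/
theorem exists_lift (h : IsLogComponent Ω V) {w : ℂ} {ε : ℝ} (hw : w ≠ 0) (hε : ε ≤ ‖w‖)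
    (hB : ball w ε ⊆ Ω) {ζ : ℂ} (hζ : ζ ∈ V) (hζB : Complex.exp ζ ∈ ball w ε) :
    ∃ L : ℂ → ℂ, DifferentiableOn ℂ L (ball w ε) ∧ (∀ u ∈ ball w ε, Complex.exp (L u) = u) ∧
      MapsTo L (ball w ε) V := by
  have hs : ∀ u ∈ ball w ε, u / w ∈ Complex.slitPlane := fun u hu => by
    refine Complex.mem_slitPlane_of_norm_lt_one (z := u / w - 1) ?_ |> fun h => by simpa using h
    rw [div_sub_one hw, norm_div, div_lt_one (norm_pos_iff.mpr hw), ← dist_eq_norm]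
    exact lt_of_lt_of_le hu hε
  set L : ℂ → ℂ := fun u => ζ - Complex.log (Complex.exp ζ / w) + Complex.log (u / w) with hL
  have hLd : DifferentiableOn ℂ L (ball w ε) :=
    ((differentiableOn_id.div_const w).clog hs).const_add _
  have hLe : ∀ u ∈ ball w ε, Complex.exp (L u) = u := fun u hu => by
    rw [hL, Complex.exp_add, Complex.exp_sub,
      Complex.exp_log (Complex.slitPlane_ne_zero (hs _ hζB)),
      Complex.exp_log (Complex.slitPlane_ne_zero (hs _ hu)), div_div_cancel₀ (Complex.exp_ne_zero _),
      mul_div_cancel₀ _ hw]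
  refine ⟨L, hLd, hLe, fun u hu => ?_⟩
  refine h.maximal (L '' ball w ε) ((convex_ball w ε).isPreconnected.image _ hLd.continuousOn)
    ?_ ⟨ζ, ⟨_, hζB, by simp [hL]⟩, hζ⟩ ⟨u, hu, rfl⟩
  rintro _ ⟨v, hv, rfl⟩
  rw [hLe v hv]
  exact hB hv

/-- The set `exp '' V` is open, and by local lifts it is closed in the connected set `Ω`. -/
theorem surjOn (h : IsLogComponent Ω V) (hΩ : IsOpen Ω) (hc : IsPreconnected Ω)
    (h0 : (0 : ℂ) ∉ Ω) : SurjOn Complex.exp V Ω := by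
  obtain ⟨ζ₀, hζ₀⟩ := h.isConnected.nonempty
  have hball : ∀ w ∈ Ω, ∃ ε > 0, ε ≤ ‖w‖ ∧ ball w ε ⊆ Ω := fun w hw => by
    have hw0 : w ≠ 0 := fun h => h0 (h ▸ hw)
    obtain ⟨ε, hε, hB⟩ := Metric.isOpen_iff.mp hΩ w hw
    exact ⟨min ε ‖w‖, lt_min hε (norm_pos_iff.mpr hw0), min_le_right _ _,
      (ball_subset_ball (min_le_left _ _)).trans hB⟩
  refine hc.subset_of_closure_inter_subset (u := Complex.exp '' V) ?_
    ⟨_, h.mapsTo hζ₀, ζ₀, hζ₀, rfl⟩ ?_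
  · exact Complex.isOpenMap_exp _ h.isOpen
  · rintro w ⟨hwc, hw⟩
    obtain ⟨ε, hε, hεw, hB⟩ := hball w hw
    obtain ⟨_, hζB, ζ, hζ, rfl⟩ := mem_closure_iff_nhds.mp hwc _ (ball_mem_nhds w hε)
    obtain ⟨L, -, hLe, hLV⟩ := h.exists_lift (fun h => h0 (h ▸ hw)) hεw hB hζ hζB
    exact ⟨L w, hLV (mem_ball_self hε), hLe w (mem_ball_self hε)⟩

/-- The part of `exp '' N` outside `Ω` is a compact hole of `Ω` that misses `0`, hence empty. So `N`
lies over `Ω` but off `V`, and the other components of the preimage do not touch `V`. Thus `N` is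
both open and compact in the plane. -/
theorem noCompactHoles (h : IsLogComponent Ω V) (hΩ : IsOpen Ω) (hc : IsPreconnected Ω)
    (h0 : (0 : ℂ) ∉ Ω)
    (hH : ∀ M : Set ℂ, IsCompact M → Disjoint M Ω → IsOpen (Ω ∪ M) → (0 : ℂ) ∉ M → M = ∅) :
    NoCompactHoles V := by
  intro N hN hNV hopen
  have hexp : Continuous Complex.exp := Complex.continuous_exp
  have hM : Complex.exp '' N \ Ω = ∅ := by
    refine hH _ ((hN.image hexp).diff hΩ) disjoint_sdiff_left ?_ ?_
    · have : Ω ∪ Complex.exp '' N \ Ω = Complex.exp '' (V ∪ N) := by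
        rw [union_sdiff_self, image_union, h.mapsTo.image_subset.antisymm (h.surjOn hΩ hc h0)]
      rw [this]
      exact Complex.isOpenMap_exp _ hopen
    · rintro ⟨⟨ζ, -, hζ⟩, -⟩
      exact Complex.exp_ne_zero ζ hζ
  have hNU : ∀ ζ ∈ N, Complex.exp ζ ∈ Ω := fun ζ hζ => by
    by_contra hcon
    exact hM.subset ⟨⟨ζ, hζ, rfl⟩, hcon⟩
  have hNopen : IsOpen N := by
    refine isOpen_iff_mem_nhds.mpr fun ζ hζ => ?_
    have hζV : ζ ∉ V := hNV.notMem_of_mem_left hζ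
    obtain ⟨ε, hε, hB⟩ := Metric.isOpen_iff.mp (hΩ.preimage hexp) ζ (hNU ζ hζ)
    have hBV : Disjoint (ball ζ ε) V := by
      rw [Set.disjoint_iff_inter_eq_empty, ← not_nonempty_iff_eq_empty]
      exact fun hne => hζV (h.maximal _ (convex_ball ζ ε).isPreconnected hB hne
        (mem_ball_self hε))
    filter_upwards [ball_mem_nhds ζ hε, hopen.mem_nhds (Or.inr hζ)] with x hx1 hx2
    exact hx2.resolve_left (hBV.notMem_of_mem_left hx1)
  rcases isClopen_iff.mp ⟨hN.isClosed, hNopen⟩ with he | he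
  · exact he
  · exact absurd (he ▸ hN) (noncompact_univ ℂ)

theorem deck (h : IsLogComponent Ω V) {k : ℤ} {ζ : ℂ} (hζ : ζ ∈ V)
    (hk : ζ + k * (2 * Real.pi * Complex.I) ∈ V) {x : ℂ} (hx : x ∈ V) :
    x + k * (2 * Real.pi * Complex.I) ∈ V := by
  refine h.maximal ((fun x => x + k * (2 * Real.pi * Complex.I)) '' V)
    (h.isConnected.isPreconnected.image _ (by fun_prop)) ?_ ⟨_, ⟨ζ, hζ, rfl⟩, hk⟩ ⟨x, hx, rfl⟩
  rintro _ ⟨y, hy, rfl⟩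
  rw [Complex.exp_periodic.int_mul k y]
  exact h.mapsTo hy

/-- The translations by multiples of `2πi` that preserve the component. -/
def deckGroup (h : IsLogComponent Ω V) : AddSubgroup ℤ where
  carrier := {k | ∀ x ∈ V, x + k * (2 * Real.pi * Complex.I) ∈ V}
  zero_mem' := fun x hx => by simpa using hx
  add_mem' := fun {a b} ha hb x hx => by
    have := hb _ (ha x hx)
    rw [add_assoc, ← add_mul] at this
    exact_mod_cast this
  neg_mem' := fun {a} ha x hx => by
    refine h.deck (ζ := x + a * (2 * Real.pi * Complex.I)) (ha x hx) ?_ hx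
    convert hx using 1
    push_cast
    ring

theorem exists_generator (h : IsLogComponent Ω V) :
    ∃ m : ℤ, ∀ k : ℤ, (∀ x ∈ V, x + k * (2 * Real.pi * Complex.I) ∈ V) ↔ ∃ j : ℤ, k = j * m := by
  obtain ⟨m, hm⟩ := Int.subgroup_cyclic h.deckGroup
  refine ⟨m, fun k => ?_⟩
  change k ∈ h.deckGroup ↔ _
  rw [hm, AddSubgroup.mem_closure_singleton]
  exact ⟨fun ⟨j, hj⟩ => ⟨j, by simpa using hj.symm⟩, fun ⟨j, hj⟩ => ⟨j, by simpa using hj.symm⟩⟩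

/-- A function on the cover that factors through the exponential map descends to `Ω`. -/
theorem exists_descend (h : IsLogComponent Ω V) (hΩ : IsOpen Ω) (hc : IsPreconnected Ω)
    (h0 : (0 : ℂ) ∉ Ω) {F : ℂ → ℂ} (hF : DifferentiableOn ℂ F V)
    (hFe : ∀ x ∈ V, ∀ y ∈ V, Complex.exp x = Complex.exp y → F x = F y) :
    ∃ φ : ℂ → ℂ, DifferentiableOn ℂ φ Ω ∧ ∀ x ∈ V, φ (Complex.exp x) = F x := by
  have hsurj : ∀ w ∈ Ω, ∃ x ∈ V, Complex.exp x = w := fun w hw => h.surjOn hΩ hc h0 hw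
  choose! ℓ hℓV hℓe using hsurj
  refine ⟨fun w => F (ℓ w), fun w hw => ?_, fun x hx =>
    hFe _ (hℓV _ (h.mapsTo hx)) _ hx (hℓe _ (h.mapsTo hx))⟩
  have hw0 : w ≠ 0 := fun h => h0 (h ▸ hw)
  obtain ⟨ε, hε, hB⟩ := Metric.isOpen_iff.mp hΩ w hw
  have hε' : 0 < min ε ‖w‖ := lt_min hε (norm_pos_iff.mpr hw0)
  have hB' := (ball_subset_ball (min_le_left ε ‖w‖)).trans hB
  obtain ⟨L, hLd, hLe, hLV⟩ := h.exists_lift hw0 (min_le_right _ _) hB' (hℓV _ hw)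
    (by rw [hℓe _ hw]; exact mem_ball_self hε')
  have hnhds := ball_mem_nhds w hε'
  refine DifferentiableAt.differentiableWithinAt ?_
  refine ((hF.comp hLd hLV).differentiableAt hnhds).congr_of_eventuallyEq ?_
  filter_upwards [hnhds] with u hu
  exact hFe _ (hℓV _ (hB' hu)) _ (hLV hu) (by rw [hℓe _ (hB' hu), hLe u hu])

end IsLogComponent

/-- A domain omitting `0`, all of whose compact holes contain `0`, is conformally equivalent to the
disk or to an annulus, unless it is the punctured plane. -/
theorem uniformization_of_zero_notMem {Ω : Set ℂ} (hΩ : IsOpen Ω) (hc : IsConnected Ω)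
    (h0 : (0 : ℂ) ∉ Ω) (hne : Ω ≠ {0}ᶜ)
    (hH : ∀ M : Set ℂ, IsCompact M → Disjoint M Ω → IsOpen (Ω ∪ M) → (0 : ℂ) ∉ M → M = ∅) :
    (∃ φ ψ, IsConformalEquiv φ ψ Ω (ball 0 1)) ∨
      ∃ r : ℝ, 0 ≤ r ∧ r < 1 ∧ ∃ φ ψ, IsConformalEquiv φ ψ Ω (annulus r) := by
  obtain ⟨V, hV⟩ := exists_isLogComponent hΩ hc.nonempty h0
  have hsurj := hV.surjOn hΩ hc.isPreconnected h0
  have hVne : V ≠ univ := fun he => hne (by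
    rw [← hV.mapsTo.image_subset.antisymm hsurj, he, image_univ, Complex.range_exp])
  obtain ⟨f, ψ, hf⟩ := exists_isConformalEquiv_ball hV.isOpen hV.isConnected
    (hV.noCompactHoles hΩ hc.isPreconnected h0 hH) hVne
  have hexpd : DifferentiableOn ℂ Complex.exp V := Complex.differentiable_exp.differentiableOn
  obtain ⟨m, hm⟩ := hV.exists_generator
  have hdeck : ∀ x ∈ V, ∀ y ∈ V, Complex.exp x = Complex.exp y →
      ∃ j : ℤ, x = y + ((j * m : ℤ) : ℂ) * (2 * Real.pi * Complex.I) := by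
    intro x hx y hy hxy
    obtain ⟨k, hk⟩ := Complex.exp_eq_exp_iff_exists_int.mp hxy
    obtain ⟨j, hj⟩ := (hm k).mp fun v hv => hV.deck hy (hk ▸ hx) hv
    exact ⟨j, by rw [← hj]; exact hk⟩
  -- Without deck translations `exp` is injective on `V` and `Ω` is conformally a disk.
  by_cases hm0 : m = 0
  · left
    have hinj : InjOn Complex.exp V := fun x hx y hy hxy => by
      obtain ⟨j, hj⟩ := hdeck x hx y hy hxy
      rw [hm0] at hj
      simpa using hj
    obtain ⟨ℓ, hℓ⟩ := exists_isConformalEquiv hV.isOpen hexpd hinj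
    rw [hV.mapsTo.image_subset.antisymm hsurj] at hℓ
    exact ⟨_, _, hℓ.symm.trans hf⟩
  · right
    have h2pi : (2 * Real.pi * Complex.I : ℂ) ≠ 0 := Complex.two_pi_I_ne_zero
    have hT : IsConformalEquiv (fun x => x + m * (2 * Real.pi * Complex.I))
        (fun x => x - m * (2 * Real.pi * Complex.I)) V V := by
      refine ⟨by fun_prop, by fun_prop, (hm m).mpr ⟨1, by ring⟩, fun x hx => ?_,
        fun x _ => by simp, fun x _ => by simp⟩
      have := (hm (-m)).mpr ⟨-1, by ring⟩ x hx
      push_cast at this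
      rwa [neg_mul, ← sub_eq_add_neg] at this
    -- The generating deck translation seen in the disk. It has no fixed points because `m ≠ 0`.
    have hτ := (hf.symm.trans hT).trans hf
    obtain ⟨r, hr0, hr1, Ψ, Ψ', hΨ, s, hs, hΨτ⟩ := exists_conj_strip_translation hτ
      (fun w hw he => by
        have h1 := hf.injOn (hT.mapsTo (hf.mapsTo_symm hw)) (hf.mapsTo_symm hw)
          (by rw [hf.right_inv w hw]; exact he)
        simp [hm0, Real.pi_ne_zero] at h1)
    have hG := hf.trans hΨ
    set G := Ψ ∘ f with hGdef
    have hGT : ∀ x ∈ V, G (x + m * (2 * Real.pi * Complex.I)) =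
        G x + s * (2 * Real.pi * Complex.I) := fun x hx => by
      have := hΨτ (f x) (hf.mapsTo hx)
      simp only [Function.comp_apply, hf.left_inv x hx] at this
      exact this
    have hmem : ∀ (j : ℤ), ∀ x ∈ V, x + ((j * m : ℤ) : ℂ) * (2 * Real.pi * Complex.I) ∈ V :=
      fun j => (hm (j * m)).mpr ⟨j, rfl⟩
    have hGj : ∀ j : ℤ, ∀ x ∈ V, G (x + ((j * m : ℤ) : ℂ) * (2 * Real.pi * Complex.I)) =
        G x + ((j * s : ℤ) : ℂ) * (2 * Real.pi * Complex.I) := by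
      intro j
      induction j with
      | zero => simp
      | succ n ih =>
        intro x hx
        have h1 := hGT _ (hmem n x hx)
        rw [ih x hx] at h1
        convert h1 using 1
        · congr 1; push_cast; ring
        · push_cast; ring
      | pred n ih =>
        intro x hx
        have h1 := hGT _ (hmem (-n - 1) x hx)
        have e : x + (((-n - 1 : ℤ) * m : ℤ) : ℂ) * (2 * Real.pi * Complex.I) +
            m * (2 * Real.pi * Complex.I) =
            x + (((-n : ℤ) * m : ℤ) : ℂ) * (2 * Real.pi * Complex.I) := by push_cast; ring
        rw [e, ih x hx] at h1
        push_cast at h1 ⊢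
        linear_combination -h1
    -- `G` turns the deck translations into multiples of `2πi`, so `exp ∘ G` factors through `exp`.
    -- As `s = ±1`, every multiple of `2πi` arises, which gives injectivity of `φ`.
    obtain ⟨φ, hφd, hφ⟩ := hV.exists_descend hΩ hc.isPreconnected h0
      (F := fun x => Complex.exp (G x)) hG.diff.cexp fun x hx y hy hxy => by
        obtain ⟨j, hj⟩ := hdeck x hx y hy hxy
        rw [hj, hGj j y hy]
        exact Complex.exp_periodic.int_mul _ _
    have hφinj : InjOn φ Ω := by
      intro u hu v hv huv
      obtain ⟨x, hx, rfl⟩ := hsurj hu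
      obtain ⟨y, hy, rfl⟩ := hsurj hv
      rw [hφ x hx, hφ y hy] at huv
      obtain ⟨n, hn⟩ := Complex.exp_eq_exp_iff_exists_int.mp huv
      have hss : s * s = 1 := by rcases hs with rfl | rfl <;> rfl
      have h1 : G x = G (y + (((n * s : ℤ) * m : ℤ) : ℂ) * (2 * Real.pi * Complex.I)) := by
        rw [hGj _ y hy, hn, mul_assoc n s s, hss, mul_one]
      rw [hG.injOn hx (hmem _ y hy) h1]
      exact Complex.exp_periodic.int_mul _ _
    have himage : φ '' Ω = annulus r := by
      refine Subset.antisymm ?_ fun w hw => ?_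
      · rintro _ ⟨u, hu, rfl⟩
        obtain ⟨x, hx, rfl⟩ := hsurj hu
        rw [hφ x hx]
        exact hG.mapsTo hx
      · have hw0 : w ≠ 0 := norm_pos_iff.mp (hr0.trans_lt hw.1)
        have hl : Complex.log w ∈ strip r := by
          change Complex.exp (Complex.log w) ∈ annulus r
          rwa [Complex.exp_log hw0]
        refine ⟨_, hV.mapsTo (hG.mapsTo_symm hl), ?_⟩
        rw [hφ _ (hG.mapsTo_symm hl), hG.right_inv _ hl, Complex.exp_log hw0]
    obtain ⟨χ, hχ⟩ := exists_isConformalEquiv hΩ hφd hφinj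
    exact ⟨r, hr0, hr1, φ, χ, himage ▸ hχ⟩

theorem uniformization {Ω : Set ℂ} {p : ℂ} (hΩ : IsOpen Ω) (hc : IsConnected Ω)
    (hp : p ∉ Ω) (hne : Ω ≠ {p}ᶜ)
    (hH : ∀ M : Set ℂ, IsCompact M → Disjoint M Ω → IsOpen (Ω ∪ M) → p ∉ M → M = ∅) :
    (∃ φ ψ, IsConformalEquiv φ ψ Ω (ball 0 1)) ∨
      ∃ r : ℝ, 0 ≤ r ∧ r < 1 ∧ ∃ φ ψ, IsConformalEquiv φ ψ Ω (annulus r) := by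
  let e : ℂ ≃ₜ ℂ := Homeomorph.addRight p
  set Ω' : Set ℂ := e ⁻¹' Ω with hΩ'
  have hmem : ∀ x, x ∈ Ω' ↔ x + p ∈ Ω := fun x => Iff.rfl
  have hT : IsConformalEquiv (fun x => x - p) (fun x => x + p) Ω Ω' :=
    ⟨by fun_prop, by fun_prop, fun x hx => by simpa [hmem] using hx, fun x hx => hx,
      fun x _ => by ring, fun x _ => by ring⟩
  have h1 := uniformization_of_zero_notMem (Ω := Ω') (hΩ.preimage e.continuous)
    (by rw [← hT.image_eq]; exact hc.image _ (by fun_prop)) (by simpa [hmem] using hp)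
    (fun he => hne (by
      ext x
      have := Set.ext_iff.mp he (x - p)
      simpa [hmem, sub_eq_zero] using this))
    fun M hM hMΩ hopen h0 => by
      have h2 := hH (e '' M) (hM.image e.continuous) ?_ ?_ ?_
      · simpa using h2
      · rw [Set.disjoint_left] at hMΩ ⊢
        rintro _ ⟨x, hx, rfl⟩ hxΩ
        exact hMΩ hx hxΩ
      · have : Ω ∪ e '' M = e '' (Ω' ∪ M) := by
          rw [image_union, image_preimage_eq _ e.surjective]
        rw [this]
        exact e.isOpenMap _ hopen
      · rintro ⟨x, hx, hxp⟩
        have : x = 0 := by simpa [e] using hxp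
        exact h0 (this ▸ hx)
  rcases h1 with ⟨φ, ψ, h⟩ | ⟨r, h0, h1, φ, ψ, h⟩
  · exact Or.inl ⟨_, _, hT.trans h⟩
  · exact Or.inr ⟨r, h0, h1, _, _, hT.trans h⟩

/-! ### Ends -/

/-- A filter on `A` with a base of connected sets that leaves every compact subset of `A`. -/
structure IsEnd (A : Set ℂ) (E : Filter ℂ) : Prop where
  neBot : E.NeBot
  exists_preconnected : ∀ S ∈ E, ∃ T ∈ E, T ⊆ S ∧ T ⊆ A ∧ IsPreconnected T
  notMem : ∀ C : Set ℂ, IsCompact C → C ⊆ A → ∀ᶠ w in E, w ∉ C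

theorem exists_of_mem_outerEnd {S : Set ℂ} (hS : S ∈ outerEnd) :
    ∃ l < 1, ∀ w : ℂ, l < ‖w‖ → ‖w‖ < 1 → w ∈ S := by
  have h1 : ∀ᶠ t in 𝓝[<] (1 : ℝ), ∀ w : ℂ, ‖w‖ = t → w ∈ S := eventually_outerEnd.mp hS
  obtain ⟨l, hl, hsub⟩ := (mem_nhdsLT_iff_exists_Ioo_subset (a := (1 : ℝ))).mp h1
  exact ⟨l, hl, fun w h2 h3 => hsub ⟨h2, h3⟩ w rfl⟩

theorem exists_of_mem_innerEnd {r : ℝ} {S : Set ℂ} (hS : S ∈ innerEnd r) :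
    ∃ l > r, ∀ w : ℂ, r < ‖w‖ → ‖w‖ < l → w ∈ S := by
  have h1 : ∀ᶠ t in 𝓝[>] r, ∀ w : ℂ, ‖w‖ = t → w ∈ S := eventually_innerEnd.mp hS
  obtain ⟨l, hl, hsub⟩ := (mem_nhdsGT_iff_exists_Ioo_subset (a := r)).mp h1
  exact ⟨l, hl, fun w h2 h3 => hsub ⟨h2, h3⟩ w rfl⟩

theorem isEnd_outerEnd {r : ℝ} (hr : r < 1) : IsEnd (annulus r) outerEnd := by
  refine ⟨outerEnd_neBot, fun S hS => ?_, fun C hC hCA => eventually_outerEnd_notMem hC hCA⟩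
  obtain ⟨l, hl, hlS⟩ := exists_of_mem_outerEnd hS
  refine ⟨{w | max l (max r 0) < ‖w‖ ∧ ‖w‖ < 1}, ?_, fun w hw => ?_, fun w hw => ?_,
    isPreconnected_norm_Ioo ((le_max_right _ _).trans (le_max_right _ _)) _⟩
  · refine eventually_outerEnd.mpr ?_
    filter_upwards [Ioo_mem_nhdsLT (max_lt hl (max_lt hr one_pos))] with t ht w hw
    rw [← hw] at ht
    exact ht
  · exact hlS w ((le_max_left _ _).trans_lt hw.1) hw.2
  · exact ⟨((le_max_left _ _).trans (le_max_right _ _)).trans_lt hw.1, hw.2⟩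

theorem isEnd_innerEnd {r : ℝ} (hr0 : 0 ≤ r) (hr : r < 1) : IsEnd (annulus r) (innerEnd r) := by
  refine ⟨innerEnd_neBot hr0, fun S hS => ?_, fun C hC hCA => eventually_innerEnd_notMem hC hCA⟩
  obtain ⟨l, hl, hlS⟩ := exists_of_mem_innerEnd hS
  refine ⟨{w | r < ‖w‖ ∧ ‖w‖ < min l 1}, ?_, fun w hw => ?_, fun w hw => ?_,
    isPreconnected_norm_Ioo hr0 _⟩
  · refine eventually_innerEnd.mpr ?_
    filter_upwards [Ioo_mem_nhdsGT (lt_min hl hr)] with t ht w hw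
    rw [← hw] at ht
    exact ht
  · exact hlS w hw.1 (hw.2.trans_le (min_le_left _ _))
  · exact ⟨hw.1, hw.2.trans_le (min_le_right _ _)⟩

theorem exists_isCompact_annulus {r : ℝ} {S T : Set ℂ} (hS : S ∈ outerEnd) (hT : T ∈ innerEnd r) :
    ∃ Q : Set ℂ, IsCompact Q ∧ Q ⊆ annulus r ∧ annulus r ⊆ S ∪ T ∪ Q := by
  obtain ⟨l, hl, hlS⟩ := exists_of_mem_outerEnd hS
  obtain ⟨u, hu, huT⟩ := exists_of_mem_innerEnd hT
  refine ⟨{w | u ≤ ‖w‖ ∧ ‖w‖ ≤ l}, ?_, fun w hw => ⟨hu.trans_le hw.1, hw.2.trans_lt hl⟩,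
    fun w hw => ?_⟩
  · refine (isCompact_closedBall (0 : ℂ) l).of_isClosed_subset ?_ fun w hw => by
      simpa using hw.2
    exact (isClosed_le continuous_const continuous_norm).inter
      (isClosed_le continuous_norm continuous_const)
  · rcases lt_or_ge l ‖w‖ with h1 | h1
    · exact Or.inl (Or.inl (hlS w h1 hw.2))
    · rcases lt_or_ge ‖w‖ u with h2 | h2
      · exact Or.inl (Or.inr (huT w hw.1 h2))
      · exact Or.inr ⟨h2, h1⟩

/-- Lets the statement about the outer end of an annulus be used for the disk. -/
theorem annulus_neg_one : annulus (-1) = ball 0 1 := by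
  ext w
  rw [mem_annulus, mem_ball_zero_iff]
  exact ⟨fun h => h.2, fun h => ⟨by linarith [norm_nonneg w], h⟩⟩

theorem exists_isCompact_ball {S : Set ℂ} (hS : S ∈ outerEnd) :
    ∃ Q : Set ℂ, IsCompact Q ∧ Q ⊆ ball 0 1 ∧ ball 0 1 ⊆ S ∪ S ∪ Q := by
  obtain ⟨l, hl, hlS⟩ := exists_of_mem_outerEnd hS
  refine ⟨closedBall 0 l, isCompact_closedBall _ _, closedBall_subset_ball hl, fun w hw => ?_⟩
  rw [mem_ball_zero_iff] at hw
  rcases lt_or_ge l ‖w‖ with h1 | h1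
  · exact Or.inl (Or.inl (hlS w h1 hw))
  · exact Or.inr (by simpa using h1)

/-! ### The two components of the complement and the ends of the domain -/

/-- The complement of `Ω` in the sphere is the disjoint union of two nonempty closed sets. -/
structure IsComplPair (Ω : Set ℂ) (K L : Set (OnePoint ℂ)) : Prop where
  isClosed_left : IsClosed K
  isClosed_right : IsClosed L
  nonempty_left : K.Nonempty
  nonempty_right : L.Nonempty
  disjoint : Disjoint K L
  union_eq : K ∪ L = sphereCompl Ω

theorem isCompact_coe_preimage {C : Set (OnePoint ℂ)} (hC : IsClosed C)
    (h : OnePoint.infty ∉ C) : IsCompact ((fun w : ℂ => (w : OnePoint ℂ)) ⁻¹' C) := by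
  refine OnePoint.isOpenEmbedding_coe.isInducing.isCompact_preimage_iff ?_ |>.mpr hC.isCompact
  intro x hx
  induction x with
  | infty => exact absurd hx h
  | coe x => exact ⟨x, rfl⟩

/-- The component `K` of the complement of `Ω` corresponds to the end `E` under the conformal map
`φ` with inverse `ψ`. -/
structure CorrespondsToEnd (Ω : Set ℂ) (φ ψ : ℂ → ℂ) (K : Set (OnePoint ℂ)) (E : Filter ℂ) :
    Prop where
  eventually_mem : ∀ U : Set (OnePoint ℂ), IsOpen U → K ⊆ U →
    ∀ᶠ w in E, ((ψ w : ℂ) : OnePoint ℂ) ∈ U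
  tendsto : ∀ q ∈ K, Tendsto φ (comap (fun w : ℂ => (w : OnePoint ℂ)) (𝓝 q) ⊓ 𝓟 Ω) E

namespace IsComplPair

variable {Ω A : Set ℂ} {K L : Set (OnePoint ℂ)} {φ ψ : ℂ → ℂ} {E F : Filter ℂ}

theorem symm (h : IsComplPair Ω K L) : IsComplPair Ω L K :=
  ⟨h.isClosed_right, h.isClosed_left, h.nonempty_right, h.nonempty_left, h.disjoint.symm,
    by rw [union_comm, h.union_eq]⟩

theorem coe_mem (h : IsComplPair Ω K L) {w : ℂ} :
    (w : OnePoint ℂ) ∈ K ∪ L ↔ w ∉ Ω := by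
  rw [h.union_eq, sphereCompl, mem_compl_iff, OnePoint.coe_injective.mem_set_image]

theorem isOpen (h : IsComplPair Ω K L) : IsOpen Ω := by
  have : Ω = (fun w : ℂ => (w : OnePoint ℂ)) ⁻¹' (K ∪ L)ᶜ := by
    ext w
    rw [mem_preimage, mem_compl_iff, h.coe_mem, not_not]
  rw [this]
  exact (h.isClosed_left.union h.isClosed_right).isOpen_compl.preimage OnePoint.continuous_coe

theorem infty_mem (h : IsComplPair Ω K L) : OnePoint.infty ∈ K ∪ L := by
  rw [h.union_eq, sphereCompl]
  rintro ⟨w, -, hw⟩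
  exact OnePoint.coe_ne_infty w hw

theorem exists_separation (h : IsComplPair Ω K L) :
    ∃ U V : Set (OnePoint ℂ), IsOpen U ∧ IsOpen V ∧ K ⊆ U ∧ L ⊆ V ∧ Disjoint U V :=
  normal_separation h.isClosed_left h.isClosed_right h.disjoint

/-- What is left of the sphere outside `U ∪ V` is a compact subset of `Ω`, which the end eventually
leaves. Connected members of the end then lie on one side. -/
theorem eventually_or (h : IsComplPair Ω K L) (hφ : IsConformalEquiv φ ψ Ω A) (hE : IsEnd A E)
    {U V : Set (OnePoint ℂ)} (hU : IsOpen U) (hV : IsOpen V) (hKU : K ⊆ U) (hLV : L ⊆ V)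
    (hUV : Disjoint U V) :
    (∀ᶠ w in E, ((ψ w : ℂ) : OnePoint ℂ) ∈ U) ∨ ∀ᶠ w in E, ((ψ w : ℂ) : OnePoint ℂ) ∈ V := by
  set C : Set ℂ := (fun w : ℂ => (w : OnePoint ℂ)) ⁻¹' (U ∪ V)ᶜ with hCdef
  have hKL : K ∪ L ⊆ U ∪ V := union_subset_union hKU hLV
  have hC : IsCompact C := isCompact_coe_preimage (hU.union hV).isClosed_compl
    fun hcon => hcon (hKL h.infty_mem)
  have hCΩ : C ⊆ Ω := fun w hw => by
    by_contra hcon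
    exact hw (hKL (h.coe_mem.mpr hcon))
  have hS := hE.notMem (φ '' C) (hC.image_of_continuousOn (hφ.diff.continuousOn.mono hCΩ))
    (image_subset_iff.mpr fun w hw => hφ.mapsTo (hCΩ hw))
  obtain ⟨T, hT, hTS, hTA, hTc⟩ := hE.exists_preconnected _ hS
  have hcont : ContinuousOn (fun w => ((ψ w : ℂ) : OnePoint ℂ)) T :=
    OnePoint.continuous_coe.comp_continuousOn (hφ.diff_symm.continuousOn.mono hTA)
  have hsub : (fun w => ((ψ w : ℂ) : OnePoint ℂ)) '' T ⊆ U ∪ V := by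
    rintro _ ⟨w, hw, rfl⟩
    by_contra hcon
    exact hTS hw ⟨ψ w, hcon, hφ.right_inv w (hTA hw)⟩
  have hpc := hTc.image _ hcont
  rcases (isPreconnected_iff_subset_of_disjoint.mp hpc) U V hU hV hsub
    (by rw [hUV.inter_eq, inter_empty]) with h1 | h1
  · exact Or.inl (mem_of_superset hT fun w hw => h1 ⟨w, hw, rfl⟩)
  · exact Or.inr (mem_of_superset hT fun w hw => h1 ⟨w, hw, rfl⟩)

theorem frontier_subset (h : IsComplPair Ω K L) : frontier K ⊆ K :=
  h.isClosed_left.frontier_subset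

theorem ne_univ (h : IsComplPair Ω K L) : K ≠ univ := fun hK => by
  obtain ⟨q, hq⟩ := h.nonempty_right
  exact h.disjoint.notMem_of_mem_right hq (hK ▸ mem_univ q)

theorem frontier_nonempty (h : IsComplPair Ω K L) : (frontier K).Nonempty :=
  nonempty_frontier_iff.mpr ⟨h.nonempty_left, h.ne_univ⟩

theorem exists_mem_of_frontier (h : IsComplPair Ω K L) {q : OnePoint ℂ} (hq : q ∈ frontier K)
    {N : Set (OnePoint ℂ)} (hN : N ∈ 𝓝 q) : ∃ w ∈ Ω, (w : OnePoint ℂ) ∈ N := by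
  have hqL : q ∉ L := h.disjoint.notMem_of_mem_left (h.frontier_subset hq)
  have h1 : N ∩ Lᶜ ∈ 𝓝 q := inter_mem hN (h.isClosed_right.isOpen_compl.mem_nhds hqL)
  have h2 : ¬ N ∩ Lᶜ ⊆ K := fun hsub =>
    (frontier_eq_closure_inter_closure (s := K) ▸ hq : q ∈ closure K ∩ closure Kᶜ).2 |>
      fun h3 => by
        rw [mem_closure_iff_nhds] at h3
        obtain ⟨x, hx, hxK⟩ := h3 _ h1
        exact hxK (hsub hx)
  obtain ⟨x, hx, hxK⟩ := not_subset.mp h2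
  have hx' : x ∉ K ∪ L := fun h3 => h3.elim hxK hx.2
  induction x with
  | infty => exact absurd h.infty_mem hx'
  | coe x => exact ⟨x, not_not.mp (mt h.coe_mem.mpr hx'), hx.1⟩

/-- Otherwise all of `Ω` outside a compact subset would lie in `U`, and `Ω` could not accumulate at
the frontier of `L`. -/
theorem not_both (h : IsComplPair Ω K L) (hφ : IsConformalEquiv φ ψ Ω A)
    (hEF : ∀ S ∈ E, ∀ T ∈ F, ∃ Q : Set ℂ, IsCompact Q ∧ Q ⊆ A ∧ A ⊆ S ∪ T ∪ Q)
    {U V : Set (OnePoint ℂ)} (hV : IsOpen V) (hLV : L ⊆ V)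
    (hUV : Disjoint U V) (hE : ∀ᶠ w in E, ((ψ w : ℂ) : OnePoint ℂ) ∈ U)
    (hF : ∀ᶠ w in F, ((ψ w : ℂ) : OnePoint ℂ) ∈ U) : False := by
  obtain ⟨Q, hQ, hQA, hcov⟩ := hEF _ hE _ hF
  obtain ⟨q, hq⟩ := h.symm.frontier_nonempty
  have hqL := h.symm.frontier_subset hq
  set P : Set (OnePoint ℂ) := (fun w => ((ψ w : ℂ) : OnePoint ℂ)) '' Q with hP
  have hPc : IsClosed P := (hQ.image_of_continuousOn
    (OnePoint.continuous_coe.comp_continuousOn (hφ.diff_symm.continuousOn.mono hQA))).isClosed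
  have hqP : q ∉ P := by
    rintro ⟨w, hw, rfl⟩
    exact h.coe_mem.mp (Or.inr hqL) (hφ.mapsTo_symm (hQA hw))
  obtain ⟨w, hw, hwN⟩ := h.symm.exists_mem_of_frontier hq
    (inter_mem (hV.mem_nhds (hLV hqL)) (hPc.isOpen_compl.mem_nhds hqP))
  have hwU : (w : OnePoint ℂ) ∉ U := hUV.notMem_of_mem_right hwN.1
  rcases hcov (hφ.mapsTo hw) with (h1 | h1) | h1
  · exact hwU (by simpa only [mem_ofPred_eq, hφ.left_inv w hw] using h1)
  · exact hwU (by simpa only [mem_ofPred_eq, hφ.left_inv w hw] using h1)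
  · exact hwN.2 ⟨φ w, h1, by simp only [hφ.left_inv w hw]⟩

/-- Points of `Ω` near `K` avoid both the compact middle part and `V`, so they lie near the end `E`.
Conversely the end enters any neighbourhood of `K`, since the alternative in `eventually_or` would
send it into `V`. -/
theorem correspondsToEnd (h : IsComplPair Ω K L) (hφ : IsConformalEquiv φ ψ Ω A) (hE : IsEnd A E)
    (hEF : ∀ S ∈ E, ∀ T ∈ F, ∃ Q : Set ℂ, IsCompact Q ∧ Q ⊆ A ∧ A ⊆ S ∪ T ∪ Q)
    {U V : Set (OnePoint ℂ)} (hU : IsOpen U) (hV : IsOpen V) (hKU : K ⊆ U) (hLV : L ⊆ V)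
    (hUV : Disjoint U V) (hEU : ∀ᶠ w in E, ((ψ w : ℂ) : OnePoint ℂ) ∈ U)
    (hFV : ∀ᶠ w in F, ((ψ w : ℂ) : OnePoint ℂ) ∈ V) : CorrespondsToEnd Ω φ ψ K E := by
  have := hE.neBot
  refine ⟨fun W hW hKW => ?_, fun q hq S hS => ?_⟩
  · rcases h.eventually_or hφ hE (hW.inter hU) hV (subset_inter hKW hKU) hLV
      (hUV.mono_left inter_subset_right) with h1 | h1
    · exact h1.mono fun w hw => hw.1
    · obtain ⟨w, hw1, hw2⟩ := (h1.and hEU).exists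
      exact absurd hw1 (hUV.notMem_of_mem_left hw2)
  · obtain ⟨Q, hQ, hQA, hcov⟩ := hEF S hS _ hFV
    set P : Set (OnePoint ℂ) := (fun w => ((ψ w : ℂ) : OnePoint ℂ)) '' Q with hP
    have hPc : IsClosed P := (hQ.image_of_continuousOn
      (OnePoint.continuous_coe.comp_continuousOn (hφ.diff_symm.continuousOn.mono hQA))).isClosed
    have hqP : q ∉ P := by
      rintro ⟨w, hw, rfl⟩
      exact h.coe_mem.mp (Or.inl hq) (hφ.mapsTo_symm (hQA hw))
    have hN := inter_mem (hU.mem_nhds (hKU hq)) (hPc.isOpen_compl.mem_nhds hqP)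
    refine mem_map.mpr (mem_of_superset (inter_mem_inf (preimage_mem_comap hN)
      (mem_principal_self Ω)) ?_)
    rintro w ⟨hwN, hw⟩
    rcases hcov (hφ.mapsTo hw) with (h1 | h1) | h1
    · exact h1
    · exact absurd (by simpa only [mem_ofPred_eq, hφ.left_inv w hw] using h1)
        (hUV.notMem_of_mem_left hwN.1)
    · exact absurd ⟨φ w, h1, by simp only [hφ.left_inv w hw]⟩ hwN.2

theorem exists_correspondsToEnd (h : IsComplPair Ω K L) (hφ : IsConformalEquiv φ ψ Ω A)
    (hE : IsEnd A E) (hF : IsEnd A F)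
    (hEF : ∀ S ∈ E, ∀ T ∈ F, ∃ Q : Set ℂ, IsCompact Q ∧ Q ⊆ A ∧ A ⊆ S ∪ T ∪ Q) :
    (CorrespondsToEnd Ω φ ψ K E ∧ CorrespondsToEnd Ω φ ψ L F) ∨
      (CorrespondsToEnd Ω φ ψ L E ∧ CorrespondsToEnd Ω φ ψ K F) := by
  obtain ⟨U, V, hU, hV, hKU, hLV, hUV⟩ := h.exists_separation
  have hFE : ∀ S ∈ F, ∀ T ∈ E, ∃ Q : Set ℂ, IsCompact Q ∧ Q ⊆ A ∧ A ⊆ S ∪ T ∪ Q :=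
    fun S hS T hT => by
      obtain ⟨Q, h1, h2, h3⟩ := hEF T hT S hS
      exact ⟨Q, h1, h2, by rwa [union_comm S T]⟩
  rcases h.eventually_or hφ hE hU hV hKU hLV hUV with h1 | h1 <;>
    rcases h.eventually_or hφ hF hU hV hKU hLV hUV with h2 | h2
  · exact (h.not_both hφ hEF hV hLV hUV h1 h2).elim
  · exact Or.inl ⟨h.correspondsToEnd hφ hE hEF hU hV hKU hLV hUV h1 h2,
      h.symm.correspondsToEnd hφ hF hFE hV hU hLV hKU hUV.symm h2 h1⟩
  · exact Or.inr ⟨h.symm.correspondsToEnd hφ hE hEF hV hU hLV hKU hUV.symm h1 h2,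
      h.correspondsToEnd hφ hF hFE hU hV hKU hLV hUV h2 h1⟩
  · exact (h.symm.not_both hφ hEF hU hKU hUV.symm h1 h2).elim

/-- A domain with two complementary components is not conformally equivalent to the disk. -/
theorem not_isConformalEquiv_ball (h : IsComplPair Ω K L)
    (hφ : IsConformalEquiv φ ψ Ω (ball 0 1)) : False := by
  obtain ⟨U, V, hU, hV, hKU, hLV, hUV⟩ := h.exists_separation
  have hE : IsEnd (ball 0 1) outerEnd := by
    rw [← annulus_neg_one]
    exact isEnd_outerEnd (by norm_num)
  have hEE : ∀ S ∈ outerEnd, ∀ T ∈ outerEnd, ∃ Q : Set ℂ, IsCompact Q ∧ Q ⊆ ball 0 1 ∧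
      ball 0 1 ⊆ S ∪ T ∪ Q := fun S hS T hT => by
    obtain ⟨Q, h1, h2, h3⟩ := exists_isCompact_ball (inter_mem hS hT)
    exact ⟨Q, h1, h2, h3.trans (union_subset_union_left _
      (union_subset_union inter_subset_left inter_subset_right))⟩
  rcases h.eventually_or hφ hE hU hV hKU hLV hUV with h1 | h1
  · exact h.not_both hφ hEE hV hLV hUV h1 h1
  · exact h.symm.not_both hφ hEE hU hKU hUV.symm h1 h1

end IsComplPair

/-! ### Limits at the ends -/

namespace CorrespondsToEnd

variable {Ω A : Set ℂ} {K L : Set (OnePoint ℂ)} {φ ψ : ℂ → ℂ} {E : Filter ℂ}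

theorem exists_tendsto_ultrafilter (hK : CorrespondsToEnd Ω φ ψ K E) (h : IsComplPair Ω K L)
    (hφ : IsConformalEquiv φ ψ Ω A) (hA : ∀ᶠ w in E, w ∈ A) (𝒰 : Ultrafilter ℂ) (h𝒰 : ↑𝒰 ≤ E) :
    ∃ q ∈ frontier K, Tendsto (fun w => ((ψ w : ℂ) : OnePoint ℂ)) 𝒰 (𝓝 q) := by
  obtain ⟨q, -, hq⟩ := isCompact_univ.ultrafilter_le_nhds
    (𝒰.map fun w => ((ψ w : ℂ) : OnePoint ℂ)) (by simp)
  have hq' : Tendsto (fun w => ((ψ w : ℂ) : OnePoint ℂ)) 𝒰 (𝓝 q) := hq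
  refine ⟨q, ?_, hq'⟩
  have hqK : q ∈ K := by
    by_contra hcon
    obtain ⟨U, V, hU, hV, hKU, hqV, hUV⟩ :=
      SeparatedNhds.of_isCompact_isCompact (h.isClosed_left.isCompact) (isCompact_singleton (x := q))
        (disjoint_singleton_right.mpr hcon)
    obtain ⟨w, h1, h2⟩ := (((hK.eventually_mem U hU hKU).filter_mono h𝒰).and
      (hq'.eventually (hV.mem_nhds (hqV rfl)))).exists
    exact hUV.notMem_of_mem_left h1 h2
  refine ⟨subset_closure hqK, fun hint => ?_⟩
  obtain ⟨w, h1, h2⟩ := ((hq'.eventually (mem_interior_iff_mem_nhds.mp hint)).and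
    (hA.filter_mono h𝒰)).exists
  exact h.coe_mem.mp (Or.inl h1) (hφ.mapsTo_symm h2)

theorem tendsto_of_subsingleton (hK : CorrespondsToEnd Ω φ ψ K E) (h : IsComplPair Ω K L)
    (hφ : IsConformalEquiv φ ψ Ω A) (hA : ∀ᶠ w in E, w ∈ A) (hs : ¬ (frontier K).Nontrivial) :
    ∃ q, Tendsto (fun w => ((ψ w : ℂ) : OnePoint ℂ)) E (𝓝 q) := by
  obtain ⟨q, hq⟩ := h.frontier_nonempty
  refine ⟨q, tendsto_iff_ultrafilter _ _ _ |>.mpr fun 𝒰 h𝒰 => ?_⟩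
  obtain ⟨q', hq', ht⟩ := hK.exists_tendsto_ultrafilter h hφ hA 𝒰 h𝒰
  rwa [not_nontrivial_iff.mp hs hq hq']

/-- Every frontier point is a limit of points of `Ω`; their images tend to the end, along which `ψ`
has the limit `q`. -/
theorem subsingleton_of_tendsto (hK : CorrespondsToEnd Ω φ ψ K E) (h : IsComplPair Ω K L)
    (hφ : IsConformalEquiv φ ψ Ω A) {q : OnePoint ℂ}
    (hq : Tendsto (fun w => ((ψ w : ℂ) : OnePoint ℂ)) E (𝓝 q)) : (frontier K).Subsingleton := by
  have key : ∀ q' ∈ frontier K, q' = q := fun q' hq' => by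
    set G : Filter ℂ := comap (fun w : ℂ => (w : OnePoint ℂ)) (𝓝 q') ⊓ 𝓟 Ω with hG
    have hne : G.NeBot := by
      refine inf_principal_neBot_iff.mpr fun S hS => ?_
      obtain ⟨N, hN, hNS⟩ := mem_comap.mp hS
      obtain ⟨w, hw, hwN⟩ := h.exists_mem_of_frontier hq' hN
      exact ⟨w, hNS hwN, hw⟩
    have h1 : Tendsto (fun w : ℂ => (w : OnePoint ℂ)) G (𝓝 q') := tendsto_comap.mono_left inf_le_left
    have h2 : Tendsto (fun w => ((ψ (φ w) : ℂ) : OnePoint ℂ)) G (𝓝 q) :=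
      hq.comp (hK.tendsto q' (h.frontier_subset hq'))
    refine tendsto_nhds_unique h1 (h2.congr' ?_)
    filter_upwards [(inf_le_right : G ≤ 𝓟 Ω) (mem_principal_self Ω)] with w hw
    rw [hφ.left_inv w hw]
  exact fun x hx y hy => (key x hx).trans (key y hy).symm

theorem tendsto_seq (hK : CorrespondsToEnd Ω φ ψ K E) {u : ℕ → ℂ} (hu : ∀ k, u k ∈ Ω)
    {q : OnePoint ℂ} (hq : q ∈ K) (h : Tendsto (fun k => (u k : OnePoint ℂ)) atTop (𝓝 q)) :
    Tendsto (fun k => φ (u k)) atTop E :=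
  (hK.tendsto q hq).comp (tendsto_inf.mpr ⟨tendsto_comap_iff.mpr h,
    tendsto_principal.mpr (Eventually.of_forall hu)⟩)

end CorrespondsToEnd

/-- Needed to extract sequences from filters, since boundary correspondence is formulated with
sequences. -/
theorem isCountablyGenerated_comap_coe (q : OnePoint ℂ) :
    (comap (fun w : ℂ => (w : OnePoint ℂ)) (𝓝 q)).IsCountablyGenerated := by
  induction q with
  | infty =>
    rw [OnePoint.comap_coe_nhds_infty, coclosedCompact_eq_cocompact, ← Metric.cobounded_eq_cocompact,
      ← comap_norm_atTop]
    infer_instance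
  | coe x =>
    rw [← OnePoint.isOpenEmbedding_coe.isInducing.nhds_eq_comap]
    infer_instance

/-- Boundary correspondence, for filters instead of sequences. -/
theorem BoundaryCorresponds.mem_of_tendsto {Ω C : Set ℂ} {F : ℂ → ℂ} {Γ : Set (OnePoint ℂ)}
    (h : BoundaryCorresponds Ω F Γ C) {q : OnePoint ℂ} (hq : q ∈ Γ) {l : Filter ℂ} [l.NeBot]
    (hl : ∀ᶠ w in l, w ∈ Ω) (hlq : Tendsto (fun w : ℂ => (w : OnePoint ℂ)) l (𝓝 q)) {w : ℂ}
    (hlw : Tendsto F l (𝓝 w)) : w ∈ C := by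
  have := isCountablyGenerated_comap_coe q
  set G : Filter ℂ := comap (fun w : ℂ => (w : OnePoint ℂ)) (𝓝 q) ⊓ comap F (𝓝 w) ⊓ 𝓟 Ω with hG
  have hlG : l ≤ G := le_inf (le_inf (tendsto_iff_comap.mp hlq) (tendsto_iff_comap.mp hlw))
    (le_principal_iff.mpr hl)
  have : G.NeBot := NeBot.mono ‹l.NeBot› hlG
  obtain ⟨u, hu⟩ := exists_seq_tendsto G
  obtain ⟨hu1, hu2⟩ := tendsto_inf.mp hu
  obtain ⟨hu3, hu4⟩ := tendsto_inf.mp hu1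
  obtain ⟨n, hn⟩ := eventually_atTop.mp (tendsto_principal.mp hu2)
  have hshift := tendsto_add_atTop_nat n
  exact h (fun k => u (k + n)) (fun k => hn _ (Nat.le_add_left n k)) q hq
    ((tendsto_comap_iff.mp hu3).comp hshift) w
    ((tendsto_comap_iff.mp hu4).comp hshift).mapClusterPt

/-- Reflection in the annulus interchanges the ends. -/
theorem CorrespondsToEnd.reflect {Ω : Set ℂ} {K : Set (OnePoint ℂ)} {φ ψ : ℂ → ℂ} {E E' : Filter ℂ}
    {ρ : ℂ → ℂ} (h : CorrespondsToEnd Ω φ ψ K E) (h1 : Tendsto ρ E E') (h2 : Tendsto ρ E' E) :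
    CorrespondsToEnd Ω (ρ ∘ φ) (ψ ∘ ρ) K E' :=
  ⟨fun U hU hKU => h2.eventually (h.eventually_mem U hU hKU), fun q hq => h1.comp (h.tendsto q hq)⟩

/-! ### Degenerate boundary components -/

/-- A holomorphic function with vanishing boundary values on one boundary circle vanishes. -/
theorem eq_zero_of_tendsto_outerEnd {r : ℝ} (hr : 0 ≤ r) {H : ℂ → ℂ}
    (hH : DifferentiableOn ℂ H (annulus r)) (h0 : Tendsto H outerEnd (𝓝 0)) :
    ∀ w ∈ annulus r, H w = 0 := by
  set F : ℂ → ℂ := fun ζ => H (Complex.exp ζ) with hF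
  have hFd : DifferentiableOn ℂ F (strip r) :=
    hH.comp Complex.differentiable_exp.differentiableOn fun ζ hζ => hζ
  have hper : ∀ ζ ∈ strip r, F (ζ + 2 * Real.pi * Complex.I) = F ζ := fun ζ _ => by
    simp only [hF, Complex.exp_periodic ζ]
  intro w hw
  have hw0 : w ≠ 0 := norm_pos_iff.mp (hr.trans_lt hw.1)
  have hs : Real.exp (Real.log ‖w‖) ∈ Ioo r 1 := by
    rw [Real.exp_log (norm_pos_iff.mpr hw0)]; exact hw
  have hcoef : ∀ n : ℤ, stripCoeff F n (Real.log ‖w‖) = 0 := fun n => by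
    set c := ‖stripCoeff F n (Real.log ‖w‖)‖ with hc
    -- The coefficients do not depend on the line. On lines with `-1 < log t < 0` the exponential is
    -- at most `exp |n|`, so letting `t → 1` makes them vanish.
    set B := Real.exp |(n : ℝ)| * (2 * Real.pi) with hB
    have hBpos : 0 < B := by positivity
    have key : ∀ ε > 0, c ≤ ε * B := fun ε hε => by
      have h1 : ∀ᶠ t in 𝓝[<] (1 : ℝ), ∀ w : ℂ, ‖w‖ = t → ‖H w‖ < ε := by
        refine eventually_outerEnd.mp ?_
        filter_upwards [h0 (ball_mem_nhds 0 hε)] with w hw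
        simpa using hw
      obtain ⟨t, ht, htr, ht1⟩ := (h1.and (Ioo_mem_nhdsLT
        (max_lt (hw.1.trans hw.2) (Real.exp_lt_one_iff.mpr neg_one_lt_zero)))).exists
      have htr' := (le_max_left _ _).trans_lt htr
      have hte := (le_max_right _ _).trans_lt htr
      have ht0 : 0 < t := hr.trans_lt htr'
      have hst : Real.exp (Real.log t) ∈ Ioo r 1 := by rw [Real.exp_log ht0]; exact ⟨htr', ht1⟩
      have hl1 : -1 < Real.log t := (Real.lt_log_iff_exp_lt ht0).mpr hte
      have hl0 : Real.log t < 0 := Real.log_neg ht0 ht1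
      rw [hc, stripCoeff_eq hFd hper n hs hst]
      have h2 := intervalIntegral.norm_integral_le_of_norm_le_const (a := 0) (b := 2 * Real.pi)
        (C := ε * Real.exp |(n : ℝ)|)
        (f := fun θ : ℝ => F (Real.log t + θ * Complex.I) *
          Complex.exp (-n * (Real.log t + θ * Complex.I))) fun θ _ => by
          rw [norm_mul]
          refine mul_le_mul (ht _ ?_).le ?_ (norm_nonneg _) hε.le
          · rw [Complex.norm_exp]; simp [Real.exp_log ht0]
          · rw [Complex.norm_exp, Real.exp_le_exp]
            have : (-(n : ℂ) * (Real.log t + θ * Complex.I)).re = -n * Real.log t := by simp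
            rw [this]
            calc -(n : ℝ) * Real.log t ≤ |-(n : ℝ) * Real.log t| := le_abs_self _
              _ = |(n : ℝ)| * |Real.log t| := by rw [abs_mul, abs_neg]
              _ ≤ |(n : ℝ)| * 1 := by
                gcongr
                rw [abs_le]; constructor <;> linarith
              _ = _ := mul_one _
      rw [sub_zero, abs_of_pos Real.two_pi_pos, mul_assoc] at h2
      exact h2
    have hc0 : c ≤ 0 := by
      refine le_of_forall_pos_le_add fun ε hε => ?_
      have := key (ε / B) (div_pos hε hBpos)
      rwa [div_mul_cancel₀ _ hBpos.ne', ← zero_add ε] at this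
    exact norm_le_zero_iff.mp hc0
  have h3 := eq_zero_of_stripCoeff_eq_zero hFd hper hs hcoef w.arg
  have h4 : Complex.exp ((Real.log ‖w‖ : ℝ) + w.arg * Complex.I) = w := by
    have : ((Real.log ‖w‖ : ℝ) : ℂ) + w.arg * Complex.I = Complex.log w := rfl
    rw [this, Complex.exp_log hw0]
  simpa only [hF, h4] using h3

theorem tendsto_inv_of_tendsto_infty {l : Filter ℂ} {ψ : ℂ → ℂ} (c : ℂ)
    (h : Tendsto (fun w => ((ψ w : ℂ) : OnePoint ℂ)) l (𝓝 OnePoint.infty)) :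
    Tendsto (fun w => (ψ w - c)⁻¹) l (𝓝 0) := by
  have h1 : Tendsto ψ l (cocompact ℂ) := by
    rw [← coclosedCompact_eq_cocompact, ← OnePoint.comap_coe_nhds_infty]
    exact tendsto_comap_iff.mpr h
  have h2 : Tendsto (fun w => w - c) (cocompact ℂ) (cocompact ℂ) :=
    (Homeomorph.subRight c).isClosedEmbedding.tendsto_cocompact
  rw [← Metric.cobounded_eq_cocompact] at h1 h2
  exact tendsto_inv₀_cobounded.comp (h2.comp h1)

/-- If the frontier were one point, `ψ` would tend to it along the whole unit circle, and `ψ` minus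
that point would vanish identically. For the point at infinity the same applies to `1 / (ψ - ψ t)`
on the smaller annulus outside radius `t`. -/
theorem nontrivial_of_outerEnd {r : ℝ} (hr0 : 0 ≤ r) (hr : r < 1) {Ω : Set ℂ}
    {K L : Set (OnePoint ℂ)} {φ ψ : ℂ → ℂ} (h : IsComplPair Ω K L)
    (hφ : IsConformalEquiv φ ψ Ω (annulus r)) (hK : CorrespondsToEnd Ω φ ψ K outerEnd) :
    (frontier K).Nontrivial := by
  by_contra hcon
  obtain ⟨q, hq⟩ := hK.tendsto_of_subsingleton h hφ (eventually_outerEnd_mem hr) hcon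
  have hpt : ∀ t : ℝ, r < t → t < 1 → (t : ℂ) ∈ annulus r := fun t h1 h2 => by
    rw [mem_annulus, Complex.norm_real, Real.norm_of_nonneg (hr0.trans h1.le)]
    exact ⟨h1, h2⟩
  obtain ⟨t, ht1, ht2⟩ := exists_between hr
  obtain ⟨t', ht1', ht2'⟩ := exists_between ht2
  have hw := hpt t ht1 ht2
  have hw' := hpt t' (ht1.trans ht1') ht2'
  have hne : ψ t' ≠ ψ t := fun he => ht1'.ne' (by
    exact_mod_cast hφ.symm.injOn hw' hw he)
  induction q with
  | infty =>
    have hsub : annulus t ⊆ annulus r := fun w hw => ⟨ht1.trans hw.1, hw.2⟩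
    have hne0 : ∀ w ∈ annulus t, ψ w - ψ t ≠ 0 := fun w hw1 he => by
      have := hφ.symm.injOn (hsub hw1) hw (sub_eq_zero.mp he)
      have h2 := hw1.1
      rw [this, Complex.norm_real, Real.norm_of_nonneg (hr0.trans ht1.le)] at h2
      exact lt_irrefl _ h2
    have hd : DifferentiableOn ℂ (fun w => (ψ w - ψ t)⁻¹) (annulus t) :=
      ((hφ.diff_symm.mono hsub).sub_const _).inv hne0
    have hm : (t' : ℂ) ∈ annulus t := by
      rw [mem_annulus, Complex.norm_real, Real.norm_of_nonneg (hr0.trans (ht1.trans ht1').le)]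
      exact ⟨ht1', ht2'⟩
    exact inv_ne_zero (hne0 _ hm) (eq_zero_of_tendsto_outerEnd (hr0.trans ht1.le) hd
      (tendsto_inv_of_tendsto_infty _ hq) _ hm)
  | coe x =>
    have hx : Tendsto ψ outerEnd (𝓝 x) := by
      rw [OnePoint.isOpenEmbedding_coe.isInducing.nhds_eq_comap]
      exact tendsto_comap_iff.mpr hq
    have hx0 : Tendsto (fun w => ψ w - x) outerEnd (𝓝 0) := by
      simpa using hx.sub_const x
    have h1 := eq_zero_of_tendsto_outerEnd hr0 (hφ.diff_symm.sub_const x) hx0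
    exact hne (by rw [sub_eq_zero.mp (h1 _ hw), sub_eq_zero.mp (h1 _ hw')])

theorem innerEnd_zero : innerEnd 0 = 𝓝[≠] (0 : ℂ) := by
  ext S
  constructor
  · intro hS
    obtain ⟨l, hl, hlS⟩ := exists_of_mem_innerEnd hS
    filter_upwards [self_mem_nhdsWithin, mem_nhdsWithin_of_mem_nhds (ball_mem_nhds (0 : ℂ) hl)]
      with w hw1 hw2
    exact hlS w (norm_pos_iff.mpr hw1) (by simpa using hw2)
  · intro hS
    obtain ⟨ε, hε, hsub⟩ := Metric.mem_nhdsWithin_iff.mp hS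
    refine eventually_innerEnd.mpr ?_
    filter_upwards [Ioo_mem_nhdsGT hε] with t ht w hw
    rw [← hw] at ht
    exact hsub ⟨by simpa using ht.2, norm_pos_iff.mp ht.1⟩

/-- Near the puncture the injective map `ψ` avoids a neighbourhood of `ψ a`, so `1 / (ψ - ψ a)` is
bounded and its singularity is removable. Hence `ψ` has a limit in the sphere. -/
theorem subsingleton_of_innerEnd_zero {Ω : Set ℂ} {K L : Set (OnePoint ℂ)} {φ ψ : ℂ → ℂ}
    (h : IsComplPair Ω K L) (hφ : IsConformalEquiv φ ψ Ω (annulus 0))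
    (hK : CorrespondsToEnd Ω φ ψ K (innerEnd 0)) : (frontier K).Subsingleton := by
  suffices ∃ q : OnePoint ℂ, Tendsto (fun w => ((ψ w : ℂ) : OnePoint ℂ)) (innerEnd 0) (𝓝 q) by
    obtain ⟨q, hq⟩ := this
    exact hK.subsingleton_of_tendsto h hφ hq
  set a : ℂ := 1 / 2 with ha
  have hna : ‖a‖ = 1 / 2 := by rw [ha]; norm_num
  have haA : a ∈ annulus 0 := by rw [mem_annulus, hna]; norm_num
  set D : Set ℂ := ball 0 (1 / 4) \ {0} with hD
  have hDA : D ⊆ annulus 0 := fun w hw =>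
    ⟨norm_pos_iff.mpr hw.2, by have := mem_ball_zero_iff.mp hw.1; linarith⟩
  have hDo : IsOpen (ball (0 : ℂ) (1 / 4)) := isOpen_ball
  set B : Set ℂ := ball a (1 / 8) with hB
  have hBn : ∀ w ∈ B, 1 / 4 < ‖w‖ := fun w hw => by
    have h1 := mem_ball_iff_norm'.mp hw
    have := norm_sub_norm_le a w
    linarith
  have hBA : B ⊆ annulus 0 := fun w hw => ⟨by linarith [hBn w hw], by
    have h1 := mem_ball_iff_norm.mp hw
    have := norm_sub_norm_le w a
    linarith⟩
  have hopen : IsOpen (ψ '' B) := isOpen_image_of_injOn isOpen_ball (hφ.diff_symm.mono hBA)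
    (hφ.symm.injOn.mono hBA)
  obtain ⟨δ, hδ, hball⟩ := Metric.isOpen_iff.mp hopen (ψ a) ⟨a, mem_ball_self (by norm_num), rfl⟩
  have hfar : ∀ w ∈ D, δ ≤ ‖ψ w - ψ a‖ := fun w hw => by
    by_contra hcon
    obtain ⟨v, hv, hvw⟩ := hball (mem_ball_iff_norm.mpr (not_le.mp hcon))
    have := hφ.symm.injOn (hBA hv) (hDA hw) hvw
    have h1 := hBn v hv
    have h2 := mem_ball_zero_iff.mp hw.1
    rw [this] at h1
    linarith
  have hne : ∀ w ∈ D, ψ w - ψ a ≠ 0 := fun w hw he => by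
    have := hfar w hw
    rw [he, norm_zero] at this
    linarith
  have hDn : D ∈ 𝓝[≠] (0 : ℂ) := by
    rw [hD, Set.sdiff_eq, inter_comm]
    exact inter_mem_nhdsWithin _ (ball_mem_nhds 0 (by norm_num))
  have hd : DifferentiableOn ℂ (fun w => (ψ w - ψ a)⁻¹) D :=
    ((hφ.diff_symm.mono hDA).sub_const _).inv hne
  have hlim := Complex.tendsto_limUnder_of_differentiable_on_punctured_nhds_of_bounded_under
    (c := (0 : ℂ)) (f := fun w => (ψ w - ψ a)⁻¹) (by
      filter_upwards [hDn] with w hw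
      refine hd.differentiableAt ?_
      rw [hD, Set.sdiff_eq]
      exact inter_mem (hDo.mem_nhds hw.1) (isOpen_compl_singleton.mem_nhds hw.2))
    (by
      refine isBoundedUnder_of_eventually_le (a := δ⁻¹ + ‖(ψ 0 - ψ a)⁻¹‖) ?_
      filter_upwards [hDn] with w hw
      refine (norm_sub_le _ _).trans (by
        gcongr
        rw [norm_inv]
        exact inv_anti₀ hδ (hfar w hw)))
  set b := limUnder (𝓝[≠] (0 : ℂ)) fun w => (ψ w - ψ a)⁻¹ with hb
  rw [innerEnd_zero]
  by_cases hb0 : b = 0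
  · refine ⟨OnePoint.infty, ?_⟩
    rw [hb0] at hlim
    have h1 : Tendsto (fun w => ψ w - ψ a) (𝓝[≠] 0) (Bornology.cobounded ℂ) := by
      have h2 : Tendsto (fun w => (ψ w - ψ a)⁻¹) (𝓝[≠] 0) (𝓝[≠] 0) :=
        tendsto_nhdsWithin_iff.mpr ⟨hlim, by
          filter_upwards [hDn] with w hw
          exact inv_ne_zero (hne w hw)⟩
      simpa [Function.comp_def] using tendsto_inv₀_nhdsNE_zero.comp h2
    rw [Metric.cobounded_eq_cocompact] at h1
    have h3 : Tendsto (fun w => w + ψ a) (cocompact ℂ) (cocompact ℂ) :=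
      (Homeomorph.addRight (ψ a)).isClosedEmbedding.tendsto_cocompact
    have h4 : Tendsto ψ (𝓝[≠] 0) (cocompact ℂ) := by
      simpa [Function.comp_def] using h3.comp h1
    rw [← coclosedCompact_eq_cocompact, ← OnePoint.comap_coe_nhds_infty] at h4
    exact tendsto_comap_iff.mp h4
  · refine ⟨((b⁻¹ + ψ a : ℂ) : OnePoint ℂ), ?_⟩
    have h1 := (hlim.inv₀ hb0).add_const (ψ a)
    simp only [inv_inv, sub_add_cancel] at h1
    exact (OnePoint.continuous_coe.tendsto _).comp h1

/-! ### Conformal models of doubly connected domains -/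

theorem isClosed_connectedComponentIn {X : Type*} [TopologicalSpace X] {S : Set X} (hS : IsClosed S)
    (p : X) : IsClosed (connectedComponentIn S p) := by
  by_cases hp : p ∈ S
  · refine closure_subset_iff_isClosed.mp ?_
    exact isPreconnected_connectedComponentIn.closure.subset_connectedComponentIn
      (subset_closure (mem_connectedComponentIn hp))
      (closure_minimal (connectedComponentIn_subset S p) hS)
  · rw [connectedComponentIn_eq_empty hp]
    exact isClosed_empty

theorem eq_connectedComponentIn_of_mem {Ω : Set ℂ} {K : Set (OnePoint ℂ)}
    (hK : K ∈ complComponents Ω) {x : OnePoint ℂ} (hx : x ∈ K) :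
    K = connectedComponentIn (sphereCompl Ω) x := by
  obtain ⟨p, hp, rfl⟩ := hK
  exact connectedComponentIn_eq hx

theorem IsDoublyConnected.exists_isComplPair {Ω : Set ℂ} (h : IsDoublyConnected Ω) :
    ∃ K L, IsComplPair Ω K L ∧ complComponents Ω = {K, L} := by
  obtain ⟨K, L, hne, heq⟩ := ncard_eq_two.mp h.ncard_components
  have hS : IsClosed (sphereCompl Ω) :=
    (OnePoint.isOpenEmbedding_coe.isOpenMap Ω h.isOpen).isClosed_compl
  have hK : K ∈ complComponents Ω := heq ▸ Or.inl rfl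
  have hL : L ∈ complComponents Ω := heq ▸ Or.inr rfl
  have hcl : ∀ M ∈ complComponents Ω, IsClosed M ∧ M.Nonempty ∧ M ⊆ sphereCompl Ω := by
    rintro _ ⟨p, hp, rfl⟩
    exact ⟨isClosed_connectedComponentIn hS p, ⟨p, mem_connectedComponentIn hp⟩,
      connectedComponentIn_subset _ _⟩
  refine ⟨K, L, ⟨(hcl K hK).1, (hcl L hL).1, (hcl K hK).2.1, (hcl L hL).2.1, ?_, ?_⟩, heq⟩
  · refine Set.disjoint_left.mpr fun x hxK hxL => hne ?_
    rw [eq_connectedComponentIn_of_mem hK hxK, ← eq_connectedComponentIn_of_mem hL hxL]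
  · refine Subset.antisymm (union_subset (hcl K hK).2.2 (hcl L hL).2.2) fun x hx => ?_
    have hx' : connectedComponentIn (sphereCompl Ω) x ∈ ({K, L} : Set (Set (OnePoint ℂ))) :=
      heq ▸ ⟨x, hx, rfl⟩
    rcases hx' with h1 | h1
    · exact Or.inl (h1 ▸ mem_connectedComponentIn hx)
    · exact Or.inr (h1 ▸ mem_connectedComponentIn hx)

/-- A compact hole of `Ω` contains a whole component of the complement. -/
theorem exists_component_subset {Ω M : Set ℂ} (hM : IsCompact M) (hMΩ : Disjoint M Ω)
    (ho : IsOpen (Ω ∪ M)) (hne : M.Nonempty) :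
    ∃ K ∈ complComponents Ω, K ⊆ (fun w : ℂ => (w : OnePoint ℂ)) '' M := by
  obtain ⟨x, hx⟩ := hne
  have hxS : (x : OnePoint ℂ) ∈ sphereCompl Ω := by
    rw [sphereCompl, mem_compl_iff, OnePoint.coe_injective.mem_set_image]
    exact hMΩ.notMem_of_mem_left hx
  refine ⟨_, ⟨x, hxS, rfl⟩, ?_⟩
  have hpc : IsPreconnected (connectedComponentIn (sphereCompl Ω) (x : OnePoint ℂ)) :=
    isPreconnected_connectedComponentIn
  have hsub := connectedComponentIn_subset (sphereCompl Ω) (x : OnePoint ℂ)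
  have hcl1 : IsClosed ((fun w : ℂ => (w : OnePoint ℂ)) '' M) :=
    (hM.image OnePoint.continuous_coe).isClosed
  have hcl2 : IsClosed ((fun w : ℂ => (w : OnePoint ℂ)) '' (Ω ∪ M))ᶜ :=
    (OnePoint.isOpenEmbedding_coe.isOpenMap _ ho).isClosed_compl
  have hcov : connectedComponentIn (sphereCompl Ω) (x : OnePoint ℂ) ⊆
      (fun w : ℂ => (w : OnePoint ℂ)) '' M ∪ ((fun w : ℂ => (w : OnePoint ℂ)) '' (Ω ∪ M))ᶜ := by
    intro y hy
    by_cases h2 : y ∈ (fun w : ℂ => (w : OnePoint ℂ)) '' M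
    · exact Or.inl h2
    · refine Or.inr ?_
      rw [image_union]
      exact fun h3 => h3.elim (hsub hy) h2
  have hdisj : connectedComponentIn (sphereCompl Ω) (x : OnePoint ℂ) ∩
      ((fun w : ℂ => (w : OnePoint ℂ)) '' M ∩
        ((fun w : ℂ => (w : OnePoint ℂ)) '' (Ω ∪ M))ᶜ) = ∅ := by
    rw [← not_nonempty_iff_eq_empty]
    rintro ⟨y, -, ⟨w, hw, rfl⟩, h2⟩
    exact h2 ⟨w, Or.inr hw, rfl⟩
  refine (isPreconnected_iff_subset_of_disjoint_closed.mp hpc _ _ hcl1 hcl2 hcov hdisj).resolve_right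
    fun h1 => ?_
  exact absurd ⟨x, Or.inr hx, rfl⟩ (h1 (mem_connectedComponentIn hxS))

/-- Every compact hole contains a whole component, and this cannot be the one through infinity, so
it contains `p`. The punctured plane is excluded by non-degeneracy and the disk by the two
components. The components are finally named by the ends they correspond to. -/
theorem IsDoublyConnected.exists_isConformalEquiv {Ω : Set ℂ} (h : IsDoublyConnected Ω)
    (hne : (nondegenerateComponents Ω).Nonempty) :
    ∃ r : ℝ, 0 ≤ r ∧ r < 1 ∧ ∃ φ ψ, IsConformalEquiv φ ψ Ω (annulus r) ∧
      ∃ K L, IsComplPair Ω K L ∧ boundaryComponents Ω = {frontier K, frontier L} ∧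
        CorrespondsToEnd Ω φ ψ K outerEnd ∧ CorrespondsToEnd Ω φ ψ L (innerEnd r) := by
  obtain ⟨K₀, L₀, hKL₀, heq₀⟩ := h.exists_isComplPair
  have hpair : ∃ K L, IsComplPair Ω K L ∧ complComponents Ω = {K, L} ∧ OnePoint.infty ∈ K := by
    rcases hKL₀.infty_mem with h1 | h1
    · exact ⟨K₀, L₀, hKL₀, heq₀, h1⟩
    · exact ⟨L₀, K₀, hKL₀.symm, by rw [heq₀, pair_comm], h1⟩
  clear hKL₀ heq₀ K₀ L₀
  obtain ⟨K, L, hKL, heq, hinf⟩ := hpair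
  have hbd : boundaryComponents Ω = {frontier K, frontier L} := by
    ext Γ
    simp [boundaryComponents, heq]
  obtain ⟨p, hp⟩ : ∃ p : ℂ, (p : OnePoint ℂ) ∈ L := by
    obtain ⟨x, hx⟩ := hKL.nonempty_right
    induction x with
    | infty => exact absurd hx (hKL.disjoint.notMem_of_mem_left hinf)
    | coe p => exact ⟨p, hx⟩
  have hpΩ : p ∉ Ω := hKL.coe_mem.mp (Or.inr hp)
  have hΩp : Ω ≠ {p}ᶜ := fun he => by
    have hsub : ∀ x ∈ K ∪ L, x = OnePoint.infty ∨ x = p := fun x hx => by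
      induction x with
      | infty => exact Or.inl rfl
      | coe x =>
        have := hKL.coe_mem.mp hx
        rw [he, mem_compl_iff, not_not] at this
        exact Or.inr (by rw [this])
    obtain ⟨Γ, hΓ, hnt⟩ := hne
    rw [hbd] at hΓ
    have hK : K.Subsingleton := fun x hx y hy => by
      have key : ∀ x ∈ K, x = OnePoint.infty := fun x hx =>
        (hsub x (Or.inl hx)).resolve_right fun hxp =>
          hKL.disjoint.notMem_of_mem_left hx (hxp ▸ hp)
      rw [key x hx, key y hy]
    have hL : L.Subsingleton := fun x hx y hy => by
      have key : ∀ x ∈ L, x = p := fun x hx =>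
        (hsub x (Or.inr hx)).resolve_left fun hxp =>
          hKL.disjoint.notMem_of_mem_right hx (hxp ▸ hinf)
      rw [key x hx, key y hy]
    rcases hΓ with rfl | rfl
    · exact not_nontrivial_iff.mpr (hK.anti hKL.frontier_subset) hnt
    · exact not_nontrivial_iff.mpr (hL.anti hKL.symm.frontier_subset) hnt
  have hH : ∀ M : Set ℂ, IsCompact M → Disjoint M Ω → IsOpen (Ω ∪ M) → p ∉ M → M = ∅ := by
    intro M hM hMΩ ho hpM
    by_contra hcon
    obtain ⟨C, hC, hCM⟩ := exists_component_subset hM hMΩ ho (nonempty_iff_ne_empty.mpr hcon)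
    rw [heq] at hC
    rcases hC with rfl | rfl
    · obtain ⟨w, -, hw⟩ := hCM hinf
      exact OnePoint.coe_ne_infty w hw
    · exact hpM ((OnePoint.coe_injective.mem_set_image).mp (hCM hp))
  rcases uniformization h.isOpen h.isConnected hpΩ hΩp hH with
    ⟨φ, ψ, hφ⟩ | ⟨r, hr0, hr1, φ, ψ, hφ⟩
  · exact (hKL.not_isConformalEquiv_ball hφ).elim
  · refine ⟨r, hr0, hr1, φ, ψ, hφ, ?_⟩
    rcases hKL.exists_correspondsToEnd hφ (isEnd_outerEnd hr1) (isEnd_innerEnd hr0 hr1)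
      (fun S hS T hT => exists_isCompact_annulus hS hT) with ⟨h1, h2⟩ | ⟨h1, h2⟩
    · exact ⟨K, L, hKL, hbd, h1, h2⟩
    · exact ⟨L, K, hKL.symm, by rw [hbd, pair_comm], h1, h2⟩

/-! ### The canonical maps -/

theorem IsCanonicalMap.isAdmissible {Ω : Set ℂ} {z : ℂ} {Γ : Set (OnePoint ℂ)} {f : ℂ → ℂ}
    (h : IsCanonicalMap Ω z Γ f) : IsAdmissible Ω z f :=
  ⟨h.differentiableOn, h.injOn, fun w hw => h.slitDisk.subset_ball ⟨w, hw, rfl⟩, h.map_base⟩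

/-- Composing with a conformal equivalence defined on the image. -/
theorem IsAdmissible.comp_symm {U V : Set ℂ} {φ ψ f : ℂ → ℂ} {z : ℂ} (h : IsConformalEquiv φ ψ U V)
    (hz : z ∈ U) (hf : IsAdmissible U z f) : IsAdmissible V (φ z) (f ∘ ψ) :=
  IsAdmissible.comp h.symm (by rwa [h.left_inv z hz])

/-- The canonical map for the boundary component that corresponds to the outer end of the model
annulus. -/
theorem exists_isCanonicalMap {r : ℝ} (hr0 : 0 ≤ r) {Ω : Set ℂ} {K L : Set (OnePoint ℂ)}
    {φ ψ : ℂ → ℂ} (h : IsComplPair Ω K L) (hφ : IsConformalEquiv φ ψ Ω (annulus r))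
    (hK : CorrespondsToEnd Ω φ ψ K outerEnd) {z : ℂ} (hz : z ∈ Ω) :
    ∃ f, IsCanonicalMap Ω z (frontier K) f ∧
      (∀ g, IsCanonicalMap Ω z (frontier K) g → EqOn g f Ω) ∧ boundaryDist Ω f = ‖φ z‖ := by
  have hzA := hφ.mapsTo hz
  have hr1 : r < 1 := hzA.1.trans hzA.2
  have hΩ := h.isOpen
  obtain ⟨g₀, hg₀⟩ := exists_isAnnulusSlitMap hr0 hzA
  have hadm₀ := IsAdmissible.comp hφ (hg₀.isAdmissible hr0 hzA)
  have hd0 : deriv (g₀ ∘ φ) z ≠ 0 :=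
    deriv_ne_zero_of_injOn hΩ hadm₀.differentiableOn hadm₀.injOn hz
  set d := deriv (g₀ ∘ φ) z with hd
  have hnd : (‖d‖ : ℂ) ≠ 0 := by exact_mod_cast norm_ne_zero_iff.mpr hd0
  -- The rotation that makes the derivative at `z` positive.
  set c : ℂ := ‖d‖ / d with hc
  have hcn : ‖c‖ = 1 := by
    rw [hc, norm_div, Complex.norm_real, norm_norm, div_self (norm_ne_zero_iff.mpr hd0)]
  have hg := hg₀.const_mul hr0 hzA (f := fun w => c * g₀ w) hcn fun w _ => rfl
  set g : ℂ → ℂ := fun w => c * g₀ w with hgdef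
  have hadm := IsAdmissible.comp hφ (hg.isAdmissible hr0 hzA)
  have hderiv : deriv (g ∘ φ) z = ‖d‖ := by
    have : (g ∘ φ) = fun w => c * (g₀ ∘ φ) w := rfl
    rw [this, deriv_const_mul _ (hadm₀.differentiableOn.differentiableAt (hΩ.mem_nhds hz)), ← hd, hc,
      div_mul_cancel₀ _ hd0]
  refine ⟨g ∘ φ, ⟨hadm.differentiableOn, hadm.injOn, ?_, hadm.map_base,
    ⟨‖d‖, norm_pos_iff.mpr hd0, hderiv⟩, ?_⟩, fun f hf => ?_, ?_⟩
  · rw [hφ.image_comp]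
    exact hg.isCircularlySlitDisk hr0 hzA
  · intro u hu q hq hlim w hw
    have h1 := hg.outer.comp (hK.tendsto_seq hu (h.frontier_subset hq) hlim)
    have h2 : MapClusterPt ‖w‖ atTop (fun k => ‖(g ∘ φ) (u k)‖) :=
      hw.continuousAt_comp continuous_norm.continuousAt
    have h3 : ‖w‖ = 1 := eq_of_nhds_neBot (h2.neBot.mono (inf_le_inf_left _ h1))
    simpa using h3
  · have hfa := hf.isAdmissible
    have hfψ := hfa.comp_symm hφ hz
    -- Along any ultrafilter at the outer end the preimages tend to a point of `frontier K`, so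
    -- boundary correspondence puts the limit of `f ∘ ψ` on the unit circle.
    have hout : Tendsto (fun w => ‖(f ∘ ψ) w‖) outerEnd (𝓝 1) := by
      refine tendsto_iff_ultrafilter _ _ _ |>.mpr fun 𝒰 h𝒰 => ?_
      have hA : ∀ᶠ w in (𝒰 : Filter ℂ), w ∈ annulus r := (eventually_outerEnd_mem hr1).filter_mono h𝒰
      obtain ⟨q, hq, hqlim⟩ := hK.exists_tendsto_ultrafilter h hφ (eventually_outerEnd_mem hr1) 𝒰 h𝒰
      obtain ⟨w, -, hw⟩ := (isCompact_closedBall (0 : ℂ) 1).ultrafilter_le_nhds (𝒰.map (f ∘ ψ)) (by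
        rw [le_principal_iff]
        exact mem_map.mpr (mem_of_superset hA fun w hw =>
          ball_subset_closedBall (hfψ.mapsTo hw)))
      have hw' : Tendsto (f ∘ ψ) 𝒰 (𝓝 w) := hw
      have := hf.boundary.mem_of_tendsto hq (l := map ψ 𝒰)
        (eventually_map.mpr (hA.mono fun w hw => hφ.mapsTo_symm hw)) (tendsto_map'_iff.mpr hqlim)
        (tendsto_map'_iff.mpr hw')
      rw [← mem_sphere_zero_iff_norm.mp this]
      exact hw'.norm
    obtain ⟨e, he, heq⟩ := hg.eq_of_slitDisk hr0 hzA hfψ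
      (by rw [hφ.symm.image_comp]; exact hf.slitDisk) hout
    have heq' : ∀ w ∈ Ω, (g ∘ φ) w = e * f w := fun w hw => by
      have := heq _ (hφ.mapsTo hw)
      rwa [Function.comp_apply, hφ.left_inv w hw] at this
    obtain ⟨k, hk, hfk⟩ := hf.deriv_pos
    have h1 : deriv (g ∘ φ) z = e * deriv f z := by
      rw [← deriv_const_mul _ (hf.differentiableOn.differentiableAt (hΩ.mem_nhds hz))]
      refine EventuallyEq.deriv_eq ?_
      filter_upwards [hΩ.mem_nhds hz] with w hw using heq' w hw
    rw [hderiv, hfk] at h1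
    have hk1 : ‖d‖ = k := by
      have := congrArg norm h1
      rwa [norm_mul, he, one_mul, Complex.norm_real, Complex.norm_real, norm_norm,
        Real.norm_of_nonneg hk.le] at this
    have he1 : e = 1 := by
      have hk0 : (k : ℂ) ≠ 0 := by exact_mod_cast hk.ne'
      rw [hk1] at h1
      exact mul_right_cancel₀ hk0 (by rw [one_mul]; exact h1.symm)
    intro w hw
    rw [heq' w hw, he1, one_mul]
  · rw [hφ.boundaryDist_comp]
    exact hg.boundaryDist_eq hr0 hzA

/-- The squeezing function and the canonical maps of a doubly connected domain in terms of a model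
annulus. -/
theorem squeezing_of_model {r : ℝ} (hr0 : 0 ≤ r) {Ω : Set ℂ} {K L : Set (OnePoint ℂ)}
    {φ ψ : ℂ → ℂ} (h : IsComplPair Ω K L) (hφ : IsConformalEquiv φ ψ Ω (annulus r))
    (hbd : boundaryComponents Ω = {frontier K, frontier L})
    (hK : CorrespondsToEnd Ω φ ψ K outerEnd) (hL : CorrespondsToEnd Ω φ ψ L (innerEnd r)) {z : ℂ}
    (hz : z ∈ Ω) :
    (∀ Γ ∈ nondegenerateComponents Ω, ∃ f, IsCanonicalMap Ω z Γ f ∧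
      ∀ g, IsCanonicalMap Ω z Γ g → EqOn g f Ω) ∧
    IsGreatest {d : ℝ | ∃ Γ ∈ nondegenerateComponents Ω, ∃ f : ℂ → ℂ,
      IsCanonicalMap Ω z Γ f ∧ d = boundaryDist Ω f} (squeezing Ω z) ∧
    ∀ f, IsExtremal Ω z f → IsCircularlySlitDisk (f '' Ω) := by
  have hzA := hφ.mapsTo hz
  have hr1 : r < 1 := hzA.1.trans hzA.2
  obtain ⟨f₁, hf₁, huniq₁, hd₁⟩ := exists_isCanonicalMap hr0 h hφ hK hz
  have hK' : frontier K ∈ nondegenerateComponents Ω :=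
    ⟨hbd ▸ Or.inl rfl, nontrivial_of_outerEnd hr0 hr1 h hφ hK⟩
  -- Reflection exchanges the ends, so `L` takes the place of `K`.
  have hinner : 0 < r → frontier L ∈ nondegenerateComponents Ω ∧
      ∃ f, IsCanonicalMap Ω z (frontier L) f ∧
      (∀ g, IsCanonicalMap Ω z (frontier L) g → EqOn g f Ω) ∧ boundaryDist Ω f = r / ‖φ z‖ := by
    intro hr
    have hφ' := hφ.trans (isConformalEquiv_reflect hr)
    have hL' := hL.reflect (tendsto_reflect_innerEnd hr) (tendsto_reflect_outerEnd hr)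
    refine ⟨⟨hbd ▸ Or.inr rfl, nontrivial_of_outerEnd hr0 hr1 h.symm hφ' hL'⟩, ?_⟩
    obtain ⟨f, hf, hu, hd⟩ := exists_isCanonicalMap hr0 h.symm hφ' hL' hz
    exact ⟨f, hf, hu, by rw [hd, Function.comp_apply, norm_reflect hr0]⟩
  have hcases : ∀ Γ ∈ nondegenerateComponents Ω, Γ = frontier K ∨ Γ = frontier L ∧ 0 < r := by
    rintro Γ ⟨hΓ, hnt⟩
    rw [hbd] at hΓ
    rcases hΓ with rfl | rfl
    · exact Or.inl rfl
    · refine Or.inr ⟨rfl, hr0.lt_of_ne fun he => ?_⟩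
      subst he
      exact not_nontrivial_iff.mpr (subsingleton_of_innerEnd_zero h.symm hφ hL) hnt
  have hup : ∀ f, IsAdmissible Ω z f →
      (boundaryDist Ω f ≤ ‖φ z‖ ∧ (boundaryDist Ω f = ‖φ z‖ → IsCircularlySlitDisk (f '' Ω))) ∨
      (0 < r ∧ boundaryDist Ω f ≤ r / ‖φ z‖ ∧
        (boundaryDist Ω f = r / ‖φ z‖ → IsCircularlySlitDisk (f '' Ω))) := fun f hf => by
    have := (hf.comp_symm hφ hz).annulus_cases hr0 hzA
    rwa [hφ.symm.boundaryDist_comp, hφ.symm.image_comp] at this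
  have hle₁ : ‖φ z‖ ≤ squeezing Ω z := hd₁ ▸ hf₁.isAdmissible.boundaryDist_le_squeezing hz
  have hle₂ : 0 < r → r / ‖φ z‖ ≤ squeezing Ω z := fun hr => by
    obtain ⟨-, f, hf, -, hd⟩ := hinner hr
    exact hd ▸ hf.isAdmissible.boundaryDist_le_squeezing hz
  have hne : {d : ℝ | ∃ f : ℂ → ℂ, IsAdmissible Ω z f ∧ d = boundaryDist Ω f}.Nonempty :=
    ⟨_, f₁, hf₁.isAdmissible, rfl⟩
  refine ⟨fun Γ hΓ => ?_, ⟨?_, ?_⟩, fun f hf => ?_⟩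
  · rcases hcases Γ hΓ with rfl | ⟨rfl, hr⟩
    · exact ⟨f₁, hf₁, huniq₁⟩
    · obtain ⟨-, f, hf, hu, -⟩ := hinner hr
      exact ⟨f, hf, hu⟩
  -- If the supremum exceeds `‖φ z‖`, some admissible map does too, which forces `r > 0` and `‖φ z‖
  -- < r / ‖φ z‖`. The map for `L` then attains the supremum.
  · by_cases hbig : squeezing Ω z ≤ ‖φ z‖
    · exact ⟨_, hK', f₁, hf₁, by rw [hd₁]; exact le_antisymm hbig hle₁⟩
    · obtain ⟨_, ⟨f, hf, rfl⟩, hlt⟩ := exists_lt_of_lt_csSup hne (not_le.mp hbig)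
      obtain ⟨hr, -⟩ := (hup f hf).resolve_left fun h1 => hlt.not_ge h1.1
      obtain ⟨hΓ, f₂, hf₂, -, hd₂⟩ := hinner hr
      refine ⟨_, hΓ, f₂, hf₂, ?_⟩
      rw [hd₂]
      refine le_antisymm (csSup_le hne ?_) (hle₂ hr)
      rintro _ ⟨f', hf', rfl⟩
      rcases hup f' hf' with h1 | h1
      · rcases hup f hf with h2 | h2
        · exact absurd h2.1 hlt.not_ge
        · exact h1.1.trans (hlt.le.trans h2.2.1)
      · exact h1.2.1
  · rintro _ ⟨Γ, -, f, hf, rfl⟩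
    exact hf.isAdmissible.boundaryDist_le_squeezing hz
  · rcases hup f hf.1 with h1 | ⟨hr, h1⟩
    · exact h1.2 (le_antisymm h1.1 (hf.2 ▸ hle₁))
    · exact h1.2 (le_antisymm h1.1 (hf.2 ▸ hle₂ hr))

end Squeezing

end

theorem theorem2 :
    (∀ Ω : Set ℂ, Squeezing.IsDoublyConnected Ω →
      (Squeezing.nondegenerateComponents Ω).Nonempty →
      ∀ z ∈ Ω,
        -- the canonical maps exist and are unique (as maps on `Ω`)
        (∀ Γ ∈ Squeezing.nondegenerateComponents Ω,
          ∃ f : ℂ → ℂ, Squeezing.IsCanonicalMap Ω z Γ f ∧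
            ∀ g : ℂ → ℂ, Squeezing.IsCanonicalMap Ω z Γ g → Set.EqOn g f Ω) ∧
        -- the squeezing function is the maximum over the canonical maps
        IsGreatest
          {d : ℝ | ∃ Γ ∈ Squeezing.nondegenerateComponents Ω, ∃ f : ℂ → ℂ,
            Squeezing.IsCanonicalMap Ω z Γ f ∧ d = Squeezing.boundaryDist Ω f}
          (Squeezing.squeezing Ω z) ∧
        -- every extremal function maps onto a circularly slit disk
        (∀ f : ℂ → ℂ, Squeezing.IsExtremal Ω z f →
          Squeezing.IsCircularlySlitDisk (f '' Ω))) ∧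
    (∀ r : ℝ, 0 < r → r < 1 → ∀ z ∈ Squeezing.annulus r,
      Squeezing.squeezing (Squeezing.annulus r) z = max ‖z‖ (r / ‖z‖)) := by
  refine ⟨fun Ω hΩ hne z hz => ?_, fun r hr _ z hz => Squeezing.squeezing_annulus hr hz⟩
  obtain ⟨r, hr0, -, φ, ψ, hφ, K, L, hKL, hbd, hK, hL⟩ := hΩ.exists_isConformalEquiv hne
  exact Squeezing.squeezing_of_model hr0 hKL hφ hbd hK hL hz
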